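/- **Background.** Let $\rho_0,v_0$ be $C^\infty$ functions on $\mathbb R$, $\rho_0$ even and $v_0$ odd, let $R_*>0$, and put, for $R\ge 0$, $$m(R)=4\pi\int_0^R\rho_0(s)s^2\,ds,\quad E(R)=\tfrac12 v_0(R)^2-\tfrac{m(R)}{R},\quad c(R)=\frac{2m(R)}{R^3},\quad q(R)=\sqrt{1-\frac{(v_0(R)/R)^2}{c(R)}}$$ (quotients at $R=0$ are understood as limits). Assume: $\rho_0>0$ on $[0,R_*)$ and $\rho_0=0$ on $[R_*,\infty)$; $c'(R)\le 0$, $2m(R)/R<1$ and $q'(R)\ge 0$ for all $R>0$; $v_0(R)/R<0$ and $(v_0(R)/R)^2<c(R)$ for all $R\ge 0$; and, for every $R\ge 0$, $q'(R)/R>0$ whenever $c'(R)/R=0$. With $f(x)=x\sqrt{1-x^2}+\arccos x$ let $$\tau(y,R)=\frac{f(q(R)y)-f(q(R))}{q(R)^3\sqrt{c(R)}},\quad 0\le y\le 1,\qquad \tau_s(R)=\tau(0,R).$$ For $0\le\tau\le\tau_s(R)$ let $y(\tau,R)\in[0,1]$ be the solution $y$ of $\tau(y,R)=\tau$, let $r(\tau,R)=R\,y(\tau,R)^2$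 and $\gamma=\sqrt{1+2E}/\partial_R r$. The Tolman–Bondi spacetime is $M=\{(\tau,R\,\omega): R\ge 0,\ 0\le\tau<\tau_s(R),\ \omega\in S^2\}\subset\mathbb R\times\mathbb R^3$ with the metric (smooth across the centre $R=0$) $$\mathbf g=-d\tau^2+\frac{dR^2}{\gamma^2}+r^2\,d\Omega^2 .$$ The Cauchy horizon $\tau=\tau_{CH}(R)$, $R>0$, is the first outgoing radial light ray ($d\tau/dR=1/\gamma$) emanating from the central singularity $(\tau,R)=(\tau_s(0),0)$. Assume that this singularity is globally naked: the Cauchy horizon reaches the surface $R=R_*$ of the cloud, and does so before the apparent horizon, i.e. $r>2m$ there. Let $D$ be the maximal future development of the surface $\tau=0$, that is, the set of points of $M$ with $R=0$ or $\tau<\tau_{CH}(R)$. **Theorem.** Let $\mu\ge 0$, and let $\Phi$ be a real-valued classical ($C^2$) solution of the Klein–Gordon equation $\Box\Phi+\mu^2\Phi=0$ on $(D,\mathbf g)$, where $\Box=-\nabla^\alpha\nabla_\alpha$, whose initial data $\Phi|_{\tau=0}$ and $\partial_\tau\Phi|_{\tau=0}$ are smooth and compactly supported on $\mathbb R^3$.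 Then there is a constant $C>0$ such that $$\sqrt{r}\,|\Phi(x)|\le C\qquad\text{for all }x\in D .$$ In particular, for every $r_0>0$ the field $\Phi$ is bounded on $\{x\in D: r\ge r_0\}$, so that it cannot diverge along the Cauchy horizon away from the central singular point. -/

import Mathlib

open scoped ContDiff

noncomputable section

namespace TolmanBondi

/-- For `f` differentiable with `f 0 = 0`: the continuous extension of `R ↦ f R / R` to `R = 0`. -/
def divR (f : ℝ → ℝ) (R : ℝ) : ℝ :=
  if R = 0 then deriv f 0 else f R / R

/-- Initial data of a spherical dust cloud: initial density `ρ₀` and initial radial velocity `v₀`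
(already extended to the whole real axis), and the radius `Rs` of the cloud. -/
structure DustData where
  ρ₀ : ℝ → ℝ
  v₀ : ℝ → ℝ
  Rs : ℝ

namespace DustData

variable (d : DustData)

/-- Mass inside the shell `R`. -/
def m (R : ℝ) : ℝ := 4 * Real.pi * ∫ s in (0 : ℝ)..R, d.ρ₀ s * s ^ 2

/-- Conserved energy of the shell `R` (for admissible data `E 0 = 0`, the limit value). -/
def E (R : ℝ) : ℝ := d.v₀ R ^ 2 / 2 - d.m R / R

/-- `2 m(R) / R³`, with its limit `8 π ρ₀(0) / 3` at the centre. -/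
def c (R : ℝ) : ℝ :=
  if R = 0 then 8 * Real.pi / 3 * d.ρ₀ 0 else 2 * d.m R / R ^ 3

/-- `√(1 - R v₀(R)² / (2 m(R))) = √(1 - (v₀(R)/R)² / c(R))`. -/
def q (R : ℝ) : ℝ := √(1 - divR d.v₀ R ^ 2 / d.c R)

/-- The standing assumptions on the initial data. -/
structure Admissible : Prop where
  Rs_pos : 0 < d.Rs
  smooth_ρ₀ : ContDiff ℝ ∞ d.ρ₀
  even_ρ₀ : Function.Even d.ρ₀
  smooth_v₀ : ContDiff ℝ ∞ d.v₀
  odd_v₀ : Function.Odd d.v₀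
  density_pos : ∀ R, 0 ≤ R → R < d.Rs → 0 < d.ρ₀ R
  density_zero : ∀ R, d.Rs ≤ R → d.ρ₀ R = 0
  mean_density_antitone : ∀ R, 0 < R → deriv d.c R ≤ 0
  untrapped : ∀ R, 0 < R → 2 * d.m R / R < 1
  collapsing : ∀ R, 0 ≤ R → divR d.v₀ R < 0
  bounded : ∀ R, 0 ≤ R → divR d.v₀ R ^ 2 < d.c R
  no_shell_crossing : ∀ R, 0 < R → 0 ≤ deriv d.q R
  nondegenerate : ∀ R, 0 ≤ R → divR (deriv d.c) R = 0 → 0 < divR (deriv d.q) R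

end DustData

/-- `f(x) = x √(1 - x²) + arccos x` on `[0, 1]`. -/
def f (x : ℝ) : ℝ := x * √(1 - x ^ 2) + Real.arccos x

/-- `g(q, y) = (f(q y) - f(q)) / q³`. -/
def g (q y : ℝ) : ℝ := (f (q * y) - f q) / q ^ 3

namespace DustData

variable (d : DustData)

/-- Proper time at which the shell `R` has areal radius `R y²`, for `0 ≤ y ≤ 1`. -/
def tau (y R : ℝ) : ℝ := g (d.q R) y / √(d.c R)

/-- Collapse time of the shell `R`. -/
def tauS (R : ℝ) : ℝ := d.tau 0 R

/-- `y = √(r/R)` as a function of `(τ, R)`: the inverse of the strictly decreasing function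
`y ↦ tau y R` from `[0, 1]` onto `[0, tauS R]`. -/
def y (τ R : ℝ) : ℝ := Function.invFunOn (fun y => d.tau y R) (Set.Icc 0 1) τ

/-- Areal radius. -/
def r (τ R : ℝ) : ℝ := R * d.y τ R ^ 2

/-- `γ = √(1 + 2E) / r'`, the prime being the partial derivative with respect to `R`. -/
def γ (τ R : ℝ) : ℝ := √(1 + 2 * d.E R) / deriv (fun R' => d.r τ R') R

/-- `σ` describes, on `0 < R ≤ R₁`, an outgoing radial light ray `τ = σ(R)`
(`dτ/dR = 1/γ`) which emanates from the central singularity `(τ, R) = (tauS 0, 0)`. -/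
structure IsSingularRay (R₁ : ℝ) (σ : ℝ → ℝ) : Prop where
  mem : ∀ R ∈ Set.Ioc 0 R₁, 0 ≤ σ R ∧ σ R < d.tauS R
  null : ∀ R ∈ Set.Ioc 0 R₁, HasDerivWithinAt σ (d.γ (σ R) R)⁻¹ (Set.Ioc 0 R₁) R
  emanates : Filter.Tendsto σ (nhdsWithin 0 (Set.Ioi 0)) (nhds (d.tauS 0))

/-- The Cauchy horizon `τ = tauCH R`, `R > 0`: the first light ray from the central singularity. -/
def tauCH (R : ℝ) : ℝ := sInf {t | ∃ σ, d.IsSingularRay R σ ∧ σ R = t}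

/-- The central singularity is globally naked: the Cauchy horizon reaches the surface of the cloud,
and does so before the apparent horizon `r = 2 m`. -/
def GloballyNaked : Prop :=
  (∃ σ, d.IsSingularRay d.Rs σ) ∧ 2 * d.m d.Rs < d.r (d.tauCH d.Rs) d.Rs

end DustData

/-- Radial coordinate of a point `(τ, x₁, x₂, x₃)`; here `x = R ω` with `ω` on the unit sphere. -/
def rad (p : Fin 4 → ℝ) : ℝ := √(∑ i : Fin 3, p i.succ ^ 2)

/-- The unit radial covector `dR` in the coordinates `(τ, x₁, x₂, x₃)`. -/
def dRad (p : Fin 4 → ℝ) (i : Fin 4) : ℝ := if i = 0 then 0 else p i / rad p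

namespace DustData

variable (d : DustData)

/-- The maximal future development of the initial surface `τ = 0`: the points of the spacetime
`0 ≤ τ < tauS R` which lie strictly before the Cauchy horizon (no condition at the centre). -/
def D : Set (Fin 4 → ℝ) :=
  {p | 0 ≤ p 0 ∧ p 0 < d.tauS (rad p) ∧ (0 < rad p → p 0 < d.tauCH (rad p))}

/-- The metric `-dτ² + dR²/γ² + r² dΩ²` in the coordinates `(τ, x₁, x₂, x₃)`, `x = R ω`, where
`r² dΩ² = (r/R)² (|dx|² - dR²)` and `r/R = y²`. At the centre, where `p i / rad p = 0`, this is
the smooth extension `-dτ² + y⁴ |dx|²`. -/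
def metric (p : Fin 4 → ℝ) : Matrix (Fin 4) (Fin 4) ℝ := fun i j =>
  if i = 0 ∧ j = 0 then -1
  else if i = 0 ∨ j = 0 then 0
  else ((d.γ (p 0) (rad p))⁻¹) ^ 2 * (dRad p i * dRad p j)
    + d.y (p 0) (rad p) ^ 4 * ((if i = j then 1 else 0) - dRad p i * dRad p j)

end DustData

/-- Partial derivative along the `i`-th coordinate. -/
def pd (i : Fin 4) (F : (Fin 4 → ℝ) → ℝ) (p : Fin 4 → ℝ) : ℝ := fderiv ℝ F p (Pi.single i 1)

/-- `□Φ = -∇^i ∇_i Φ = -|G|^{-1/2} ∂_i (|G|^{1/2} G^{ij} ∂_j Φ)` for the metric `G`. -/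
def box (G : (Fin 4 → ℝ) → Matrix (Fin 4) (Fin 4) ℝ) (Φ : (Fin 4 → ℝ) → ℝ)
    (p : Fin 4 → ℝ) : ℝ :=
  -((√|(G p).det|)⁻¹ *
    ∑ i, pd i (fun z => √|(G z).det| * ∑ j, (G z)⁻¹ i j * pd j Φ z) p)

/-- `Φ` is a (classical) solution of `□Φ + μ² Φ = 0` on `D` with `Φ = φ₀` and `∂Φ/∂τ = φ₁` on the
initial surface `τ = 0`. -/
structure IsKGSolution (d : DustData) (μ : ℝ) (φ₀ φ₁ : (Fin 3 → ℝ) → ℝ)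
    (Φ : (Fin 4 → ℝ) → ℝ) : Prop where
  regular : ContDiffOn ℝ 2 Φ d.D
  equation : ∀ p ∈ d.D, 0 < p 0 → box d.metric Φ p + μ ^ 2 * Φ p = 0
  initial_value : ∀ x, Φ (Fin.cons 0 x) = φ₀ x
  initial_velocity : ∀ x,
    HasDerivWithinAt (fun t : ℝ => Φ (Fin.cons t x)) (φ₁ x) (Set.Ici 0) 0

end TolmanBondi

end

/-! The field is reduced to functions of two variables. Around an arbitrary axis, Φ is integrated
over the spheres against P(cos θ), P a Legendre polynomial of degree n. Such a zonal mode u(τ, R)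
solves a wave equation with angular eigenvalue λ = n(n+1) (`isMode_mode`). It is enough to bound √r
|u| by a constant times (1+λ)^(-2): the value of Φ at the pole of the axis is controlled by the
Legendre coefficients (`pole_bound`), and the axis may be drawn through any given point.

For one mode, the energy current is built with the Kodama vector field w ∂_τ + (s w / r') ∂_R, where
s = -∂_τ r, r' = ∂_R r and w = √(1+2E). Since w² - s² = 1 - 2m/r, this field is timelike exactly in
the untrapped region. Its current is conserved up to the source (r m'/r') u_τ u_R, so the energy
grows at a rate governed by m'/(r r'). Two geometric facts carry the estimate.

`uniformly_untrapped`: 2m/r ≤ 1 - δ on all of D, so the energy density controls both derivatives of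
u. Global nakedness enters here, through a ray from the singularity that is still untrapped at the
surface of the cloud.

`kap_bound`: inside the cloud m'/(r r') ≤ C |τ - τ_s(0)|^(-5/6), which is integrable in τ across the
time of the central singularity, so that Gronwall's inequality keeps the energy bounded.

Near the centre both rest on `exists_barrier`: there y³ ≥ k (|τ - τ_s(0)| + R²) on D. Indeed a point
of D is reached by an outgoing ray that starts before τ_s(0), and close to the centre such a ray
cannot cross a parabola τ = τ_s(0) + η R², because on it the slope of rays is O(R^(4/3)). With X =
|τ - τ_s(0)| + R² this gives m'/(r r') ≤ C R / y⁴ ≤ C X^(1/2 - 4/3) = C X^(-5/6).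

`mode_bound` turns the energy into a pointwise bound. From a point of D, the energy is followed in
the region between the past-directed outgoing ray (continued along the centre) and an outer curve R
= a(τ) of superluminal speed. The flux through the inner boundary has a good sign. The flux F
through the outer curve controls the derivative of u along it, (du/dτ)² ≤ A (-dr/dτ) F / r², so
|du/dτ| ≤ θ A (-dr/dτ) / (2r²) + F / (2θ) for every θ > 0. The first term integrates to at most θ A
/ (2r), the second is bounded by the initial energy E₀. With θ = t √r, √r |u| is at most C (t +
E₀/t) plus the contribution of the initial values, for every t > 0.

Integration by parts on the sphere makes the modes of smooth compactly supported data decay faster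
than any power of 1+λ (`zonal_decay`). The rate E₀ = O((1+λ)^(-5)) with t = (1+λ)^(-2) is enough,
and the sum over modes converges. -/

open scoped ContDiff NNReal
open MeasureTheory Filter Topology Set

noncomputable section

namespace TolmanBondi

open scoped ContDiff

/-! ### Integrals over compact sets depending on a parameter -/

section Parametric

variable {X E H G : Type*} [NormedAddCommGroup E] [NormedSpace ℝ E]
  [NormedAddCommGroup H] [NormedSpace ℝ H] [MeasurableSpace H] [BorelSpace H]
  [SecondCountableTopology H]
  [NormedAddCommGroup G] [NormedSpace ℝ G]
  {μ : Measure H} [IsFiniteMeasureOnCompacts μ]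

/-- A function continuous along a compact slice is, near that slice, uniformly close to its values
on it. -/
theorem eventually_forall_dist_lt [TopologicalSpace X] {F : X × H → G} {S : Set X} {K : Set H}
    (hK : IsCompact K) (hF : ContinuousOn F (S ×ˢ K)) {x₀ : X} (hx₀ : x₀ ∈ S) {ε : ℝ} (hε : 0 < ε) :
    ∀ᶠ x in 𝓝 x₀, ∀ k ∈ K, x ∈ S → dist (F (x, k)) (F (x₀, k)) < ε := by
  have key : ∀ y ∈ K, ∀ᶠ z in 𝓝 x₀ ×ˢ 𝓝 y,
      (fun x k => k ∈ K → x ∈ S → dist (F (x, k)) (F (x₀, k)) < ε) z.1 z.2 := by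
    intro y hy
    have h1 := hF (x₀, y) ⟨hx₀, hy⟩
    have h2 : ∀ᶠ z in 𝓝 (x₀, y), z ∈ S ×ˢ K → dist (F z) (F (x₀, y)) < ε / 2 := by
      have := Metric.tendsto_nhds.1 h1 (ε / 2) (by positivity)
      exact eventually_nhdsWithin_iff.1 this
    rw [nhds_prod_eq] at h2
    have h3 : ∀ᶠ z in 𝓝 x₀ ×ˢ 𝓝 y, z.2 ∈ K → dist (F (x₀, z.2)) (F (x₀, y)) < ε / 2 := by
      have ht : Tendsto (fun z : X × H => (x₀, z.2)) (𝓝 x₀ ×ˢ 𝓝 y) (𝓝 x₀ ×ˢ 𝓝 y) :=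
        (tendsto_const_nhds).prodMk tendsto_snd
      filter_upwards [ht.eventually h2] with z hz hzK using hz ⟨hx₀, hzK⟩
    filter_upwards [h2, h3] with z hz hz' hzK hzS
    have a := hz ⟨hzS, hzK⟩
    have b := hz' hzK
    rw [dist_comm] at b
    calc dist (F (z.1, z.2)) (F (x₀, z.2))
        ≤ dist (F z) (F (x₀, y)) + dist (F (x₀, y)) (F (x₀, z.2)) := dist_triangle _ _ _
      _ < ε := by linarith
  filter_upwards [hK.eventually_forall_of_forall_eventually (x₀ := x₀)
    (P := fun x k => k ∈ K → x ∈ S → dist (F (x, k)) (F (x₀, k)) < ε)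
    (fun y hy => by rw [nhds_prod_eq]; exact key y hy)] with x hx k hk hxS
    using hx k hk hk hxS

theorem integrableOn_slice [TopologicalSpace X] {F : X × H → G} {S : Set X} {K : Set H}
    (hK : IsCompact K) (hF : ContinuousOn F (S ×ˢ K)) {x : X} (hx : x ∈ S) :
    IntegrableOn (fun k => F (x, k)) K μ := by
  have h : ContinuousOn (fun k => F (x, k)) K :=
    hF.comp (f := fun k => (x, k)) (by fun_prop) (fun k hk => ⟨hx, hk⟩)
  exact h.integrableOn_compact hK

/-- Integrals over a compact set depend continuously on a parameter. -/
theorem continuousOn_setIntegral [TopologicalSpace X] {F : X × H → G} {S : Set X} {K : Set H}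
    (hK : IsCompact K) (hF : ContinuousOn F (S ×ˢ K)) :
    ContinuousOn (fun x => ∫ k in K, F (x, k) ∂μ) S := by
  intro x₀ hx₀
  rw [ContinuousWithinAt, Metric.tendsto_nhds]
  intro ε hε
  set M := μ.real K
  have hM : 0 ≤ M := measureReal_nonneg
  have h := eventually_forall_dist_lt hK hF hx₀ (ε := ε / (M + 1)) (by positivity)
  filter_upwards [nhdsWithin_le_nhds h, self_mem_nhdsWithin] with x hx hxS
  rw [dist_eq_norm, ← integral_sub (integrableOn_slice hK hF hxS) (integrableOn_slice hK hF hx₀)]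
  have : ‖∫ k in K, F (x, k) - F (x₀, k) ∂μ‖ ≤ ε / (M + 1) * M := by
    apply norm_setIntegral_le_of_norm_le_const hK.measure_lt_top
    intro k hk
    rw [← dist_eq_norm]
    exact (hx k hk hxS).le
  refine this.trans_lt ?_
  rw [div_mul_eq_mul_div, div_lt_iff₀ (by positivity)]
  nlinarith

/-- Differentiation under an integral over a compact set. -/
theorem hasFDerivAt_setIntegral {F : E × H → G} {F' : E × H → E →L[ℝ] G} {U : Set E} {K : Set H}
    (hU : IsOpen U) (hK : IsCompact K) (hF : ContinuousOn F (U ×ˢ K))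
    (hF' : ContinuousOn F' (U ×ˢ K))
    (hd : ∀ x ∈ U, ∀ k ∈ K, HasFDerivAt (fun z => F (z, k)) (F' (x, k)) x) {x₀ : E} (hx₀ : x₀ ∈ U) :
    HasFDerivAt (fun x => ∫ k in K, F (x, k) ∂μ) (∫ k in K, F' (x₀, k) ∂μ) x₀ := by
  obtain ⟨C, hC⟩ := hK.exists_bound_of_continuousOn (f := fun k => F' (x₀, k))
    (hF'.comp (by fun_prop) (fun k hk => ⟨hx₀, hk⟩))
  have h := eventually_forall_dist_lt hK hF' hx₀ one_pos
  have hUn : ∀ᶠ x in 𝓝 x₀, x ∈ U := hU.mem_nhds hx₀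
  have hKm : MeasurableSet K := hK.measurableSet
  refine hasFDerivAt_integral_of_dominated_of_fderiv_le (bound := fun _ => C + 1)
    (F' := fun x k => F' (x, k)) (h.and hUn) ?_ (integrableOn_slice hK hF hx₀)
    (integrableOn_slice hK hF' hx₀).aestronglyMeasurable ?_ ?_ ?_
  · filter_upwards [hUn] with x hx using (integrableOn_slice hK hF hx).aestronglyMeasurable
  · refine (ae_restrict_iff' hKm).2 (Eventually.of_forall fun k hk x hx => ?_)
    have h1 := hx.1 k hk hx.2
    rw [dist_eq_norm] at h1
    have h2 := hC k hk
    calc ‖F' (x, k)‖ = ‖(F' (x, k) - F' (x₀, k)) + F' (x₀, k)‖ := by rw [sub_add_cancel]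
      _ ≤ ‖F' (x, k) - F' (x₀, k)‖ + ‖F' (x₀, k)‖ := norm_add_le _ _
      _ ≤ C + 1 := by linarith
  · exact integrableOn_const hK.measure_lt_top.ne
  · exact (ae_restrict_iff' hKm).2 (Eventually.of_forall fun k hk x hx => hd x hx.2 k hk)

theorem hasFDerivAt_setIntegral_of_contDiffOn {F : E × H → G} {O : Set (E × H)} (hO : IsOpen O)
    (hF : ContDiffOn ℝ 1 F O) {K : Set H} (hK : IsCompact K) {U : Set E} (hU : IsOpen U)
    (hUK : U ×ˢ K ⊆ O) {x₀ : E} (hx₀ : x₀ ∈ U) :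
    HasFDerivAt (fun x => ∫ k in K, F (x, k) ∂μ)
      (∫ k in K, (fderiv ℝ F (x₀, k)).comp (ContinuousLinearMap.inl ℝ E H) ∂μ) x₀ := by
  refine hasFDerivAt_setIntegral (F' := fun z => (fderiv ℝ F z).comp
    (ContinuousLinearMap.inl ℝ E H)) hU hK (hF.continuousOn.mono hUK) ?_ ?_ hx₀
  · have := (hF.continuousOn_fderiv_of_isOpen hO le_rfl).mono hUK
    exact this.clm_comp continuousOn_const
  · intro x hx k hk
    have h1 : HasFDerivAt F (fderiv ℝ F (x, k)) (x, k) :=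
      ((hF.contDiffAt (hO.mem_nhds (hUK ⟨hx, hk⟩))).differentiableAt (by norm_num)).hasFDerivAt
    exact h1.comp x (hasFDerivAt_prodMk_left x k)

/-- Integrals over a compact set depend smoothly on a parameter. -/
theorem contDiffOn_setIntegral {E H : Type} [NormedAddCommGroup E] [NormedSpace ℝ E]
    [NormedAddCommGroup H] [NormedSpace ℝ H] [MeasurableSpace H] [BorelSpace H]
    [SecondCountableTopology H] {μ : Measure H} [IsFiniteMeasureOnCompacts μ] (n : ℕ)
    {O : Set (E × H)} (hO : IsOpen O) {K : Set H} (hK : IsCompact K) {U : Set E} (hU : IsOpen U)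
    (hUK : U ×ˢ K ⊆ O) : ∀ {G : Type} [NormedAddCommGroup G] [NormedSpace ℝ G] {F : E × H → G},
    ContDiffOn ℝ n F O → ContDiffOn ℝ n (fun x => ∫ k in K, F (x, k) ∂μ) U := by
  induction n with
  | zero =>
    intro G _ _ F hF
    rw [Nat.cast_zero, contDiffOn_zero] at *
    exact continuousOn_setIntegral hK (hF.mono hUK)
  | succ n ih =>
    intro G _ _ F hF
    have h1 : ContDiffOn ℝ 1 F O := hF.of_le (by exact_mod_cast Nat.le_add_left 1 n)
    have hd := fun x hx => hasFDerivAt_setIntegral_of_contDiffOn (μ := μ) hO h1 hK hU hUK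
      (x₀ := x) hx
    have hF' : ContDiffOn ℝ n (fun z => (fderiv ℝ F z).comp (ContinuousLinearMap.inl ℝ E H)) O :=
      (hF.fderiv_of_isOpen hO (by norm_cast)).clm_comp contDiffOn_const
    rw [Nat.cast_succ, contDiffOn_succ_iff_fderiv_of_isOpen hU]
    refine ⟨fun x hx => (hd x hx).differentiableAt.differentiableWithinAt, by simp, ?_⟩
    exact (ih hF').congr fun x hx => (hd x hx).fderiv

end Parametric

open scoped ContDiff

/-! ### Division by the radius -/

/-- Quotients by powers of R are smooth at R = 0 once they are written as averages over [0, 1] of a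
dilated smooth function. This is how the coefficients at the centre are handled. -/
theorem contDiff_integral_dilation {φ w : ℝ → ℝ} (hφ : ContDiff ℝ ∞ φ) (hw : ContDiff ℝ ∞ w) :
    ContDiff ℝ ∞ (fun R : ℝ => ∫ s in (0 : ℝ)..1, φ (R * s) * w s) := by
  rw [contDiff_infty]
  intro n
  have h := contDiffOn_setIntegral (μ := (volume : Measure ℝ)) n (O := (univ : Set (ℝ × ℝ))) isOpen_univ
    (isCompact_Icc (a := (0 : ℝ)) (b := 1)) (U := univ) isOpen_univ (subset_univ _)
    (F := fun z : ℝ × ℝ => φ (z.1 * z.2) * w z.2) (by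
      have h1 : ContDiff ℝ n φ := hφ.of_le (by exact_mod_cast le_top)
      have h2 : ContDiff ℝ n w := hw.of_le (by exact_mod_cast le_top)
      exact ContDiff.contDiffOn (by fun_prop))
  rw [contDiffOn_univ] at h
  simpa only [intervalIntegral.integral_of_le zero_le_one, integral_Icc_eq_integral_Ioc] using h

/-- Hadamard's lemma: the fundamental theorem of calculus on [0, R], rescaled by s ↦ R s. At R = 0
the integral gives the value `deriv φ 0` prescribed by `divR`. -/
theorem divR_eq_integral {φ : ℝ → ℝ} (hφ : ContDiff ℝ ∞ φ) (h0 : φ 0 = 0) (R : ℝ) :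
    divR φ R = ∫ s in (0 : ℝ)..1, deriv φ (R * s) * 1 := by
  unfold divR
  split_ifs with h
  · simp [h]
  · have hd : ∀ x, HasDerivAt φ (deriv φ x) x := fun x =>
      (hφ.differentiable (by simp) x).hasDerivAt
    have h1 : ∫ s in (0 : ℝ)..R, deriv φ s = φ R - φ 0 :=
      intervalIntegral.integral_eq_sub_of_hasDerivAt (fun x _ => hd x)
        ((hφ.continuous_deriv (by simp)).intervalIntegrable _ _)
    have h2 := intervalIntegral.mul_integral_comp_mul_left (a := 0) (b := 1) (f := deriv φ) (c := R)
    simp only [mul_zero, mul_one] at h2 ⊢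
    rw [div_eq_iff h, mul_comm, h2, h1, h0, sub_zero]

theorem contDiff_divR {φ : ℝ → ℝ} (hφ : ContDiff ℝ ∞ φ) (h0 : φ 0 = 0) :
    ContDiff ℝ ∞ (divR φ) := by
  have : divR φ = fun R => ∫ s in (0 : ℝ)..1, deriv φ (R * s) * 1 :=
    funext (divR_eq_integral hφ h0)
  rw [this]
  exact contDiff_integral_dilation ((contDiff_infty_iff_deriv.1 hφ).2) contDiff_const

theorem mul_divR {φ : ℝ → ℝ} (h0 : φ 0 = 0) (R : ℝ) : R * divR φ R = φ R := by
  unfold divR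
  split_ifs with h
  · simp [h, h0]
  · field_simp

theorem Even.deriv_zero {φ : ℝ → ℝ} (h : Function.Even φ) : deriv φ 0 = 0 := by
  have h1 : deriv (fun x => φ (-x)) 0 = - deriv φ (-0) := deriv_comp_neg φ 0
  have h2 : (fun x => φ (-x)) = φ := funext h
  rw [h2, neg_zero] at h1
  linarith

theorem divR_even {φ : ℝ → ℝ} (h : Function.Odd φ) : Function.Even (divR φ) := by
  intro R
  unfold divR
  by_cases hR : R = 0
  · simp [hR]
  · simp [hR, h R, neg_div_neg_eq]

namespace DustData

variable {d : DustData}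

theorem c_eq_integral (d : DustData) (R : ℝ) :
    d.c R = 8 * Real.pi * ∫ s in (0 : ℝ)..1, d.ρ₀ (R * s) * s ^ 2 := by
  unfold c
  split_ifs with h
  · simp [h]; ring
  · have h2 := intervalIntegral.mul_integral_comp_mul_left (a := 0) (b := 1)
      (f := fun s => d.ρ₀ s * s ^ 2) (c := R)
    simp only [mul_zero, mul_one] at h2
    unfold m
    rw [← h2]
    have h3 : ∀ s, d.ρ₀ (R * s) * (R * s) ^ 2 = R ^ 2 * (d.ρ₀ (R * s) * s ^ 2) := fun s => by ring
    simp only [h3, intervalIntegral.integral_const_mul]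
    field_simp
    ring

theorem m_eq (d : DustData) (R : ℝ) : d.m R = d.c R * R ^ 3 / 2 := by
  unfold c
  split_ifs with h
  · simp [h, m]
  · field_simp

namespace Admissible

theorem contDiff_c (hd : d.Admissible) : ContDiff ℝ ∞ d.c := by
  have : d.c = fun R => 8 * Real.pi * ∫ s in (0 : ℝ)..1, d.ρ₀ (R * s) * s ^ 2 :=
    funext d.c_eq_integral
  rw [this]
  exact contDiff_const.mul (contDiff_integral_dilation hd.smooth_ρ₀ (by fun_prop))

theorem even_c (hd : d.Admissible) : Function.Even d.c := by
  intro R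
  rw [d.c_eq_integral, d.c_eq_integral]
  have : ∀ s, d.ρ₀ (-R * s) = d.ρ₀ (R * s) := fun s => by rw [neg_mul, hd.even_ρ₀]
  simp only [this]

theorem v₀_zero (hd : d.Admissible) : d.v₀ 0 = 0 := hd.odd_v₀.map_zero

theorem contDiff_divR_v₀ (hd : d.Admissible) : ContDiff ℝ ∞ (divR d.v₀) :=
  contDiff_divR hd.smooth_v₀ hd.v₀_zero

theorem divR_v₀_neg (hd : d.Admissible) (R : ℝ) : divR d.v₀ R < 0 := by
  rcases le_total 0 R with h | h
  · exact hd.collapsing R h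
  · rw [← divR_even hd.odd_v₀ R]; exact hd.collapsing _ (by linarith)

theorem divR_v₀_sq_lt (hd : d.Admissible) (R : ℝ) : divR d.v₀ R ^ 2 < d.c R := by
  rcases le_total 0 R with h | h
  · exact hd.bounded R h
  · rw [← divR_even hd.odd_v₀ R, ← hd.even_c R]; exact hd.bounded _ (by linarith)

theorem c_pos (hd : d.Admissible) (R : ℝ) : 0 < d.c R :=
  (sq_nonneg _).trans_lt (hd.divR_v₀_sq_lt R)

theorem q_arg_pos (hd : d.Admissible) (R : ℝ) : 0 < 1 - divR d.v₀ R ^ 2 / d.c R := by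
  rw [sub_pos, div_lt_one (hd.c_pos R)]; exact hd.divR_v₀_sq_lt R

theorem q_pos (hd : d.Admissible) (R : ℝ) : 0 < d.q R := Real.sqrt_pos.2 (hd.q_arg_pos R)

theorem q_sq (hd : d.Admissible) (R : ℝ) : d.q R ^ 2 = 1 - divR d.v₀ R ^ 2 / d.c R :=
  Real.sq_sqrt (hd.q_arg_pos R).le

theorem q_lt_one (hd : d.Admissible) (R : ℝ) : d.q R < 1 := by
  have h1 := hd.q_sq R
  have h2 : 0 < divR d.v₀ R ^ 2 / d.c R :=
    div_pos (by have := hd.divR_v₀_neg R; nlinarith) (hd.c_pos R)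
  nlinarith [hd.q_pos R]

theorem contDiff_q (hd : d.Admissible) : ContDiff ℝ ∞ d.q := by
  have : ContDiff ℝ ∞ (fun R => 1 - divR d.v₀ R ^ 2 / d.c R) :=
    contDiff_const.sub ((hd.contDiff_divR_v₀.pow 2).div hd.contDiff_c fun R => (hd.c_pos R).ne')
  exact this.sqrt fun R => (hd.q_arg_pos R).ne'

theorem even_q (hd : d.Admissible) : Function.Even d.q := by
  intro R
  unfold q
  rw [divR_even hd.odd_v₀ R, hd.even_c R]

theorem contDiff_divR_c (hd : d.Admissible) : ContDiff ℝ ∞ (divR (deriv d.c)) :=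
  contDiff_divR ((contDiff_infty_iff_deriv.1 hd.contDiff_c).2) (Even.deriv_zero hd.even_c)

theorem contDiff_divR_q (hd : d.Admissible) : ContDiff ℝ ∞ (divR (deriv d.q)) :=
  contDiff_divR ((contDiff_infty_iff_deriv.1 hd.contDiff_q).2) (Even.deriv_zero hd.even_q)

theorem hasDerivAt_c (hd : d.Admissible) (R : ℝ) : HasDerivAt d.c (deriv d.c R) R :=
  (hd.contDiff_c.differentiable (by simp) R).hasDerivAt

theorem hasDerivAt_q (hd : d.Admissible) (R : ℝ) : HasDerivAt d.q (deriv d.q R) R :=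
  (hd.contDiff_q.differentiable (by simp) R).hasDerivAt

theorem deriv_c_eq (hd : d.Admissible) (R : ℝ) : deriv d.c R = R * divR (deriv d.c) R :=
  (mul_divR (Even.deriv_zero hd.even_c) R).symm

theorem deriv_q_eq (hd : d.Admissible) (R : ℝ) : deriv d.q R = R * divR (deriv d.q) R :=
  (mul_divR (Even.deriv_zero hd.even_q) R).symm

/-- For R > 0 this is the assumed monotonicity; the value at R = 0 follows by continuity of `divR
(deriv d.c)`, since 0 lies in the closure of the positive axis. -/
theorem divR_c_nonpos (hd : d.Admissible) {R : ℝ} (hR : 0 ≤ R) : divR (deriv d.c) R ≤ 0 := by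
  have h : ∀ x ∈ Ioi (0 : ℝ), divR (deriv d.c) x ≤ 0 := fun x hx => by
    have hx' : 0 < x := hx
    rw [divR, if_neg hx'.ne']
    exact div_nonpos_of_nonpos_of_nonneg (hd.mean_density_antitone x hx) hx'.le
  have hcl : R ∈ closure (Ioi (0 : ℝ)) := by rw [closure_Ioi]; exact hR
  exact closure_minimal (fun x hx => h x hx)
    (isClosed_le hd.contDiff_divR_c.continuous continuous_const) hcl

theorem divR_q_nonneg (hd : d.Admissible) {R : ℝ} (hR : 0 ≤ R) : 0 ≤ divR (deriv d.q) R := by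
  have h : ∀ x ∈ Ioi (0 : ℝ), 0 ≤ divR (deriv d.q) x := fun x hx => by
    have hx' : 0 < x := hx
    rw [divR, if_neg hx'.ne']
    exact div_nonneg (hd.no_shell_crossing x hx) hx'.le
  have hcl : R ∈ closure (Ioi (0 : ℝ)) := by rw [closure_Ioi]; exact hR
  exact closure_minimal (fun x hx => h x hx)
    (isClosed_le continuous_const hd.contDiff_divR_q.continuous) hcl

theorem hasDerivAt_m (hd : d.Admissible) (R : ℝ) :
    HasDerivAt d.m (4 * Real.pi * (d.ρ₀ R * R ^ 2)) R := by
  have hc : Continuous fun s => d.ρ₀ s * s ^ 2 := by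
    have := hd.smooth_ρ₀.continuous; fun_prop
  exact (intervalIntegral.integral_hasDerivAt_right (hc.intervalIntegrable _ _)
    (hc.stronglyMeasurableAtFilter _ _) hc.continuousAt).const_mul _

theorem mass_ratio_lt_one (hd : d.Admissible) {R : ℝ} (hR : 0 ≤ R) : R ^ 2 * d.c R < 1 := by
  rcases hR.eq_or_lt with h | h
  · simp [← h]
  · have := hd.untrapped R h
    rw [d.m_eq] at this
    calc R ^ 2 * d.c R = 2 * (d.c R * R ^ 3 / 2) / R := by field_simp
      _ < 1 := this

end Admissible

/-- The square root of `1 + 2 E`, in terms of `c` and `q`. -/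
def w (d : DustData) (R : ℝ) : ℝ := √(1 - R ^ 2 * d.c R * d.q R ^ 2)

namespace Admissible

theorem w_arg_pos (hd : d.Admissible) {R : ℝ} (hR : 0 ≤ R) :
    0 < 1 - R ^ 2 * d.c R * d.q R ^ 2 := by
  have h1 := hd.mass_ratio_lt_one hR
  have h2 := hd.q_pos R
  have h3 := hd.q_lt_one R
  have h4 : 0 ≤ R ^ 2 * d.c R := by have := hd.c_pos R; positivity
  nlinarith [mul_nonneg h4 (by nlinarith : 0 ≤ 1 - d.q R ^ 2)]

theorem w_pos (hd : d.Admissible) {R : ℝ} (hR : 0 ≤ R) : 0 < d.w R := Real.sqrt_pos.2 (hd.w_arg_pos hR)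

theorem w_sq (hd : d.Admissible) {R : ℝ} (hR : 0 ≤ R) :
    d.w R ^ 2 = 1 - R ^ 2 * d.c R * d.q R ^ 2 := Real.sq_sqrt (hd.w_arg_pos hR).le

theorem w_le_one (hd : d.Admissible) (R : ℝ) : d.w R ≤ 1 := by
  have : 0 ≤ R ^ 2 * d.c R * d.q R ^ 2 := by have := hd.c_pos R; positivity
  exact Real.sqrt_le_one.2 (by linarith)

/-- With v₀ = R · divR v₀ and 2m/R = R² c, 2E = R² ((v₀/R)² - c) = -R² c q². -/
theorem sqrt_one_add_E (hd : d.Admissible) (R : ℝ) : √(1 + 2 * d.E R) = d.w R := by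
  unfold w E
  congr 1
  rw [d.m_eq, hd.q_sq, ← mul_divR hd.v₀_zero R]
  have := (hd.c_pos R).ne'
  field_simp
  ring

theorem contDiffAt_w (hd : d.Admissible) {R : ℝ} (hR : 0 ≤ R) : ContDiffAt ℝ ∞ d.w R := by
  have hc := hd.contDiff_c
  have hq := hd.contDiff_q
  have : ContDiff ℝ ∞ (fun R => 1 - R ^ 2 * d.c R * d.q R ^ 2) := by fun_prop
  exact this.contDiffAt.sqrt (hd.w_arg_pos hR).ne'

end Admissible

end DustData

open scoped ContDiff

/-! ### The collapse function -/

theorem one_sub_sq_pos {x : ℝ} (hx : |x| < 1) : 0 < 1 - x ^ 2 := by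
  have := (sq_lt_one_iff_abs_lt_one x).2 hx
  linarith

theorem hasDerivAt_sqrt_one_sub_sq {x : ℝ} (hx : |x| < 1) :
    HasDerivAt (fun x : ℝ => √(1 - x ^ 2)) (-x / √(1 - x ^ 2)) x := by
  have h : HasDerivAt (fun x : ℝ => 1 - x ^ 2) (-(2 * x)) x := by
    simpa using (hasDerivAt_pow 2 x).const_sub 1
  convert h.sqrt (one_sub_sq_pos hx).ne' using 1
  field_simp

/-- The derivative of `f` on `(-1, 1)`. -/
def f₁ (x : ℝ) : ℝ := -2 * x ^ 2 / √(1 - x ^ 2)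

theorem hasDerivAt_f {x : ℝ} (hx : |x| < 1) : HasDerivAt f (f₁ x) x := by
  have h0 := one_sub_sq_pos hx
  have h1 := (hasDerivAt_id' x).mul (hasDerivAt_sqrt_one_sub_sq hx)
  have hx' := abs_lt.1 hx
  have h2 := Real.hasDerivAt_arccos (x := x) (by linarith) (by linarith)
  refine (h1.add h2).congr_deriv ?_
  have hs := Real.sqrt_pos.2 h0
  have hs2 := Real.sq_sqrt h0.le
  unfold f₁
  field_simp
  rw [hs2]
  ring

theorem contDiffAt_f {x : ℝ} (hx : |x| < 1) : ContDiffAt ℝ ∞ f x := by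
  have hx' := abs_lt.1 hx
  have h1 : ContDiffAt ℝ ∞ (fun x : ℝ => √(1 - x ^ 2)) x :=
    ContDiffAt.sqrt (by fun_prop) (one_sub_sq_pos hx).ne'
  exact (contDiffAt_id.mul h1).add (Real.contDiffAt_arccos (by linarith) (by linarith))

/-- `x f'(x) - 3 f(x)`, whose increments give the derivative of `g` in its first variable. -/
def fAux (x : ℝ) : ℝ := x * f₁ x - 3 * f x

theorem hasDerivAt_f₁ {x : ℝ} (hx : |x| < 1) :
    HasDerivAt f₁ (-4 * x / √(1 - x ^ 2) - 2 * x ^ 3 / √(1 - x ^ 2) ^ 3) x := by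
  have h0 := one_sub_sq_pos hx
  have hs := Real.sqrt_pos.2 h0
  have h1 : HasDerivAt (fun x : ℝ => -2 * x ^ 2) (-2 * (2 * x)) x := by
    simpa using (hasDerivAt_pow 2 x).const_mul (-2)
  refine (h1.div (hasDerivAt_sqrt_one_sub_sq hx) hs.ne').congr_deriv ?_
  field_simp
  ring

theorem hasDerivAt_fAux {x : ℝ} (hx : |x| < 1) :
    HasDerivAt fAux (-2 * x ^ 4 / √(1 - x ^ 2) ^ 3) x := by
  have h0 := one_sub_sq_pos hx
  have hs := Real.sqrt_pos.2 h0
  have hs2 := Real.sq_sqrt h0.le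
  refine (((hasDerivAt_id' x).mul (hasDerivAt_f₁ hx)).sub
    ((hasDerivAt_f hx).const_mul 3)).congr_deriv ?_
  unfold f₁
  field_simp
  rw [hs2]
  ring

/-- The derivative is -2x⁴/(1-x²)^(3/2). The resulting positivity of `gq` means that an increasing q
delays the collapse. -/
theorem strictAntiOn_fAux : StrictAntiOn fAux (Ico 0 1) := by
  refine strictAntiOn_of_deriv_neg (convex_Ico 0 1) (fun x hx => ?_) fun x hx => ?_
  · exact (hasDerivAt_fAux (by rw [abs_of_nonneg hx.1]; exact hx.2)).continuousAt.continuousWithinAt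
  · rw [interior_Ico] at hx
    have hx1 : |x| < 1 := by rw [abs_of_pos hx.1]; exact hx.2
    rw [(hasDerivAt_fAux hx1).deriv]
    have hs := Real.sqrt_pos.2 (one_sub_sq_pos hx1)
    have := pow_pos hx.1 4
    exact div_neg_of_neg_of_pos (by linarith) (by positivity)

theorem strictAntiOn_f : StrictAntiOn f (Ico 0 1) := by
  refine strictAntiOn_of_deriv_neg (convex_Ico 0 1) (fun x hx => ?_) fun x hx => ?_
  · exact (hasDerivAt_f (by rw [abs_of_nonneg hx.1]; exact hx.2)).continuousAt.continuousWithinAt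
  · rw [interior_Ico] at hx
    have hx1 : |x| < 1 := by rw [abs_of_pos hx.1]; exact hx.2
    rw [(hasDerivAt_f hx1).deriv, f₁]
    have hs := Real.sqrt_pos.2 (one_sub_sq_pos hx1)
    have := pow_pos hx.1 2
    exact div_neg_of_neg_of_pos (by linarith) (by positivity)

/-- The partial derivative of `g` in its first variable. -/
def gq (q y : ℝ) : ℝ := (fAux (q * y) - fAux q) / q ^ 4

theorem hasDerivAt_g_left {q y : ℝ} (hq : 0 < q) (hq1 : q < 1) (hy : |q * y| < 1) :
    HasDerivAt (fun q => g q y) (gq q y) q := by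
  have h1 : HasDerivAt (fun q : ℝ => f (q * y)) (f₁ (q * y) * y) q :=
    HasDerivAt.comp (h₂ := f) (h := fun q : ℝ => q * y) q (hasDerivAt_f hy)
      (by simpa using (hasDerivAt_id' q).mul_const y)
  have h2 := hasDerivAt_f (x := q) (by rw [abs_of_pos hq]; exact hq1)
  have h3 : HasDerivAt (fun q : ℝ => q ^ 3) (3 * q ^ 2) q := by simpa using hasDerivAt_pow 3 q
  refine ((h1.sub h2).div h3 (by positivity)).congr_deriv ?_
  unfold gq fAux
  simp only [Pi.sub_apply]
  field_simp
  ring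

theorem hasDerivAt_g_right {q y : ℝ} (hq : 0 < q) (hy : |q * y| < 1) :
    HasDerivAt (fun y => g q y) (-2 * y ^ 2 / √(1 - (q * y) ^ 2)) y := by
  have h1 : HasDerivAt (fun y : ℝ => f (q * y)) (f₁ (q * y) * q) y :=
    HasDerivAt.comp (h₂ := f) (h := fun y : ℝ => q * y) y (hasDerivAt_f hy)
      (by simpa using (hasDerivAt_id' y).const_mul q)
  refine ((h1.sub_const (f q)).div_const (q ^ 3)).congr_deriv ?_
  have hs := Real.sqrt_pos.2 (one_sub_sq_pos hy)
  unfold f₁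
  field_simp

theorem g_one (q : ℝ) : g q 1 = 0 := by simp [g]

theorem gq_one (q : ℝ) : gq q 1 = 0 := by simp [gq]

theorem mul_mem_Ico {q y : ℝ} (hq : 0 < q) (hq1 : q < 1) (hy : y ∈ Icc (0 : ℝ) 1) :
    q * y ∈ Ico (0 : ℝ) 1 :=
  ⟨mul_nonneg hq.le hy.1, by nlinarith [hy.1, hy.2]⟩

theorem gq_nonneg {q y : ℝ} (hq : 0 < q) (hq1 : q < 1) (hy : y ∈ Icc (0 : ℝ) 1) : 0 ≤ gq q y := by
  have := strictAntiOn_fAux.antitoneOn (mul_mem_Ico hq hq1 hy) ⟨hq.le, hq1⟩ (by nlinarith [hy.1, hy.2])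
  exact div_nonneg (by linarith) (by positivity)

theorem gq_pos {q y : ℝ} (hq : 0 < q) (hq1 : q < 1) (hy : y ∈ Ico (0 : ℝ) 1) : 0 < gq q y := by
  have := strictAntiOn_fAux (mul_mem_Ico hq hq1 ⟨hy.1, hy.2.le⟩) ⟨hq.le, hq1⟩
    (by nlinarith [hy.1, hy.2])
  exact div_pos (by linarith) (by positivity)

theorem g_nonneg {q y : ℝ} (hq : 0 < q) (hq1 : q < 1) (hy : y ∈ Icc (0 : ℝ) 1) : 0 ≤ g q y := by
  have := strictAntiOn_f.antitoneOn (mul_mem_Ico hq hq1 hy) ⟨hq.le, hq1⟩ (by nlinarith [hy.1, hy.2])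
  exact div_nonneg (by linarith) (by positivity)

theorem g_pos {q y : ℝ} (hq : 0 < q) (hq1 : q < 1) (hy : y ∈ Ico (0 : ℝ) 1) : 0 < g q y := by
  have := strictAntiOn_f (mul_mem_Ico hq hq1 ⟨hy.1, hy.2.le⟩) ⟨hq.le, hq1⟩
    (by nlinarith [hy.1, hy.2])
  exact div_pos (by linarith) (by positivity)

/-! ### The proper time as a function of `(y, R)` -/

namespace DustData

variable {d : DustData}

/-- `- ∂y/∂τ`. -/
def ySpeed (d : DustData) (y R : ℝ) : ℝ := √(d.c R) * √(1 - (d.q R * y) ^ 2) / (2 * y ^ 2)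

/-- The derivative of `tau` in its second variable, divided by `R`. -/
def tauK (d : DustData) (y R : ℝ) : ℝ :=
  gq (d.q R) y * divR (deriv d.q) R / √(d.c R)
    - g (d.q R) y * divR (deriv d.c) R / (2 * d.c R * √(d.c R))

/-- The derivative of the areal radius in `R` at fixed proper time. -/
def rR (d : DustData) (y R : ℝ) : ℝ := y ^ 2 + 2 * R * y * (d.ySpeed y R * (R * d.tauK y R))

/-- Minus the derivative of the areal radius in proper time. -/
def infall (d : DustData) (y R : ℝ) : ℝ := R * √(d.c R) * √(1 - (d.q R * y) ^ 2) / y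

/-- The domain `0 < y < 1/q(R)` of coordinates `(y, R)`. -/
def yDom (d : DustData) : Set (ℝ × ℝ) := {z | 0 < z.1 ∧ d.q z.2 * z.1 < 1}

namespace Admissible

theorem isOpen_yDom (hd : d.Admissible) : IsOpen d.yDom := by
  have h := hd.contDiff_q.continuous
  have h' : Continuous fun z : ℝ × ℝ => d.q z.2 * z.1 := by fun_prop
  exact (isOpen_lt continuous_const continuous_fst).inter (isOpen_lt h' continuous_const)

theorem abs_q_mul_lt (hd : d.Admissible) {y R : ℝ} (h : (y, R) ∈ d.yDom) : |d.q R * y| < 1 := by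
  rw [abs_of_pos (mul_pos (hd.q_pos R) h.1)]; exact h.2

theorem mem_yDom (hd : d.Admissible) {y R : ℝ} (hy : y ∈ Ioc (0 : ℝ) 1) : (y, R) ∈ d.yDom :=
  ⟨hy.1, by have := hd.q_pos R; have := hd.q_lt_one R; show d.q R * y < 1; nlinarith [hy.1, hy.2]⟩

theorem abs_q_mul_lt' (hd : d.Admissible) {y : ℝ} (hy : y ∈ Icc (0 : ℝ) 1) (R : ℝ) :
    |d.q R * y| < 1 := by
  have h := mul_mem_Ico (hd.q_pos R) (hd.q_lt_one R) hy
  rw [abs_of_nonneg h.1]; exact h.2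

theorem sqrt_c_pos (hd : d.Admissible) (R : ℝ) : 0 < √(d.c R) := Real.sqrt_pos.2 (hd.c_pos R)

theorem sqrt_q_pos (hd : d.Admissible) {y R : ℝ} (h : (y, R) ∈ d.yDom) :
    0 < √(1 - (d.q R * y) ^ 2) := Real.sqrt_pos.2 (one_sub_sq_pos (hd.abs_q_mul_lt h))

theorem ySpeed_pos (hd : d.Admissible) {y R : ℝ} (h : (y, R) ∈ d.yDom) : 0 < d.ySpeed y R := by
  have h1 := hd.sqrt_c_pos R
  have h2 := hd.sqrt_q_pos h
  have h3 : 0 < y := h.1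
  unfold ySpeed
  positivity

theorem contDiffAt_tau (hd : d.Admissible) {y R : ℝ} (h : |d.q R * y| < 1) :
    ContDiffAt ℝ ∞ (fun z : ℝ × ℝ => d.tau z.1 z.2) (y, R) := by
  have hq : ContDiffAt ℝ ∞ (fun z : ℝ × ℝ => d.q z.2) (y, R) :=
    hd.contDiff_q.contDiffAt.comp _ contDiffAt_snd
  have hc : ContDiffAt ℝ ∞ (fun z : ℝ × ℝ => d.c z.2) (y, R) :=
    hd.contDiff_c.contDiffAt.comp _ contDiffAt_snd
  have h1 : ContDiffAt ℝ ∞ (fun z : ℝ × ℝ => f (d.q z.2 * z.1)) (y, R) :=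
    ContDiffAt.comp (g := f) (f := fun z : ℝ × ℝ => d.q z.2 * z.1) (y, R) (contDiffAt_f h)
      (hq.mul contDiffAt_fst)
  have h2 : ContDiffAt ℝ ∞ (fun z : ℝ × ℝ => f (d.q z.2)) (y, R) :=
    ContDiffAt.comp (g := f) (f := fun z : ℝ × ℝ => d.q z.2) (y, R)
      (contDiffAt_f (by rw [abs_of_pos (hd.q_pos R)]; exact hd.q_lt_one R)) hq
  exact ((h1.sub h2).div (hq.pow 3) (pow_pos (hd.q_pos R) 3).ne').div
    (hc.sqrt (hd.c_pos R).ne') (hd.sqrt_c_pos R).ne'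

theorem hasDerivAt_tau_y (hd : d.Admissible) {y R : ℝ} (h : |d.q R * y| < 1) :
    HasDerivAt (fun y => d.tau y R) (-2 * y ^ 2 / √(1 - (d.q R * y) ^ 2) / √(d.c R)) y :=
  (hasDerivAt_g_right (hd.q_pos R) h).div_const _

/-- Since c and q are even, both their derivatives carry a factor R. Extracting it leaves the smooth
function `tauK`, which does not degenerate at the centre. -/
theorem hasDerivAt_tau_R (hd : d.Admissible) {y R : ℝ} (h : |d.q R * y| < 1) :
    HasDerivAt (fun R => d.tau y R) (R * d.tauK y R) R := by
  have hc := hd.c_pos R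
  have h1 : HasDerivAt (fun R => g (d.q R) y) (gq (d.q R) y * deriv d.q R) R :=
    HasDerivAt.comp (h₂ := fun q => g q y) R (hasDerivAt_g_left (hd.q_pos R) (hd.q_lt_one R) h)
      (hd.hasDerivAt_q R)
  refine (h1.div ((hd.hasDerivAt_c R).sqrt hc.ne') (hd.sqrt_c_pos R).ne').congr_deriv ?_
  rw [hd.deriv_c_eq, hd.deriv_q_eq]
  have hs := hd.sqrt_c_pos R
  have hs2 := Real.sq_sqrt hc.le
  unfold tauK
  rw [hs2]
  field_simp
  rw [hs2]
  ring

theorem tauK_nonneg (hd : d.Admissible) {y R : ℝ} (hy : y ∈ Icc (0 : ℝ) 1) (hR : 0 ≤ R) :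
    0 ≤ d.tauK y R := by
  have h1 := gq_nonneg (hd.q_pos R) (hd.q_lt_one R) hy
  have h2 := g_nonneg (hd.q_pos R) (hd.q_lt_one R) hy
  have h3 := hd.divR_c_nonpos hR
  have h4 := hd.divR_q_nonneg hR
  have h5 := hd.sqrt_c_pos R
  have h6 := hd.c_pos R
  unfold tauK
  have a : 0 ≤ gq (d.q R) y * divR (deriv d.q) R / √(d.c R) := by positivity
  have b : g (d.q R) y * divR (deriv d.c) R / (2 * d.c R * √(d.c R)) ≤ 0 :=
    div_nonpos_of_nonpos_of_nonneg (mul_nonpos_of_nonneg_of_nonpos h2 h3) (by positivity)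
  linarith

/-- Both terms of `tauK` are nonnegative for R ≥ 0. The one with c' is positive unless c'/R = 0, and
in that case the nondegeneracy assumption makes the one with q' positive. -/
theorem tauK_pos (hd : d.Admissible) {y R : ℝ} (hy : y ∈ Ico (0 : ℝ) 1) (hR : 0 ≤ R) :
    0 < d.tauK y R := by
  have h1 := gq_pos (hd.q_pos R) (hd.q_lt_one R) hy
  have h2 := g_pos (hd.q_pos R) (hd.q_lt_one R) hy
  have h4 := hd.divR_q_nonneg hR
  have h5 := hd.sqrt_c_pos R
  have h6 := hd.c_pos R
  unfold tauK
  have a : 0 ≤ gq (d.q R) y * divR (deriv d.q) R / √(d.c R) := by positivity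
  rcases (hd.divR_c_nonpos hR).eq_or_lt with h | h
  · have := hd.nondegenerate R hR h
    rw [h]
    simp only [mul_zero, zero_div, sub_zero]
    positivity
  · have b : g (d.q R) y * divR (deriv d.c) R / (2 * d.c R * √(d.c R)) < 0 :=
      div_neg_of_neg_of_pos (mul_neg_of_pos_of_neg h2 h) (by positivity)
    linarith

theorem tauK_one (d : DustData) (R : ℝ) : d.tauK 1 R = 0 := by simp [tauK, g_one, gq_one]

/-- Absence of shell crossings: r' = y² plus a multiple of `tauK`, and `tauK` is nonnegative. In
particular r' > 0 before collapse. -/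
theorem sq_le_rR (hd : d.Admissible) {y R : ℝ} (hy : y ∈ Ioc (0 : ℝ) 1) (hR : 0 ≤ R) :
    y ^ 2 ≤ d.rR y R := by
  have h1 := hd.tauK_nonneg ⟨hy.1.le, hy.2⟩ hR
  have h2 := hd.ySpeed_pos (hd.mem_yDom (R := R) hy)
  have h3 := hy.1
  unfold rR
  have : 0 ≤ 2 * R * y * (d.ySpeed y R * (R * d.tauK y R)) := by positivity
  linarith

theorem rR_pos (hd : d.Admissible) {y R : ℝ} (hy : y ∈ Ioc (0 : ℝ) 1) (hR : 0 ≤ R) :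
    0 < d.rR y R := (pow_pos hy.1 2).trans_le (hd.sq_le_rR hy hR)

theorem infall_pos (hd : d.Admissible) {y R : ℝ} (hy : (y, R) ∈ d.yDom) (hR : 0 < R) :
    0 < d.infall y R := by
  have h1 := hd.sqrt_c_pos R
  have h2 := hd.sqrt_q_pos hy
  have h3 : 0 < y := hy.1
  unfold infall
  positivity

/-- The energy equation of a dust shell. -/
theorem infall_sq (hd : d.Admissible) {y R : ℝ} (hy : (y, R) ∈ d.yDom) (hR : 0 ≤ R) :
    d.infall y R ^ 2 = d.w R ^ 2 - 1 + R ^ 2 * d.c R / y ^ 2 := by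
  have h3 : y ≠ 0 := hy.1.ne'
  rw [hd.w_sq hR, infall, div_pow, mul_pow, mul_pow, Real.sq_sqrt (hd.c_pos R).le,
    Real.sq_sqrt (one_sub_sq_pos (hd.abs_q_mul_lt hy)).le]
  field_simp
  ring

end Admissible

end DustData

open scoped ContDiff

namespace DustData

variable {d : DustData}

/-! ### The shell coordinate `y` as a function of `(τ, R)` -/

/-- The smooth extension of `y` to slightly negative proper times. -/
def yE (d : DustData) (τ R : ℝ) : ℝ :=
  Function.invFunOn (fun y => d.tau y R) {y | (y, R) ∈ d.yDom} τ

/-- The domain of `yE`. -/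
def tDom (d : DustData) : Set (ℝ × ℝ) := {z | ∃ y, (y, z.2) ∈ d.yDom ∧ d.tau y z.2 = z.1}

namespace Admissible

theorem strictAntiOn_tau (hd : d.Admissible) (R : ℝ) :
    StrictAntiOn (fun y => d.tau y R) {y | 0 ≤ y ∧ d.q R * y < 1} := by
  have hq := hd.q_pos R
  have habs : ∀ y, 0 ≤ y → d.q R * y < 1 → |d.q R * y| < 1 := fun y h1 h2 => by
    rw [abs_of_nonneg (by positivity)]; exact h2
  have hset : {y | 0 ≤ y ∧ d.q R * y < 1} = Ico 0 (1 / d.q R) := by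
    ext y; simp only [mem_ofPred_eq, mem_Ico, lt_div_iff₀ hq, mul_comm]
  rw [hset]
  refine strictAntiOn_of_deriv_neg (convex_Ico _ _) (fun y hy => ?_) fun y hy => ?_
  · rw [← hset] at hy
    exact (hd.hasDerivAt_tau_y (habs y hy.1 hy.2)).continuousAt.continuousWithinAt
  · rw [interior_Ico] at hy
    have h2 : d.q R * y < 1 := by rw [mul_comm, ← lt_div_iff₀ hq]; exact hy.2
    have hm := habs y hy.1.le h2
    rw [(hd.hasDerivAt_tau_y hm).deriv]
    have hs := Real.sqrt_pos.2 (one_sub_sq_pos hm)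
    have hc := hd.sqrt_c_pos R
    have := pow_pos hy.1 2
    exact div_neg_of_neg_of_pos (div_neg_of_neg_of_pos (by linarith) hs) hc

theorem injOn_tau (hd : d.Admissible) (R : ℝ) :
    InjOn (fun y => d.tau y R) {y | (y, R) ∈ d.yDom} := by
  have hsub : {y | (y, R) ∈ d.yDom} ⊆ {y | 0 ≤ y ∧ d.q R * y < 1} :=
    fun y hy => ⟨le_of_lt hy.1, hy.2⟩
  exact (hd.strictAntiOn_tau R).injOn.mono hsub

theorem Icc_subset (hd : d.Admissible) (R : ℝ) : Icc (0 : ℝ) 1 ⊆ {y | 0 ≤ y ∧ d.q R * y < 1} :=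
  fun _ hy => ⟨hy.1, (mul_mem_Ico (hd.q_pos R) (hd.q_lt_one R) hy).2⟩

theorem yE_tau (hd : d.Admissible) {y R : ℝ} (h : (y, R) ∈ d.yDom) : d.yE (d.tau y R) R = y :=
  (hd.injOn_tau R).leftInvOn_invFunOn h

theorem tau_one (d : DustData) (R : ℝ) : d.tau 1 R = 0 := by simp [tau, g_one]

theorem continuousOn_tau (hd : d.Admissible) (R : ℝ) :
    ContinuousOn (fun y => d.tau y R) (Icc 0 1) := fun _ hy =>
  (hd.hasDerivAt_tau_y (hd.abs_q_mul_lt' hy R)).continuousAt.continuousWithinAt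

theorem y_spec (hd : d.Admissible) {τ R : ℝ} (h0 : 0 ≤ τ) (h1 : τ ≤ d.tauS R) :
    d.y τ R ∈ Icc (0 : ℝ) 1 ∧ d.tau (d.y τ R) R = τ := by
  have h := intermediate_value_Icc' zero_le_one (hd.continuousOn_tau R)
  rw [tau_one] at h
  have hτ : τ ∈ (fun y => d.tau y R) '' Icc 0 1 := h ⟨h0, h1⟩
  exact ⟨Function.invFunOn_mem hτ, Function.invFunOn_eq hτ⟩

theorem y_tau (hd : d.Admissible) {y : ℝ} (R : ℝ) (hy : y ∈ Icc (0 : ℝ) 1) :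
    d.y (d.tau y R) R = y :=
  ((hd.strictAntiOn_tau R).injOn.mono (hd.Icc_subset R)).leftInvOn_invFunOn hy

theorem y_mem (hd : d.Admissible) {τ R : ℝ} (h0 : 0 ≤ τ) (h1 : τ < d.tauS R) :
    d.y τ R ∈ Ioc (0 : ℝ) 1 := by
  obtain ⟨h, h'⟩ := hd.y_spec h0 h1.le
  refine ⟨lt_of_le_of_ne h.1 fun h2 => ?_, h.2⟩
  rw [← h2] at h'
  exact h1.ne h'.symm

theorem tau_y (hd : d.Admissible) {τ R : ℝ} (h0 : 0 ≤ τ) (h1 : τ < d.tauS R) :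
    d.tau (d.y τ R) R = τ := (hd.y_spec h0 h1.le).2

theorem yE_eq_y (hd : d.Admissible) {τ R : ℝ} (h0 : 0 ≤ τ) (h1 : τ < d.tauS R) :
    d.yE τ R = d.y τ R := by
  conv_lhs => rw [← hd.tau_y h0 h1]
  exact hd.yE_tau (hd.mem_yDom (hd.y_mem h0 h1))

theorem mem_tDom (hd : d.Admissible) {τ R : ℝ} (h0 : 0 ≤ τ) (h1 : τ < d.tauS R) :
    (τ, R) ∈ d.tDom := ⟨d.y τ R, hd.mem_yDom (hd.y_mem h0 h1), hd.tau_y h0 h1⟩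

theorem yE_spec (hd : d.Admissible) {z : ℝ × ℝ} (h : z ∈ d.tDom) :
    (d.yE z.1 z.2, z.2) ∈ d.yDom ∧ d.tau (d.yE z.1 z.2) z.2 = z.1 := by
  obtain ⟨y, hy, hz⟩ := h
  rw [← hz, hd.yE_tau hy]
  exact ⟨hy, rfl⟩

theorem y_lt_one (hd : d.Admissible) {τ R : ℝ} (h0 : 0 < τ) (h1 : τ < d.tauS R) :
    d.y τ R < 1 := by
  refine lt_of_le_of_ne (hd.y_mem h0.le h1).2 fun h => ?_
  have := hd.tau_y h0.le h1
  rw [h, tau_one] at this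
  exact h0.ne this

theorem tau_nonneg (hd : d.Admissible) {y : ℝ} (R : ℝ) (hy : y ∈ Icc (0 : ℝ) 1) :
    0 ≤ d.tau y R := div_nonneg (g_nonneg (hd.q_pos R) (hd.q_lt_one R) hy) (Real.sqrt_nonneg _)

theorem tau_lt_tauS (hd : d.Admissible) {y : ℝ} (R : ℝ) (hy : y ∈ Ioc (0 : ℝ) 1) :
    d.tau y R < d.tauS R :=
  hd.strictAntiOn_tau R (hd.Icc_subset R ⟨le_rfl, zero_le_one⟩)
    (hd.Icc_subset R ⟨hy.1.le, hy.2⟩) hy.1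

theorem tau_lt_tau_iff (hd : d.Admissible) {y y' : ℝ} (R : ℝ) (hy : y ∈ Icc (0 : ℝ) 1)
    (hy' : y' ∈ Icc (0 : ℝ) 1) : d.tau y R < d.tau y' R ↔ y' < y :=
  (hd.strictAntiOn_tau R).lt_iff_gt (hd.Icc_subset R hy) (hd.Icc_subset R hy')

theorem y_le_y_iff (hd : d.Admissible) {τ τ' R : ℝ} (h0 : 0 ≤ τ) (h1 : τ < d.tauS R)
    (h0' : 0 ≤ τ') (h1' : τ' < d.tauS R) : d.y τ R ≤ d.y τ' R ↔ τ' ≤ τ := by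
  have a := hd.y_mem h0 h1
  have b := hd.y_mem h0' h1'
  rw [← not_lt, ← hd.tau_lt_tau_iff R ⟨a.1.le, a.2⟩ ⟨b.1.le, b.2⟩, hd.tau_y h0 h1, hd.tau_y h0' h1',
    not_lt]

theorem contDiff_tauS (hd : d.Admissible) : ContDiff ℝ ∞ d.tauS := by
  rw [contDiff_iff_contDiffAt]
  intro R
  exact ContDiffAt.comp (g := fun z : ℝ × ℝ => d.tau z.1 z.2) (f := fun R : ℝ => ((0 : ℝ), R)) R
    (hd.contDiffAt_tau (by simp)) (by fun_prop)

theorem hasDerivAt_tauS (hd : d.Admissible) (R : ℝ) : HasDerivAt d.tauS (R * d.tauK 0 R) R :=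
  hd.hasDerivAt_tau_R (by simp)

theorem strictMonoOn_tauS (hd : d.Admissible) : StrictMonoOn d.tauS (Ici 0) := by
  refine strictMonoOn_of_deriv_pos (convex_Ici 0) hd.contDiff_tauS.continuous.continuousOn
    fun R hR => ?_
  rw [interior_Ici] at hR
  rw [(hd.hasDerivAt_tauS R).deriv]
  exact mul_pos hR (hd.tauK_pos ⟨le_rfl, zero_lt_one⟩ (le_of_lt hR))

theorem tauS_pos (hd : d.Admissible) (R : ℝ) : 0 < d.tauS R :=
  (hd.tau_nonneg R ⟨zero_le_one, le_rfl⟩).trans_lt (hd.tau_lt_tauS R ⟨zero_lt_one, le_rfl⟩)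

theorem hasFDerivAt_tau (hd : d.Admissible) {y R : ℝ} (h : |d.q R * y| < 1) :
    HasFDerivAt (fun z : ℝ × ℝ => d.tau z.1 z.2)
      ((-2 * y ^ 2 / √(1 - (d.q R * y) ^ 2) / √(d.c R)) • ContinuousLinearMap.fst ℝ ℝ ℝ
        + (R * d.tauK y R) • ContinuousLinearMap.snd ℝ ℝ ℝ) (y, R) := by
  have hF := ((hd.contDiffAt_tau h).differentiableAt (by simp)).hasFDerivAt
  refine hF.congr_fderiv ?_
  set L := fderiv ℝ (fun z : ℝ × ℝ => d.tau z.1 z.2) (y, R)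
  have h1 : L (1, 0) = -2 * y ^ 2 / √(1 - (d.q R * y) ^ 2) / √(d.c R) := by
    have := hF.comp_hasDerivAt y ((hasDerivAt_id' y).prodMk (hasDerivAt_const y R))
    exact this.unique (hd.hasDerivAt_tau_y h)
  have h2 : L (0, 1) = R * d.tauK y R := by
    have := hF.comp_hasDerivAt R ((hasDerivAt_const R y).prodMk (hasDerivAt_id' R))
    exact this.unique (hd.hasDerivAt_tau_R h)
  ext
  · simpa using h1
  · simpa using h2

/-- The inverse function theorem for (y, R) ↦ (tau y R, R). The Jacobian is triangular, with ∂τ/∂y =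
-1/`ySpeed` ≠ 0 for y > 0, and injectivity in y identifies the local inverse with the globally
chosen `yE`. -/
theorem local_inverse (hd : d.Admissible) {y R : ℝ} (h : (y, R) ∈ d.yDom) :
    d.tDom ∈ 𝓝 (d.tau y R, R) ∧
    ContDiffAt ℝ ∞ (fun z : ℝ × ℝ => d.yE z.1 z.2) (d.tau y R, R) ∧
    HasFDerivAt (fun z : ℝ × ℝ => d.yE z.1 z.2)
      ((-d.ySpeed y R) • ContinuousLinearMap.fst ℝ ℝ ℝ
        + (d.ySpeed y R * (R * d.tauK y R)) • ContinuousLinearMap.snd ℝ ℝ ℝ) (d.tau y R, R) := by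
  have hq := hd.abs_q_mul_lt h
  set a := -2 * y ^ 2 / √(1 - (d.q R * y) ^ 2) / √(d.c R) with ha
  set b := R * d.tauK y R
  have hy : 0 < y := h.1
  have hs := hd.sqrt_q_pos h
  have hc := hd.sqrt_c_pos R
  have ha' : a * (-d.ySpeed y R) = 1 := by
    rw [ha, ySpeed]
    generalize √(1 - (d.q R * y) ^ 2) = k at *
    field_simp
  have hP := hd.ySpeed_pos h
  -- The triangular Jacobian and its inverse are written out; both composites are the identity by
  -- `ha'`. The inverse is then the derivative of `yE`.
  let e : (ℝ × ℝ) ≃L[ℝ] (ℝ × ℝ) := ContinuousLinearEquiv.equivOfInverse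
    ((a • ContinuousLinearMap.fst ℝ ℝ ℝ + b • ContinuousLinearMap.snd ℝ ℝ ℝ).prod
      (ContinuousLinearMap.snd ℝ ℝ ℝ))
    (((-d.ySpeed y R) • ContinuousLinearMap.fst ℝ ℝ ℝ
      + (d.ySpeed y R * b) • ContinuousLinearMap.snd ℝ ℝ ℝ).prod (ContinuousLinearMap.snd ℝ ℝ ℝ))
    (fun z => by
      refine Prod.ext ?_ (by simp)
      simp
      linear_combination z.1 * ha')
    (fun z => by
      refine Prod.ext ?_ (by simp)
      simp
      linear_combination (z.1 - b * z.2) * ha')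
  let Ψ : ℝ × ℝ → ℝ × ℝ := fun z => (d.tau z.1 z.2, z.2)
  have hΨ : ContDiffAt ℝ ∞ Ψ (y, R) := (hd.contDiffAt_tau hq).prodMk contDiffAt_snd
  have hΨ' : HasFDerivAt Ψ (e : ℝ × ℝ →L[ℝ] ℝ × ℝ) (y, R) :=
    (hd.hasFDerivAt_tau hq).prodMk hasFDerivAt_snd
  have hstrict : HasStrictFDerivAt Ψ (e : ℝ × ℝ →L[ℝ] ℝ × ℝ) (y, R) :=
    hΨ.hasStrictFDerivAt' hΨ' (by simp)
  set inv := hstrict.localInverse Ψ e (y, R)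
  have hinv0 : inv (Ψ (y, R)) = (y, R) := hstrict.localInverse_apply_image
  have hright : ∀ᶠ z in 𝓝 (Ψ (y, R)), Ψ (inv z) = z := hstrict.eventually_right_inverse
  have hcont : Tendsto inv (𝓝 (Ψ (y, R))) (𝓝 (y, R)) := hstrict.localInverse_tendsto
  have hdom : ∀ᶠ z in 𝓝 (Ψ (y, R)), inv z ∈ d.yDom :=
    hcont (hd.isOpen_yDom.mem_nhds h)
  -- `yE` is chosen fibre by fibre and has no regularity by construction; uniqueness in the fibre
  -- forces it to agree with the smooth local inverse.
  have heq : ∀ᶠ z in 𝓝 (Ψ (y, R)), d.yE z.1 z.2 = (inv z).1 ∧ z ∈ d.tDom := by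
    filter_upwards [hright, hdom] with z hz hz'
    have h1 : d.tau (inv z).1 (inv z).2 = z.1 := congrArg Prod.fst hz
    have h2 : (Ψ (inv z)).2 = z.2 := congrArg Prod.snd hz
    replace h2 : (inv z).2 = z.2 := h2
    have h3 : ((inv z).1, z.2) ∈ d.yDom := by rw [← h2]; exact hz'
    rw [h2] at h1
    exact ⟨by rw [← h1]; exact hd.yE_tau h3, ⟨(inv z).1, h3, h1⟩⟩
  have heq' : (fun z : ℝ × ℝ => d.yE z.1 z.2) =ᶠ[𝓝 (Ψ (y, R))] fun z => (inv z).1 :=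
    heq.mono fun z hz => hz.1
  refine ⟨heq.mono fun z hz => hz.2, ?_, ?_⟩
  · have : ContDiffAt ℝ ∞ inv (Ψ (y, R)) := hΨ.to_localInverse hΨ' (by simp)
    exact (contDiffAt_fst.comp _ this).congr_of_eventuallyEq heq'
  · have := hstrict.to_localInverse.hasFDerivAt
    exact (hasFDerivAt_fst.comp _ this).congr_of_eventuallyEq heq'

theorem isOpen_tDom (hd : d.Admissible) : IsOpen d.tDom := by
  rw [isOpen_iff_mem_nhds]
  rintro ⟨τ, R⟩ ⟨y, hy, hτ⟩
  dsimp only at hy hτ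
  subst hτ
  exact (hd.local_inverse hy).1

theorem contDiffOn_yE (hd : d.Admissible) :
    ContDiffOn ℝ ∞ (fun z : ℝ × ℝ => d.yE z.1 z.2) d.tDom := by
  rintro ⟨τ, R⟩ ⟨y, hy, hτ⟩
  dsimp only at hy hτ
  subst hτ
  exact (hd.local_inverse hy).2.1.contDiffWithinAt

theorem hasFDerivAt_yE (hd : d.Admissible) {z : ℝ × ℝ} (h : z ∈ d.tDom) :
    HasFDerivAt (fun z : ℝ × ℝ => d.yE z.1 z.2)
      ((-d.ySpeed (d.yE z.1 z.2) z.2) • ContinuousLinearMap.fst ℝ ℝ ℝ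
        + (d.ySpeed (d.yE z.1 z.2) z.2 * (z.2 * d.tauK (d.yE z.1 z.2) z.2))
          • ContinuousLinearMap.snd ℝ ℝ ℝ) z := by
  obtain ⟨τ, R⟩ := z
  obtain ⟨y, hy, hτ⟩ := h
  dsimp only at hy hτ ⊢
  subst hτ
  rw [hd.yE_tau hy]
  exact (hd.local_inverse hy).2.2

theorem hasDerivAt_yE_time (hd : d.Admissible) {τ R : ℝ} (h : (τ, R) ∈ d.tDom) :
    HasDerivAt (fun t => d.yE t R) (-d.ySpeed (d.yE τ R) R) τ := by
  have := (hd.hasFDerivAt_yE h).comp_hasDerivAt (f := fun t : ℝ => (t, R)) τ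
    ((hasDerivAt_id' τ).prodMk (hasDerivAt_const τ R))
  simpa [Function.comp_def] using this

theorem hasDerivAt_yE_radius (hd : d.Admissible) {τ R : ℝ} (h : (τ, R) ∈ d.tDom) :
    HasDerivAt (fun x => d.yE τ x) (d.ySpeed (d.yE τ R) R * (R * d.tauK (d.yE τ R) R)) R := by
  have := (hd.hasFDerivAt_yE h).comp_hasDerivAt (f := fun x : ℝ => (τ, x)) R
    ((hasDerivAt_const R τ).prodMk (hasDerivAt_id' R))
  simpa [Function.comp_def] using this

/-- The original `y` is meaningful only for τ ≥ 0, so at τ = 0 it has no two-sided derivative in τ.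
At fixed τ it agrees with `yE` for all nearby radii, which is all that the radial derivative in γ
needs. -/
theorem eventually_y_eq (hd : d.Admissible) {τ R : ℝ} (h0 : 0 ≤ τ) (h1 : τ < d.tauS R) :
    ∀ᶠ x in 𝓝 R, d.y τ x = d.yE τ x := by
  filter_upwards [(isOpen_lt continuous_const hd.contDiff_tauS.continuous).mem_nhds h1] with x hx
  exact (hd.yE_eq_y h0 hx).symm

theorem hasDerivAt_r_radius (hd : d.Admissible) {τ R : ℝ} (h0 : 0 ≤ τ) (h1 : τ < d.tauS R) :
    HasDerivAt (fun x => d.r τ x) (d.rR (d.y τ R) R) R := by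
  have h := hd.hasDerivAt_yE_radius (hd.mem_tDom h0 h1)
  have h2 : HasDerivAt (fun x => x * d.yE τ x ^ 2) (d.rR (d.yE τ R) R) R := by
    refine ((hasDerivAt_id' R).mul (h.pow 2)).congr_deriv ?_
    simp only [rR, Nat.cast_ofNat, Nat.add_one_sub_one, pow_one, Pi.pow_apply]
    ring
  rw [hd.yE_eq_y h0 h1] at h2
  refine h2.congr_of_eventuallyEq ?_
  filter_upwards [hd.eventually_y_eq h0 h1] with x hx
  rw [r, hx]

theorem γ_eq (hd : d.Admissible) {τ R : ℝ} (h0 : 0 ≤ τ) (h1 : τ < d.tauS R) :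
    d.γ τ R = d.w R / d.rR (d.y τ R) R := by
  rw [γ, (hd.hasDerivAt_r_radius h0 h1).deriv, hd.sqrt_one_add_E]

end Admissible

end DustData

/-! ### Scalar ordinary differential equations -/

theorem lipschitzWith_clamp (δ η : ℝ) : LipschitzWith 1 (fun x : ℝ => max δ (min η x)) :=
  (LipschitzWith.id.const_min η).const_max δ

/-- Global solutions of a scalar equation whose right-hand side is frozen outside a strip. -/
theorem exists_clamped_solution {v : ℝ × ℝ → ℝ} {α β δ η t₀ : ℝ} (y₀ : ℝ) {K : ℝ≥0}
    (hδη : δ ≤ η) (ht₀ : t₀ ∈ Icc α β)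
    (hv : LipschitzOnWith K v (Icc α β ×ˢ Icc δ η)) :
    ∃ Y : ℝ → ℝ, Y t₀ = y₀ ∧ ∀ t ∈ Icc α β,
      HasDerivWithinAt Y (v (t, max δ (min η (Y t)))) (Icc α β) t := by
  obtain ⟨L, hL⟩ := (isCompact_Icc.prod isCompact_Icc).exists_bound_of_continuousOn hv.continuousOn
  have hcl : ∀ x : ℝ, max δ (min η x) ∈ Icc δ η := fun x =>
    ⟨le_max_left _ _, max_le hδη (min_le_left _ _)⟩
  have hL0 : 0 ≤ L := (norm_nonneg _).trans (hL (t₀, max δ (min η 0)) ⟨ht₀, hcl 0⟩)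
  have hαβ : 0 ≤ β - α := sub_nonneg.2 (ht₀.1.trans ht₀.2)
  have hPL : IsPicardLindelof (fun t x => v (t, max δ (min η x))) (tmin := α) (tmax := β) ⟨t₀, ht₀⟩
      y₀ (L.toNNReal * (β - α).toNNReal) 0 L.toNNReal K := by
    refine ⟨fun t ht => ?_, fun x _ => ?_, fun t ht x _ => ?_, ?_⟩
    · intro x _ x' _
      refine (hv (x := (t, _)) ⟨ht, hcl x⟩ (y := (t, _)) ⟨ht, hcl x'⟩).trans ?_
      gcongr
      rw [Prod.edist_eq]
      simp only [edist_self, zero_le, sup_of_le_right]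
      simpa using lipschitzWith_clamp δ η x x'
    · exact hv.continuousOn.comp (by fun_prop) fun t ht => ⟨ht, hcl x⟩
    · rw [Real.coe_toNNReal _ hL0]
      exact hL _ ⟨ht, hcl x⟩
    · push_cast
      rw [Real.coe_toNNReal _ hL0, Real.coe_toNNReal _ hαβ, sub_zero]
      gcongr
      exact max_le (by linarith [ht₀.1]) (by linarith [ht₀.2])
  exact hPL.exists_eq_forall_mem_Icc_hasDerivWithinAt₀

theorem hasDerivWithinAt_Ici_of_Icc {Y : ℝ → ℝ} {Y' α β t : ℝ}
    (h : HasDerivWithinAt Y Y' (Icc α β) t) (ht : t ∈ Ico α β) :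
    HasDerivWithinAt Y Y' (Ici t) t :=
  h.mono_of_mem_nhdsWithin (mem_of_superset (Icc_mem_nhdsGE ht.2) (Icc_subset_Icc_left ht.1))

/-- A solution stays below a level which it can only cross downwards. -/
theorem le_of_deriv_neg_at_level {Y Y' : ℝ → ℝ} {α β k : ℝ}
    (hY : ∀ t ∈ Icc α β, HasDerivWithinAt Y (Y' t) (Icc α β) t) (h0 : Y α ≤ k)
    (hneg : ∀ t ∈ Ico α β, Y t = k → Y' t < 0) : ∀ t ∈ Icc α β, Y t ≤ k := by
  intro t ht
  exact image_le_of_deriv_right_lt_deriv_boundary' (f' := Y') (B := fun _ => k) (B' := fun _ => 0)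
    (fun t ht => (hY t ht).continuousWithinAt)
    (fun t ht => hasDerivWithinAt_Ici_of_Icc (hY t ⟨ht.1, ht.2.le⟩) ht) h0 continuousOn_const
    (fun t _ => hasDerivWithinAt_const _ _ _) hneg ht

theorem eq_of_lipschitz_ode_forward {v : ℝ × ℝ → ℝ} {α β : ℝ} {s : Set ℝ} {K : ℝ≥0}
    (hv : LipschitzOnWith K v (Icc α β ×ˢ s)) {Y Z : ℝ → ℝ}
    (hY : ∀ t ∈ Icc α β, Y t ∈ s ∧ HasDerivWithinAt Y (v (t, Y t)) (Icc α β) t)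
    (hZ : ∀ t ∈ Icc α β, Z t ∈ s ∧ HasDerivWithinAt Z (v (t, Z t)) (Icc α β) t)
    (h : Y α = Z α) : ∀ t ∈ Icc α β, Y t = Z t := by
  intro t ht
  refine sub_eq_zero.1 (eq_zero_of_abs_deriv_le_mul_abs_self_of_eq_zero_right (K := K)
    (f := fun t => Y t - Z t) (f' := fun t => v (t, Y t) - v (t, Z t)) (a := α) (b := β)
    (fun t ht => ((hY t ht).2.sub (hZ t ht).2).continuousWithinAt)
    (fun t ht => hasDerivWithinAt_Ici_of_Icc
      ((hY t ⟨ht.1, ht.2.le⟩).2.sub (hZ t ⟨ht.1, ht.2.le⟩).2) ht) (by simp [h])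
    (fun t ht => ?_) t ht)
  have ht' : t ∈ Icc α β := ⟨ht.1, ht.2.le⟩
  have := hv.dist_le_mul (t, Y t) ⟨ht', (hY t ht').1⟩ (t, Z t) ⟨ht', (hZ t ht').1⟩
  rwa [Prod.dist_eq, dist_self, max_eq_right dist_nonneg, dist_eq_norm, dist_eq_norm] at this

/-- The forward statement after the reflection t ↦ -t. -/
theorem eq_of_lipschitz_ode_backward {v : ℝ × ℝ → ℝ} {α β : ℝ} {s : Set ℝ} {K : ℝ≥0}
    (hv : LipschitzOnWith K v (Icc α β ×ˢ s)) {Y Z : ℝ → ℝ}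
    (hY : ∀ t ∈ Icc α β, Y t ∈ s ∧ HasDerivWithinAt Y (v (t, Y t)) (Icc α β) t)
    (hZ : ∀ t ∈ Icc α β, Z t ∈ s ∧ HasDerivWithinAt Z (v (t, Z t)) (Icc α β) t)
    (h : Y β = Z β) : ∀ t ∈ Icc α β, Y t = Z t := by
  have hmem : ∀ t ∈ Icc (-β) (-α), -t ∈ Icc α β := fun t ht =>
    ⟨by linarith [ht.2], by linarith [ht.1]⟩
  have hrefl : ∀ W : ℝ → ℝ, (∀ t ∈ Icc α β, W t ∈ s ∧ HasDerivWithinAt W (v (t, W t)) (Icc α β) t) →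
      ∀ t ∈ Icc (-β) (-α), W (-t) ∈ s ∧
        HasDerivWithinAt (fun t => W (-t)) (-v (-t, W (-t))) (Icc (-β) (-α)) t := by
    intro W hW t ht
    refine ⟨(hW _ (hmem t ht)).1, ?_⟩
    have := (hW _ (hmem t ht)).2.scomp t (h := fun t => -t) (hasDerivWithinAt_neg t (Icc (-β) (-α)))
      hmem
    exact this.congr_deriv (by simp)
  have hv' : LipschitzOnWith K (fun z : ℝ × ℝ => -v (-z.1, z.2)) (Icc (-β) (-α) ×ˢ s) := by
    intro z hz z' hz'
    rw [edist_neg_neg]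
    refine (hv (x := (-z.1, z.2)) ⟨hmem _ hz.1, hz.2⟩ (y := (-z'.1, z'.2))
      ⟨hmem _ hz'.1, hz'.2⟩).trans (le_of_eq ?_)
    rw [Prod.edist_eq, Prod.edist_eq, edist_neg_neg]
  intro t ht
  have := eq_of_lipschitz_ode_forward hv' (hrefl Y hY) (hrefl Z hZ) (by simpa using h) (-t)
    ⟨by linarith [ht.2], by linarith [ht.1]⟩
  simpa using this

/-- A function of class `C¹` near a compact convex set is Lipschitz on it. -/
theorem exists_lipschitzOnWith_of_contDiffAt {E : Type*} [NormedAddCommGroup E] [NormedSpace ℝ E]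
    {v : E → ℝ} {s : Set E} (hs : IsCompact s) (hc : Convex ℝ s) (hv : ∀ x ∈ s, ContDiffAt ℝ 1 v x) :
    ∃ K : ℝ≥0, LipschitzOnWith K v s := by
  have hcont : ContinuousOn (fderiv ℝ v) s := fun x hx =>
    ((hv x hx).fderiv_right (m := 0) (by norm_num)).continuousAt.continuousWithinAt
  obtain ⟨C, hC⟩ := hs.exists_bound_of_continuousOn hcont
  refine ⟨C.toNNReal, hc.lipschitzOnWith_of_nnnorm_fderiv_le
    (fun x hx => (hv x hx).differentiableAt (by norm_num)) fun x hx => ?_⟩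
  rw [← NNReal.coe_le_coe, coe_nnnorm]
  exact (hC x hx).trans (Real.le_coe_toNNReal C)

theorem contDiffAt_f₁ {x : ℝ} (hx : |x| < 1) : ContDiffAt ℝ ∞ f₁ x := by
  have h1 : ContDiffAt ℝ ∞ (fun x : ℝ => √(1 - x ^ 2)) x :=
    ContDiffAt.sqrt (by fun_prop) (one_sub_sq_pos hx).ne'
  exact ContDiffAt.div (by fun_prop) h1 (Real.sqrt_pos.2 (one_sub_sq_pos hx)).ne'

theorem contDiffAt_fAux {x : ℝ} (hx : |x| < 1) : ContDiffAt ℝ ∞ fAux x :=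
  (contDiffAt_id.mul (contDiffAt_f₁ hx)).sub (contDiffAt_const.mul (contDiffAt_f hx))

namespace DustData

variable {d : DustData}

/-! ### Outgoing radial light rays -/

/-- The slope `dy/dR` along an outgoing light ray. -/
def rayY (d : DustData) (y R : ℝ) : ℝ := d.ySpeed y R * (R * d.tauK y R - d.rR y R / d.w R)

/-- `τ = σ(R)`, `ρ ≤ R ≤ R₁`, is an outgoing radial light ray. -/
structure IsRay (d : DustData) (ρ R₁ : ℝ) (σ : ℝ → ℝ) : Prop where
  mem : ∀ R ∈ Icc ρ R₁, 0 ≤ σ R ∧ σ R < d.tauS R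
  null : ∀ R ∈ Icc ρ R₁, HasDerivWithinAt σ (d.rR (d.y (σ R) R) R / d.w R) (Icc ρ R₁) R

namespace Admissible

theorem contDiffAt_q_mul (hd : d.Admissible) (y R : ℝ) :
    ContDiffAt ℝ ∞ (fun z : ℝ × ℝ => d.q z.2 * z.1) (y, R) :=
  (hd.contDiff_q.contDiffAt.comp _ contDiffAt_snd).mul contDiffAt_fst

theorem contDiffAt_sqrt_c (hd : d.Admissible) (y R : ℝ) :
    ContDiffAt ℝ ∞ (fun z : ℝ × ℝ => √(d.c z.2)) (y, R) :=
  ContDiffAt.sqrt (hd.contDiff_c.contDiffAt.comp _ contDiffAt_snd) (hd.c_pos R).ne'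

theorem contDiffAt_sqrt_q (hd : d.Admissible) {y R : ℝ} (h : |d.q R * y| < 1) :
    ContDiffAt ℝ ∞ (fun z : ℝ × ℝ => √(1 - (d.q z.2 * z.1) ^ 2)) (y, R) :=
  ContDiffAt.sqrt (contDiffAt_const.sub ((hd.contDiffAt_q_mul y R).pow 2)) (one_sub_sq_pos h).ne'

theorem contDiffAt_tauK (hd : d.Admissible) {y R : ℝ} (h : |d.q R * y| < 1) :
    ContDiffAt ℝ ∞ (fun z : ℝ × ℝ => d.tauK z.1 z.2) (y, R) := by
  have hqy := hd.contDiffAt_q_mul y R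
  have hq : ContDiffAt ℝ ∞ (fun z : ℝ × ℝ => d.q z.2) (y, R) :=
    hd.contDiff_q.contDiffAt.comp _ contDiffAt_snd
  have hc : ContDiffAt ℝ ∞ (fun z : ℝ × ℝ => d.c z.2) (y, R) :=
    hd.contDiff_c.contDiffAt.comp _ contDiffAt_snd
  have hdq : ContDiffAt ℝ ∞ (fun z : ℝ × ℝ => divR (deriv d.q) z.2) (y, R) :=
    hd.contDiff_divR_q.contDiffAt.comp _ contDiffAt_snd
  have hdc : ContDiffAt ℝ ∞ (fun z : ℝ × ℝ => divR (deriv d.c) z.2) (y, R) :=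
    hd.contDiff_divR_c.contDiffAt.comp _ contDiffAt_snd
  have hq1 : |d.q R| < 1 := by rw [abs_of_pos (hd.q_pos R)]; exact hd.q_lt_one R
  have e1 : ContDiffAt ℝ ∞ (fun z : ℝ × ℝ => fAux (d.q z.2 * z.1)) (y, R) :=
    ContDiffAt.comp (g := fAux) (f := fun z : ℝ × ℝ => d.q z.2 * z.1) (y, R) (contDiffAt_fAux h) hqy
  have e2 : ContDiffAt ℝ ∞ (fun z : ℝ × ℝ => fAux (d.q z.2)) (y, R) :=
    ContDiffAt.comp (g := fAux) (f := fun z : ℝ × ℝ => d.q z.2) (y, R) (contDiffAt_fAux hq1) hq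
  have e3 : ContDiffAt ℝ ∞ (fun z : ℝ × ℝ => f (d.q z.2 * z.1)) (y, R) :=
    ContDiffAt.comp (g := f) (f := fun z : ℝ × ℝ => d.q z.2 * z.1) (y, R) (contDiffAt_f h) hqy
  have e4 : ContDiffAt ℝ ∞ (fun z : ℝ × ℝ => f (d.q z.2)) (y, R) :=
    ContDiffAt.comp (g := f) (f := fun z : ℝ × ℝ => d.q z.2) (y, R) (contDiffAt_f hq1) hq
  have hsc := hd.contDiffAt_sqrt_c y R
  have hsp := hd.sqrt_c_pos R
  have hcp := hd.c_pos R
  have hgq : ContDiffAt ℝ ∞ (fun z : ℝ × ℝ => gq (d.q z.2) z.1) (y, R) :=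
    (e1.sub e2).div (hq.pow 4) (pow_pos (hd.q_pos R) 4).ne'
  have hg : ContDiffAt ℝ ∞ (fun z : ℝ × ℝ => g (d.q z.2) z.1) (y, R) :=
    (e3.sub e4).div (hq.pow 3) (pow_pos (hd.q_pos R) 3).ne'
  exact ((hgq.mul hdq).div hsc hsp.ne').sub
    ((hg.mul hdc).div ((contDiffAt_const.mul hc).mul hsc) (by positivity))

theorem contDiffAt_ySpeed (hd : d.Admissible) {y R : ℝ} (h : (y, R) ∈ d.yDom) :
    ContDiffAt ℝ ∞ (fun z : ℝ × ℝ => d.ySpeed z.1 z.2) (y, R) :=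
  ((hd.contDiffAt_sqrt_c y R).mul (hd.contDiffAt_sqrt_q (hd.abs_q_mul_lt h))).div
    (contDiffAt_const.mul (contDiffAt_fst.pow 2)) (by have : 0 < y := h.1; positivity)

theorem contDiffAt_infall (hd : d.Admissible) {y R : ℝ} (h : (y, R) ∈ d.yDom) :
    ContDiffAt ℝ ∞ (fun z : ℝ × ℝ => d.infall z.1 z.2) (y, R) :=
  ((contDiffAt_snd.mul (hd.contDiffAt_sqrt_c y R)).mul
    (hd.contDiffAt_sqrt_q (hd.abs_q_mul_lt h))).div contDiffAt_fst h.1.ne'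

theorem contDiffAt_rR (hd : d.Admissible) {y R : ℝ} (h : (y, R) ∈ d.yDom) :
    ContDiffAt ℝ ∞ (fun z : ℝ × ℝ => d.rR z.1 z.2) (y, R) :=
  (contDiffAt_fst.pow 2).add (((contDiffAt_const.mul contDiffAt_snd).mul contDiffAt_fst).mul
    ((hd.contDiffAt_ySpeed h).mul
      (contDiffAt_snd.mul (hd.contDiffAt_tauK (hd.abs_q_mul_lt h)))))

theorem contDiffAt_w_snd (hd : d.Admissible) {y R : ℝ} (hR : 0 ≤ R) :
    ContDiffAt ℝ ∞ (fun z : ℝ × ℝ => d.w z.2) (y, R) :=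
  ContDiffAt.comp (g := d.w) (f := fun z : ℝ × ℝ => z.2) (y, R) (hd.contDiffAt_w hR) contDiffAt_snd

theorem contDiffAt_rayY (hd : d.Admissible) {y R : ℝ} (h : (y, R) ∈ d.yDom) (hR : 0 ≤ R) :
    ContDiffAt ℝ ∞ (fun z : ℝ × ℝ => d.rayY z.1 z.2) (y, R) :=
  (hd.contDiffAt_ySpeed h).mul
    ((contDiffAt_snd.mul (hd.contDiffAt_tauK (hd.abs_q_mul_lt h))).sub
      ((hd.contDiffAt_rR h).div (hd.contDiffAt_w_snd hR) (hd.w_pos hR).ne'))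

theorem exists_lipschitz_rayY (hd : d.Admissible) {α β δ : ℝ} (hα : 0 ≤ α) (hδ : 0 < δ) :
    ∃ K : ℝ≥0, LipschitzOnWith K (fun z : ℝ × ℝ => d.rayY z.2 z.1) (Icc α β ×ˢ Icc δ 1) := by
  refine exists_lipschitzOnWith_of_contDiffAt (isCompact_Icc.prod isCompact_Icc)
    ((convex_Icc _ _).prod (convex_Icc _ _)) ?_
  rintro ⟨R, y⟩ ⟨hR, hy⟩
  exact ContDiffAt.comp (g := fun z : ℝ × ℝ => d.rayY z.1 z.2) (f := fun z : ℝ × ℝ => (z.2, z.1))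
    (R, y) ((hd.contDiffAt_rayY (hd.mem_yDom ⟨hδ.trans_le hy.1, hy.2⟩) (hα.trans hR.1)).of_le
      (by exact_mod_cast le_top)) (by fun_prop)

theorem rR_eq (d : DustData) {y R : ℝ} (hy : y ≠ 0) :
    d.rR y R = y ^ 2 + d.infall y R * (R * d.tauK y R) := by
  unfold rR infall ySpeed
  field_simp

/-- Along an outgoing ray `dr/dR = (∂r/∂R) (1 - s/w)`. -/
theorem sq_add_rayY (d : DustData) {y R : ℝ} (hy : y ≠ 0) :
    y ^ 2 + 2 * R * y * d.rayY y R = d.rR y R * (1 - d.infall y R / d.w R) := by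
  have h : 2 * R * y * d.ySpeed y R = d.infall y R := by
    unfold infall ySpeed; field_simp
  have h2 := rR_eq d (R := R) hy
  unfold rayY
  linear_combination (R * d.tauK y R - d.rR y R / d.w R) * h - h2

/-- By the energy equation s² - w² = R² c / y² - 1 = 2m/r - 1, so comparing s with w is the same as
comparing r with 2m. -/
theorem infall_le_w_iff (hd : d.Admissible) {y R : ℝ} (hy : y ∈ Ioc (0 : ℝ) 1) (hR : 0 < R) :
    d.infall y R ≤ d.w R ↔ R ^ 2 * d.c R ≤ y ^ 2 := by
  have h1 := hd.infall_pos (hd.mem_yDom (R := R) hy) hR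
  have h2 := hd.w_pos hR.le
  have h3 := hd.infall_sq (hd.mem_yDom (R := R) hy) hR.le
  have h4 := pow_pos hy.1 2
  rw [← abs_of_pos h1, ← abs_of_pos h2, ← sq_le_sq, h3, ← div_le_one h4]
  constructor <;> intro h <;> linarith

theorem infall_lt_w_iff (hd : d.Admissible) {y R : ℝ} (hy : y ∈ Ioc (0 : ℝ) 1) (hR : 0 < R) :
    d.infall y R < d.w R ↔ R ^ 2 * d.c R < y ^ 2 := by
  have h1 := hd.infall_pos (hd.mem_yDom (R := R) hy) hR
  have h2 := hd.w_pos hR.le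
  have h3 := hd.infall_sq (hd.mem_yDom (R := R) hy) hR.le
  have h4 := pow_pos hy.1 2
  rw [← abs_of_pos h1, ← abs_of_pos h2, ← sq_lt_sq, h3, ← div_lt_one h4]
  constructor <;> intro h <;> linarith

/-- In the trapped region `y` decreases along outgoing rays. -/
theorem rayY_neg_of_trapped (hd : d.Admissible) {y R : ℝ} (hy : y ∈ Ioc (0 : ℝ) 1) (hR : 0 < R)
    (ht : y ^ 2 ≤ R ^ 2 * d.c R) : d.rayY y R < 0 := by
  have h1 : d.w R ≤ d.infall y R := by
    rw [← not_lt, hd.infall_lt_w_iff hy hR, not_lt]; exact ht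
  have hw := hd.w_pos hR.le
  have hr := hd.rR_pos hy hR.le
  have h3 := sq_add_rayY d (R := R) hy.1.ne'
  have h4 : 1 - d.infall y R / d.w R ≤ 0 := by
    rw [sub_nonpos, le_div_iff₀ hw]; linarith
  have h5 : d.rR y R * (1 - d.infall y R / d.w R) ≤ 0 := mul_nonpos_of_nonneg_of_nonpos hr.le h4
  have h6 := pow_pos hy.1 2
  by_contra hcon
  push Not at hcon
  have : 0 ≤ 2 * R * y * d.rayY y R := by have := hy.1; positivity
  linarith

/-- At y = 1, the initial surface, `tauK` vanishes and only the negative term of `rayY` remains. An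
outgoing ray followed outwards therefore cannot leave y ≤ 1. -/
theorem rayY_one_neg (hd : d.Admissible) {R : ℝ} (hR : 0 ≤ R) : d.rayY 1 R < 0 := by
  have h1 := hd.ySpeed_pos (hd.mem_yDom (R := R) ⟨zero_lt_one, le_rfl⟩)
  have h2 := hd.rR_pos (R := R) ⟨zero_lt_one, le_rfl⟩ hR
  have hw := hd.w_pos hR
  have h3 := div_pos h2 hw
  rw [rayY, tauK_one]
  nlinarith

theorem ySpeed_mul (hd : d.Admissible) {y R : ℝ} (h : (y, R) ∈ d.yDom) :
    -2 * y ^ 2 / √(1 - (d.q R * y) ^ 2) / √(d.c R) * d.ySpeed y R = -1 := by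
  have h1 := hd.sqrt_q_pos h
  have h2 := hd.sqrt_c_pos R
  have h3 : 0 < y := h.1
  unfold ySpeed
  generalize √(1 - (d.q R * y) ^ 2) = k at *
  field_simp

/-- In the variable y the ray equation has a right-hand side smooth up to and beyond the initial
surface y = 1, so existence and uniqueness are treated for y and transported to τ. -/
theorem isRay_of_y (hd : d.Admissible) {ρ R₁ : ℝ} {Y : ℝ → ℝ} (hY : ∀ R ∈ Icc ρ R₁, Y R ∈ Ioc (0 : ℝ) 1)
    (hY' : ∀ R ∈ Icc ρ R₁, HasDerivWithinAt Y (d.rayY (Y R) R) (Icc ρ R₁) R) :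
    d.IsRay ρ R₁ (fun R => d.tau (Y R) R) := by
  refine ⟨fun R hR => ⟨hd.tau_nonneg R ⟨(hY R hR).1.le, (hY R hR).2⟩, hd.tau_lt_tauS R (hY R hR)⟩,
    fun R hR => ?_⟩
  have hy := hY R hR
  rw [hd.y_tau R ⟨hy.1.le, hy.2⟩]
  have hdom := hd.mem_yDom (R := R) hy
  have := (hd.hasFDerivAt_tau (hd.abs_q_mul_lt hdom)).comp_hasDerivWithinAt
    (f := fun R => (Y R, R)) R ((hY' R hR).prodMk (hasDerivWithinAt_id R _))
  refine this.congr_deriv ?_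
  have h1 := hd.ySpeed_mul hdom
  simp only [add_apply, smul_apply,
    ContinuousLinearMap.coe_fst', ContinuousLinearMap.coe_snd', smul_eq_mul, rayY]
  linear_combination (R * d.tauK (Y R) R - d.rR (Y R) R / d.w R) * h1

theorem y_of_isRay (hd : d.Admissible) {ρ R₁ : ℝ} {σ : ℝ → ℝ} (h : d.IsRay ρ R₁ σ) :
    ∀ R ∈ Icc ρ R₁, d.y (σ R) R ∈ Ioc (0 : ℝ) 1 ∧
      HasDerivWithinAt (fun R => d.y (σ R) R) (d.rayY (d.y (σ R) R) R) (Icc ρ R₁) R := by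
  intro R hR
  have hm := h.mem R hR
  refine ⟨hd.y_mem hm.1 hm.2, ?_⟩
  have h1 := (hd.hasFDerivAt_yE (hd.mem_tDom hm.1 hm.2)).comp_hasDerivWithinAt
    (f := fun R => (σ R, R)) R ((h.null R hR).prodMk (hasDerivWithinAt_id R _))
  have h2 : HasDerivWithinAt (fun R => d.yE (σ R) R) (d.rayY (d.y (σ R) R) R) (Icc ρ R₁) R := by
    refine h1.congr_deriv ?_
    simp only [add_apply, smul_apply,
      ContinuousLinearMap.coe_fst', ContinuousLinearMap.coe_snd', smul_eq_mul, rayY,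
      hd.yE_eq_y hm.1 hm.2]
    ring
  exact h2.congr (fun x hx => (hd.yE_eq_y (h.mem x hx).1 (h.mem x hx).2).symm)
    (hd.yE_eq_y hm.1 hm.2).symm

theorem exists_y_lower_bound (hd : d.Admissible) {ρ R₁ : ℝ} {σ : ℝ → ℝ} (h : d.IsRay ρ R₁ σ) :
    ∃ δ > 0, ∀ R ∈ Icc ρ R₁, δ ≤ d.y (σ R) R := by
  by_cases hne : (Icc ρ R₁).Nonempty
  · obtain ⟨x, hx, hmin⟩ := isCompact_Icc.exists_isMinOn hne
      (f := fun R => d.y (σ R) R) fun R hR => (hd.y_of_isRay h R hR).2.continuousWithinAt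
    exact ⟨_, (hd.y_of_isRay h x hx).1.1, fun R hR => hmin hR⟩
  · exact ⟨1, one_pos, fun R hR => (hne ⟨R, hR⟩).elim⟩

/-- By compactness y stays away from 0 along both rays, and on such a strip the equation for y is
Lipschitz. -/
theorem isRay_unique (hd : d.Admissible) {ρ R₁ : ℝ} (hρ : 0 ≤ ρ) {σ σ' : ℝ → ℝ}
    (h : d.IsRay ρ R₁ σ) (h' : d.IsRay ρ R₁ σ') (heq : σ ρ = σ' ρ ∨ σ R₁ = σ' R₁) :
    ∀ R ∈ Icc ρ R₁, σ R = σ' R := by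
  obtain ⟨δ, hδ, hb⟩ := hd.exists_y_lower_bound h
  obtain ⟨δ', hδ', hb'⟩ := hd.exists_y_lower_bound h'
  obtain ⟨K, hK⟩ := hd.exists_lipschitz_rayY (β := R₁) hρ (lt_min hδ hδ')
  have hY := fun R hR => hd.y_of_isRay h R hR
  have hY' := fun R hR => hd.y_of_isRay h' R hR
  have e1 : ∀ R ∈ Icc ρ R₁, d.y (σ R) R ∈ Icc (min δ δ') 1 ∧ HasDerivWithinAt
      (fun R => d.y (σ R) R) ((fun z : ℝ × ℝ => d.rayY z.2 z.1) (R, d.y (σ R) R)) (Icc ρ R₁) R :=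
    fun R hR => ⟨⟨(min_le_left _ _).trans (hb R hR), (hY R hR).1.2⟩, (hY R hR).2⟩
  have e2 : ∀ R ∈ Icc ρ R₁, d.y (σ' R) R ∈ Icc (min δ δ') 1 ∧ HasDerivWithinAt
      (fun R => d.y (σ' R) R) ((fun z : ℝ × ℝ => d.rayY z.2 z.1) (R, d.y (σ' R) R)) (Icc ρ R₁) R :=
    fun R hR => ⟨⟨(min_le_right _ _).trans (hb' R hR), (hY' R hR).1.2⟩, (hY' R hR).2⟩
  have key : ∀ R ∈ Icc ρ R₁, d.y (σ R) R = d.y (σ' R) R := by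
    rcases heq with heq | heq
    · exact eq_of_lipschitz_ode_forward hK e1 e2 (by simp only [heq])
    · exact eq_of_lipschitz_ode_backward hK e1 e2 (by simp only [heq])
  intro R hR
  have a := h.mem R hR
  have b := h'.mem R hR
  rw [← hd.tau_y a.1 a.2, key R hR, hd.tau_y b.1 b.2]

theorem IsRay.mono {ρ ρ' R₁ R₂ : ℝ} {σ : ℝ → ℝ} (h : d.IsRay ρ R₁ σ) (h1 : ρ ≤ ρ') (h2 : R₂ ≤ R₁) :
    d.IsRay ρ' R₂ σ :=
  ⟨fun R hR => h.mem R ⟨h1.trans hR.1, hR.2.trans h2⟩,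
    fun R hR => (h.null R ⟨h1.trans hR.1, hR.2.trans h2⟩).mono (Icc_subset_Icc h1 h2)⟩

theorem IsRay.continuousOn {ρ R₁ : ℝ} {σ : ℝ → ℝ} (h : d.IsRay ρ R₁ σ) :
    ContinuousOn σ (Icc ρ R₁) := fun R hR => (h.null R hR).continuousWithinAt

theorem ray_slope_pos (hd : d.Admissible) {τ R : ℝ} (hR : 0 ≤ R) (h0 : 0 ≤ τ) (h1 : τ < d.tauS R) :
    0 < d.rR (d.y τ R) R / d.w R :=
  div_pos (hd.rR_pos (hd.y_mem h0 h1) hR) (hd.w_pos hR)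

theorem IsRay.hasDerivAt {ρ R₁ : ℝ} {σ : ℝ → ℝ} (h : d.IsRay ρ R₁ σ) {R : ℝ} (hR : R ∈ Ioo ρ R₁) :
    HasDerivAt σ (d.rR (d.y (σ R) R) R / d.w R) R :=
  (h.null R ⟨hR.1.le, hR.2.le⟩).hasDerivAt (Icc_mem_nhds hR.1 hR.2)

theorem isRay_strictMonoOn (hd : d.Admissible) {ρ R₁ : ℝ} (hρ : 0 ≤ ρ) {σ : ℝ → ℝ}
    (h : d.IsRay ρ R₁ σ) : StrictMonoOn σ (Icc ρ R₁) := by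
  refine strictMonoOn_of_deriv_pos (convex_Icc _ _) (IsRay.continuousOn h) fun R hR => ?_
  rw [interior_Icc] at hR
  rw [(IsRay.hasDerivAt h hR).deriv]
  have hm := h.mem R ⟨hR.1.le, hR.2.le⟩
  exact hd.ray_slope_pos (hρ.trans hR.1.le) hm.1 hm.2

/-- The past-directed outgoing ray from a point extends to any smaller radius, unless it meets the
initial surface before. -/
theorem exists_backward_ray (hd : d.Admissible) {τ₁ R₁ ρ : ℝ} (hρ : 0 < ρ) (hρR : ρ < R₁)
    (h0 : 0 < τ₁) (h1 : τ₁ < d.tauS R₁) :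
    ∃ ρ' ∈ Ico ρ R₁, ∃ σ, d.IsRay ρ' R₁ σ ∧ σ R₁ = τ₁ ∧ (ρ' = ρ ∨ σ ρ' = 0) := by
  have hy1 := hd.y_mem h0.le h1
  have hy1' := hd.y_lt_one h0 h1
  obtain ⟨x, hx, hmin⟩ := isCompact_Icc.exists_isMinOn (nonempty_Icc.2 hρR.le)
    (f := fun R => R * √(d.c R)) (by
      have := hd.contDiff_c.continuous
      exact Continuous.continuousOn (by fun_prop))
  have hxpos : 0 < x * √(d.c x) := mul_pos (hρ.trans_le hx.1) (hd.sqrt_c_pos x)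
  -- A level below the value of y at the given point and trapped at every radius in [ρ, R₁]: x
  -- minimises R √c there, so δ² ≤ R² c throughout.
  set δ := min (d.y τ₁ R₁ / 2) (x * √(d.c x)) with hδdef
  have hδ : 0 < δ := lt_min (by linarith [hy1.1]) hxpos
  have hδ1 : δ < d.y τ₁ R₁ := (min_le_left _ _).trans_lt (by linarith [hy1.1])
  have hδ1' : δ ≤ 1 := hδ1.le.trans hy1.2
  have htrap : ∀ R ∈ Icc ρ R₁, d.rayY δ R < 0 := by
    intro R hR
    have hRp : 0 < R := hρ.trans_le hR.1
    refine hd.rayY_neg_of_trapped ⟨hδ, hδ1'⟩ hRp ?_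
    have h2 : δ ≤ R * √(d.c R) := (min_le_right _ _).trans (hmin hR)
    calc δ ^ 2 ≤ (R * √(d.c R)) ^ 2 := by gcongr
      _ = R ^ 2 * d.c R := by rw [mul_pow, Real.sq_sqrt (hd.c_pos R).le]
  obtain ⟨K, hK⟩ := hd.exists_lipschitz_rayY (β := R₁) hρ.le hδ
  obtain ⟨Y, hY1, hY⟩ := exists_clamped_solution (d.y τ₁ R₁) hδ1' ⟨hρR.le, le_rfl⟩ hK
  dsimp only at hY
  -- At the trapped level δ, y decreases outwards. A solution below δ at some radius would remain
  -- below it up to R₁, where its value exceeds δ.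
  have hlow : ∀ R ∈ Icc ρ R₁, δ ≤ Y R := by
    intro R hR
    by_contra hcon
    push Not at hcon
    have := le_of_deriv_neg_at_level (k := δ) (α := R) (β := R₁)
      (fun t ht => (hY t ⟨hR.1.trans ht.1, ht.2⟩).mono (Icc_subset_Icc_left hR.1)) hcon.le
      (fun t ht h => by
        rw [h, min_eq_right hδ1', max_self]
        exact htrap t ⟨hR.1.trans ht.1, ht.2.le⟩) R₁ ⟨hR.2, le_rfl⟩
    rw [hY1] at this
    linarith
  have hcont : ContinuousOn Y (Icc ρ R₁) := fun R hR => (hY R hR).continuousWithinAt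
  have hfin : ∀ ρ' ∈ Ico ρ R₁, (∀ R ∈ Icc ρ' R₁, Y R ≤ 1) →
      d.IsRay ρ' R₁ (fun R => d.tau (Y R) R) := by
    intro ρ' hρ' hle
    have hsub : ∀ R ∈ Icc ρ' R₁, R ∈ Icc ρ R₁ := fun R hR => ⟨hρ'.1.trans hR.1, hR.2⟩
    refine hd.isRay_of_y (fun R hR => ⟨hδ.trans_le (hlow R (hsub R hR)), hle R hR⟩) fun R hR => ?_
    have := (hY R (hsub R hR)).mono (Icc_subset_Icc_left hρ'.1)
    rwa [min_eq_right (hle R hR), max_eq_right (hlow R (hsub R hR))] at this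
  have hval : d.tau (Y R₁) R₁ = τ₁ := by rw [hY1, hd.tau_y h0.le h1]
  by_cases hall : ∀ R ∈ Icc ρ R₁, Y R ≤ 1
  · exact ⟨ρ, ⟨le_rfl, hρR⟩, _, hfin ρ ⟨le_rfl, hρR⟩ hall, hval, Or.inl rfl⟩
  · push Not at hall
    obtain ⟨R₀, hR₀, hR₀1⟩ := hall
    -- If y exceeds 1 somewhere, the ray is cut at the largest radius where y ≥ 1. There y = 1, that
    -- is, τ = 0.
    have hS : IsCompact (Icc R₀ R₁ ∩ Y ⁻¹' Ici 1) :=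
      isCompact_Icc.of_isClosed_subset ((hcont.mono (Icc_subset_Icc_left hR₀.1)
        ).preimage_isClosed_of_isClosed isClosed_Icc isClosed_Ici) inter_subset_left
    obtain ⟨ρ', hρ', hmax⟩ := hS.exists_isGreatest ⟨R₀, ⟨le_rfl, hR₀.2⟩, hR₀1.le⟩
    have hlt : ρ' < R₁ := lt_of_le_of_ne hρ'.1.2 fun h => by
      have h2 : 1 ≤ Y ρ' := hρ'.2
      rw [h, hY1] at h2
      linarith
    have hρρ' : ρ ≤ ρ' := hR₀.1.trans hρ'.1.1
    obtain ⟨R', hR', hR'1⟩ := intermediate_value_Icc' hlt.le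
      (hcont.mono (Icc_subset_Icc_left hρρ')) ⟨by rw [hY1]; exact hy1'.le, hρ'.2⟩
    have hR'eq : R' = ρ' := le_antisymm
      (hmax ⟨⟨hρ'.1.1.trans hR'.1, hR'.2⟩, hR'1.ge⟩) hR'.1
    subst hR'eq
    have hle : ∀ R ∈ Icc R' R₁, Y R ≤ 1 := by
      intro R hR
      by_contra hcon
      push Not at hcon
      have := hmax ⟨⟨hρ'.1.1.trans hR.1, hR.2⟩, hcon.le⟩
      have h3 : R = R' := le_antisymm this hR.1
      rw [h3, hR'1] at hcon
      exact lt_irrefl _ hcon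
    exact ⟨R', ⟨hρρ', hlt⟩, _, hfin R' ⟨hρρ', hlt⟩ hle, hval, Or.inr (by
      simp only [hR'1, tau_one])⟩

/-- Outgoing rays do not cross. -/
theorem isRay_lt (hd : d.Admissible) {α β : ℝ} (hα : 0 ≤ α) (hαβ : α ≤ β) {σ σ' : ℝ → ℝ}
    (h : d.IsRay α β σ) (h' : d.IsRay α β σ') (hlt : σ α < σ' α) : σ β < σ' β := by
  by_contra hcon
  push Not at hcon
  have hc : ContinuousOn (fun R => σ R - σ' R) (Icc α β) :=
    (IsRay.continuousOn h).sub (IsRay.continuousOn h')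
  obtain ⟨R, hR, hR0⟩ := intermediate_value_Icc hαβ hc (show (0 : ℝ) ∈ _ from
    ⟨by simpa using hlt.le, by simpa using hcon⟩)
  have := hd.isRay_unique hα (IsRay.mono h le_rfl hR.2) (IsRay.mono h' le_rfl hR.2)
    (Or.inr (sub_eq_zero.1 hR0)) α ⟨le_rfl, hR.1⟩
  exact hlt.ne this

theorem isRay_lt_backward (hd : d.Admissible) {α β : ℝ} (hα : 0 ≤ α) (hαβ : α ≤ β) {σ σ' : ℝ → ℝ}
    (h : d.IsRay α β σ) (h' : d.IsRay α β σ') (hlt : σ β < σ' β) : σ α < σ' α := by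
  rcases lt_trichotomy (σ α) (σ' α) with h1 | h1 | h1
  · exact h1
  · exact absurd (hd.isRay_unique hα h h' (Or.inl h1) β ⟨hαβ, le_rfl⟩) hlt.ne
  · exact absurd (hd.isRay_lt hα hαβ h' h h1) (not_lt.2 hlt.le)

end Admissible

end DustData

namespace DustData

variable {d : DustData}

/-! ### The Cauchy horizon and the maximal development -/

namespace Admissible

theorem singularRay_mono {R R₁ : ℝ} {σ : ℝ → ℝ} (h : d.IsSingularRay R₁ σ) (hR : R ≤ R₁) :
    d.IsSingularRay R σ :=
  ⟨fun x hx => h.mem x ⟨hx.1, hx.2.trans hR⟩,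
    fun x hx => (h.null x ⟨hx.1, hx.2.trans hR⟩).mono (Ioc_subset_Ioc_right hR), h.emanates⟩

theorem slope_eq (hd : d.Admissible) {τ R : ℝ} (h0 : 0 ≤ τ) (h1 : τ < d.tauS R) :
    (d.γ τ R)⁻¹ = d.rR (d.y τ R) R / d.w R := by
  rw [hd.γ_eq h0 h1, inv_div]

theorem isRay_of_singularRay (hd : d.Admissible) {R₁ ρ : ℝ} {σ : ℝ → ℝ} (h : d.IsSingularRay R₁ σ)
    (hρ : 0 < ρ) : d.IsRay ρ R₁ σ := by
  have hsub : ∀ R ∈ Icc ρ R₁, R ∈ Ioc 0 R₁ := fun R hR => ⟨hρ.trans_le hR.1, hR.2⟩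
  refine ⟨fun R hR => h.mem R (hsub R hR), fun R hR => ?_⟩
  have hm := h.mem R (hsub R hR)
  rw [← hd.slope_eq hm.1 hm.2]
  exact (h.null R (hsub R hR)).mono hsub

/-- Outgoing rays are strictly increasing in R, and this one tends to tauS 0 at the centre. -/
theorem tauS_zero_lt_singularRay (hd : d.Admissible) {R₁ : ℝ} {σ : ℝ → ℝ}
    (h : d.IsSingularRay R₁ σ) {R : ℝ} (hR : R ∈ Ioc 0 R₁) : d.tauS 0 < σ R := by
  have hlt : ∀ x ∈ Ioo 0 R, ∀ x' ∈ Ioc x R, σ x < σ x' := fun x hx x' hx' =>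
    hd.isRay_strictMonoOn hx.1.le (hd.isRay_of_singularRay h hx.1)
      ⟨le_rfl, hx.2.le.trans hR.2⟩ ⟨hx'.1.le, hx'.2.trans hR.2⟩ hx'.1
  have h2 : d.tauS 0 ≤ σ (R / 2) := by
    refine le_of_tendsto h.emanates ?_
    filter_upwards [Ioo_mem_nhdsGT (show 0 < R / 2 by linarith [hR.1])] with x hx
    exact (hlt x ⟨hx.1, by linarith [hx.2, hR.1]⟩ (R / 2) ⟨hx.2, by linarith [hR.1]⟩).le
  exact h2.trans_lt (hlt (R / 2) ⟨by linarith [hR.1], by linarith [hR.1]⟩ R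
    ⟨by linarith [hR.1], le_rfl⟩)

theorem bddBelow_rays (d : DustData) {R : ℝ} (hR : 0 < R) :
    BddBelow {t | ∃ σ, d.IsSingularRay R σ ∧ σ R = t} :=
  ⟨0, fun _ ⟨_, hσ, ht⟩ => ht ▸ (hσ.mem R ⟨hR, le_rfl⟩).1⟩

theorem tauCH_le (d : DustData) {R : ℝ} (hR : 0 < R) {σ : ℝ → ℝ} (h : d.IsSingularRay R σ) :
    d.tauCH R ≤ σ R := csInf_le (bddBelow_rays d hR) ⟨σ, h, rfl⟩

theorem mass_const (hd : d.Admissible) {R : ℝ} (hR : d.Rs ≤ R) : d.m R = d.m d.Rs := by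
  unfold m
  congr 1
  have hc : Continuous fun s => d.ρ₀ s * s ^ 2 := by
    have := hd.smooth_ρ₀.continuous; fun_prop
  rw [← intervalIntegral.integral_add_adjacent_intervals (hc.intervalIntegrable 0 d.Rs)
    (hc.intervalIntegrable d.Rs R)]
  have : ∫ s in d.Rs..R, d.ρ₀ s * s ^ 2 = ∫ s in d.Rs..R, (0 : ℝ) := by
    refine intervalIntegral.integral_congr fun s hs => ?_
    rw [uIcc_of_le hR] at hs
    simp [hd.density_zero s hs.1]
  rw [this]
  simp

theorem sq_c_eq (d : DustData) {R : ℝ} (hR : 0 < R) : R ^ 2 * d.c R = 2 * d.m R / R := by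
  rw [d.m_eq]; field_simp

theorem continuousAt_y (hd : d.Admissible) {τ R : ℝ} (h0 : 0 < τ) (h1 : τ < d.tauS R) :
    ContinuousAt (fun t => d.y t R) τ := by
  have h := (hd.hasDerivAt_yE_time (hd.mem_tDom h0.le h1)).continuousAt
  refine h.congr ?_
  filter_upwards [Ioo_mem_nhds h0 h1] with t ht
  exact hd.yE_eq_y ht.1.le ht.2

/-- There is a ray from the central singularity which is untrapped at the surface of the cloud. -/
theorem exists_untrapped_singularRay (hd : d.Admissible) (hn : d.GloballyNaked) :
    ∃ σ, d.IsSingularRay d.Rs σ ∧ 2 * d.m d.Rs < d.Rs * d.y (σ d.Rs) d.Rs ^ 2 := by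
  obtain ⟨⟨σ₀, hσ₀⟩, hr⟩ := hn
  have hRs := hd.Rs_pos
  set S := {t | ∃ σ, d.IsSingularRay d.Rs σ ∧ σ d.Rs = t}
  have hne : S.Nonempty := ⟨_, σ₀, hσ₀, rfl⟩
  have hpos : 0 < d.tauCH d.Rs := (hd.tauS_pos 0).trans_le
    (le_csInf hne fun t ⟨σ, hσ, ht⟩ => ht ▸ (hd.tauS_zero_lt_singularRay hσ ⟨hRs, le_rfl⟩).le)
  have hlt : d.tauCH d.Rs < d.tauS d.Rs :=
    (tauCH_le d hRs hσ₀).trans_lt (hσ₀.mem _ ⟨hRs, le_rfl⟩).2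
  -- The infimum defining `tauCH` need not be known to be attained. By continuity of r in τ, some
  -- singular ray arriving only slightly later is still untrapped at the surface.
  have hc : ContinuousAt (fun t => d.r t d.Rs) (d.tauCH d.Rs) :=
    continuousAt_const.mul ((hd.continuousAt_y hpos hlt).pow 2)
  obtain ⟨ε, hε, hball⟩ := Metric.eventually_nhds_iff.1 (hc.eventually (lt_mem_nhds hr))
  obtain ⟨t, ⟨σ, hσ, rfl⟩, ht⟩ := exists_lt_of_csInf_lt hne
    (show sInf S < d.tauCH d.Rs + ε by show d.tauCH d.Rs < _; linarith)
  refine ⟨σ, hσ, hball ?_⟩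
  rw [Real.dist_eq, abs_of_nonneg (sub_nonneg.2 (tauCH_le d hRs hσ))]
  linarith

/-- Beyond the surface of the cloud an untrapped ray stays at a definite distance from `r = 2m`. -/
theorem exists_extended_singularRay (hd : d.Admissible) (hn : d.GloballyNaked) :
    ∃ l > 2 * d.m d.Rs, ∀ R₂, d.Rs ≤ R₂ →
      ∃ σ, d.IsSingularRay R₂ σ ∧ l ≤ R₂ * d.y (σ R₂) R₂ ^ 2 := by
  obtain ⟨σ₀, hσ₀, hr⟩ := hd.exists_untrapped_singularRay hn
  have hRs := hd.Rs_pos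
  set y₀ := d.y (σ₀ d.Rs) d.Rs
  have hm₀ := hσ₀.mem _ ⟨hRs, le_rfl⟩
  have hy₀ : y₀ ∈ Ioc (0 : ℝ) 1 := hd.y_mem hm₀.1 hm₀.2
  -- The midpoint between 2m and the areal radius of the ray at the surface. The level r = l is a
  -- barrier that rays outside the cloud can only cross upwards.
  set l := (2 * d.m d.Rs + d.Rs * y₀ ^ 2) / 2 with hl
  have hl1 : 2 * d.m d.Rs < l := by rw [hl]; linarith
  have hl2 : l < d.Rs * y₀ ^ 2 := by rw [hl]; linarith
  have hm0 : 0 ≤ d.m d.Rs := by rw [d.m_eq]; have := hd.c_pos d.Rs; positivity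
  have hlpos : 0 < l := by linarith
  have hlRs : l < d.Rs := by
    have : y₀ ^ 2 ≤ 1 := pow_le_one₀ hy₀.1.le hy₀.2
    nlinarith
  refine ⟨l, hl1, fun R₂ hR₂ => ?_⟩
  have hB : ∀ R ∈ Icc d.Rs R₂, √(l / R) ∈ Icc (√(l / R₂)) 1 := by
    intro R hR
    have hRp : 0 < R := hRs.trans_le hR.1
    refine ⟨Real.sqrt_le_sqrt (by have := hR.2; gcongr), Real.sqrt_le_one.2 ?_⟩
    rw [div_le_one hRp]; linarith [hR.1]
  have hδ : 0 < √(l / R₂) := Real.sqrt_pos.2 (div_pos hlpos (hRs.trans_le hR₂))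
  have hδ1 : √(l / R₂) ≤ 1 := (hB R₂ ⟨hR₂, le_rfl⟩).2
  obtain ⟨K, hK⟩ := hd.exists_lipschitz_rayY (β := R₂) hRs.le hδ
  obtain ⟨Y, hY1, hY⟩ := exists_clamped_solution y₀ hδ1 (left_mem_Icc.2 hR₂) hK
  dsimp only at hY
  have hup : ∀ R ∈ Icc d.Rs R₂, Y R ≤ 1 := le_of_deriv_neg_at_level hY (by rw [hY1]; exact hy₀.2)
    fun R hR h => by
      rw [h, min_self, max_eq_right hδ1]
      exact hd.rayY_one_neg (hRs.le.trans hR.1)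
  have hBd : ∀ R ∈ Icc d.Rs R₂, HasDerivAt (fun R => √(l / R)) (-√(l / R) / (2 * R)) R := by
    intro R hR
    have hRp : 0 < R := hRs.trans_le hR.1
    have h1 : HasDerivAt (fun R => l / R) (-l / R ^ 2) R := by
      simpa [div_eq_mul_inv] using (hasDerivAt_inv hRp.ne').const_mul l
    refine (h1.sqrt (div_pos hlpos hRp).ne').congr_deriv ?_
    have hs := Real.sqrt_pos.2 (div_pos hlpos hRp)
    have hs2 := Real.sq_sqrt (div_pos hlpos hRp).le
    field_simp
    rw [hs2]
    field_simp
  have hlow : ∀ R ∈ Icc d.Rs R₂, √(l / R) ≤ Y R := by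
    intro R hR
    have := image_le_of_deriv_right_lt_deriv_boundary' (f := fun R => √(l / R))
      (f' := fun R => -√(l / R) / (2 * R)) (B := Y)
      (B' := fun R => d.rayY (max (√(l / R₂)) (min 1 (Y R))) R) (a := d.Rs) (b := R₂)
      (fun R hR => (hBd R hR).continuousAt.continuousWithinAt)
      (fun R hR => (hBd R ⟨hR.1, hR.2.le⟩).hasDerivWithinAt)
      (by
        rw [hY1]
        refine Real.sqrt_le_iff.2 ⟨hy₀.1.le, ?_⟩
        rw [div_le_iff₀ hRs]; linarith)
      (fun R hR => (hY R hR).continuousWithinAt)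
      (fun R hR => hasDerivWithinAt_Ici_of_Icc (hY R ⟨hR.1, hR.2.le⟩) hR) ?_ hR
    · exact this
    -- At a contact with y = √(l/R) the areal radius is l > 2m, so r strictly increases along the
    -- ray, whereas it is constant along the barrier.
    · intro R hR h
      have hR' : R ∈ Icc d.Rs R₂ := ⟨hR.1, hR.2.le⟩
      have hRp : 0 < R := hRs.trans_le hR.1
      rw [← h, min_eq_right (hB R hR').2, max_eq_right (hB R hR').1]
      set b := √(l / R)
      have hb : b ∈ Ioc (0 : ℝ) 1 := ⟨hδ.trans_le (hB R hR').1, (hB R hR').2⟩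
      have hb2 : b ^ 2 = l / R := Real.sq_sqrt (div_pos hlpos hRp).le
      have hlt : d.infall b R < d.w R := by
        rw [hd.infall_lt_w_iff hb hRp, sq_c_eq d hRp, hd.mass_const hR.1, hb2]
        gcongr
      have h2 := sq_add_rayY d (R := R) hb.1.ne'
      have hw := hd.w_pos hRp.le
      have h3 : 0 < d.rR b R * (1 - d.infall b R / d.w R) :=
        mul_pos (hd.rR_pos hb hRp.le) (by rw [sub_pos, div_lt_one hw]; exact hlt)
      rw [div_lt_iff₀ (by positivity)]
      have := hb.1
      nlinarith
  have hYmem : ∀ R ∈ Icc d.Rs R₂, Y R ∈ Ioc (0 : ℝ) 1 := fun R hR =>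
    ⟨hδ.trans_le ((hB R hR).1.trans (hlow R hR)), hup R hR⟩
  have hray : d.IsRay d.Rs R₂ (fun R => d.tau (Y R) R) := hd.isRay_of_y hYmem fun R hR => by
    have := hY R hR
    rwa [min_eq_right (hup R hR), max_eq_right ((hB R hR).1.trans (hlow R hR))] at this
  have hRsmem : d.Rs ∈ Icc d.Rs R₂ := ⟨le_rfl, hR₂⟩
  have hglue : d.tau (Y d.Rs) d.Rs = σ₀ d.Rs := by rw [hY1]; exact hd.tau_y hm₀.1 hm₀.2
  -- The given ray inside the cloud is glued to the solution outside; both satisfy the same equation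
  -- at R = Rs, so the one-sided derivatives match.
  let σ : ℝ → ℝ := fun R => if R ≤ d.Rs then σ₀ R else d.tau (Y R) R
  have hσ1 : ∀ R ∈ Ioc 0 d.Rs, σ R = σ₀ R := fun R hR => if_pos hR.2
  have hσ2 : ∀ R ∈ Icc d.Rs R₂, σ R = d.tau (Y R) R := by
    intro R hR
    rcases hR.1.eq_or_lt with h | h
    · rw [← h, hglue]; exact if_pos le_rfl
    · exact if_neg (not_le.2 h)
  have hU : Ioc 0 d.Rs ∪ Icc d.Rs R₂ = Ioc 0 R₂ := by
    ext x
    constructor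
    · rintro (h | h)
      · exact ⟨h.1, h.2.trans hR₂⟩
      · exact ⟨hRs.trans_le h.1, h.2⟩
    · intro h
      rcases le_total x d.Rs with h' | h'
      · exact Or.inl ⟨h.1, h'⟩
      · exact Or.inr ⟨h', h.2⟩
  refine ⟨σ, ⟨?_, ?_, ?_⟩, ?_⟩
  · intro R hR
    rw [← hU] at hR
    rcases hR with h | h
    · rw [hσ1 R h]; exact hσ₀.mem R h
    · rw [hσ2 R h]; exact hray.mem R h
  · intro R hR
    have key1 : R ∈ Ioc 0 d.Rs → HasDerivWithinAt σ (d.γ (σ R) R)⁻¹ (Ioc 0 d.Rs) R := by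
      intro h
      rw [hσ1 R h]
      exact (hσ₀.null R h).congr hσ1 (hσ1 R h)
    have key2 : R ∈ Icc d.Rs R₂ → HasDerivWithinAt σ (d.γ (σ R) R)⁻¹ (Icc d.Rs R₂) R := by
      intro h
      have hm := hray.mem R h
      rw [hσ2 R h, hd.slope_eq hm.1 hm.2]
      exact (hray.null R h).congr hσ2 (hσ2 R h)
    rw [← hU]
    rcases lt_trichotomy R d.Rs with h | h | h
    · refine (key1 ⟨hR.1, h.le⟩).mono_of_mem_nhdsWithin ?_
      rw [hU]
      exact mem_nhdsWithin.2 ⟨Iio d.Rs, isOpen_Iio, h, fun x hx => ⟨hx.2.1, le_of_lt hx.1⟩⟩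
    · exact (key1 ⟨hR.1, h.le⟩).union (key2 ⟨h.ge, hR.2⟩)
    · refine (key2 ⟨h.le, hR.2⟩).mono_of_mem_nhdsWithin ?_
      rw [hU]
      exact mem_nhdsWithin.2 ⟨Ioi d.Rs, isOpen_Ioi, h, fun x hx => ⟨le_of_lt hx.1, hx.2.2⟩⟩
  · refine hσ₀.emanates.congr' ?_
    filter_upwards [Ioc_mem_nhdsGT hRs] with x hx
    exact (hσ1 x hx).symm
  · have h2 : R₂ ∈ Icc d.Rs R₂ := ⟨hR₂, le_rfl⟩
    have hR₂p : 0 < R₂ := hRs.trans_le hR₂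
    rw [hσ2 R₂ h2, hd.y_tau R₂ ⟨(hYmem R₂ h2).1.le, (hYmem R₂ h2).2⟩]
    have h3 := hlow R₂ h2
    have h4 : l / R₂ ≤ Y R₂ ^ 2 := by
      rw [← Real.sq_sqrt (div_pos hlpos hR₂p).le]; gcongr
    rwa [div_le_iff₀ hR₂p, mul_comm] at h4

theorem exists_singularRay (hd : d.Admissible) (hn : d.GloballyNaked) (R : ℝ) :
    ∃ σ, d.IsSingularRay R σ := by
  obtain ⟨l, -, h⟩ := hd.exists_extended_singularRay hn
  obtain ⟨σ, hσ, -⟩ := h (max R d.Rs) (le_max_right _ _)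
  exact ⟨σ, singularRay_mono hσ (le_max_left _ _)⟩

/-- Singular rays exist up to every radius, so the set in the definition of `tauCH` is nonempty and
`sInf` does not take its default value 0. -/
theorem le_tauCH (hd : d.Admissible) (hn : d.GloballyNaked) {R t : ℝ}
    (h : ∀ σ, d.IsSingularRay R σ → t ≤ σ R) : t ≤ d.tauCH R := by
  obtain ⟨σ, hσ⟩ := hd.exists_singularRay hn R
  exact le_csInf ⟨_, σ, hσ, rfl⟩ fun t ⟨σ, hσ, ht⟩ => ht ▸ h σ hσ

theorem tauS_zero_le_tauCH (hd : d.Admissible) (hn : d.GloballyNaked) {R : ℝ} (hR : 0 < R) :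
    d.tauS 0 ≤ d.tauCH R :=
  hd.le_tauCH hn fun _ hσ => (hd.tauS_zero_lt_singularRay hσ ⟨hR, le_rfl⟩).le

theorem tauCH_mono (hd : d.Admissible) (hn : d.GloballyNaked) {R R' : ℝ} (hR : 0 < R)
    (h : R ≤ R') : d.tauCH R ≤ d.tauCH R' :=
  hd.le_tauCH hn fun _ hσ => (tauCH_le d hR (singularRay_mono hσ h)).trans
    ((hd.isRay_strictMonoOn hR.le (hd.isRay_of_singularRay hσ hR)).monotoneOn
      ⟨le_rfl, h⟩ ⟨h, le_rfl⟩ h)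

end Admissible

end DustData

/-! ### The maximal development in the (τ, R) half-plane -/

namespace DustData

variable {d : DustData}

/-- The maximal development, in the coordinates `(τ, R)`. -/
def D₂ (d : DustData) : Set (ℝ × ℝ) :=
  {z | 0 ≤ z.2 ∧ 0 ≤ z.1 ∧ z.1 < d.tauS z.2 ∧ (0 < z.2 → z.1 < d.tauCH z.2)}

namespace Admissible

/-- Before the time of the central singularity nothing is missing at any radius: shells further out
collapse later, and singular rays lie above tauS 0. -/
theorem slab_subset (hd : d.Admissible) (hn : d.GloballyNaked) {τ R : ℝ} (hR : 0 ≤ R) (h0 : 0 ≤ τ)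
    (h1 : τ < d.tauS 0) : (τ, R) ∈ d.D₂ :=
  ⟨hR, h0, h1.trans_le (hd.strictMonoOn_tauS.monotoneOn self_mem_Ici hR hR),
    fun h => h1.trans_le (hd.tauS_zero_le_tauCH hn h)⟩

theorem D₂_outward (hd : d.Admissible) (hn : d.GloballyNaked) {τ τ' R R' : ℝ} (h : (τ, R) ∈ d.D₂)
    (hR : 0 < R) (hR' : R ≤ R') (h0 : 0 ≤ τ') (hτ : τ' ≤ τ) : (τ', R') ∈ d.D₂ :=
  ⟨hR.le.trans hR', h0, (hτ.trans_lt h.2.2.1).trans_le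
    (hd.strictMonoOn_tauS.monotoneOn hR.le (hR.le.trans hR') hR'),
    fun _ => (hτ.trans_lt (h.2.2.2 hR)).trans_le (hd.tauCH_mono hn hR hR')⟩

/-- The past-directed outgoing ray from a point meets the initial surface or reaches arbitrarily
small radii. -/
theorem ray_dichotomy (hd : d.Admissible) {τ₁ R₁ : ℝ}
    (h0 : 0 < τ₁) (h1 : τ₁ < d.tauS R₁) :
    (∃ ρ ∈ Ioo 0 R₁, ∃ σ, d.IsRay ρ R₁ σ ∧ σ R₁ = τ₁ ∧ σ ρ = 0) ∨
    (∃ σ, σ R₁ = τ₁ ∧ ∀ ρ ∈ Ioo 0 R₁, d.IsRay ρ R₁ σ) := by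
  by_cases hA : ∃ ρ ∈ Ioo 0 R₁, ∃ σ, d.IsRay ρ R₁ σ ∧ σ R₁ = τ₁ ∧ σ ρ = 0
  · exact Or.inl hA
  right
  have hex : ∀ ρ, ∃ σ : ℝ → ℝ, ρ ∈ Ioo 0 R₁ → d.IsRay ρ R₁ σ ∧ σ R₁ = τ₁ := by
    intro ρ
    by_cases hρ : ρ ∈ Ioo 0 R₁
    · obtain ⟨ρ', hρ', σ, hσ, hσ1, h | h⟩ := hd.exists_backward_ray hρ.1 hρ.2 h0 h1
      · exact ⟨σ, fun _ => ⟨h ▸ hσ, hσ1⟩⟩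
      · exact (hA ⟨ρ', ⟨hρ.1.trans_le hρ'.1, hρ'.2⟩, σ, hσ, hσ1, h⟩).elim
    · exact ⟨0, fun h => (hρ h).elim⟩
  choose s hs using hex
  -- For each ρ there is a ray down to ρ; uniqueness from the common end point makes them
  -- restrictions of one function.
  let σ : ℝ → ℝ := fun R => if R < R₁ then s R R else τ₁
  have heq : ∀ ρ ∈ Ioo 0 R₁, ∀ R ∈ Icc ρ R₁, σ R = s ρ R := by
    intro ρ hρ R hR
    rcases hR.2.eq_or_lt with h | h
    · rw [h, (hs ρ hρ).2]; exact if_neg (lt_irrefl _)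
    · have hR' : R ∈ Ioo 0 R₁ := ⟨hρ.1.trans_le hR.1, h⟩
      have : σ R = s R R := if_pos h
      rw [this]
      exact hd.isRay_unique hR'.1.le (hs R hR').1 (IsRay.mono (hs ρ hρ).1 hR.1 le_rfl)
        (Or.inr ((hs R hR').2.trans (hs ρ hρ).2.symm)) R ⟨le_rfl, hR.2⟩
  refine ⟨σ, if_neg (lt_irrefl _), fun ρ hρ => ⟨fun R hR => ?_, fun R hR => ?_⟩⟩
  · rw [heq ρ hρ R hR]; exact (hs ρ hρ).1.mem R hR
  · rw [heq ρ hρ R hR]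
    exact ((hs ρ hρ).1.null R hR).congr (heq ρ hρ) (heq ρ hρ R hR)

/-- Before the Cauchy horizon, a past-directed outgoing ray which reaches the centre does so before
the central singularity. -/
theorem exists_lt_tauS_zero (hd : d.Admissible) {τ₁ R₁ : ℝ} (hR : 0 < R₁)
    (h2 : τ₁ < d.tauCH R₁) {σ : ℝ → ℝ} (hσ1 : σ R₁ = τ₁) (hσ : ∀ ρ ∈ Ioo 0 R₁, d.IsRay ρ R₁ σ) :
    ∃ ρ ∈ Ioo 0 R₁, σ ρ < d.tauS 0 := by
  -- Otherwise the ray would be squeezed between tauS 0 and tauS R as R → 0. It would then emanate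
  -- from the central singularity, contradicting τ₁ < `tauCH`.
  by_contra hcon
  push Not at hcon
  have hmem : ∀ R ∈ Ioc 0 R₁, 0 ≤ σ R ∧ σ R < d.tauS R := fun R hR =>
    (hσ (R / 2) ⟨by linarith [hR.1], by linarith [hR.1, hR.2]⟩).mem R
      ⟨by linarith [hR.1], hR.2⟩
  have hsing : d.IsSingularRay R₁ σ := by
    refine ⟨hmem, fun R hR => ?_, ?_⟩
    · rw [hd.slope_eq (hmem R hR).1 (hmem R hR).2]
      have h := (hσ (R / 2) ⟨by linarith [hR.1], by linarith [hR.1, hR.2]⟩).null R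
        ⟨by linarith [hR.1], hR.2⟩
      refine h.mono_of_mem_nhdsWithin ?_
      exact mem_nhdsWithin.2 ⟨Ioi (R / 2), isOpen_Ioi, by show R / 2 < R; linarith [hR.1],
        fun x hx => ⟨le_of_lt hx.1, hx.2.2⟩⟩
    · have ht : Tendsto d.tauS (𝓝[>] 0) (𝓝 (d.tauS 0)) :=
        (hd.contDiff_tauS.continuous.tendsto 0).mono_left nhdsWithin_le_nhds
      refine tendsto_of_tendsto_of_tendsto_of_le_of_le' tendsto_const_nhds ht ?_ ?_
      · filter_upwards [Ioo_mem_nhdsGT hR] with x hx using hcon x hx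
      · filter_upwards [Ioo_mem_nhdsGT hR] with x hx using (hmem x ⟨hx.1, hx.2.le⟩).2.le
  have := tauCH_le d hR hsing
  rw [hσ1] at this
  linarith

/-- A past-directed outgoing ray from a point of the maximal development stays in it. -/
theorem ray_lt_tauCH (hd : d.Admissible) (hn : d.GloballyNaked) {τ₁ R₁ ρ : ℝ} (hρ : 0 < ρ)
    (h0 : 0 < τ₁) (h1 : τ₁ < d.tauS R₁) (h2 : τ₁ < d.tauCH R₁) {σ : ℝ → ℝ}
    (hσ : d.IsRay ρ R₁ σ) (hσ1 : σ R₁ = τ₁) {R : ℝ} (hR : R ∈ Icc ρ R₁) : σ R < d.tauCH R := by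
  have hR₁ : 0 < R₁ := hρ.trans_le (hR.1.trans hR.2)
  have hRp : 0 < R := hρ.trans_le hR.1
  -- A slightly later point, still before collapse and horizon. Its ray lies strictly above the
  -- given one and, starting before tauS 0, below every singular ray. The margin turns the weak
  -- inequality with an infimum into a strict one.
  obtain ⟨τ₂, ha, hb⟩ := exists_between (lt_min h1 h2)
  have hb1 := hb.trans_le (min_le_left _ _)
  have hb2 := hb.trans_le (min_le_right _ _)
  have hcmp : ∀ ρ₂ σ₂, 0 < ρ₂ → d.IsRay ρ₂ R₁ σ₂ → σ₂ R₁ = τ₂ → ∀ x ∈ Icc ρ R₁, ρ₂ ≤ x → σ x < σ₂ x := by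
    intro ρ₂ σ₂ hρ₂ hσ₂ hσ₂1 x hx hx2
    exact hd.isRay_lt_backward (hρ.le.trans hx.1) hx.2 (IsRay.mono hσ hx.1 le_rfl)
      (IsRay.mono hσ₂ hx2 le_rfl) (by rw [hσ1, hσ₂1]; exact ha)
  have hfin : ∀ ρ₂ σ₂, 0 < ρ₂ → ρ₂ ≤ R → d.IsRay ρ₂ R₁ σ₂ → σ₂ R₁ = τ₂ → σ₂ ρ₂ < d.tauS 0 →
      σ R < d.tauCH R := by
    intro ρ₂ σ₂ hρ₂ hρ₂R hσ₂ hσ₂1 hlt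
    refine (hcmp ρ₂ σ₂ hρ₂ hσ₂ hσ₂1 R hR hρ₂R).trans_le (hd.le_tauCH hn fun s hs => ?_)
    have h3 : σ₂ ρ₂ < s ρ₂ := hlt.trans (hd.tauS_zero_lt_singularRay hs ⟨hρ₂, hρ₂R⟩)
    exact (hd.isRay_lt hρ₂.le hρ₂R (IsRay.mono hσ₂ le_rfl hR.2)
      (hd.isRay_of_singularRay hs hρ₂) h3).le
  rcases hd.ray_dichotomy (h0.trans ha) hb1 with ⟨ρ₂, hρ₂, σ₂, hσ₂, hσ₂1, hz⟩ | ⟨σ₂, hσ₂1, hσ₂⟩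
  · refine hfin ρ₂ σ₂ hρ₂.1 ?_ hσ₂ hσ₂1 (by rw [hz]; exact hd.tauS_pos 0)
    by_contra hcon
    push Not at hcon
    have hx : ρ₂ ∈ Icc ρ R₁ := ⟨hR.1.trans hcon.le, hρ₂.2.le⟩
    have := hcmp ρ₂ σ₂ hρ₂.1 hσ₂ hσ₂1 ρ₂ hx le_rfl
    rw [hz] at this
    exact absurd (hσ.mem ρ₂ hx).1 (not_le.2 this)
  · obtain ⟨ρ₂, hρ₂, hlt⟩ := hd.exists_lt_tauS_zero hR₁ hb2 hσ₂1 hσ₂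
    rcases le_total ρ₂ R with h | h
    · exact hfin ρ₂ σ₂ hρ₂.1 h (hσ₂ ρ₂ hρ₂) hσ₂1 hlt
    · have hR' : R ∈ Ioo 0 R₁ := ⟨hRp, h.trans_lt hρ₂.2⟩
      refine hfin R σ₂ hRp le_rfl (hσ₂ R hR') hσ₂1 (lt_of_le_of_lt ?_ hlt)
      exact (hd.isRay_strictMonoOn hRp.le (hσ₂ R hR')).monotoneOn ⟨le_rfl, hR.2⟩
        ⟨h, hρ₂.2.le⟩ h

/-- The region below a past-directed outgoing ray lies in the maximal development. -/
theorem mem_D₂_of_le_ray (hd : d.Admissible) (hn : d.GloballyNaked) {τ₁ R₁ ρ : ℝ} (hρ : 0 < ρ)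
    (h0 : 0 < τ₁) (h1 : (τ₁, R₁) ∈ d.D₂) {σ : ℝ → ℝ}
    (hσ : d.IsRay ρ R₁ σ) (hσ1 : σ R₁ = τ₁) {R τ : ℝ} (hR : R ∈ Icc ρ R₁) (hτ0 : 0 ≤ τ)
    (hτ : τ ≤ σ R) : (τ, R) ∈ d.D₂ :=
  ⟨hρ.le.trans hR.1, hτ0, hτ.trans_lt (hσ.mem R hR).2, fun _ => hτ.trans_lt
    (hd.ray_lt_tauCH hn hρ h0 h1.2.2.1 (h1.2.2.2 (hρ.trans_le (hR.1.trans hR.2))) hσ hσ1 hR)⟩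

/-- Continuity of `tauCH` is not available. Instead a past-directed ray is drawn from a slightly
later point: at smaller radii the region below this ray lies in the development, and at larger radii
`D₂_outward` applies. -/
theorem D₂_isOpen_at (hd : d.Admissible) (hn : d.GloballyNaked) {τ R : ℝ} (h : (τ, R) ∈ d.D₂)
    (h0 : 0 < τ) : ∀ᶠ z in 𝓝 (τ, R), 0 ≤ z.2 → z ∈ d.D₂ := by
  have hpos : ∀ᶠ z in 𝓝 (τ, R), 0 < z.1 :=
    (isOpen_lt continuous_const continuous_fst).mem_nhds h0
  rcases h.1.eq_or_lt with hR | hR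
  · dsimp only at hR
    subst hR
    have h1 : ∀ᶠ z in 𝓝 (τ, (0 : ℝ)), z.1 < d.tauS 0 :=
      (isOpen_lt continuous_fst continuous_const).mem_nhds h.2.2.1
    filter_upwards [hpos, h1] with z hz hz1 hz2
    exact hd.slab_subset hn hz2 (le_of_lt hz) hz1
  · obtain ⟨τ₂, ha, hb⟩ := exists_between (lt_min h.2.2.1 (h.2.2.2 hR))
    dsimp only at ha hb hR
    have hb1 := hb.trans_le (min_le_left _ _)
    have hb2 := hb.trans_le (min_le_right _ _)
    have h2 : (τ₂, R) ∈ d.D₂ := ⟨h.1, (h0.trans ha).le, hb1, fun _ => hb2⟩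
    obtain ⟨ρ, hρ, σ, hσ, hσ1, -⟩ := hd.exists_backward_ray (half_pos hR) (by linarith)
      (h0.trans ha) hb1
    have hρ0 : 0 < ρ := (half_pos hR).trans_le hρ.1
    have hc : ∀ᶠ x in 𝓝[Icc ρ R] R, (τ + τ₂) / 2 < σ x := by
      have := (IsRay.continuousOn hσ) R ⟨hρ.2.le, le_rfl⟩
      exact this.eventually (lt_mem_nhds (by rw [hσ1]; linarith))
    have hc' : ∀ᶠ x in 𝓝 R, x ∈ Icc ρ R → (τ + τ₂) / 2 < σ x := eventually_nhdsWithin_iff.1 hc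
    have hc2 : ∀ᶠ z in 𝓝 (τ, R), z.2 ∈ Icc ρ R → (τ + τ₂) / 2 < σ z.2 :=
      (continuous_snd.tendsto (τ, R)).eventually hc'
    have hc3 : ∀ᶠ z in 𝓝 (τ, R), z.1 < (τ + τ₂) / 2 :=
      (isOpen_lt continuous_fst continuous_const).mem_nhds (by show τ < _; linarith)
    have hc4 : ∀ᶠ z in 𝓝 (τ, R), ρ < z.2 :=
      (isOpen_lt continuous_const continuous_snd).mem_nhds hρ.2
    filter_upwards [hpos, hc2, hc3, hc4] with z hz0 hz1 hz2 hz3 _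
    rcases le_total z.2 R with hle | hle
    · exact hd.mem_D₂_of_le_ray hn hρ0 (h0.trans ha) h2 hσ hσ1 ⟨hz3.le, hle⟩ hz0.le
        (hz2.trans (hz1 ⟨hz3.le, hle⟩)).le
    · exact hd.D₂_outward hn h2 hR hle hz0.le (by linarith)

end Admissible

end DustData

/-! ### The development in Cartesian coordinates -/

theorem rad_nonneg (p : Fin 4 → ℝ) : 0 ≤ rad p := Real.sqrt_nonneg _

theorem continuous_rad : Continuous rad := by unfold rad; fun_prop

theorem mem_D_iff {d : DustData} {p : Fin 4 → ℝ} : p ∈ d.D ↔ (p 0, rad p) ∈ d.D₂ :=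
  ⟨fun h => ⟨rad_nonneg p, h⟩, fun h => h.2⟩

namespace DustData

namespace Admissible

variable {d : DustData}

theorem D_mem_nhds (hd : d.Admissible) (hn : d.GloballyNaked) {p : Fin 4 → ℝ} (hp : p ∈ d.D)
    (h0 : 0 < p 0) : d.D ∈ 𝓝 p := by
  have hc : Continuous fun p : Fin 4 → ℝ => (p 0, rad p) :=
    (continuous_apply 0).prodMk continuous_rad
  filter_upwards [(hc.tendsto p).eventually (hd.D₂_isOpen_at hn (mem_D_iff.1 hp) h0)] with z hz
  exact mem_D_iff.2 (hz (rad_nonneg z))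

/-- This makes `fderivWithin` of the solution on D continuous up to the initial surface, where D is
only one-sided. -/
theorem uniqueDiffOn_D (hd : d.Admissible) (hn : d.GloballyNaked) : UniqueDiffOn ℝ d.D := by
  intro p hp
  rcases hp.1.eq_or_lt with h | h
  · have hsub : {z : Fin 4 → ℝ | z 0 ∈ Ico 0 (d.tauS 0)} ⊆ d.D := fun z hz =>
      mem_D_iff.2 (hd.slab_subset hn (rad_nonneg z) hz.1 hz.2)
    have hconv : Convex ℝ {z : Fin 4 → ℝ | z 0 ∈ Ico 0 (d.tauS 0)} :=
      (convex_Ico 0 (d.tauS 0)).is_linear_preimage (f := fun z : Fin 4 → ℝ => z 0)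
        ⟨fun _ _ => rfl, fun _ _ => rfl⟩
    have hint : (interior {z : Fin 4 → ℝ | z 0 ∈ Ico 0 (d.tauS 0)}).Nonempty := by
      have hop : IsOpen {z : Fin 4 → ℝ | z 0 ∈ Ioo 0 (d.tauS 0)} :=
        isOpen_Ioo.preimage (continuous_apply 0)
      have hsub' : {z : Fin 4 → ℝ | z 0 ∈ Ioo 0 (d.tauS 0)} ⊆
          {z : Fin 4 → ℝ | z 0 ∈ Ico 0 (d.tauS 0)} := fun z hz => Ioo_subset_Ico_self hz
      refine ⟨fun _ => d.tauS 0 / 2, interior_maximal hsub' hop ?_⟩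
      have := hd.tauS_pos 0
      exact ⟨by linarith, by linarith⟩
    exact ((uniqueDiffOn_convex hconv hint) p ⟨h.le, h ▸ hd.tauS_pos 0⟩).mono hsub
  · exact uniqueDiffWithinAt_of_mem_nhds (hd.D_mem_nhds hn hp h)

end Admissible

end DustData

theorem exists_pos_bounds {X : Type*} [TopologicalSpace X] {s : Set X} (hs : IsCompact s)
    {F : X → ℝ} (hF : ContinuousOn F s) (hpos : ∀ x ∈ s, 0 < F x) :
    ∃ a > 0, ∃ b > 0, ∀ x ∈ s, a ≤ F x ∧ F x ≤ b := by
  rcases s.eq_empty_or_nonempty with h | h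
  · exact ⟨1, one_pos, 1, one_pos, fun x hx => by simp [h] at hx⟩
  · obtain ⟨x, hx, hmin⟩ := hs.exists_isMinOn h hF
    obtain ⟨x', hx', hmax⟩ := hs.exists_isMaxOn h hF
    exact ⟨F x, hpos x hx, F x', hpos x' hx', fun y hy => ⟨hmin hy, hmax hy⟩⟩

namespace DustData

variable {d : DustData}

namespace Admissible

/-! ### Estimates near the central singularity -/

/-- ∂τ/∂y is -2y² divided by a quantity lying between positive constants on the compact set;
integration from y = 0 gives the cubic. -/
theorem tauS_sub_tau_bounds (hd : d.Admissible) :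
    ∃ a > 0, ∃ b > 0, ∀ R ∈ Icc 0 d.Rs, ∀ y ∈ Icc (0 : ℝ) 1,
      a * y ^ 3 ≤ d.tauS R - d.tau y R ∧ d.tauS R - d.tau y R ≤ b * y ^ 3 := by
  have hcont : ContinuousOn (fun z : ℝ × ℝ => √(1 - (d.q z.2 * z.1) ^ 2) * √(d.c z.2))
      (Icc (0 : ℝ) 1 ×ˢ Icc 0 d.Rs) := by
    have h1 := hd.contDiff_q.continuous
    have h2 := hd.contDiff_c.continuous
    exact Continuous.continuousOn (by fun_prop)
  obtain ⟨a, ha, b, hb, hab⟩ := exists_pos_bounds (isCompact_Icc.prod isCompact_Icc) hcont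
    (fun z hz => mul_pos (Real.sqrt_pos.2 (one_sub_sq_pos (hd.abs_q_mul_lt' hz.1 z.2)))
      (hd.sqrt_c_pos z.2))
  have hderiv : ∀ R, ∀ k : ℝ, ∀ y ∈ Icc (0 : ℝ) 1, HasDerivAt (fun y => d.tauS R - d.tau y R - k * y ^ 3)
      (2 * y ^ 2 / (√(1 - (d.q R * y) ^ 2) * √(d.c R)) - k * (3 * y ^ 2)) y := by
    intro R k y hy
    have h1 := hd.hasDerivAt_tau_y (hd.abs_q_mul_lt' hy R)
    have h2 : HasDerivAt (fun y : ℝ => k * y ^ 3) (k * (3 * y ^ 2)) y := by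
      simpa using (hasDerivAt_pow 3 y).const_mul k
    refine ((h1.const_sub _).sub h2).congr_deriv ?_
    rw [div_div]; ring
  refine ⟨2 / (3 * b), by positivity, 2 / (3 * a), by positivity, fun R hR y hy => ⟨?_, ?_⟩⟩
  · have hmono : MonotoneOn (fun y => d.tauS R - d.tau y R - 2 / (3 * b) * y ^ 3) (Icc 0 1) := by
      refine monotoneOn_of_deriv_nonneg (convex_Icc 0 1)
        (fun y hy => (hderiv R _ y hy).continuousAt.continuousWithinAt)
        (fun y hy => (hderiv R _ y (interior_subset hy)).differentiableAt.differentiableWithinAt)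
        fun y hy => ?_
      have hy' := interior_subset hy
      rw [(hderiv R _ y hy').deriv]
      have hB := hab (y, R) ⟨hy', hR⟩
      have hpos := ha.trans_le hB.1
      have : 2 * y ^ 2 / b ≤ 2 * y ^ 2 / (√(1 - (d.q R * y) ^ 2) * √(d.c R)) := by
        have := hB.2; gcongr
      have e : 2 / (3 * b) * (3 * y ^ 2) = 2 * y ^ 2 / b := by field_simp
      rw [e]; linarith
    have := hmono ⟨le_rfl, zero_le_one⟩ hy hy.1
    simp only [tauS, sub_self] at this ⊢
    linarith
  · have hmono : AntitoneOn (fun y => d.tauS R - d.tau y R - 2 / (3 * a) * y ^ 3) (Icc 0 1) := by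
      refine antitoneOn_of_deriv_nonpos (convex_Icc 0 1)
        (fun y hy => (hderiv R _ y hy).continuousAt.continuousWithinAt)
        (fun y hy => (hderiv R _ y (interior_subset hy)).differentiableAt.differentiableWithinAt)
        fun y hy => ?_
      have hy' := interior_subset hy
      rw [(hderiv R _ y hy').deriv]
      have hB := hab (y, R) ⟨hy', hR⟩
      have : 2 * y ^ 2 / (√(1 - (d.q R * y) ^ 2) * √(d.c R)) ≤ 2 * y ^ 2 / a := by
        have := hB.1; gcongr
      have e : 2 / (3 * a) * (3 * y ^ 2) = 2 * y ^ 2 / a := by field_simp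
      rw [e]; linarith
    have := hmono ⟨le_rfl, zero_le_one⟩ hy hy.1
    simp only [tauS, sub_self] at this ⊢
    linarith

/-- The derivative of tauS is R · tauK 0 R, and `tauK` is positive at y = 0 up to and including the
centre. The nondegeneracy assumption therefore makes the minimum of the collapse time quadratic. -/
theorem tauS_bounds (hd : d.Admissible) :
    ∃ a > 0, ∃ b > 0, ∀ R ∈ Icc 0 d.Rs,
      a * R ^ 2 ≤ d.tauS R - d.tauS 0 ∧ d.tauS R - d.tauS 0 ≤ b * R ^ 2 := by
  have hcont : ContinuousOn (fun R : ℝ => d.tauK 0 R) (Icc 0 d.Rs) := fun R _ => by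
    have h : ContinuousAt (fun z : ℝ × ℝ => d.tauK z.1 z.2) (0, R) :=
      (hd.contDiffAt_tauK (y := 0) (R := R) (by simp)).continuousAt
    exact (ContinuousAt.comp (g := fun z : ℝ × ℝ => d.tauK z.1 z.2) (f := fun R : ℝ => ((0 : ℝ), R))
      h (by fun_prop)).continuousWithinAt
  obtain ⟨a, ha, b, hb, hab⟩ := exists_pos_bounds isCompact_Icc hcont
    (fun R hR => hd.tauK_pos ⟨le_rfl, zero_lt_one⟩ hR.1)
  have hderiv : ∀ k R : ℝ, HasDerivAt (fun R => d.tauS R - k * R ^ 2)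
      (R * d.tauK 0 R - k * (2 * R)) R := by
    intro k R
    have h2 : HasDerivAt (fun y : ℝ => k * y ^ 2) (k * (2 * R)) R := by
      simpa using (hasDerivAt_pow 2 R).const_mul k
    exact (hd.hasDerivAt_tauS R).sub h2
  refine ⟨a / 2, by positivity, b / 2, by positivity, fun R hR => ⟨?_, ?_⟩⟩
  · have hmono : MonotoneOn (fun R => d.tauS R - a / 2 * R ^ 2) (Icc 0 d.Rs) := by
      refine monotoneOn_of_deriv_nonneg (convex_Icc 0 _)
        (fun y hy => (hderiv _ y).continuousAt.continuousWithinAt)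
        (fun y hy => (hderiv _ y).differentiableAt.differentiableWithinAt) fun y hy => ?_
      have hy' := interior_subset hy
      rw [(hderiv _ y).deriv]
      have := mul_le_mul_of_nonneg_left (hab y hy').1 hy'.1
      linarith
    have := hmono ⟨le_rfl, hR.1.trans hR.2⟩ hR hR.1
    norm_num at this
    linarith
  · have hmono : AntitoneOn (fun R => d.tauS R - b / 2 * R ^ 2) (Icc 0 d.Rs) := by
      refine antitoneOn_of_deriv_nonpos (convex_Icc 0 _)
        (fun y hy => (hderiv _ y).continuousAt.continuousWithinAt)
        (fun y hy => (hderiv _ y).differentiableAt.differentiableWithinAt) fun y hy => ?_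
      have hy' := interior_subset hy
      rw [(hderiv _ y).deriv]
      have := mul_le_mul_of_nonneg_left (hab y hy').2 hy'.1
      linarith
    have := hmono ⟨le_rfl, hR.1.trans hR.2⟩ hR hR.1
    norm_num at this
    linarith

/-- y r' = y³ + R² √c √(1-q²y²) tauK. Since `tauK` vanishes at y = 1, the lower bound is split at y
= 1/2: below, `tauK` is bounded below by compactness; above, y³ alone dominates because R ≤ Rs. -/
theorem rR_bounds (hd : d.Admissible) :
    ∃ a > 0, ∃ b > 0, ∀ R ∈ Icc 0 d.Rs, ∀ y ∈ Ioc (0 : ℝ) 1,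
      a * (y ^ 3 + R ^ 2) ≤ y * d.rR y R ∧ y * d.rR y R ≤ b * (y ^ 3 + R ^ 2) := by
  have hcont : ContinuousOn (fun z : ℝ × ℝ => √(d.c z.2) * √(1 - (d.q z.2 * z.1) ^ 2)
      * d.tauK z.1 z.2) (Icc (0 : ℝ) 1 ×ˢ Icc 0 d.Rs) := by
    have h1 := hd.contDiff_q.continuous
    have h2 := hd.contDiff_c.continuous
    refine ContinuousOn.mul (Continuous.continuousOn (by fun_prop)) ?_
    rintro ⟨y, R⟩ ⟨hy, hR⟩
    exact (hd.contDiffAt_tauK (hd.abs_q_mul_lt' hy R)).continuousAt.continuousWithinAt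
  have heq : ∀ y R : ℝ, 0 < y → y * d.rR y R =
      y ^ 3 + R ^ 2 * (√(d.c R) * √(1 - (d.q R * y) ^ 2) * d.tauK y R) := by
    intro y R hy
    rw [rR_eq d hy.ne', infall]
    field_simp
  obtain ⟨B, hB⟩ := (isCompact_Icc.prod isCompact_Icc).exists_bound_of_continuousOn hcont
  have hsub : Icc (0 : ℝ) (1 / 2) ×ˢ Icc 0 d.Rs ⊆ Icc (0 : ℝ) 1 ×ˢ Icc 0 d.Rs :=
    prod_mono (Icc_subset_Icc_right (by norm_num)) Subset.rfl
  obtain ⟨k, hk, _, _, hkb⟩ := exists_pos_bounds (isCompact_Icc.prod isCompact_Icc)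
    (hcont.mono hsub) (fun z hz => by
      have hz1 : z.1 ∈ Icc (0 : ℝ) 1 := (hsub hz).1
      exact mul_pos (mul_pos (hd.sqrt_c_pos z.2)
        (Real.sqrt_pos.2 (one_sub_sq_pos (hd.abs_q_mul_lt' hz1 z.2))))
        (hd.tauK_pos ⟨hz1.1, by have := hz.1.2; linarith⟩ hz.2.1))
  have hRs := hd.Rs_pos
  have hquad : 0 < 1 / (1 + 8 * d.Rs ^ 2) := by positivity
  refine ⟨min (min 1 k) (1 / (1 + 8 * d.Rs ^ 2)), by positivity, max 1 B,
    lt_max_of_lt_left one_pos, fun R hR y hy => ?_⟩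
  rw [heq y R hy.1]
  have hy3 := pow_pos hy.1 3
  have hR2 := sq_nonneg R
  constructor
  · rcases le_total y (1 / 2) with h | h
    · have h1 := (hkb (y, R) ⟨⟨hy.1.le, h⟩, hR⟩).1
      dsimp only at h1
      have h2 : min (min 1 k) (1 / (1 + 8 * d.Rs ^ 2)) ≤ 1 := (min_le_left _ _).trans (min_le_left _ _)
      have h3 : min (min 1 k) (1 / (1 + 8 * d.Rs ^ 2)) ≤ k := (min_le_left _ _).trans (min_le_right _ _)
      rw [mul_add]
      have := mul_le_mul_of_nonneg_right h2 hy3.le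
      have := mul_le_mul_of_nonneg_left (h3.trans h1) hR2
      linarith
    · have h1 : 0 ≤ √(d.c R) * √(1 - (d.q R * y) ^ 2) * d.tauK y R :=
        mul_nonneg (by positivity) (hd.tauK_nonneg ⟨hy.1.le, hy.2⟩ hR.1)
      have h2 := min_le_right (min 1 k) (1 / (1 + 8 * d.Rs ^ 2))
      have h3 : (1 / 2 : ℝ) ^ 3 ≤ y ^ 3 := by gcongr
      have h4 : R ^ 2 ≤ d.Rs ^ 2 := by have := hR.1; have := hR.2; gcongr
      have h5 : y ^ 3 + R ^ 2 ≤ (1 + 8 * d.Rs ^ 2) * y ^ 3 := by nlinarith [sq_nonneg d.Rs]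
      calc min (min 1 k) (1 / (1 + 8 * d.Rs ^ 2)) * (y ^ 3 + R ^ 2)
          ≤ 1 / (1 + 8 * d.Rs ^ 2) * ((1 + 8 * d.Rs ^ 2) * y ^ 3) := by gcongr
        _ = y ^ 3 := by field_simp
        _ ≤ _ := by have := mul_nonneg hR2 h1; linarith
  · have h1 := (le_abs_self _).trans (hB (y, R) ⟨⟨hy.1.le, hy.2⟩, hR⟩)
    dsimp only at h1
    rw [mul_add]
    have h2 := mul_le_mul_of_nonneg_right (le_max_left 1 B) hy3.le
    have h3 := mul_le_mul_of_nonneg_left (h1.trans (le_max_right 1 B)) hR2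
    linarith

/-- Near the centre the maximal development stays well before the collapse time. -/
theorem exists_barrier (hd : d.Admissible) :
    ∃ ε > 0, ε ≤ d.Rs ∧ ∃ k > 0, ∀ τ R, (τ, R) ∈ d.D₂ → 0 < R → (R ≤ ε ∨ R ≤ d.Rs ∧ τ ≤ d.tauS 0) →
      k * (|τ - d.tauS 0| + R ^ 2) ≤ d.y τ R ^ 3 := by
  obtain ⟨a, ha, b, hb, h3⟩ := hd.tauS_sub_tau_bounds
  obtain ⟨a', ha', b', hb', h2⟩ := hd.tauS_bounds
  obtain ⟨_, _, C, hC, hr⟩ := hd.rR_bounds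
  have hRs := hd.Rs_pos
  obtain ⟨wm, hwm, _, _, hw⟩ := exists_pos_bounds (isCompact_Icc (a := 0) (b := d.Rs))
    (F := d.w) (fun R hR => (hd.contDiffAt_w hR.1).continuousAt.continuousWithinAt)
    (fun R hR => hd.w_pos hR.1)
  -- Half of the quadratic lower rate of tauS: on τ = tauS 0 + η R² a time of at least η R² is left
  -- before collapse, which forces y³ ≥ (η/b) R².
  set η := a' / 2 with hη
  have hη0 : 0 < η := by positivity
  set M := C * (b' / a + 1) with hM
  have hM0 : 0 < M := by positivity
  -- Chosen so that M x < 2 η w y on the parabola for x ≤ ε; this is possible because y is at least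
  -- a multiple of x^(2/3) there.
  set ε := min d.Rs ((2 * η * wm) ^ 3 * (η / b) / (2 * M ^ 3)) with hε
  have hε0 : 0 < ε := lt_min hRs (by positivity)
  have hεRs : ε ≤ d.Rs := min_le_left _ _
  have hyb : ∀ τ R, 0 ≤ τ → τ < d.tauS R → R ∈ Icc 0 d.Rs →
      a * d.y τ R ^ 3 ≤ d.tauS R - τ ∧ d.tauS R - τ ≤ b * d.y τ R ^ 3 := by
    intro τ R hτ hτ' hR
    have hm := hd.y_mem hτ hτ'
    have := h3 R hR (d.y τ R) ⟨hm.1.le, hm.2⟩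
    rwa [hd.tau_y hτ hτ'] at this
  -- On the parabola the ray slope r'/w is O(x²/y) = O(x^(4/3)), less than the slope 2 η x of the
  -- parabola.
  have hslope : ∀ x ∈ Ioc 0 ε, ∀ t, 0 ≤ t → t < d.tauS x → t = d.tauS 0 + η * x ^ 2 →
      d.rR (d.y t x) x / d.w x < η * (2 * x) := by
    intro x hx t ht ht' hteq
    have hxR : x ∈ Icc 0 d.Rs := ⟨hx.1.le, hx.2.trans hεRs⟩
    have hym := hd.y_mem ht ht'
    set y := d.y t x
    obtain ⟨hy1, hy2⟩ := hyb t x ht ht' hxR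
    obtain ⟨ht1, ht2⟩ := h2 x hxR
    have hx2 := pow_pos hx.1 2
    have hup : y ^ 3 ≤ b' / a * x ^ 2 := by
      rw [div_mul_eq_mul_div, le_div_iff₀ ha]
      have := mul_pos hη0 hx2
      linarith
    have hlo : η / b * x ^ 2 ≤ y ^ 3 := by
      rw [div_mul_eq_mul_div, div_le_iff₀ hb]
      have e : η * x ^ 2 = a' * x ^ 2 - η * x ^ 2 := by rw [hη]; ring
      linarith
    have hrr : y * d.rR y x ≤ M * x ^ 2 := by
      refine (hr x hxR y hym).2.trans ?_
      rw [hM, mul_assoc]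
      gcongr
      linarith
    have hwx := (hw x hxR).1
    have hwp : 0 < d.w x := hwm.trans_le hwx
    rw [div_lt_iff₀ hwp]
    have hkey : M * x < 2 * η * d.w x * y := by
      refine lt_of_pow_lt_pow_left₀ 3 (by have := hym.1; positivity) ?_
      have hx' : x ≤ (2 * η * wm) ^ 3 * (η / b) / (2 * M ^ 3) := hx.2.trans (min_le_right _ _)
      rw [le_div_iff₀ (by positivity)] at hx'
      calc (M * x) ^ 3 < (x * (2 * M ^ 3)) * x ^ 2 := by
            have : 0 < M ^ 3 * x ^ 3 := by have := hx.1; positivity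
            nlinarith
        _ ≤ (2 * η * wm) ^ 3 * (η / b) * x ^ 2 := by gcongr
        _ = (2 * η * wm) ^ 3 * (η / b * x ^ 2) := by ring
        _ ≤ (2 * η * d.w x) ^ 3 * y ^ 3 := by gcongr
        _ = (2 * η * d.w x * y) ^ 3 := by ring
    have h4 : y * d.rR y x < y * (η * (2 * x) * d.w x) := by
      calc y * d.rR y x ≤ M * x ^ 2 := hrr
        _ = (M * x) * x := by ring
        _ < (2 * η * d.w x * y) * x := by have := hx.1; gcongr
        _ = _ := by ring
    exact lt_of_mul_lt_mul_left h4 hym.1.le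
  -- The past-directed ray from a point of the development starts below the parabola, either on τ =
  -- 0 or before tauS 0, and cannot cross it.
  have hbar : ∀ τ R, (τ, R) ∈ d.D₂ → 0 < R → R ≤ ε → τ ≤ d.tauS 0 + η * R ^ 2 := by
    intro τ R hD hR hRε
    have hτ0 : 0 ≤ τ := hD.2.1
    rcases hτ0.eq_or_lt with h0 | h0
    · rw [← h0]; have := hd.tauS_pos 0; positivity
    have hτs : τ < d.tauS R := hD.2.2.1
    have hfin : ∀ ρ σ, ρ ∈ Ioo 0 R → d.IsRay ρ R σ → σ R = τ → σ ρ < d.tauS 0 →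
        τ ≤ d.tauS 0 + η * R ^ 2 := by
      intro ρ σ hρ hσ hσ1 hlt
      have hBd : ∀ x : ℝ, HasDerivAt (fun x => d.tauS 0 + η * x ^ 2) (η * (2 * x)) x := fun x => by
        simpa using ((hasDerivAt_pow 2 x).const_mul η).const_add (d.tauS 0)
      rw [← hσ1]
      refine image_le_of_deriv_right_lt_deriv_boundary' (B := fun x => d.tauS 0 + η * x ^ 2)
        (f' := fun x => d.rR (d.y (σ x) x) x / d.w x) (a := ρ) (b := R) (IsRay.continuousOn hσ)
        (fun x hx => hasDerivWithinAt_Ici_of_Icc (hσ.null x ⟨hx.1, hx.2.le⟩) hx) ?_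
        (fun x _ => (hBd x).continuousAt.continuousWithinAt) (fun x _ => (hBd x).hasDerivWithinAt)
        ?_ ⟨hρ.2.le, le_rfl⟩
      · have := mul_nonneg hη0.le (sq_nonneg ρ); linarith
      · intro x hx hxe
        have hm := hσ.mem x ⟨hx.1, hx.2.le⟩
        exact hslope x ⟨hρ.1.trans_le hx.1, hx.2.le.trans hRε⟩ (σ x) hm.1 hm.2 hxe
    rcases hd.ray_dichotomy h0 hτs with ⟨ρ, hρ, σ, hσ, hσ1, hz⟩ | ⟨σ, hσ1, hσ⟩
    · exact hfin ρ σ hρ hσ hσ1 (by rw [hz]; exact hd.tauS_pos 0)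
    · obtain ⟨ρ, hρ, hlt⟩ := hd.exists_lt_tauS_zero hR (hD.2.2.2 hR) hσ1 hσ
      exact hfin ρ σ hρ (hσ ρ hρ) hσ1 hlt
  have hk : 0 < min (a' / 4) (1 / 2) := by positivity
  refine ⟨ε, hε0, hεRs, min (a' / 4) (1 / 2) / b, by positivity, fun τ R hD hR hRε => ?_⟩
  have hR' : R ∈ Icc 0 d.Rs := ⟨hR.le, by rcases hRε with h | h; exacts [h.trans hεRs, h.1]⟩
  obtain ⟨-, hy2⟩ := hyb τ R hD.2.1 hD.2.2.1 hR'
  obtain ⟨ht1, -⟩ := h2 R hR'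
  rw [div_mul_eq_mul_div, div_le_iff₀ hb, mul_comm (d.y τ R ^ 3)]
  refine le_trans ?_ hy2
  have hR2 := sq_nonneg R
  have hm1 := min_le_left (a' / 4) (1 / 2 : ℝ)
  have hm2 := min_le_right (a' / 4) (1 / 2 : ℝ)
  rw [mul_add]
  have e1 := mul_le_mul_of_nonneg_right hm1 hR2
  have e2 := mul_le_mul_of_nonneg_right hm2 (abs_nonneg (τ - d.tauS 0))
  -- What remains is that the time left, tauS R - τ, is at least a multiple of |τ - tauS 0| + R².
  -- Before tauS 0 this is immediate from `tauS_bounds`; after it the parabola is needed.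
  rcases le_total τ (d.tauS 0) with h | h
  · rw [abs_of_nonpos (by linarith)] at *
    nlinarith
  · have hle : τ ≤ d.tauS 0 + η * R ^ 2 := by
      rcases hRε with h' | h'
      · exact hbar τ R hD hR h'
      · have := mul_nonneg hη0.le hR2; linarith [h'.2]
    rw [abs_of_nonneg (by linarith)] at *
    have e3 : a' * R ^ 2 = 2 * (η * R ^ 2) := by rw [hη]; ring
    have e4 : a' / 4 * R ^ 2 = η * R ^ 2 / 2 := by rw [hη]; ring
    linarith

end Admissible

end DustData

/-! ### Distance from the apparent horizon and growth rate of the energy -/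

namespace DustData

variable {d : DustData}

namespace Admissible

/-- A ray from the singularity which is untrapped at the surface is untrapped inside the cloud. -/
theorem untrapped_along_ray (hd : d.Admissible) {σ : ℝ → ℝ} (hσ : d.IsSingularRay d.Rs σ)
    (hr : 2 * d.m d.Rs < d.Rs * d.y (σ d.Rs) d.Rs ^ 2) {R : ℝ} (hR : R ∈ Ioc 0 d.Rs) :
    R ^ 2 * d.c R < d.y (σ R) R ^ 2 := by
  by_contra hcon
  push Not at hcon
  have hY := hd.y_of_isRay (hd.isRay_of_singularRay hσ hR.1)
  set Y : ℝ → ℝ := fun x => d.y (σ x) x with hYdef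
  have hpos : ∀ x ∈ Icc R d.Rs, 0 < x := fun x hx => hR.1.trans_le hx.1
  have hZ : ∀ x ∈ Icc R d.Rs, HasDerivWithinAt (fun x => x * Y x ^ 2 - 2 * d.m x)
      (d.rR (Y x) x * (1 - d.infall (Y x) x / d.w x) - 2 * (4 * Real.pi * (d.ρ₀ x * x ^ 2)))
      (Icc R d.Rs) x := by
    intro x hx
    have h1 := (hasDerivWithinAt_id x (Icc R d.Rs)).mul ((hY x hx).2.pow 2)
    have h2 := ((hd.hasDerivAt_m x).const_mul 2).hasDerivWithinAt (s := Icc R d.Rs)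
    refine (h1.sub h2).congr_deriv ?_
    rw [← sq_add_rayY d (hY x hx).1.1.ne']
    simp only [id, Pi.pow_apply, Nat.cast_ofNat, Nat.add_one_sub_one, pow_one, hYdef]
    ring
  have h0 : R * Y R ^ 2 - 2 * d.m R ≤ 0 := by
    rw [d.m_eq]
    have := mul_le_mul_of_nonneg_left hcon hR.1.le
    simp only [hYdef]
    linarith
  have hle := le_of_deriv_neg_at_level hZ h0 (fun x hx hx0 => ?_) d.Rs ⟨hR.2, le_rfl⟩
  · simp only [hYdef] at hle
    linarith
  -- At a zero of r - 2m the ray has dr/dR ≤ 0, while 2m strictly increases because ρ₀ > 0 inside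
  -- the cloud. Hence r - 2m cannot recover by the time the ray reaches the surface.
  · have hx' : x ∈ Icc R d.Rs := ⟨hx.1, hx.2.le⟩
    have hxp := hpos x hx'
    have hy := (hY x hx').1
    have hle : d.w x ≤ d.infall (Y x) x := by
      rw [← not_lt, hd.infall_lt_w_iff hy hxp, not_lt]
      rw [d.m_eq] at hx0
      have : x * Y x ^ 2 = x * (x ^ 2 * d.c x) := by linarith
      exact (mul_left_cancel₀ hxp.ne' this).le
    have hw := hd.w_pos hxp.le
    have h4 : 1 - d.infall (Y x) x / d.w x ≤ 0 := by
      rw [sub_nonpos, le_div_iff₀ hw]; linarith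
    have h5 := mul_nonpos_of_nonneg_of_nonpos (hd.rR_pos hy hxp.le).le h4
    have h6 := hd.density_pos x hxp.le hx.2
    have h7 : 0 < 2 * (4 * Real.pi * (d.ρ₀ x * x ^ 2)) := by positivity
    linarith

/-- The maximal development stays uniformly away from the apparent horizon. -/
theorem uniformly_untrapped (hd : d.Admissible) (hn : d.GloballyNaked) :
    ∃ δ > 0, δ ≤ 1 ∧ ∀ τ R, (τ, R) ∈ d.D₂ → 0 < R → R ^ 2 * d.c R ≤ (1 - δ) * d.y τ R ^ 2 := by
  obtain ⟨ε, hε, hεRs, k, hk, hbar⟩ := hd.exists_barrier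
  have hRs := hd.Rs_pos
  obtain ⟨_, _, A, hA, hcA⟩ := exists_pos_bounds (isCompact_Icc (a := 0) (b := d.Rs)) (F := d.c)
    hd.contDiff_c.continuous.continuousOn (fun R _ => hd.c_pos R)
  -- near the centre
  obtain ⟨ε', hε', hε'1, hε'2⟩ : ∃ ε' > 0, ε' ≤ ε ∧ (2 * A) ^ 3 * ε' ^ 2 ≤ k ^ 2 := by
    refine ⟨min ε (√(k ^ 2 / (2 * A) ^ 3)), lt_min hε (by positivity), min_le_left _ _, ?_⟩
    have h1 : min ε (√(k ^ 2 / (2 * A) ^ 3)) ^ 2 ≤ √(k ^ 2 / (2 * A) ^ 3) ^ 2 := by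
      have := min_le_right ε (√(k ^ 2 / (2 * A) ^ 3))
      have h0 : 0 ≤ min ε (√(k ^ 2 / (2 * A) ^ 3)) := by positivity
      gcongr
    rw [Real.sq_sqrt (by positivity), le_div_iff₀ (by positivity)] at h1
    linarith
  have hnear : ∀ τ R, (τ, R) ∈ d.D₂ → 0 < R → R ≤ ε' → R ^ 2 * d.c R ≤ (1 - 1 / 2) * d.y τ R ^ 2 := by
    intro τ R hD hR hRε
    have h1 := hbar τ R hD hR (Or.inl (hRε.trans hε'1))
    set y := d.y τ R
    -- From y³ ≥ k R² it follows that y² is at least of order R^(4/3), which dominates R² c for R ≤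
    -- ε'.
    have h2 : k * R ^ 2 ≤ y ^ 3 := le_trans (by
      have := abs_nonneg (τ - d.tauS 0)
      have := mul_nonneg hk.le this
      nlinarith) h1
    have hc := (hcA R ⟨hR.le, hRε.trans (hε'1.trans hεRs)⟩).2
    have hcp := hd.c_pos R
    have h3 : 2 * A * R ^ 2 ≤ y ^ 2 := by
      refine le_of_pow_le_pow_left₀ three_ne_zero (sq_nonneg y) ?_
      calc (2 * A * R ^ 2) ^ 3 = (2 * A) ^ 3 * R ^ 2 * R ^ 4 := by ring
        _ ≤ (2 * A) ^ 3 * ε' ^ 2 * R ^ 4 := by gcongr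
        _ ≤ k ^ 2 * R ^ 4 := by gcongr
        _ = (k * R ^ 2) ^ 2 := by ring
        _ ≤ (y ^ 3) ^ 2 := by gcongr
        _ = (y ^ 2) ^ 3 := by ring
    have : R ^ 2 * d.c R ≤ R ^ 2 * A := by gcongr
    linarith
  -- inside the cloud
  obtain ⟨σ, hσ, hr⟩ := hd.exists_untrapped_singularRay hn
  have hY := hd.y_of_isRay (hd.isRay_of_singularRay hσ hε')
  obtain ⟨δ₁, hδ₁, _, _, hin⟩ := exists_pos_bounds (isCompact_Icc (a := ε') (b := d.Rs))
    (F := fun R => 1 - R ^ 2 * d.c R / d.y (σ R) R ^ 2) (by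
      intro R hR
      have hy := hY R hR
      have hc := hd.contDiff_c.continuous
      exact continuousWithinAt_const.sub (ContinuousWithinAt.div
        (Continuous.continuousWithinAt (by fun_prop)) (hy.2.continuousWithinAt.pow 2)
        (pow_pos hy.1.1 2).ne'))
    (fun R hR => by
      have hy := (hY R hR).1
      rw [sub_pos, div_lt_one (pow_pos hy.1 2)]
      exact hd.untrapped_along_ray hσ hr ⟨hε'.trans_le hR.1, hR.2⟩)
  have hmid : ∀ τ R, (τ, R) ∈ d.D₂ → ε' ≤ R → R ≤ d.Rs → R ^ 2 * d.c R ≤ (1 - δ₁) * d.y τ R ^ 2 := by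
    intro τ R hD hR hR'
    have hRp := hε'.trans_le hR
    have h1 := (hin R ⟨hR, hR'⟩).1
    have hy := (hY R ⟨hR, hR'⟩).1
    have hm := hσ.mem R ⟨hRp, hR'⟩
    -- The development lies before this untrapped singular ray, and at fixed R an earlier time means
    -- a larger y. The bound on the ray is thus inherited by the whole development.
    have hτ : τ ≤ σ R := (hD.2.2.2 hRp).le.trans (tauCH_le d hRp (singularRay_mono hσ hR'))
    have hle : d.y (σ R) R ≤ d.y τ R := (hd.y_le_y_iff hm.1 hm.2 hD.2.1 hD.2.2.1).2 hτ
    have h2 : R ^ 2 * d.c R / d.y (σ R) R ^ 2 ≤ 1 - δ₁ := by linarith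
    rw [div_le_iff₀ (pow_pos hy.1 2)] at h2
    have hcp := hd.c_pos R
    have h3 : 0 ≤ 1 - δ₁ := by
      by_contra hneg
      push Not at hneg
      have : 0 < R ^ 2 * d.c R := by positivity
      nlinarith [pow_pos hy.1 2]
    refine h2.trans ?_
    have := hy.1
    gcongr
  -- outside the cloud
  obtain ⟨l, hl, hout⟩ := hd.exists_extended_singularRay hn
  have hM0 : 0 ≤ d.m d.Rs := by rw [d.m_eq]; have := hd.c_pos d.Rs; positivity
  have hl0 : 0 < l := by linarith
  have hfar : ∀ τ R, (τ, R) ∈ d.D₂ → d.Rs ≤ R →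
      R ^ 2 * d.c R ≤ (1 - (1 - 2 * d.m d.Rs / l)) * d.y τ R ^ 2 := by
    intro τ R hD hR
    have hRp := hRs.trans_le hR
    obtain ⟨σ', hσ', hr'⟩ := hout R hR
    have hm := hσ'.mem R ⟨hRp, le_rfl⟩
    have hτ : τ ≤ σ' R := (hD.2.2.2 hRp).le.trans (tauCH_le d hRp hσ')
    have hle : d.y (σ' R) R ≤ d.y τ R := (hd.y_le_y_iff hm.1 hm.2 hD.2.1 hD.2.2.1).2 hτ
    have hy := (hd.y_mem hm.1 hm.2).1
    have h3 : l ≤ R * d.y τ R ^ 2 := hr'.trans (by gcongr)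
    rw [sq_c_eq d hRp, hd.mass_const hR, sub_sub_cancel, div_mul_eq_mul_div,
      div_le_div_iff₀ hRp hl0]
    calc 2 * d.m d.Rs * l ≤ 2 * d.m d.Rs * (R * d.y τ R ^ 2) := by gcongr
      _ = _ := by ring
  have hδ₂ : 0 < 1 - 2 * d.m d.Rs / l := by rw [sub_pos, div_lt_one hl0]; exact hl
  refine ⟨min (1 / 2) (min δ₁ (1 - 2 * d.m d.Rs / l)), by positivity,
    (min_le_left _ _).trans (by norm_num), fun τ R hD hR => ?_⟩
  have key : ∀ δ', R ^ 2 * d.c R ≤ (1 - δ') * d.y τ R ^ 2 → min (1 / 2) (min δ₁ (1 - 2 * d.m d.Rs / l)) ≤ δ' →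
      R ^ 2 * d.c R ≤ (1 - min (1 / 2) (min δ₁ (1 - 2 * d.m d.Rs / l))) * d.y τ R ^ 2 := by
    intro δ' h1 h2
    have := sq_nonneg (d.y τ R)
    nlinarith
  rcases le_total R ε' with h | h
  · exact key _ (hnear τ R hD hR h) (min_le_left _ _)
  rcases le_total R d.Rs with h' | h'
  · exact key _ (hmid τ R hD h h') ((min_le_right _ _).trans (min_le_left _ _))
  · exact key _ (hfar τ R hD h') ((min_le_right _ _).trans (min_le_right _ _))

/-- The mass aspect `m'/(r r')`, which governs the growth of the energy. -/
def kap (d : DustData) (τ R : ℝ) : ℝ :=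
  4 * Real.pi * (d.ρ₀ R * R ^ 2) / (R * d.y τ R ^ 2 * d.rR (d.y τ R) R)

/-- A scaling estimate: since r' ≥ a y², `kap` is at most a constant times R / y⁴. Near the centre
`exists_barrier` bounds this by X^(1/2 - 4/3) with X = |τ - tauS 0| + R². Away from it untrappedness
keeps y bounded below, so `kap` itself is bounded. -/
theorem kap_bound (hd : d.Admissible) (hn : d.GloballyNaked) :
    ∃ C > 0, ∀ τ R, (τ, R) ∈ d.D₂ → 0 < R → R ≤ d.Rs →
      kap d τ R * (|τ - d.tauS 0| ^ (1 / 6 : ℝ)) ^ 5 ≤ C := by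
  obtain ⟨ε, hε, hεRs, k, hk, hbar⟩ := hd.exists_barrier
  obtain ⟨a, ha, _, _, hr⟩ := hd.rR_bounds
  obtain ⟨δ, hδ, hδ1, hunt⟩ := hd.uniformly_untrapped hn
  have hRs := hd.Rs_pos
  obtain ⟨P, hP⟩ := (isCompact_Icc (a := 0) (b := d.Rs)).exists_bound_of_continuousOn (f := d.ρ₀)
    hd.smooth_ρ₀.continuous.continuousOn
  have hP0 : 0 ≤ P := (norm_nonneg _).trans (hP 0 ⟨le_rfl, hRs.le⟩)
  obtain ⟨cm, hcm, _, _, hcb⟩ := exists_pos_bounds (isCompact_Icc (a := 0) (b := d.Rs)) (F := d.c)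
    hd.contDiff_c.continuous.continuousOn (fun R _ => hd.c_pos R)
  have hkap : ∀ τ R, (τ, R) ∈ d.D₂ → 0 < R → R ≤ d.Rs →
      kap d τ R * (a * d.y τ R ^ 4) ≤ 4 * Real.pi * P * R := by
    intro τ R hD hR hR'
    have hy := hd.y_mem hD.2.1 hD.2.2.1
    dsimp only at hy
    unfold kap
    set y := d.y τ R
    have h1 := (hr R ⟨hR.le, hR'⟩ y hy).1
    have h2 := (le_abs_self _).trans (hP R ⟨hR.le, hR'⟩)
    have hrp := hd.rR_pos hy hR.le
    have h3 : a * y ^ 3 ≤ y * d.rR y R := le_trans (by nlinarith [sq_nonneg R]) h1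
    have hy0 := hy.1
    rw [div_mul_eq_mul_div, div_le_iff₀ (by positivity)]
    calc 4 * Real.pi * (d.ρ₀ R * R ^ 2) * (a * y ^ 4)
        ≤ 4 * Real.pi * (P * R ^ 2) * (a * y ^ 4) := by gcongr
      _ = 4 * Real.pi * P * R ^ 2 * y * (a * y ^ 3) := by ring
      _ ≤ 4 * Real.pi * P * R ^ 2 * y * (y * d.rR y R) := by gcongr
      _ = _ := by ring
  have hkap0 : ∀ τ R, (τ, R) ∈ d.D₂ → 0 < R → R ≤ d.Rs → 0 ≤ kap d τ R := by
    intro τ R hD hR hR'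
    have hy := hd.y_mem hD.2.1 hD.2.2.1
    dsimp only at hy
    have hrp := hd.rR_pos hy hR.le
    have hρ : 0 ≤ d.ρ₀ R := by
      rcases hR'.eq_or_lt with h | h
      · rw [hd.density_zero R h.ge]
      · exact (hd.density_pos R hR.le h).le
    have := hy.1
    unfold kap
    positivity
  set T := (d.tauS d.Rs) ^ (1 / 6 : ℝ) with hT
  set k' := k ^ (1 / 3 : ℝ) with hk'
  have hk'0 : 0 < k' := Real.rpow_pos_of_pos hk _
  have hk'3 : k' ^ 3 = k := by
    rw [hk', ← Real.rpow_natCast, ← Real.rpow_mul hk.le]; norm_num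
  have hT0 : 0 < T := Real.rpow_pos_of_pos (hd.tauS_pos _) _
  set C₁ := 4 * Real.pi * P / (a * k' ^ 4)
  set C₂ := 4 * Real.pi * P * d.Rs / (a * (ε ^ 2 * cm) ^ 2) * T ^ 5
  refine ⟨C₁ + C₂ + 1, by positivity, fun τ R hD hR hR' => ?_⟩
  have hC₁ : 0 ≤ C₁ := by positivity
  have hC₂ : 0 ≤ C₂ := by positivity
  have hy := hd.y_mem hD.2.1 hD.2.2.1
  dsimp only at hy
  have h1 := hkap τ R hD hR hR'
  have h0 := hkap0 τ R hD hR hR'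
  set θ := |τ - d.tauS 0| ^ (1 / 6 : ℝ) with hθ
  have hθ0 : 0 ≤ θ := Real.rpow_nonneg (abs_nonneg _) _
  have hy0 := hy.1
  rcases le_total R ε with h | h
  · have hb := hbar τ R hD hR (Or.inl h)
    set X := |τ - d.tauS 0| + R ^ 2 with hX
    have hX0 : 0 < X := by positivity
    -- The sixth root makes all powers integral: R ≤ x³, y ≥ k' x² and θ ≤ x, so that R / y⁴ becomes
    -- x^(-5).
    set x := X ^ (1 / 6 : ℝ) with hx
    have hx0 : 0 < x := Real.rpow_pos_of_pos hX0 _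
    have hx6 : x ^ 6 = X := by
      rw [hx, ← Real.rpow_natCast, ← Real.rpow_mul hX0.le]; norm_num
    have hθx : θ ≤ x := Real.rpow_le_rpow (abs_nonneg _) (by rw [hX]; nlinarith [sq_nonneg R]) (by norm_num)
    have hRx : R ≤ x ^ 3 := by
      refine le_of_pow_le_pow_left₀ two_ne_zero (by positivity) ?_
      rw [← pow_mul]; norm_num; rw [hx6, hX]; linarith [abs_nonneg (τ - d.tauS 0)]
    have hyx : k' * x ^ 2 ≤ d.y τ R := by
      refine le_of_pow_le_pow_left₀ three_ne_zero hy0.le ?_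
      rw [mul_pow, hk'3, ← pow_mul]; norm_num; rw [hx6]; exact hb
    have h2 : kap d τ R * (a * (k' * x ^ 2) ^ 4) ≤ 4 * Real.pi * P * x ^ 3 :=
      calc kap d τ R * (a * (k' * x ^ 2) ^ 4) ≤ kap d τ R * (a * d.y τ R ^ 4) := by gcongr
        _ ≤ 4 * Real.pi * P * R := h1
        _ ≤ 4 * Real.pi * P * x ^ 3 := by gcongr
    have h3 : kap d τ R * x ^ 5 ≤ C₁ := by
      rw [le_div_iff₀ (by positivity)]
      have : kap d τ R * x ^ 5 * (a * k' ^ 4) * x ^ 3 ≤ 4 * Real.pi * P * x ^ 3 := by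
        calc _ = kap d τ R * (a * (k' * x ^ 2) ^ 4) := by ring
          _ ≤ _ := h2
      exact le_of_mul_le_mul_right this (by positivity)
    calc kap d τ R * θ ^ 5 ≤ kap d τ R * x ^ 5 := by gcongr
      _ ≤ C₁ := h3
      _ ≤ C₁ + C₂ + 1 := by linarith
  · have hu := hunt τ R hD hR
    -- For R ≥ ε, untrappedness y² ≥ R² c is itself a positive lower bound on y.
    have hy2 : ε ^ 2 * cm ≤ d.y τ R ^ 2 := by
      have hc := (hcb R ⟨hR.le, hR'⟩).1
      calc ε ^ 2 * cm ≤ R ^ 2 * d.c R := by gcongr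
        _ ≤ (1 - δ) * d.y τ R ^ 2 := hu
        _ ≤ d.y τ R ^ 2 := by nlinarith [sq_nonneg (d.y τ R)]
    have hθT : θ ≤ T := by
      refine Real.rpow_le_rpow (abs_nonneg _) ?_ (by norm_num)
      have e1 : 0 ≤ τ := hD.2.1
      have e2 : τ < d.tauS R := hD.2.2.1
      have e3 := hd.strictMonoOn_tauS.monotoneOn hR.le hRs.le hR'
      have e4 := hd.strictMonoOn_tauS.monotoneOn (self_mem_Ici (a := (0 : ℝ))) hRs.le hRs.le
      have e5 := hd.tauS_pos 0
      rw [abs_le]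
      constructor <;> linarith
    have h2 : kap d τ R ≤ 4 * Real.pi * P * d.Rs / (a * (ε ^ 2 * cm) ^ 2) := by
      rw [le_div_iff₀ (by positivity)]
      calc kap d τ R * (a * (ε ^ 2 * cm) ^ 2) ≤ kap d τ R * (a * (d.y τ R ^ 2) ^ 2) := by gcongr
        _ = kap d τ R * (a * d.y τ R ^ 4) := by ring
        _ ≤ 4 * Real.pi * P * R := h1
        _ ≤ 4 * Real.pi * P * d.Rs := by gcongr
    calc kap d τ R * θ ^ 5 ≤ 4 * Real.pi * P * d.Rs / (a * (ε ^ 2 * cm) ^ 2) * T ^ 5 := by gcongr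
      _ ≤ C₁ + C₂ + 1 := by show C₂ ≤ _; linarith

end Admissible

end DustData

/-! ### First and second derivatives of the areal radius -/

/-- Continuous linear functionals on the plane are determined by their values on the basis. -/
theorem clm_prod_eq (L : ℝ × ℝ →L[ℝ] ℝ) :
    L = L (1, 0) • ContinuousLinearMap.fst ℝ ℝ ℝ + L (0, 1) • ContinuousLinearMap.snd ℝ ℝ ℝ := by
  ext <;> simp

theorem hasDerivAt_slice_fst {F : ℝ × ℝ → ℝ} {z : ℝ × ℝ} (h : DifferentiableAt ℝ F z) :
    HasDerivAt (fun t => F (t, z.2)) (fderiv ℝ F z (1, 0)) z.1 :=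
  h.hasFDerivAt.comp_hasDerivAt (f := fun t : ℝ => (t, z.2)) z.1
    ((hasDerivAt_id' z.1).prodMk (hasDerivAt_const z.1 z.2))

theorem hasDerivAt_slice_snd {F : ℝ × ℝ → ℝ} {z : ℝ × ℝ} (h : DifferentiableAt ℝ F z) :
    HasDerivAt (fun x => F (z.1, x)) (fderiv ℝ F z (0, 1)) z.2 :=
  h.hasFDerivAt.comp_hasDerivAt (f := fun x : ℝ => (z.1, x)) z.2
    ((hasDerivAt_const z.2 z.1).prodMk (hasDerivAt_id' z.2))

theorem symmetric_mixed_deriv {F A B : ℝ × ℝ → ℝ} {z : ℝ × ℝ}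
    (h : ∀ᶠ x in 𝓝 z, HasFDerivAt F
      (A x • ContinuousLinearMap.fst ℝ ℝ ℝ + B x • ContinuousLinearMap.snd ℝ ℝ ℝ) x)
    (hA : DifferentiableAt ℝ A z) (hB : DifferentiableAt ℝ B z) :
    fderiv ℝ A z (0, 1) = fderiv ℝ B z (1, 0) := by
  have h2 := (hA.hasFDerivAt.smul_const (ContinuousLinearMap.fst ℝ ℝ ℝ)).add
    (hB.hasFDerivAt.smul_const (ContinuousLinearMap.snd ℝ ℝ ℝ))
  have := second_derivative_symmetric_of_eventually h h2 ((0 : ℝ), (1 : ℝ)) ((1 : ℝ), (0 : ℝ))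
  simpa using this

namespace DustData

variable {d : DustData}

/-- The areal radius, smoothly extended. -/
def rr (d : DustData) (z : ℝ × ℝ) : ℝ := z.2 * d.yE z.1 z.2 ^ 2

/-- The radial derivative of the areal radius, smoothly extended. -/
def rp (d : DustData) (z : ℝ × ℝ) : ℝ := d.rR (d.yE z.1 z.2) z.2

/-- The infall speed, smoothly extended. -/
def sf (d : DustData) (z : ℝ × ℝ) : ℝ := d.infall (d.yE z.1 z.2) z.2

namespace Admissible

theorem contDiffAt_yE (hd : d.Admissible) {z : ℝ × ℝ} (h : z ∈ d.tDom) :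
    ContDiffAt ℝ ∞ (fun z : ℝ × ℝ => d.yE z.1 z.2) z :=
  (hd.contDiffOn_yE).contDiffAt (hd.isOpen_tDom.mem_nhds h)

theorem contDiffAt_rr (hd : d.Admissible) {z : ℝ × ℝ} (h : z ∈ d.tDom) : ContDiffAt ℝ ∞ d.rr z :=
  contDiffAt_snd.mul ((hd.contDiffAt_yE h).pow 2)

theorem contDiffAt_rp (hd : d.Admissible) {z : ℝ × ℝ} (h : z ∈ d.tDom) : ContDiffAt ℝ ∞ d.rp z :=
  ContDiffAt.comp (g := fun z : ℝ × ℝ => d.rR z.1 z.2) (f := fun z : ℝ × ℝ => (d.yE z.1 z.2, z.2)) z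
    (hd.contDiffAt_rR (hd.yE_spec h).1) ((hd.contDiffAt_yE h).prodMk contDiffAt_snd)

theorem contDiffAt_sf (hd : d.Admissible) {z : ℝ × ℝ} (h : z ∈ d.tDom) : ContDiffAt ℝ ∞ d.sf z :=
  ContDiffAt.comp (g := fun z : ℝ × ℝ => d.infall z.1 z.2)
    (f := fun z : ℝ × ℝ => (d.yE z.1 z.2, z.2)) z
    (hd.contDiffAt_infall (hd.yE_spec h).1) ((hd.contDiffAt_yE h).prodMk contDiffAt_snd)

theorem contDiffAt_wf (hd : d.Admissible) {z : ℝ × ℝ} (h : 0 ≤ z.2) :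
    ContDiffAt ℝ ∞ (fun z : ℝ × ℝ => d.w z.2) z := hd.contDiffAt_w_snd h

theorem hasFDerivAt_rr (hd : d.Admissible) {z : ℝ × ℝ} (h : z ∈ d.tDom) :
    HasFDerivAt d.rr ((-d.sf z) • ContinuousLinearMap.fst ℝ ℝ ℝ
      + d.rp z • ContinuousLinearMap.snd ℝ ℝ ℝ) z := by
  have hy : d.yE z.1 z.2 ≠ 0 := (hd.yE_spec h).1.1.ne'
  refine (hasFDerivAt_snd.mul ((hd.hasFDerivAt_yE h).pow 2)).congr_fderiv ?_
  ext
  · simp [sf, infall, ySpeed]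
    field_simp
  · simp [rp, rR]
    ring

theorem rp_time (hd : d.Admissible) {z : ℝ × ℝ} (h : z ∈ d.tDom) :
    fderiv ℝ d.rp z (1, 0) = -fderiv ℝ d.sf z (0, 1) := by
  have hs := (hd.contDiffAt_sf h).differentiableAt (by simp)
  rw [← symmetric_mixed_deriv (F := d.rr) (A := fun z => -d.sf z) (B := d.rp) ?_ hs.neg
    ((hd.contDiffAt_rp h).differentiableAt (by simp))]
  · rw [fderiv_fun_neg]; rfl
  · filter_upwards [hd.isOpen_tDom.mem_nhds h] with x hx using hd.hasFDerivAt_rr hx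

theorem rr_pos (hd : d.Admissible) {z : ℝ × ℝ} (h : z ∈ d.tDom) (hR : 0 < z.2) : 0 < d.rr z :=
  mul_pos hR (pow_pos (hd.yE_spec h).1.1 2)

theorem sf_pos (hd : d.Admissible) {z : ℝ × ℝ} (h : z ∈ d.tDom) (hR : 0 < z.2) : 0 < d.sf z :=
  hd.infall_pos (hd.yE_spec h).1 hR

/-- The conserved energy of a shell; its derivatives in τ and R give the derivatives of the infall
speed. -/
theorem sf_sq (hd : d.Admissible) {z : ℝ × ℝ} (h : z ∈ d.tDom) (hR : 0 < z.2) :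
    d.sf z ^ 2 = d.w z.2 ^ 2 - 1 + 2 * d.m z.2 / d.rr z := by
  have h1 := hd.infall_sq (hd.yE_spec h).1 hR.le
  have hy : d.yE z.1 z.2 ≠ 0 := (hd.yE_spec h).1.1.ne'
  rw [sf, h1, sq_c_eq d hR, rr]
  field_simp

theorem hasDerivAt_w (hd : d.Admissible) {R : ℝ} (hR : 0 ≤ R) : HasDerivAt d.w (deriv d.w R) R :=
  ((hd.contDiffAt_w hR).differentiableAt (by simp)).hasDerivAt

/-- The energy equation is differentiated at fixed R and divided by s > 0, using ∂_τ r = -s. This is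
the Newtonian law -∂²r/∂τ² = m/r². -/
theorem sf_time (hd : d.Admissible) {z : ℝ × ℝ} (h : z ∈ d.tDom) (hR : 0 < z.2) :
    fderiv ℝ d.sf z (1, 0) = d.m z.2 / d.rr z ^ 2 := by
  have hs := hasDerivAt_slice_fst ((hd.contDiffAt_sf h).differentiableAt (by simp))
  have hr0 := hd.rr_pos h hR
  have hs0 := hd.sf_pos h hR
  have hr := hasDerivAt_slice_fst (hd.hasFDerivAt_rr h).differentiableAt
  rw [(hd.hasFDerivAt_rr h).fderiv] at hr
  have h1 := hs.pow 2
  have h2 : HasDerivAt (fun t => d.sf (t, z.2) ^ 2) _ z.1 :=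
    (((hasDerivAt_const z.1 (2 * d.m z.2)).div hr hr0.ne').const_add
      (d.w z.2 ^ 2 - 1)).congr_of_eventuallyEq (by
    have hc : Continuous fun t : ℝ => (t, z.2) := by fun_prop
    filter_upwards [hc.continuousAt.preimage_mem_nhds (hd.isOpen_tDom.mem_nhds h)] with t ht
    exact hd.sf_sq ht hR)
  have h3 := h1.unique h2
  have hz : (z.1, z.2) = z := rfl
  simp only [hz] at h3
  simp at h3
  have h4 : d.sf z * (fderiv ℝ d.sf z (1, 0)) = d.sf z * (d.m z.2 / d.rr z ^ 2) := by
    field_simp at h3 ⊢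
    linarith
  exact mul_left_cancel₀ hs0.ne' h4

theorem sf_radius (hd : d.Admissible) {z : ℝ × ℝ} (h : z ∈ d.tDom) (hR : 0 < z.2) :
    d.sf z * fderiv ℝ d.sf z (0, 1) = d.w z.2 * deriv d.w z.2
      + 4 * Real.pi * (d.ρ₀ z.2 * z.2 ^ 2) / d.rr z - d.m z.2 * d.rp z / d.rr z ^ 2 := by
  have hs := hasDerivAt_slice_snd ((hd.contDiffAt_sf h).differentiableAt (by simp))
  have hr0 := hd.rr_pos h hR
  have hs0 := hd.sf_pos h hR
  have hr := hasDerivAt_slice_snd (hd.hasFDerivAt_rr h).differentiableAt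
  rw [(hd.hasFDerivAt_rr h).fderiv] at hr
  have h1 := hs.pow 2
  have h2 : HasDerivAt (fun x => d.sf (z.1, x) ^ 2) _ z.2 :=
    ((((hd.hasDerivAt_w hR.le).pow 2).sub_const 1).add
      (((hd.hasDerivAt_m z.2).const_mul 2).div hr hr0.ne')).congr_of_eventuallyEq (by
    have hc : Continuous fun t : ℝ => (z.1, t) := by fun_prop
    filter_upwards [hc.continuousAt.preimage_mem_nhds (hd.isOpen_tDom.mem_nhds h),
      lt_mem_nhds hR] with t ht ht0
    exact hd.sf_sq ht ht0)
  have h3 := h1.unique h2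
  have hz : (z.1, z.2) = z := rfl
  simp only [hz] at h3
  simp at h3
  field_simp at h3 ⊢
  linarith

end Admissible

end DustData

/-! ### The Kodama energy density and flux as quadratic forms -/

/-- Energy density of a mode, as a quadratic form in the field and its derivatives. -/
def eForm (r r' s w l u ut uR : ℝ) : ℝ :=
  r ^ 2 * r' * ut ^ 2 / 2 + r ^ 2 * (w ^ 2 / r') * uR ^ 2 / 2 + l * r' * u ^ 2 / 2
    + s * r ^ 2 * (ut * uR)

/-- Energy flux of a mode, as a quadratic form in the field and its derivatives. -/
def jForm (r r' s w l u ut uR : ℝ) : ℝ :=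
  r ^ 2 * (w ^ 2 / r') * (ut * uR) + s * r ^ 2 * (ut ^ 2 + w ^ 2 / r' ^ 2 * uR ^ 2) / 2
    - s * l * u ^ 2 / 2

section Forms

variable {r r' s w l u ut uR : ℝ}

/-- What crosses an outgoing ray dR/dτ = w/r': only the derivative along the ray and u itself enter,
with coefficients nonnegative for 0 ≤ s ≤ w and l ≥ 0. This gives the sign at the inner boundary. -/
theorem flux_plus_identity (hr' : r' ≠ 0) :
    w / r' * eForm r r' s w l u ut uR + jForm r r' s w l u ut uR =
      r ^ 2 * (w + s) / 2 * (ut + w / r' * uR) ^ 2 + l * (w - s) * u ^ 2 / 2 := by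
  unfold eForm jForm; field_simp; ring

theorem flux_minus_identity (hr' : r' ≠ 0) :
    w / r' * eForm r r' s w l u ut uR - jForm r r' s w l u ut uR =
      r ^ 2 * (w - s) / 2 * (ut - w / r' * uR) ^ 2 + l * (w + s) * u ^ 2 / 2 := by
  unfold eForm jForm; field_simp; ring

/-- Displays the energy as a sum of squares; the coercivity in the derivatives is the factor w - s,
positive exactly in the untrapped region. -/
theorem energy_identity_form (hr' : r' ≠ 0) :
    w / r' * eForm r r' s w l u ut uR =
      r ^ 2 * (w - s) / 2 * (ut ^ 2 + (w / r' * uR) ^ 2) + r ^ 2 * s / 2 * (ut + w / r' * uR) ^ 2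
        + l * w * u ^ 2 / 2 := by
  unfold eForm; field_simp; ring

theorem neg_flux_le (hr' : 0 < r') (hs : 0 ≤ s) (hsw : s ≤ w) (hl : 0 ≤ l) :
    0 ≤ w / r' * eForm r r' s w l u ut uR + jForm r r' s w l u ut uR := by
  rw [flux_plus_identity hr'.ne']
  have := sub_nonneg.2 hsw
  have : 0 ≤ w := hs.trans hsw
  positivity

theorem energy_lower_bound (hr' : 0 < r') (hw : 0 < w) (hs : 0 ≤ s) (hl : 0 ≤ l) :
    r ^ 2 * (w - s) / 2 * (ut ^ 2 + (w / r' * uR) ^ 2) ≤ w / r' * eForm r r' s w l u ut uR := by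
  rw [energy_identity_form hr'.ne']
  have : 0 ≤ r ^ 2 * s / 2 * (ut + w / r' * uR) ^ 2 + l * w * u ^ 2 / 2 := by positivity
  linarith

theorem energy_nonneg (hr' : 0 < r') (hw : 0 < w) (hs : 0 ≤ s) (hsw : s ≤ w) (hl : 0 ≤ l) :
    0 ≤ eForm r r' s w l u ut uR := by
  have h := energy_lower_bound (r := r) (u := u) (ut := ut) (uR := uR) hr' hw hs hl
  have h1 := sub_nonneg.2 hsw
  have h2 : 0 ≤ w / r' * eForm r r' s w l u ut uR := le_trans (by positivity) h
  exact nonneg_of_mul_nonneg_right h2 (by positivity)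

/-- The flux through a spacelike curve of speed `V ≥ w / r'` controls the derivative along it. -/
theorem sq_deriv_le_flux {V : ℝ} (hr : 0 < r) (hr' : 0 < r') (hw : 0 < w) (hs : 0 ≤ s) (hsw : s < w)
    (hl : 0 ≤ l) (hV : w / r' ≤ V) :
    (ut - V * uR) ^ 2 * (r ^ 2 * (w * (w - s))) ≤
      2 * (s + r' * V) * (V * eForm r r' s w l u ut uR - jForm r r' s w l u ut uR) := by
  have hws := sub_pos.2 hsw
  set e := eForm r r' s w l u ut uR with he
  set j := jForm r r' s w l u ut uR with hj
  set X := ut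
  set Y := w / r' * uR with hY
  -- The speed of the curve in units of the speed of light. The case ν = 1 is the identity for
  -- incoming rays, and the excess ν - 1 is paid for by the positive energy density.
  set ν := V * r' / w with hν
  have hν1 : 1 ≤ ν := by
    rw [hν, le_div_iff₀ hw, one_mul]
    exact (div_le_iff₀ hr').1 hV
  have hVν : V = ν * (w / r') := by rw [hν]; field_simp
  have h1 : r ^ 2 * (w - s) / 2 * (X ^ 2 + Y ^ 2) ≤ w / r' * e := energy_lower_bound hr' hw hs hl
  have h2 : r ^ 2 * (w - s) / 2 * (X - Y) ^ 2 ≤ w / r' * e - j := by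
    rw [he, hj, flux_minus_identity hr'.ne']
    have : 0 ≤ l * (w + s) * u ^ 2 / 2 := by positivity
    linarith
  have h3 : r ^ 2 * (w - s) / 2 * ((X - Y) ^ 2 + (ν - 1) * Y ^ 2) ≤ V * e - j := by
    have h4 : (ν - 1) * (r ^ 2 * (w - s) / 2 * Y ^ 2) ≤ (ν - 1) * (w / r' * e) := by
      refine mul_le_mul_of_nonneg_left (le_trans ?_ h1) (by linarith)
      exact mul_le_mul_of_nonneg_left (by nlinarith [sq_nonneg X]) (by positivity)
    rw [hVν]
    linarith
  have h5 : (X - ν * Y) ^ 2 ≤ ν * ((X - Y) ^ 2 + (ν - 1) * Y ^ 2) := by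
    nlinarith [mul_nonneg (sub_nonneg.2 hν1) (sq_nonneg (X - Y + Y)), sq_nonneg (X - Y + Y)]
  have h6 : ut - V * uR = X - ν * Y := by rw [hVν, hY]; ring
  have hF : 0 ≤ V * e - j := le_trans (by have := sub_nonneg.2 hν1; positivity) h3
  have h7 : w * ν ≤ s + r' * V := by rw [hν]; field_simp; linarith
  rw [h6]
  calc (X - ν * Y) ^ 2 * (r ^ 2 * (w * (w - s)))
      ≤ (ν * ((X - Y) ^ 2 + (ν - 1) * Y ^ 2)) * (r ^ 2 * (w * (w - s))) :=
        mul_le_mul_of_nonneg_right h5 (by positivity)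
    _ = 2 * (w * ν) * (r ^ 2 * (w - s) / 2 * ((X - Y) ^ 2 + (ν - 1) * Y ^ 2)) := by ring
    _ ≤ 2 * (w * ν) * (V * e - j) := mul_le_mul_of_nonneg_left h3 (by positivity)
    _ ≤ _ := mul_le_mul_of_nonneg_right (by linarith) hF

/-- By 2ab ≤ a² + b² the source is at most m'/(r r') times the sum of squares controlled by the
energy with coercivity w - s, and that factor is absorbed by the hypothesis on k. -/
theorem source_le_energy {m' k : ℝ} (hr : 0 < r) (hr' : 0 < r') (hw : 0 < w) (hs : 0 ≤ s)
    (hl : 0 ≤ l) (hm : 0 ≤ m') (hk : m' / (r * r') ≤ k * (w - s)) (hsw : s < w) :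
    r * m' / r' * (ut * uR) ≤ k * eForm r r' s w l u ut uR := by
  have hws := sub_pos.2 hsw
  have h1 := energy_lower_bound (r := r) (u := u) (ut := ut) (uR := uR) hr' hw hs hl
  have hk0 : 0 ≤ k := nonneg_of_mul_nonneg_left (le_trans (by positivity) hk) hws
  have h2 : k * (r ^ 2 * (w - s) / 2 * (ut ^ 2 + (w / r' * uR) ^ 2)) ≤
    k * (w / r' * eForm r r' s w l u ut uR) := mul_le_mul_of_nonneg_left h1 hk0
  have h3 : r ^ 2 / 2 * (m' / (r * r')) * (ut ^ 2 + (w / r' * uR) ^ 2) ≤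
      r ^ 2 / 2 * (k * (w - s)) * (ut ^ 2 + (w / r' * uR) ^ 2) := by gcongr
  have h4 : 2 * (ut * (w / r' * uR)) ≤ ut ^ 2 + (w / r' * uR) ^ 2 := by
    nlinarith [sq_nonneg (ut - w / r' * uR)]
  have h5 : r ^ 2 / 2 * (m' / (r * r')) * (2 * (ut * (w / r' * uR))) ≤
      r ^ 2 / 2 * (m' / (r * r')) * (ut ^ 2 + (w / r' * uR) ^ 2) := by gcongr
  have h6 : r ^ 2 / 2 * (m' / (r * r')) * (2 * (ut * (w / r' * uR))) =
      w / r' * (r * m' / r' * (ut * uR)) := by field_simp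
  have h7 : w / r' * (r * m' / r' * (ut * uR)) ≤ w / r' * (k * eForm r r' s w l u ut uR) := by
    linarith
  exact le_of_mul_le_mul_left h7 (by positivity)

/-- The algebraic core of ∂_τ e - ∂_R j = source. The wave equation eliminates the second time
derivative and the differentiated energy equation eliminates w'; everything cancels except the term
with m', the failure of the Kodama current to be conserved. -/
theorem energy_balance_algebra {r' r'' sR wp m mp utt utR uRR l mu : ℝ} (hr : r ≠ 0) (hrp : r' ≠ 0)
    (hw : w ≠ 0) (hsR : s * sR = w * wp + mp / r - m * r' / r ^ 2)
    (pde : r ^ 2 * r' * utt + (2 * r * (-s) * r' + r ^ 2 * (-sR)) * ut =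
      w * ((2 * r * r' * w / r' + r ^ 2 * wp / r' - r ^ 2 * w * r'' / r' ^ 2) * uR
        + r ^ 2 * w / r' * uRR) - (l + mu ^ 2 * r ^ 2) * r' * u) :
    ((2 * r * (-s) * r' * ut ^ 2 + r ^ 2 * (-sR) * ut ^ 2 + r ^ 2 * r' * 2 * ut * utt) / 2
      + (2 * r * (-s) * w ^ 2 / r' * uR ^ 2 - r ^ 2 * w ^ 2 / r' ^ 2 * (-sR) * uR ^ 2
          + r ^ 2 * w ^ 2 / r' * 2 * uR * utR) / 2
      + (mu ^ 2 * 2 * r * (-s) * r' * u ^ 2 + (l + mu ^ 2 * r ^ 2) * (-sR) * u ^ 2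
          + (l + mu ^ 2 * r ^ 2) * r' * 2 * u * ut) / 2
      + (m / r ^ 2 * r ^ 2 * ut * uR + s * 2 * r * (-s) * ut * uR + s * r ^ 2 * utt * uR
          + s * r ^ 2 * ut * utR))
    - ((2 * r * r' * w ^ 2 / r' * ut * uR + r ^ 2 * 2 * w * wp / r' * ut * uR
          - r ^ 2 * w ^ 2 / r' ^ 2 * r'' * ut * uR + r ^ 2 * w ^ 2 / r' * utR * uR
          + r ^ 2 * w ^ 2 / r' * ut * uRR)
      + (sR * r ^ 2 + s * 2 * r * r') * (ut ^ 2 + w ^ 2 / r' ^ 2 * uR ^ 2) / 2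
      + s * r ^ 2 * (2 * ut * utR + 2 * w * wp / r' ^ 2 * uR ^ 2
          - 2 * w ^ 2 / r' ^ 3 * r'' * uR ^ 2 + w ^ 2 / r' ^ 2 * 2 * uR * uRR) / 2
      - sR * (l + mu ^ 2 * r ^ 2) * u ^ 2 / 2 - s * mu ^ 2 * 2 * r * r' * u ^ 2 / 2
      - s * (l + mu ^ 2 * r ^ 2) * 2 * u * uR / 2) = r * mp / r' * (ut * uR) := by
  have e1 : wp = (s * sR - mp / r + m * r' / r ^ 2) / w := by
    rw [hsR]; field_simp; ring
  have e2 : utt = (w * ((2 * r * r' * w / r' + r ^ 2 * wp / r' - r ^ 2 * w * r'' / r' ^ 2) * uR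
      + r ^ 2 * w / r' * uRR) - (l + mu ^ 2 * r ^ 2) * r' * u
      - (2 * r * (-s) * r' + r ^ 2 * (-sR)) * ut) / (r ^ 2 * r') := by
    field_simp; field_simp at pde; linear_combination pde
  rw [e2, e1]
  field_simp
  ring

end Forms

/-! ### The reduced wave equation and its local energy balance -/

namespace DustData

variable {d : DustData}

/-- The domain in the `(τ, R)` plane, away from the initial surface, reflected across the centre. -/
def Dx (d : DustData) : Set (ℝ × ℝ) := {z | 0 < z.1 ∧ (z.1, |z.2|) ∈ d.D₂}

/-- `u` solves the reduced wave equation with angular eigenvalue `lam`; `ut` and `uR` are its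
derivatives, which extend continuously to the initial surface. -/
structure IsMode (d : DustData) (μ lam : ℝ) (u ut uR : ℝ × ℝ → ℝ) : Prop where
  smooth : ContDiffOn ℝ 2 u d.Dx
  cont : ContinuousOn u d.D₂
  cont_time : ContinuousOn ut d.D₂
  cont_radius : ContinuousOn uR d.D₂
  time : ∀ z ∈ d.Dx, ut z = fderiv ℝ u z (1, 0)
  radius : ∀ z ∈ d.Dx, uR z = fderiv ℝ u z (0, 1)
  pde : ∀ z ∈ d.Dx, 0 < z.2 →
    d.rr z ^ 2 * d.rp z * fderiv ℝ ut z (1, 0)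
        + (2 * d.rr z * (-d.sf z) * d.rp z + d.rr z ^ 2 * (-fderiv ℝ d.sf z (0, 1))) * ut z =
      d.w z.2 * ((2 * d.rr z * d.rp z * d.w z.2 / d.rp z + d.rr z ^ 2 * deriv d.w z.2 / d.rp z
          - d.rr z ^ 2 * d.w z.2 * fderiv ℝ d.rp z (0, 1) / d.rp z ^ 2) * uR z
        + d.rr z ^ 2 * d.w z.2 / d.rp z * fderiv ℝ uR z (0, 1))
      - (lam + μ ^ 2 * d.rr z ^ 2) * d.rp z * u z

/-- Energy density of a mode. -/
def energy (d : DustData) (μ lam : ℝ) (u ut uR : ℝ × ℝ → ℝ) (z : ℝ × ℝ) : ℝ :=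
  eForm (d.rr z) (d.rp z) (d.sf z) (d.w z.2) (lam + μ ^ 2 * d.rr z ^ 2) (u z) (ut z) (uR z)

/-- Energy flux of a mode. -/
def flux (d : DustData) (μ lam : ℝ) (u ut uR : ℝ × ℝ → ℝ) (z : ℝ × ℝ) : ℝ :=
  jForm (d.rr z) (d.rp z) (d.sf z) (d.w z.2) (lam + μ ^ 2 * d.rr z ^ 2) (u z) (ut z) (uR z)

/-- Source term in the energy balance of a mode. -/
def source (d : DustData) (ut uR : ℝ × ℝ → ℝ) (z : ℝ × ℝ) : ℝ :=
  d.rr z * (4 * Real.pi * (d.ρ₀ z.2 * z.2 ^ 2)) / d.rp z * (ut z * uR z)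

namespace Admissible

theorem isOpen_Dx (hd : d.Admissible) (hn : d.GloballyNaked) : IsOpen d.Dx := by
  rw [isOpen_iff_mem_nhds]
  rintro ⟨τ, R⟩ ⟨h0, h⟩
  have hc : Continuous fun z : ℝ × ℝ => (z.1, |z.2|) := by fun_prop
  filter_upwards [(hc.tendsto (τ, R)).eventually (hd.D₂_isOpen_at hn h h0),
    (isOpen_lt continuous_const continuous_fst).mem_nhds h0] with z hz hz0
  exact ⟨hz0, hz (abs_nonneg _)⟩

theorem mem_Dx {z : ℝ × ℝ} (h : z ∈ d.D₂) (h0 : 0 < z.1) : z ∈ d.Dx :=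
  ⟨h0, by rw [abs_of_nonneg h.1]; exact h⟩

theorem mem_D₂_of_Dx {z : ℝ × ℝ} (h : z ∈ d.Dx) (h0 : 0 ≤ z.2) : z ∈ d.D₂ := by
  have := h.2; rwa [abs_of_nonneg h0] at this

theorem D₂_subset_tDom (hd : d.Admissible) : d.D₂ ⊆ d.tDom := fun _ h => hd.mem_tDom h.2.1 h.2.2.1

theorem yE_mem (hd : d.Admissible) {z : ℝ × ℝ} (h : z ∈ d.D₂) : d.yE z.1 z.2 ∈ Ioc (0 : ℝ) 1 := by
  rw [hd.yE_eq_y h.2.1 h.2.2.1]; exact hd.y_mem h.2.1 h.2.2.1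

theorem rp_pos (hd : d.Admissible) {z : ℝ × ℝ} (h : z ∈ d.D₂) : 0 < d.rp z :=
  hd.rR_pos (hd.yE_mem h) h.1

variable {μ lam : ℝ} {u ut uR : ℝ × ℝ → ℝ}

theorem contDiffOn_time (hd : d.Admissible) (hn : d.GloballyNaked) (hu : IsMode d μ lam u ut uR) :
    ContDiffOn ℝ 1 ut d.Dx := by
  have h := hu.smooth.fderiv_of_isOpen (hd.isOpen_Dx hn) (m := 1) (by norm_num)
  exact (h.clm_apply contDiffOn_const).congr hu.time

theorem contDiffOn_radius (hd : d.Admissible) (hn : d.GloballyNaked) (hu : IsMode d μ lam u ut uR) :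
    ContDiffOn ℝ 1 uR d.Dx := by
  have h := hu.smooth.fderiv_of_isOpen (hd.isOpen_Dx hn) (m := 1) (by norm_num)
  exact (h.clm_apply contDiffOn_const).congr hu.radius

theorem hasFDerivAt_mode (hd : d.Admissible) (hn : d.GloballyNaked) (hu : IsMode d μ lam u ut uR)
    {z : ℝ × ℝ} (hz : z ∈ d.Dx) : HasFDerivAt u (ut z • ContinuousLinearMap.fst ℝ ℝ ℝ
      + uR z • ContinuousLinearMap.snd ℝ ℝ ℝ) z := by
  have h := ((hu.smooth.contDiffAt ((hd.isOpen_Dx hn).mem_nhds hz)).differentiableAt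
    (by simp)).hasFDerivAt
  rw [hu.time z hz, hu.radius z hz, ← clm_prod_eq]
  exact h

theorem contDiffAt_energy (hd : d.Admissible) (hn : d.GloballyNaked) (hu : IsMode d μ lam u ut uR)
    {z : ℝ × ℝ} (hz : z ∈ d.D₂) (h0 : 0 < z.1) : ContDiffAt ℝ 1 (d.energy μ lam u ut uR) z := by
  have hx := mem_Dx hz h0
  have ht := hd.D₂_subset_tDom hz
  have hnx := (hd.isOpen_Dx hn).mem_nhds hx
  have h1 := (hd.contDiffAt_rr ht).of_le (m := 1) (by simp)
  have h2 := (hd.contDiffAt_rp ht).of_le (m := 1) (by simp)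
  have h3 := (hd.contDiffAt_sf ht).of_le (m := 1) (by simp)
  have h4 := (hd.contDiffAt_wf hz.1).of_le (m := 1) (by simp)
  have h5 := (hu.smooth.contDiffAt hnx).of_le (m := 1) (by norm_num)
  have h6 := (hd.contDiffOn_time hn hu).contDiffAt hnx
  have h7 := (hd.contDiffOn_radius hn hu).contDiffAt hnx
  have h8 := (hd.rp_pos hz).ne'
  unfold energy eForm
  exact (((((h1.pow 2).mul h2).mul (h6.pow 2)).div_const 2).add
    ((((h1.pow 2).mul ((h4.pow 2).div h2 h8)).mul (h7.pow 2)).div_const 2)).add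
    ((((contDiffAt_const.add (contDiffAt_const.mul (h1.pow 2))).mul h2).mul (h5.pow 2)).div_const 2)
    |>.add ((h3.mul (h1.pow 2)).mul (h6.mul h7))

theorem continuousOn_geometry (hd : d.Admissible) :
    ContinuousOn d.rr d.D₂ ∧ ContinuousOn d.rp d.D₂ ∧ ContinuousOn d.sf d.D₂ ∧
      ContinuousOn (fun z : ℝ × ℝ => d.w z.2) d.D₂ :=
  ⟨fun _ h => (hd.contDiffAt_rr (hd.D₂_subset_tDom h)).continuousAt.continuousWithinAt,
    fun _ h => (hd.contDiffAt_rp (hd.D₂_subset_tDom h)).continuousAt.continuousWithinAt,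
    fun _ h => (hd.contDiffAt_sf (hd.D₂_subset_tDom h)).continuousAt.continuousWithinAt,
    fun _ h => (hd.contDiffAt_wf h.1).continuousAt.continuousWithinAt⟩

theorem continuousOn_energy (hd : d.Admissible) (hu : IsMode d μ lam u ut uR) :
    ContinuousOn (d.energy μ lam u ut uR) d.D₂ := by
  obtain ⟨h1, h2, h3, h4⟩ := hd.continuousOn_geometry
  have h5 := hu.cont
  have h6 := hu.cont_time
  have h7 := hu.cont_radius
  unfold energy eForm
  have h8 : ContinuousOn (fun z : ℝ × ℝ => d.w z.2 ^ 2 / d.rp z) d.D₂ :=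
    (h4.pow 2).div h2 fun z hz => (hd.rp_pos hz).ne'
  fun_prop

theorem continuousOn_flux (hd : d.Admissible) (hu : IsMode d μ lam u ut uR) :
    ContinuousOn (d.flux μ lam u ut uR) d.D₂ := by
  obtain ⟨h1, h2, h3, h4⟩ := hd.continuousOn_geometry
  have h5 := hu.cont
  have h6 := hu.cont_time
  have h7 := hu.cont_radius
  unfold flux jForm
  have h8 : ContinuousOn (fun z : ℝ × ℝ => d.w z.2 ^ 2 / d.rp z) d.D₂ :=
    (h4.pow 2).div h2 fun z hz => (hd.rp_pos hz).ne'
  have h9 : ContinuousOn (fun z : ℝ × ℝ => d.w z.2 ^ 2 / d.rp z ^ 2) d.D₂ :=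
    (h4.pow 2).div (h2.pow 2) fun z hz => pow_ne_zero 2 (hd.rp_pos hz).ne'
  fun_prop

theorem continuousOn_source (hd : d.Admissible) (hu : IsMode d μ lam u ut uR) :
    ContinuousOn (d.source ut uR) d.D₂ := by
  obtain ⟨h1, h2, h3, h4⟩ := hd.continuousOn_geometry
  have h6 := hu.cont_time
  have h7 := hu.cont_radius
  have h8 := hd.smooth_ρ₀.continuous
  unfold source
  have h9 : ContinuousOn (fun z : ℝ × ℝ => d.rr z * (4 * Real.pi * (d.ρ₀ z.2 * z.2 ^ 2)) / d.rp z)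
    d.D₂ := ContinuousOn.div (by fun_prop) h2 fun z hz => (hd.rp_pos hz).ne'
  fun_prop

/-- The local energy balance. -/
theorem hasDerivAt_flux (hd : d.Admissible) (hn : d.GloballyNaked) (hu : IsMode d μ lam u ut uR)
    {z : ℝ × ℝ} (hz : z ∈ d.D₂) (h0 : 0 < z.1) (hR : 0 < z.2) :
    HasDerivAt (fun x => d.flux μ lam u ut uR (z.1, x))
      (fderiv ℝ (d.energy μ lam u ut uR) z (1, 0) - d.source ut uR z) z.2 := by
  have hx := mem_Dx hz h0
  have ht := hd.D₂_subset_tDom hz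
  have hnx := (hd.isOpen_Dx hn).mem_nhds hx
  have hone : (1 : WithTop ℕ∞) ≠ 0 := by simp
  have hrd := (hd.contDiffAt_rr ht).differentiableAt (by simp)
  have hpd := (hd.contDiffAt_rp ht).differentiableAt (by simp)
  have hsd := (hd.contDiffAt_sf ht).differentiableAt (by simp)
  have hud := (hu.smooth.contDiffAt hnx).differentiableAt (by simp)
  have htd := ((hd.contDiffOn_time hn hu).contDiffAt hnx).differentiableAt hone
  have hRd := ((hd.contDiffOn_radius hn hu).contDiffAt hnx).differentiableAt hone
  have hp0 := (hd.rp_pos hz).ne'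
  have hr0 := (hd.rr_pos ht hR).ne'
  have hw0 := (hd.w_pos hz.1).ne'
  have hzz : (z.1, z.2) = z := rfl
  -- The mixed derivatives arising in ∂_τ e and in ∂_R j have to be the same quantity for the
  -- second-order terms to cancel.
  have hmix : fderiv ℝ ut z (0, 1) = fderiv ℝ uR z (1, 0) :=
    symmetric_mixed_deriv (F := u) (by
      filter_upwards [hnx] with x hx using hd.hasFDerivAt_mode hn hu hx) htd hRd
  -- derivatives in time
  have r1 := hasDerivAt_slice_fst hrd
  have p1 := hasDerivAt_slice_fst hpd
  have s1 := hasDerivAt_slice_fst hsd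
  have u1 := hasDerivAt_slice_fst hud
  have t1 := hasDerivAt_slice_fst htd
  have R1 := hasDerivAt_slice_fst hRd
  have r2 := hasDerivAt_slice_snd hrd
  have p2 := hasDerivAt_slice_snd hpd
  have s2 := hasDerivAt_slice_snd hsd
  have u2 := hasDerivAt_slice_snd hud
  have t2 := hasDerivAt_slice_snd htd
  have R2 := hasDerivAt_slice_snd hRd
  have w2 := hd.hasDerivAt_w hz.1
  rw [(hd.hasFDerivAt_rr ht).fderiv] at r1 r2
  simp only [add_apply, smul_apply, ContinuousLinearMap.coe_fst',
    ContinuousLinearMap.coe_snd', smul_eq_mul, mul_one, mul_zero, add_zero, zero_add] at r1 r2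
  rw [hd.rp_time ht] at p1
  rw [hd.sf_time ht hR] at s1
  rw [← hu.time z hx] at u1
  rw [← hu.radius z hx] at u2
  rw [hmix] at t2
  have pde := hu.pde z hx hR
  have key := energy_balance_algebra hr0 hp0 hw0 (hd.sf_radius ht hR) pde
    (utR := fderiv ℝ uR z (1, 0))
  have hE := hasDerivAt_slice_fst ((hd.contDiffAt_energy hn hu hz h0).differentiableAt hone)
  have hE' := ((((((r1.pow 2).mul p1).mul (t1.pow 2)).div_const 2).add
    ((((r1.pow 2).mul ((hasDerivAt_const z.1 (d.w z.2 ^ 2)).div p1 hp0)).mul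
      (R1.pow 2)).div_const 2)).add
    (((((r1.pow 2).const_mul (μ ^ 2)).const_add lam).mul p1).mul (u1.pow 2)|>.div_const 2)).add
    ((s1.mul (r1.pow 2)).mul (t1.mul R1))
  have hEv := hE.unique hE'
  have hJ := (((r2.pow 2).mul ((w2.pow 2).div p2 hp0)).mul (t2.mul R2)).add
    ((s2.mul (r2.pow 2)).mul ((t2.pow 2).add (((w2.pow 2).div (p2.pow 2)
      (pow_ne_zero 2 hp0)).mul (R2.pow 2)))|>.div_const 2)|>.sub
    (((s2.mul (((r2.pow 2).const_mul (μ ^ 2)).const_add lam)).mul (u2.pow 2)).div_const 2)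
  refine HasDerivAt.congr_deriv (f := fun x => d.flux μ lam u ut uR (z.1, x)) hJ ?_
  rw [hEv, source, ← key]
  simp only [Pi.pow_apply, Pi.mul_apply, Pi.div_apply, Pi.add_apply, hzz]
  generalize d.rr z = r at *
  generalize d.rp z = p at *
  generalize d.sf z = s at *
  generalize d.w z.2 = w at *
  generalize fderiv ℝ d.sf z (0, 1) = sR at *
  field_simp
  ring

end Admissible

end DustData

/-! ### Calculus tools: exceptional times, a Gronwall weight, moving endpoints -/

/-- Splitting the interval at the exceptional points, where continuity suffices. These will be the
corner of the inner boundary and the times at which the Gronwall weight is not differentiable. -/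
theorem le_of_deriv_nonpos_off_finite {H : ℝ → ℝ} {S : Set ℝ} (hS : S.Finite) :
    ∀ {α β : ℝ}, α ≤ β → ContinuousOn H (Icc α β) →
      (∀ t ∈ Ioo α β \ S, ∃ H', HasDerivAt H H' t ∧ H' ≤ 0) → H β ≤ H α := by
  induction S, hS using Set.Finite.induction_on with
  | empty =>
    intro α β hαβ hc h
    refine antitoneOn_of_deriv_nonpos (convex_Icc α β) hc ?_ ?_ (left_mem_Icc.2 hαβ)
      (right_mem_Icc.2 hαβ) hαβ
    · rw [interior_Icc]
      intro t ht
      obtain ⟨_, h1, _⟩ := h t ⟨ht, by simp⟩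
      exact h1.differentiableAt.differentiableWithinAt
    · rw [interior_Icc]
      intro t ht
      obtain ⟨_, h1, h2⟩ := h t ⟨ht, by simp⟩
      rwa [h1.deriv]
  | @insert x S _ _ ih =>
    intro α β hαβ hc h
    by_cases hx : x ∈ Ioo α β
    · have h1 : H x ≤ H α := ih hx.1.le (hc.mono (Icc_subset_Icc_right hx.2.le)) fun t ht =>
        h t ⟨⟨ht.1.1, ht.1.2.trans hx.2⟩, by
          rintro (rfl | h'); exacts [lt_irrefl _ ht.1.2, ht.2 h']⟩
      have h2 : H β ≤ H x := ih hx.2.le (hc.mono (Icc_subset_Icc_left hx.1.le)) fun t ht =>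
        h t ⟨⟨hx.1.trans ht.1.1, ht.1.2⟩, by
          rintro (rfl | h'); exacts [lt_irrefl _ ht.1.1, ht.2 h']⟩
      exact h2.trans h1
    · exact ih hαβ hc fun t ht => h t ⟨ht.1, by
        rintro (rfl | h'); exacts [hx ht.1, ht.2 h']⟩

/-- A bounded increasing function whose derivative dominates an integrable power singularity. -/
theorem exists_gronwall_weight {C t₀ T : ℝ} (hC : 0 < C) (hT : 0 ≤ T) :
    ∃ (K : ℝ → ℝ) (B : ℝ), Continuous K ∧ (∀ t, 0 ≤ t → |K t| ≤ B) ∧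
      ∀ t, t ∉ ({t₀, T} : Set ℝ) → ∃ k, HasDerivAt K k t ∧ 0 ≤ k ∧
        (t < T → C / (|t - t₀| ^ (1 / 6 : ℝ)) ^ 5 ≤ k) := by
  -- The odd sixth root: continuous and increasing, with derivative |x|^(-5/6)/6 away from 0.
  set g : ℝ → ℝ := fun x => (max x 0) ^ (1 / 6 : ℝ) - (max (-x) 0) ^ (1 / 6 : ℝ) with hg
  have hgc : Continuous g := by
    have : (0 : ℝ) ≤ 1 / 6 := by norm_num
    exact ((continuous_id.max continuous_const).rpow_const fun _ => Or.inr this).sub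
      ((continuous_neg.max continuous_const).rpow_const fun _ => Or.inr this)
  have hpow : ∀ x : ℝ, 0 < x → (1 / 6 : ℝ) * x ^ ((1 / 6 : ℝ) - 1) = 1 / (6 * (x ^ (1 / 6 : ℝ)) ^ 5) := by
    intro x hx
    have h1 : (x ^ (1 / 6 : ℝ)) ^ 5 = x ^ (5 / 6 : ℝ) := by
      rw [← Real.rpow_natCast, ← Real.rpow_mul hx.le]; norm_num
    rw [h1, show (1 / 6 : ℝ) - 1 = -(5 / 6) by norm_num, Real.rpow_neg hx.le]
    field_simp
  have hgd : ∀ x : ℝ, x ≠ 0 → HasDerivAt g (1 / (6 * (|x| ^ (1 / 6 : ℝ)) ^ 5)) x := by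
    intro x hx
    rcases lt_or_gt_of_ne hx with h | h
    · have h1 : HasDerivAt (fun y : ℝ => -(-y) ^ (1 / 6 : ℝ))
          (-(-1 * (1 / 6) * (-x) ^ ((1 / 6 : ℝ) - 1))) x :=
        ((hasDerivAt_neg x).rpow_const (p := 1 / 6) (Or.inl (by simpa using hx))).neg
      rw [abs_of_neg h, ← hpow (-x) (by linarith)]
      refine (h1.congr_deriv (by ring)).congr_of_eventuallyEq ?_
      filter_upwards [gt_mem_nhds h] with y hy
      simp only [hg]
      rw [max_eq_right hy.le, max_eq_left (by linarith), Real.zero_rpow (by norm_num), zero_sub]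
    · have h1 := (hasDerivAt_id' x).rpow_const (p := 1 / 6) (Or.inl hx)
      rw [abs_of_pos h, ← hpow x h]
      refine (h1.congr_deriv (by ring)).congr_of_eventuallyEq ?_
      filter_upwards [lt_mem_nhds h] with y hy
      simp only [hg]
      rw [max_eq_left hy.le, max_eq_right (by linarith), Real.zero_rpow (by norm_num), sub_zero]
  -- Freezing the argument at T keeps the weight bounded for all later times.
  have hK : Continuous fun t => 6 * C * g (min t T - t₀) :=
    continuous_const.mul (hgc.comp ((continuous_id.min continuous_const).sub continuous_const))
  obtain ⟨B, hB⟩ := (isCompact_Icc (a := (0 : ℝ)) (b := T)).exists_bound_of_continuousOn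
    hK.continuousOn
  refine ⟨fun t => 6 * C * g (min t T - t₀), B, hK, fun t ht => ?_, fun t ht => ?_⟩
  · have := hB (min t T) ⟨le_min ht hT, min_le_right _ _⟩
    simpa using this
  · simp only [mem_insert_iff, mem_singleton_iff, not_or] at ht
    rcases lt_or_gt_of_ne ht.2 with h | h
    · refine ⟨C / (|t - t₀| ^ (1 / 6 : ℝ)) ^ 5, ?_, by positivity, fun _ => le_rfl⟩
      have h1 := (HasDerivAt.comp (h₂ := g) (h := fun s => s - t₀) t
        (hgd (t - t₀) (sub_ne_zero.2 ht.1)) ((hasDerivAt_id' t).sub_const t₀)).const_mul (6 * C)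
      have h0 : 0 < |t - t₀| := abs_pos.2 (sub_ne_zero.2 ht.1)
      refine (h1.congr_deriv ?_).congr_of_eventuallyEq ?_
      · field_simp
      · filter_upwards [gt_mem_nhds h] with s hs
        simp [min_eq_left hs.le]
    · refine ⟨0, (hasDerivAt_const t (6 * C * g (T - t₀))).congr_of_eventuallyEq ?_, le_rfl,
        fun h' => absurd h' (not_lt.2 h.le)⟩
      filter_upwards [lt_mem_nhds h] with s hs
      rw [min_eq_right hs.le]

/-- Near the base point the integrand differs little from its value there, so replacing it by that
constant costs o(a τ - a τ₀). -/
theorem hasDerivAt_integral_endpoint {e : ℝ × ℝ → ℝ} {a : ℝ → ℝ} {a' τ₀ : ℝ}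
    (he : ∀ᶠ z in 𝓝 (τ₀, a τ₀), ContinuousAt e z) (ha : HasDerivAt a a' τ₀) :
    (∀ᶠ τ in 𝓝 τ₀, IntervalIntegrable (fun R => e (τ, R)) volume (a τ₀) (a τ)) ∧
    HasDerivAt (fun τ => ∫ R in a τ₀..a τ, e (τ, R)) (e (τ₀, a τ₀) * a') τ₀ := by
  set e₀ := e (τ₀, a τ₀) with he₀
  have hloc : ∀ P : ℝ × ℝ → Prop, (∀ᶠ z in 𝓝 (τ₀, a τ₀), P z) →
      ∀ᶠ τ in 𝓝 τ₀, ∀ R ∈ uIcc (a τ₀) (a τ), P (τ, R) := by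
    intro P hP
    obtain ⟨δ, hδ, hball⟩ := Metric.eventually_nhds_iff.1 hP
    filter_upwards [Metric.ball_mem_nhds τ₀ hδ,
      ha.continuousAt.preimage_mem_nhds (Metric.ball_mem_nhds (a τ₀) hδ)] with τ h1 h2 R hR
    refine hball ?_
    rw [Prod.dist_eq, max_lt_iff]
    refine ⟨h1, lt_of_le_of_lt ?_ (show |a τ - a τ₀| < δ from h2)⟩
    exact abs_sub_left_of_mem_uIcc hR
  have hint : ∀ᶠ τ in 𝓝 τ₀, IntervalIntegrable (fun R => e (τ, R)) volume (a τ₀) (a τ) := by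
    filter_upwards [hloc _ he] with τ h
    refine ContinuousOn.intervalIntegrable fun R hR => ?_
    exact (ContinuousAt.comp (f := fun R => (τ, R)) (h R hR) (by fun_prop)).continuousWithinAt
  refine ⟨hint, ?_⟩
  have h1 : (fun τ => ∫ R in a τ₀..a τ, (e (τ, R) - e₀)) =o[𝓝 τ₀] fun τ => a τ - a τ₀ := by
    rw [Asymptotics.isLittleO_iff]
    intro c hc
    filter_upwards [hloc (fun z => ‖e z - e₀‖ ≤ c) (by
      have := he.self_of_nhds
      filter_upwards [this.preimage_mem_nhds (Metric.closedBall_mem_nhds _ hc)] with z hz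
      simpa [dist_eq_norm] using hz)] with τ h
    exact intervalIntegral.norm_integral_le_of_norm_le_const fun R hR => h R (uIoc_subset_uIcc hR)
  have h2 : HasDerivAt (fun τ => ∫ R in a τ₀..a τ, (e (τ, R) - e₀)) 0 τ₀ := by
    rw [hasDerivAt_iff_isLittleO]
    simpa using h1.trans_isBigO ha.isBigO_sub
  refine ((h2.add ((ha.sub_const (a τ₀)).const_mul e₀)).congr_deriv (by simp)).congr_of_eventuallyEq ?_
  filter_upwards [hint] with τ h
  simp only [Pi.add_apply]
  rw [intervalIntegral.integral_sub h (by simp), intervalIntegral.integral_const, smul_eq_mul]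
  ring

/-- Differentiation of an integral with moving endpoints. -/
theorem hasDerivAt_integral_moving {e : ℝ × ℝ → ℝ} {a b : ℝ → ℝ} {a' b' τ₀ : ℝ}
    (hab : b τ₀ ≤ a τ₀) (he : ∀ R ∈ Icc (b τ₀) (a τ₀), ContDiffAt ℝ 1 e (τ₀, R))
    (ha : HasDerivAt a a' τ₀) (hb : HasDerivAt b b' τ₀) :
    HasDerivAt (fun τ => ∫ R in b τ..a τ, e (τ, R))
      ((∫ R in b τ₀..a τ₀, fderiv ℝ e (τ₀, R) (1, 0)) + e (τ₀, a τ₀) * a' - e (τ₀, b τ₀) * b')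
      τ₀ := by
  set O : Set (ℝ × ℝ) := {z | ContDiffAt ℝ 1 e z} with hO
  have hOo : IsOpen O := by
    rw [isOpen_iff_mem_nhds]
    exact fun z hz => ContDiffAt.eventually hz (by simp)
  have heO : ContDiffOn ℝ 1 e O := fun z hz => ContDiffAt.contDiffWithinAt hz
  have hcont : ∀ R ∈ Icc (b τ₀) (a τ₀), ∀ᶠ z in 𝓝 (τ₀, R), ContinuousAt e z := fun R hR => by
    filter_upwards [hOo.mem_nhds (he R hR)] with z hz using ContDiffAt.continuousAt (𝕜 := ℝ) (n := 1) hz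
  obtain ⟨hia, hda⟩ := hasDerivAt_integral_endpoint (hcont _ (right_mem_Icc.2 hab)) ha
  obtain ⟨hib, hdb⟩ := hasDerivAt_integral_endpoint (hcont _ (left_mem_Icc.2 hab)) hb
  have hev : ∀ᶠ τ in 𝓝 τ₀, ∀ R ∈ Icc (b τ₀) (a τ₀), (τ, R) ∈ O :=
    isCompact_Icc.eventually_forall_of_forall_eventually fun R hR => hOo.mem_nhds (he R hR)
  obtain ⟨U, hU, hUo, hτ₀⟩ := eventually_nhds_iff.1 hev
  have hmid := hasFDerivAt_setIntegral_of_contDiffOn (μ := volume) hOo heO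
    (isCompact_Icc (a := b τ₀) (b := a τ₀)) hUo (fun z hz => hU z.1 hz.1 z.2 hz.2) hτ₀
  have hmid' := hmid.hasDerivAt
  have hii : IntegrableOn (fun R => (fderiv ℝ e (τ₀, R)).comp (ContinuousLinearMap.inl ℝ ℝ ℝ))
      (Icc (b τ₀) (a τ₀)) := by
    refine ContinuousOn.integrableOn_compact isCompact_Icc ?_
    refine ContinuousOn.clm_comp ?_ continuousOn_const
    exact (heO.continuousOn_fderiv_of_isOpen hOo le_rfl).comp (by fun_prop) fun R hR => he R hR
  rw [ContinuousLinearMap.integral_apply hii] at hmid'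
  simp only [ContinuousLinearMap.comp_apply, ContinuousLinearMap.inl_apply] at hmid'
  rw [integral_Icc_eq_integral_Ioc, ← intervalIntegral.integral_of_le hab] at hmid'
  -- The integral is the one over the interval frozen at τ₀, plus the strip at a, minus the strip at
  -- b.
  refine ((hmid'.add hda).sub hdb).congr_of_eventuallyEq ?_
  filter_upwards [hia, hib, hev] with τ h1 h2 h3
  have h4 : IntervalIntegrable (fun R => e (τ, R)) volume (b τ₀) (a τ₀) := by
    refine ContinuousOn.intervalIntegrable fun R hR => ?_
    rw [uIcc_of_le hab] at hR
    exact (ContinuousAt.comp (f := fun R => (τ, R)) (ContDiffAt.continuousAt (𝕜 := ℝ) (n := 1) (h3 R hR))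
      (by fun_prop)).continuousWithinAt
  simp only [Pi.add_apply, Pi.sub_apply]
  rw [integral_Icc_eq_integral_Ioc, ← intervalIntegral.integral_of_le hab,
    intervalIntegral.integral_add_adjacent_intervals h4 h1,
    ← intervalIntegral.integral_interval_sub_left (h4.trans h1) h2]

/-- An affine substitution maps the moving interval to [0, 1], which reduces the claim to an
integral over a fixed compact set. -/
theorem continuousOn_integral_moving {e : ℝ × ℝ → ℝ} {a b : ℝ → ℝ} {S : Set ℝ}
    (ha : ContinuousOn a S) (hb : ContinuousOn b S) (hab : ∀ τ ∈ S, b τ ≤ a τ) {D : Set (ℝ × ℝ)}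
    (he : ContinuousOn e D) (hD : ∀ τ ∈ S, ∀ R ∈ Icc (b τ) (a τ), (τ, R) ∈ D) :
    ContinuousOn (fun τ => ∫ R in b τ..a τ, e (τ, R)) S := by
  have h1 : ∀ τ ∈ S, ∫ R in b τ..a τ, e (τ, R) =
      ∫ ξ in Icc (0 : ℝ) 1, (a τ - b τ) * e (τ, b τ + (a τ - b τ) * ξ) := by
    intro τ _
    rw [integral_Icc_eq_integral_Ioc, ← intervalIntegral.integral_of_le zero_le_one,
      intervalIntegral.integral_const_mul]
    have := intervalIntegral.smul_integral_comp_add_mul (a := 0) (b := 1) (fun R => e (τ, R))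
      (a τ - b τ) (b τ)
    rw [smul_eq_mul] at this
    rw [this]; simp
  refine ContinuousOn.congr ?_ h1
  refine continuousOn_setIntegral (F := fun z : ℝ × ℝ =>
    (a z.1 - b z.1) * e (z.1, b z.1 + (a z.1 - b z.1) * z.2)) isCompact_Icc ?_
  have ha' : ContinuousOn (fun z : ℝ × ℝ => a z.1) (S ×ˢ Icc (0 : ℝ) 1) :=
    ha.comp continuousOn_fst fun z hz => hz.1
  have hb' : ContinuousOn (fun z : ℝ × ℝ => b z.1) (S ×ˢ Icc (0 : ℝ) 1) :=
    hb.comp continuousOn_fst fun z hz => hz.1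
  refine (ha'.sub hb').mul (he.comp (continuousOn_fst.prodMk
    (hb'.add ((ha'.sub hb').mul continuousOn_snd))) fun z hz => hD _ hz.1 _ ?_)
  have := hab _ hz.1
  exact ⟨by nlinarith [hz.2.1], by nlinarith [hz.2.2]⟩

/-- A continuous strictly increasing function on an interval has a continuous inverse, extended by
a constant to the left. -/
theorem exists_continuous_inverse {ρ R₁ : ℝ} {σ : ℝ → ℝ} (hρ : ρ ≤ R₁)
    (hc : ContinuousOn σ (Icc ρ R₁)) (hm : StrictMonoOn σ (Icc ρ R₁)) :
    ∃ b : ℝ → ℝ, Continuous b ∧ (∀ τ ∈ Icc (σ ρ) (σ R₁), b τ ∈ Icc ρ R₁ ∧ σ (b τ) = τ) ∧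
      (∀ τ, τ ≤ σ ρ → b τ = ρ) ∧ b (σ R₁) = R₁ := by
  set cl : ℝ → ℝ := fun x => max ρ (min x R₁) with hcl
  have hclm : ∀ x, cl x ∈ Icc ρ R₁ := fun x => ⟨le_max_left _ _, max_le hρ (min_le_right _ _)⟩
  have hclc : Continuous cl := continuous_const.max (continuous_id.min continuous_const)
  have hcle : ∀ x ∈ Icc ρ R₁, cl x = x := fun x hx => by
    simp [hcl, min_eq_left hx.2, max_eq_right hx.1]
  -- σ is continued with slope 1 on both sides to an increasing bijection of the line, whose inverse
  -- is automatically continuous.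
  set S : ℝ → ℝ := fun x => σ (cl x) + (x - cl x) with hSdef
  have hSc : Continuous S := (hc.comp_continuous hclc hclm).add (continuous_id.sub hclc)
  have hclmono : Monotone cl := fun x y h => max_le_max le_rfl (min_le_min h le_rfl)
  have hlip : ∀ x y, x ≤ y → cl y - cl x ≤ y - x := by
    intro x y h
    simp only [hcl]
    rcases le_total x R₁ with h1 | h1 <;> rcases le_total y R₁ with h2 | h2 <;>
      simp only [min_eq_left, min_eq_right, h1, h2] <;>
      rcases le_total ρ x with h3 | h3 <;> rcases le_total ρ y with h4 | h4 <;>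
      simp only [max_eq_left, max_eq_right, h3, h4, hρ] <;> linarith
  have hSm : StrictMono S := by
    intro x y hxy
    have h1 := hlip x y hxy.le
    rcases (hclmono hxy.le).eq_or_lt with h | h
    · simp only [hSdef, h]; linarith
    · have := hm (hclm x) (hclm y) h
      simp only [hSdef]; linarith
  have hSle : ∀ x ≤ ρ, S x = σ ρ + (x - ρ) := fun x hx => by
    simp [hSdef, hcl, min_eq_left (hx.trans hρ), max_eq_left hx]
  have hSge : ∀ x, R₁ ≤ x → S x = σ R₁ + (x - R₁) := fun x hx => by
    simp [hSdef, hcl, min_eq_right hx, max_eq_right hρ]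
  have hsurj : Function.Surjective S := by
    refine hSc.surjective ?_ ?_
    · refine (tendsto_atTop_add_const_left _ (σ R₁ - R₁) tendsto_id).congr' ?_
      filter_upwards [eventually_ge_atTop R₁] with x hx
      rw [hSge x hx]; simp; ring
    · refine (tendsto_atBot_add_const_left _ (σ ρ - ρ) tendsto_id).congr' ?_
      filter_upwards [eventually_le_atBot ρ] with x hx
      rw [hSle x hx]; simp; ring
  set I := hSm.orderIsoOfSurjective S hsurj with hI
  have hIS : ∀ x, I.symm (S x) = x := fun x => I.symm_apply_apply x
  have hSI : ∀ t, S (I.symm t) = t := fun t => I.apply_symm_apply t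
  have hS1 : ∀ x ∈ Icc ρ R₁, S x = σ x := fun x hx => by simp [hSdef, hcle x hx]
  have hmρ := left_mem_Icc.2 hρ
  have hmR := right_mem_Icc.2 hρ
  refine ⟨fun τ => I.symm (max τ (σ ρ)), I.symm.continuous.comp (continuous_id.max continuous_const),
    fun τ hτ => ?_, fun τ hτ => ?_, ?_⟩
  · have h1 : I.symm τ ∈ Icc ρ R₁ := by
      constructor
      · rw [← hIS ρ, I.symm.le_iff_le, hS1 ρ hmρ]; exact hτ.1
      · rw [← hIS R₁, I.symm.le_iff_le, hS1 R₁ hmR]; exact hτ.2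
    simp only [max_eq_left hτ.1]
    exact ⟨h1, by rw [← hS1 _ h1, hSI]⟩
  · simp only [max_eq_right hτ]
    rw [← hS1 ρ hmρ, hIS]
  · simp only [max_eq_left (hm.monotoneOn hmρ hmR hρ)]
    rw [← hS1 R₁ hmR, hIS]

/-! ### The region of integration and the coefficients of the energy estimate -/

namespace DustData

variable {d : DustData}

namespace Admissible

theorem hasDerivAt_inverse_ray {σ b : ℝ → ℝ} {τ s : ℝ} (hb : Continuous b)
    (hσ : HasDerivAt σ s (b τ)) (hs : s ≠ 0) (h : ∀ᶠ t in 𝓝 τ, σ (b t) = t) :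
    HasDerivAt b s⁻¹ τ := HasDerivAt.of_local_left_inverse hb.continuousAt hσ hs h

/-- The inner boundary of the past of a point: an outgoing light ray, continued by the centre. -/
theorem exists_inner_boundary (hd : d.Admissible) (hn : d.GloballyNaked) {τ₁ R₁ : ℝ}
    (h : (τ₁, R₁) ∈ d.D₂) (h0 : 0 < τ₁) (hR : 0 < R₁) :
    ∃ (τs : ℝ) (b : ℝ → ℝ), Continuous b ∧ b τ₁ = R₁ ∧
      (∀ τ ∈ Icc 0 τ₁, b τ ∈ Icc 0 R₁ ∧ ∀ R, b τ ≤ R → (τ, R) ∈ d.D₂) ∧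
      ∀ τ ∈ Ioo 0 τ₁, τ ≠ τs → (b τ = 0 ∧ HasDerivAt b 0 τ) ∨
        (0 < b τ ∧ HasDerivAt b (d.w (b τ) / d.rp (τ, b τ)) τ) := by
  -- a monotone curve bounding the region
  have key : ∀ (ρ : ℝ) (σ : ℝ → ℝ), 0 ≤ ρ → ρ < R₁ → ContinuousOn σ (Icc ρ R₁) →
      (∀ x ∈ Ioo ρ R₁, d.IsRay x R₁ σ) → StrictMonoOn σ (Icc ρ R₁) → 0 ≤ σ ρ → σ R₁ = τ₁ →
      (σ ρ = 0 ∨ ρ = 0) →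
      (∀ R ∈ Icc ρ R₁, ∀ τ, 0 ≤ τ → τ ≤ σ R → (τ, R) ∈ d.D₂) →
      ∃ (τs : ℝ) (b : ℝ → ℝ), Continuous b ∧ b τ₁ = R₁ ∧
      (∀ τ ∈ Icc 0 τ₁, b τ ∈ Icc 0 R₁ ∧ ∀ R, b τ ≤ R → (τ, R) ∈ d.D₂) ∧
      ∀ τ ∈ Ioo 0 τ₁, τ ≠ τs → (b τ = 0 ∧ HasDerivAt b 0 τ) ∨
        (0 < b τ ∧ HasDerivAt b (d.w (b τ) / d.rp (τ, b τ)) τ) := by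
    intro ρ σ hρ hρR hc hray hm hσρ hσR hor hmem
    obtain ⟨b, hb, hb1, hb2, hb3⟩ := exists_continuous_inverse hρR.le hc hm
    rw [hσR] at hb1 hb3
    refine ⟨σ ρ, b, hb, hb3, fun τ hτ => ?_, fun τ hτ hne => ?_⟩
    · have hbm : b τ ∈ Icc ρ R₁ := by
        rcases le_total τ (σ ρ) with h1 | h1
        · rw [hb2 τ h1]; exact ⟨le_rfl, hρR.le⟩
        · exact (hb1 τ ⟨h1, hτ.2⟩).1
      refine ⟨⟨hρ.trans hbm.1, hbm.2⟩, fun R hbR => ?_⟩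
      rcases le_total R R₁ with hR1 | hR1
      · refine hmem R ⟨hbm.1.trans hbR, hR1⟩ τ hτ.1 ?_
        have h2 := hm.monotoneOn hbm ⟨hbm.1.trans hbR, hR1⟩ hbR
        rcases le_total τ (σ ρ) with h1 | h1
        · exact h1.trans (hm.monotoneOn ⟨le_rfl, hρR.le⟩ ⟨hbm.1.trans hbR, hR1⟩ (hbm.1.trans hbR))
        · rwa [(hb1 τ ⟨h1, hτ.2⟩).2] at h2
      · exact hd.D₂_outward hn h hR hR1 hτ.1 hτ.2
    · rcases lt_or_gt_of_ne hne with h1 | h1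
      · left
        have hρ0 : ρ = 0 := hor.resolve_left fun h' => by linarith [hτ.1]
        refine ⟨by rw [hb2 τ h1.le, hρ0], (hasDerivAt_const τ ρ).congr_of_eventuallyEq ?_⟩
        filter_upwards [gt_mem_nhds h1] with t ht using hb2 t ht.le
      · right
        obtain ⟨hbm, hσb⟩ := hb1 τ ⟨h1.le, hτ.2.le⟩
        have hlt1 : ρ < b τ := lt_of_le_of_ne hbm.1 fun h' => by rw [← h'] at hσb; linarith
        have hlt2 : b τ < R₁ := lt_of_le_of_ne hbm.2 fun h' => by
          rw [h', hσR] at hσb; linarith [hτ.2]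
        refine ⟨hρ.trans_lt hlt1, ?_⟩
        obtain ⟨x, hx1, hx2⟩ := exists_between hlt1
        have hr := hray x ⟨hx1, hx2.trans hlt2⟩
        have hD : (τ, b τ) ∈ d.D₂ := hmem _ hbm τ hτ.1.le hσb.ge
        have hder := (hr.null (b τ) ⟨hx2.le, hlt2.le⟩).hasDerivAt (Icc_mem_nhds hx2 hlt2)
        rw [hσb, ← hd.yE_eq_y hD.2.1 hD.2.2.1] at hder
        have hp : 0 < d.rp (τ, b τ) := hd.rp_pos hD
        have hw := hd.w_pos hD.1
        have := hasDerivAt_inverse_ray hb hder (div_pos hp hw).ne' (by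
          filter_upwards [Ioo_mem_nhds h1 hτ.2] with t ht using (hb1 t ⟨ht.1.le, ht.2.le⟩).2)
        rwa [inv_div] at this
  rcases hd.ray_dichotomy h0 h.2.2.1 with ⟨ρ, hρ, σ, hσ, hσ1, hσ0⟩ | ⟨σ, hσ1, hσ⟩
  · exact key ρ σ hρ.1.le hρ.2 (IsRay.continuousOn hσ)
      (fun x hx => IsRay.mono hσ hx.1.le le_rfl)
      (hd.isRay_strictMonoOn hρ.1.le hσ) hσ0.ge hσ1 (Or.inl hσ0)
      (fun R hRm τ h1 h2 => hd.mem_D₂_of_le_ray hn hρ.1 h0 h hσ hσ1 hRm h1 h2)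
  · have hm : StrictMonoOn σ (Ioc 0 R₁) := by
      intro x hx y hy hxy
      rcases hx.2.eq_or_lt with h1 | h1
      · linarith [hy.2]
      · exact hd.isRay_strictMonoOn hx.1.le (hσ x ⟨hx.1, h1⟩) ⟨le_rfl, hx.2⟩ ⟨hxy.le, hy.2⟩ hxy
    have hnn : ∀ x ∈ Ioc 0 R₁, 0 ≤ σ x := fun x hx =>
      ((hσ (x / 2) ⟨by linarith [hx.1], by linarith [hx.1, hx.2]⟩).mem x
        ⟨by linarith [hx.1], hx.2⟩).1
    obtain ⟨ρ₀, hρ₀, hlt⟩ := hd.exists_lt_tauS_zero hR (h.2.2.2 hR) hσ1 hσ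
    -- The limit of the ray at the centre. It lies below tauS 0, so the centre up to time L belongs
    -- to the development and can serve as the rest of the boundary.
    set L := sInf (σ '' Ioc 0 R₁) with hL
    have hbdd : BddBelow (σ '' Ioc 0 R₁) := ⟨0, by rintro _ ⟨x, hx, rfl⟩; exact hnn x hx⟩
    have hne : (σ '' Ioc 0 R₁).Nonempty := ⟨_, R₁, ⟨hR, le_rfl⟩, rfl⟩
    have hLle : ∀ x ∈ Ioc 0 R₁, L ≤ σ x := fun x hx => csInf_le hbdd ⟨x, hx, rfl⟩
    have hLlt : ∀ x ∈ Ioc 0 R₁, L < σ x := fun x hx =>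
      (hLle (x / 2) ⟨by linarith [hx.1], by linarith [hx.1, hx.2]⟩).trans_lt
        (hm ⟨by linarith [hx.1], by linarith [hx.1, hx.2]⟩ hx (by linarith [hx.1]))
    have hL0 : 0 ≤ L := le_csInf hne (by rintro _ ⟨x, hx, rfl⟩; exact hnn x hx)
    set σ' : ℝ → ℝ := fun x => if x ≤ 0 then L else σ x with hσ'
    have he : ∀ x, 0 < x → σ' x = σ x := fun x hx => by simp [hσ', hx]
    have he0 : σ' 0 = L := by simp [hσ']
    have hray' : ∀ x ∈ Ioo 0 R₁, d.IsRay x R₁ σ' := by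
      intro x hx
      have h1 := hσ x hx
      refine ⟨fun R hRm => ?_, fun R hRm => ?_⟩
      · rw [he R (hx.1.trans_le hRm.1)]; exact h1.mem R hRm
      · rw [he R (hx.1.trans_le hRm.1)]
        exact (h1.null R hRm).congr (fun y hy => he y (hx.1.trans_le hy.1))
          (he R (hx.1.trans_le hRm.1))
    have hm' : StrictMonoOn σ' (Icc 0 R₁) := by
      intro x hx y hy hxy
      have hy0 : 0 < y := hx.1.trans_lt hxy
      rw [he y hy0]
      rcases hx.1.eq_or_lt with h1 | h1
      · rw [← h1, he0]; exact hLlt y ⟨hy0, hy.2⟩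
      · rw [he x h1]; exact hm ⟨h1, hx.2⟩ ⟨hy0, hy.2⟩ hxy
    have hcont : ContinuousOn σ' (Icc 0 R₁) := by
      intro x hx
      rcases hx.1.eq_or_lt with h1 | h1
      · rw [← h1]
        rw [ContinuousWithinAt, he0, Metric.tendsto_nhds]
        intro ε hε
        obtain ⟨_, ⟨y, hy, rfl⟩, hyε⟩ := exists_lt_of_csInf_lt hne (show L < L + ε by linarith)
        filter_upwards [self_mem_nhdsWithin, mem_nhdsWithin_of_mem_nhds (gt_mem_nhds hy.1)]
          with t ht hty
        have h2 : L ≤ σ' t := by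
          rw [← he0]; exact hm'.monotoneOn ⟨le_rfl, hR.le⟩ ht ht.1
        have h3 : σ' t < σ' y := hm' ht ⟨hy.1.le, hy.2⟩ hty
        rw [he y hy.1] at h3
        rw [Real.dist_eq, abs_of_nonneg (by linarith)]
        linarith
      · have h2 : x / 2 ∈ Ioo 0 R₁ := ⟨by linarith, by linarith [hx.2]⟩
        have h3 := IsRay.continuousOn (hray' _ h2) x ⟨by linarith, hx.2⟩
        refine h3.mono_of_mem_nhdsWithin ?_
        filter_upwards [self_mem_nhdsWithin,
          mem_nhdsWithin_of_mem_nhds (lt_mem_nhds (show x / 2 < x by linarith))] with t ht ht2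
        exact ⟨ht2.le, ht.2⟩
    refine key 0 σ' le_rfl hR hcont hray' hm' (by rw [he0]; exact hL0) (by rw [he R₁ hR, hσ1])
      (Or.inr rfl) ?_
    intro R hRm τ h1 h2
    rcases hRm.1.eq_or_lt with h3 | h3
    · rw [← h3] at h2 ⊢
      rw [he0] at h2
      exact hd.slab_subset hn le_rfl h1
        ((h2.trans (hLle ρ₀ ⟨hρ₀.1, hρ₀.2.le⟩)).trans_lt hlt)
    · rw [he R h3] at h2
      have h4 : R / 2 ∈ Ioo 0 R₁ := ⟨by linarith, by linarith [hRm.2]⟩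
      exact hd.mem_D₂_of_le_ray hn h4.1 h0 h (hσ _ h4) hσ1 ⟨by linarith, hRm.2⟩ h1 h2

/-- Uniform bounds for the coefficients of the energy estimate. -/
theorem energy_geometry (hd : d.Admissible) (hn : d.GloballyNaked) :
    ∃ δ > 0, ∃ C > 0, ∀ z ∈ d.D₂, 0 < z.2 → d.sf z < d.w z.2 ∧ δ ≤ 2 * (d.w z.2 * (d.w z.2 - d.sf z)) ∧
      (z.2 ≤ d.Rs → 4 * Real.pi * (d.ρ₀ z.2 * z.2 ^ 2) / (d.rr z * d.rp z)
        * (|z.1 - d.tauS 0| ^ (1 / 6 : ℝ)) ^ 5 ≤ C * (d.w z.2 - d.sf z)) := by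
  obtain ⟨δ, hδ, hδ1, hunt⟩ := hd.uniformly_untrapped hn
  obtain ⟨C, hC, hkap⟩ := hd.kap_bound hn
  refine ⟨δ, hδ, 2 * C / δ, by positivity, fun z hz hR => ?_⟩
  have ht := hd.D₂_subset_tDom hz
  have hw := hd.w_pos hz.1
  have hw1 := hd.w_le_one z.2
  have hs := hd.sf_pos ht hR
  have hy := (hd.yE_mem hz).1
  have h1 := hunt z.1 z.2 hz hR
  rw [← hd.yE_eq_y hz.2.1 hz.2.2.1] at h1
  -- Uniform untrappedness read through s² = w² - 1 + 2m/r. Since w ≤ 1, the bound on w² - s² passes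
  -- to w - s and to w (w - s).
  have h2 : d.sf z ^ 2 ≤ d.w z.2 ^ 2 - δ := by
    have h3 := hd.infall_sq (hd.yE_spec ht).1 hz.1
    have h4 : z.2 ^ 2 * d.c z.2 / d.yE z.1 z.2 ^ 2 ≤ 1 - δ := by
      rw [div_le_iff₀ (by positivity)]; exact h1
    unfold sf
    linarith
  have hlt : d.sf z < d.w z.2 := by nlinarith
  have h5 : δ ≤ 2 * (d.w z.2 * (d.w z.2 - d.sf z)) := by nlinarith
  refine ⟨hlt, h5, fun hRs => ?_⟩
  have h6 := hkap z.1 z.2 hz hR hRs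
  have h7 : kap d z.1 z.2 = 4 * Real.pi * (d.ρ₀ z.2 * z.2 ^ 2) / (d.rr z * d.rp z) := by
    rw [kap, ← hd.yE_eq_y hz.2.1 hz.2.2.1, rr, rp]
  rw [← h7]
  have h8 : δ / 2 ≤ d.w z.2 - d.sf z := by nlinarith
  calc _ ≤ C := h6
    _ = 2 * C / δ * (δ / 2) := by field_simp
    _ ≤ _ := mul_le_mul_of_nonneg_left h8 (by positivity)

/-- At fixed τ, ∂y/∂R = ySpeed · R · tauK ≥ 0: outer shells have collapsed less. -/
theorem y_mono_radius (hd : d.Admissible) {τ R R' : ℝ} (hR : 0 ≤ R) (hRR : R ≤ R') (h0 : 0 ≤ τ)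
    (h1 : τ < d.tauS R) : d.y τ R ≤ d.y τ R' := by
  have hS : ∀ x ∈ Icc R R', τ < d.tauS x := fun x hx =>
    h1.trans_le (hd.strictMonoOn_tauS.monotoneOn hR (hR.trans hx.1) hx.1)
  have hmono : MonotoneOn (fun x => d.yE τ x) (Icc R R') := by
    have hder : ∀ x ∈ Icc R R', HasDerivAt (fun x => d.yE τ x)
      (d.ySpeed (d.yE τ x) x * (x * d.tauK (d.yE τ x) x)) x := fun x hx =>
        hd.hasDerivAt_yE_radius (hd.mem_tDom h0 (hS x hx))
    refine monotoneOn_of_deriv_nonneg (convex_Icc R R')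
      (fun x hx => (hder x hx).continuousAt.continuousWithinAt)
      (fun x hx => (hder x (interior_subset hx)).differentiableAt.differentiableWithinAt) ?_
    intro x hx
    have hx' := interior_subset hx
    rw [(hder x hx').deriv, hd.yE_eq_y h0 (hS x hx')]
    have hy := hd.y_mem h0 (hS x hx')
    have h2 := hd.ySpeed_pos (hd.mem_yDom (R := x) hy)
    have h3 := hd.tauK_nonneg (R := x) ⟨hy.1.le, hy.2⟩ (hR.trans hx'.1)
    have := hR.trans hx'.1
    positivity
  have := hmono ⟨le_rfl, hRR⟩ ⟨hRR, le_rfl⟩ hRR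
  simp only at this
  rwa [hd.yE_eq_y h0 (hS R ⟨le_rfl, hRR⟩), hd.yE_eq_y h0 (hS R' ⟨hRR, le_rfl⟩)] at this

end Admissible

end DustData

/-- In the bulk term ∂_τ e is replaced by ∂_R j + s, and the divergence is integrated to the two
endpoints. -/
theorem hasDerivAt_integral_of_balance {e j s : ℝ × ℝ → ℝ} {a b : ℝ → ℝ} {a' b' τ : ℝ}
    (hab : b τ ≤ a τ) (he : ∀ R ∈ Icc (b τ) (a τ), ContDiffAt ℝ 1 e (τ, R))
    (hs : ContinuousOn (fun R => s (τ, R)) (Icc (b τ) (a τ)))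
    (hj : ContinuousOn (fun R => j (τ, R)) (Icc (b τ) (a τ)))
    (hbal : ∀ R ∈ Ioo (b τ) (a τ),
      HasDerivAt (fun x => j (τ, x)) (fderiv ℝ e (τ, R) (1, 0) - s (τ, R)) R)
    (ha : HasDerivAt a a' τ) (hb : HasDerivAt b b' τ) :
    HasDerivAt (fun t => ∫ R in b t..a t, e (t, R))
      ((∫ R in b τ..a τ, s (τ, R)) + (e (τ, a τ) * a' + j (τ, a τ))
        - (e (τ, b τ) * b' + j (τ, b τ))) τ := by
  refine (hasDerivAt_integral_moving hab he ha hb).congr_deriv ?_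
  have hce : ContinuousOn (fun R => fderiv ℝ e (τ, R) (1, 0)) (Icc (b τ) (a τ)) := by
    intro R hR
    have h1 := (he R hR).fderiv_right (m := 0) (by norm_num)
    have h2 : ContinuousAt (fun R => fderiv ℝ e (τ, R)) R :=
      ContinuousAt.comp (f := fun R => (τ, R)) h1.continuousAt (by fun_prop)
    exact (h2.clm_apply continuousAt_const).continuousWithinAt
  have his := (hs.mono (uIcc_of_le hab).subset).intervalIntegrable (μ := volume)
  have hie := (hce.mono (uIcc_of_le hab).subset).intervalIntegrable (μ := volume)
  have hftc := intervalIntegral.integral_eq_sub_of_hasDerivAt_of_le hab hj hbal (hie.sub his)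
  have hsub := intervalIntegral.integral_sub hie his
  linear_combination hftc - hsub

/-! ### The pointwise bound for a single mode -/

theorem abs_le_add_of_sq_le {x a b : ℝ} (ha : 0 ≤ a) (hb : 0 ≤ b) (h : x ^ 2 ≤ 4 * a * b) :
    |x| ≤ a + b :=
  abs_le_of_sq_le_sq (h.trans (by nlinarith [sq_nonneg (a - b)])) (by positivity)

namespace DustData

variable {d : DustData}

namespace Admissible

variable {μ lam : ℝ} {u ut uR : ℝ × ℝ → ℝ}

theorem energy_nonneg' (hd : d.Admissible) (hlam : 0 ≤ lam) {z : ℝ × ℝ} (hz : z ∈ d.D₂)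
    (hR : 0 < z.2) (hsw : d.sf z < d.w z.2) : 0 ≤ d.energy μ lam u ut uR z :=
  energy_nonneg (hd.rp_pos hz) (hd.w_pos hz.1) (hd.sf_pos (hd.D₂_subset_tDom hz) hR).le hsw.le
    (by positivity)

/-- The time derivative of the energy in a domain with moving boundary. -/
theorem hasDerivAt_total_energy (hd : d.Admissible) (hn : d.GloballyNaked)
    (hu : IsMode d μ lam u ut uR) {a b : ℝ → ℝ} {a' b' τ : ℝ} (h0 : 0 < τ) (hb0 : 0 ≤ b τ)
    (hab : b τ ≤ a τ) (hD : ∀ R ∈ Icc (b τ) (a τ), (τ, R) ∈ d.D₂)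
    (ha : HasDerivAt a a' τ) (hb : HasDerivAt b b' τ) :
    HasDerivAt (fun t => ∫ R in b t..a t, d.energy μ lam u ut uR (t, R))
      ((∫ R in b τ..a τ, d.source ut uR (τ, R))
        + (d.energy μ lam u ut uR (τ, a τ) * a' + d.flux μ lam u ut uR (τ, a τ))
        - (d.energy μ lam u ut uR (τ, b τ) * b' + d.flux μ lam u ut uR (τ, b τ))) τ := by
  have hpr : ContinuousOn (fun R : ℝ => (τ, R)) (Icc (b τ) (a τ)) := by fun_prop
  have hj : ∀ R ∈ Ioo (b τ) (a τ), HasDerivAt (fun x => d.flux μ lam u ut uR (τ, x))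
      (fderiv ℝ (d.energy μ lam u ut uR) (τ, R) (1, 0) - d.source ut uR (τ, R)) R := fun R hR =>
    hd.hasDerivAt_flux hn hu (z := (τ, R)) (hD R ⟨hR.1.le, hR.2.le⟩) h0 (hb0.trans_lt hR.1)
  exact hasDerivAt_integral_of_balance hab
    (fun R hR => hd.contDiffAt_energy hn hu (z := (τ, R)) (hD R hR) h0)
    ((hd.continuousOn_source hu).comp hpr hD) ((hd.continuousOn_flux hu).comp hpr hD) hj ha hb

set_option maxHeartbeats 1000000 in
/-- Boundedness of a mode in terms of its initial energy and initial values. -/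
theorem mode_bound (hd : d.Admissible) (hn : d.GloballyNaked) :
    ∃ C > 0, ∀ (μ lam : ℝ), 0 ≤ lam → ∀ (u ut uR : ℝ × ℝ → ℝ), IsMode d μ lam u ut uR →
      ∀ (E₀ N t : ℝ), 0 < t →
      (∀ b a, 0 ≤ b → b ≤ a → ∫ R in b..a, d.energy μ lam u ut uR (0, R) ≤ E₀) →
      (∀ R, 0 ≤ R → √R * |u (0, R)| ≤ N) →
      ∀ z ∈ d.D₂, 0 < z.1 → 0 < z.2 → √(d.rr z) * |u z| ≤ C * (t + E₀ / t) + N := by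
  obtain ⟨δ, hδ, C, hC, hgeo⟩ := hd.energy_geometry hn
  have hS0 : 0 < d.tauS d.Rs := hd.tauS_pos d.Rs
  -- The weight is frozen after all shells of the cloud have collapsed, when only vacuum is left in
  -- the development and the source vanishes.
  obtain ⟨K, B, hKc, hKB, hKd⟩ := exists_gronwall_weight hC (t₀ := d.tauS 0) hS0.le
  set c₀ := Real.exp (-B) with hc₀
  have hc₀pos : 0 < c₀ := Real.exp_pos _
  set A := 4 / δ with hA
  have hApos : 0 < A := by positivity
  refine ⟨A / 2 + Real.exp B / (2 * c₀), by positivity, ?_⟩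
  rintro μ lam hlam u ut uR hu E₀ N t ht hE₀ hN ⟨τ₁, R₁⟩ hz h0 hR
  dsimp only at h0 hR
  obtain ⟨τs, b, hbc, hb1, hbm, hbd⟩ := hd.exists_inner_boundary hn hz h0 hR
  have hy₁ := hd.yE_mem hz
  set y₁ := d.yE τ₁ R₁ with hy₁def
  change y₁ ∈ Ioc (0 : ℝ) 1 at hy₁
  -- Earlier times and larger radii only increase y, so on the outer curve r' ≥ y² ≥ y₁². With w ≤ 1
  -- this bounds the light speed w/r' there by V.
  set V := 1 / y₁ ^ 2 with hV
  have hVpos : 0 < V := by have := hy₁.1; positivity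
  set a : ℝ → ℝ := fun τ => R₁ + V * (τ₁ - τ) with ha
  have haR : ∀ τ ∈ Icc 0 τ₁, R₁ ≤ a τ := fun τ hτ => by
    have := mul_nonneg hVpos.le (sub_nonneg.2 hτ.2); simp only [ha]; linarith
  have hac : Continuous a := by fun_prop
  have had : ∀ τ, HasDerivAt a (-V) τ := fun τ => by
    have := (((hasDerivAt_id' τ).const_sub τ₁).const_mul V).const_add R₁
    exact this.congr_deriv (by ring)
  have hab : ∀ τ ∈ Icc 0 τ₁, b τ ≤ a τ := fun τ hτ => (hbm τ hτ).1.2.trans (haR τ hτ)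
  have hD : ∀ τ ∈ Icc 0 τ₁, ∀ R ∈ Icc (b τ) (a τ), (τ, R) ∈ d.D₂ := fun τ hτ R hR =>
    (hbm τ hτ).2 R hR.1
  have haD : ∀ τ ∈ Icc 0 τ₁, (τ, a τ) ∈ d.D₂ := fun τ hτ => hD τ hτ _ ⟨hab τ hτ, le_rfl⟩
  have ha0 : ∀ τ ∈ Icc 0 τ₁, 0 < a τ := fun τ hτ => hR.trans_le (haR τ hτ)
  -- the outer boundary is spacelike
  have hVγ : ∀ τ ∈ Icc 0 τ₁, d.w (a τ) / d.rp (τ, a τ) ≤ V := by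
    intro τ hτ
    have hm := haD τ hτ
    have hyle : y₁ ≤ d.yE τ (a τ) := by
      rw [hy₁def, hd.yE_eq_y hz.2.1 hz.2.2.1, hd.yE_eq_y hm.2.1 hm.2.2.1]
      have h1 : τ < d.tauS R₁ := hτ.2.trans_lt hz.2.2.1
      exact ((hd.y_le_y_iff hz.2.1 hz.2.2.1 hτ.1 h1).2 hτ.2).trans
        (hd.y_mono_radius hR.le (haR τ hτ) hτ.1 h1)
    have h3 : d.yE τ (a τ) ^ 2 ≤ d.rR (d.yE τ (a τ)) (a τ) :=
      hd.sq_le_rR (hd.yE_mem (z := (τ, a τ)) hm) (ha0 τ hτ).le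
    have h2 : y₁ ^ 2 ≤ d.rp (τ, a τ) := (pow_le_pow_left₀ hy₁.1.le hyle 2).trans h3
    have hy2 : 0 < y₁ ^ 2 := pow_pos hy₁.1 2
    exact div_le_div₀ zero_le_one (hd.w_le_one _) hy2 h2
  set e := d.energy μ lam u ut uR with he
  set j := d.flux μ lam u ut uR with hj
  set E : ℝ → ℝ := fun τ => ∫ R in b τ..a τ, e (τ, R) with hE
  have hEc : ContinuousOn E (Icc 0 τ₁) := continuousOn_integral_moving hac.continuousOn
    hbc.continuousOn hab (hd.continuousOn_energy hu) hD
  have haz : a τ₁ = R₁ := by simp [ha]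
  have hE1 : E τ₁ = 0 := by simp [hE, haz, hb1]
  have h0m : (0 : ℝ) ∈ Icc 0 τ₁ := ⟨le_rfl, h0.le⟩
  have h1m : τ₁ ∈ Icc 0 τ₁ := ⟨h0.le, le_rfl⟩
  have hE00 : E 0 ≤ E₀ := hE₀ _ _ (hbm 0 h0m).1.1 (hab 0 h0m)
  set r₁ := d.rr (τ₁, R₁) with hr₁
  have hr₁pos : 0 < r₁ := hd.rr_pos (hd.D₂_subset_tDom hz) hR
  -- With this weight the two contributions θ/r₁ and E₀/θ both scale like 1/√r₁, which is the decay
  -- asserted.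
  set θ := t * √r₁ with hθ
  have hsr := Real.sqrt_pos.2 hr₁pos
  have hθpos : 0 < θ := by positivity
  -- the decreasing functional
  have main : ∀ ε : ℝ, |ε| = 1 → ε * (u (τ₁, R₁) - u (0, a 0)) ≤
      θ * A / 2 / r₁ + Real.exp B / (2 * θ * c₀) * E₀ := by
    intro ε hε
    -- The derivative of ε u along the outer curve is compensated by those of -(θA/2)/r and of the
    -- weighted energy, so H is nonincreasing. The signs ε = ±1 give the two sides of the estimate.
    set H : ℝ → ℝ := fun τ => ε * u (τ, a τ) + (-(θ * A / 2)) * (d.rr (τ, a τ))⁻¹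
      + 1 / (2 * θ * c₀) * (E τ * Real.exp (-K τ)) with hH
    have hpa : ContinuousOn (fun τ : ℝ => (τ, a τ)) (Icc 0 τ₁) := by fun_prop
    have hHc : ContinuousOn H (Icc 0 τ₁) := by
      have h1 : ContinuousOn (fun τ => u (τ, a τ)) (Icc 0 τ₁) := hu.cont.comp hpa haD
      have h2 : ContinuousOn (fun τ => (d.rr (τ, a τ))⁻¹) (Icc 0 τ₁) :=
        (hd.continuousOn_geometry.1.comp hpa haD).inv₀ fun τ hτ =>
          (hd.rr_pos (hd.D₂_subset_tDom (haD τ hτ)) (ha0 τ hτ)).ne'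
      exact ((continuousOn_const.mul h1).add (continuousOn_const.mul h2)).add
        (continuousOn_const.mul (hEc.mul (Real.continuous_exp.comp hKc.neg).continuousOn))
    have hle : H τ₁ ≤ H 0 := by
      -- Exceptional times: the corner of the inner boundary, the central singularity, and the time
      -- at which the weight is frozen.
      refine le_of_deriv_nonpos_off_finite (S := {τs, d.tauS 0, d.tauS d.Rs}) (by simp) h0.le hHc ?_
      rintro τ ⟨hτ, hne⟩
      simp only [mem_insert_iff, mem_singleton_iff, not_or] at hne
      have hτm : τ ∈ Icc 0 τ₁ := ⟨hτ.1.le, hτ.2.le⟩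
      obtain ⟨k, hKk, hk0, hkC⟩ := hKd τ (by simp [hne.2.1, hne.2.2])
      have hza := haD τ hτm
      have hta := hd.D₂_subset_tDom hza
      obtain ⟨hsw, hδw, -⟩ := hgeo _ hza (ha0 τ hτm)
      dsimp only at hsw hδw
      have hra : 0 < d.rr (τ, a τ) := hd.rr_pos hta (ha0 τ hτm)
      have hpp := hd.rp_pos hza
      have hww := hd.w_pos hza.1
      have hss := hd.sf_pos hta (ha0 τ hτm)
      dsimp only at hww
      have hpath : HasDerivAt (fun τ : ℝ => (τ, a τ)) ((1 : ℝ), -V) τ :=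
        (hasDerivAt_id' τ).prodMk (had τ)
      have hU := (hd.hasFDerivAt_mode hn hu (mem_Dx hza hτ.1)).comp_hasDerivAt
        (f := fun τ : ℝ => (τ, a τ)) τ hpath
      have hrd := (hd.hasFDerivAt_rr hta).comp_hasDerivAt (f := fun τ : ℝ => (τ, a τ)) τ hpath
      -- the bulk term
      have hsrc : (∫ R in b τ..a τ, d.source ut uR (τ, R)) ≤ k * E τ := by
        rw [hE, ← intervalIntegral.integral_const_mul]
        have hpr : ContinuousOn (fun R : ℝ => (τ, R)) (Icc (b τ) (a τ)) := by fun_prop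
        refine intervalIntegral.integral_mono_on_of_le_Ioo (hab τ hτm) ?_ ?_ ?_
        · exact (((hd.continuousOn_source hu).comp hpr (hD τ hτm)).mono
            (uIcc_of_le (hab τ hτm)).subset).intervalIntegrable
        · exact ((((hd.continuousOn_energy hu).comp hpr (hD τ hτm)).mono
            (uIcc_of_le (hab τ hτm)).subset).intervalIntegrable).const_mul _
        · intro R hRm
          have hzR := hD τ hτm R ⟨hRm.1.le, hRm.2.le⟩
          have hR0 : 0 < R := (hbm τ hτm).1.1.trans_lt hRm.1
          obtain ⟨h1, h2, h3⟩ := hgeo _ hzR hR0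
          dsimp only at h1 h2 h3
          have hppR := hd.rp_pos hzR
          have hrrR : 0 < d.rr (τ, R) := hd.rr_pos (hd.D₂_subset_tDom hzR) hR0
          -- Outside the cloud there is no source. Inside, τ < tauS R < tauS Rs, so the weight is
          -- still active.
          rcases le_or_gt d.Rs R with hc | hc
          · have hzero : d.source ut uR (τ, R) = 0 := by
              simp [source, hd.density_zero R hc]
            rw [hzero]
            exact mul_nonneg hk0 (hd.energy_nonneg' hlam hzR hR0 h1)
          · refine source_le_energy hrrR hppR (hd.w_pos hR0.le)
              (hd.sf_pos (hd.D₂_subset_tDom hzR) hR0).le (by positivity)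
              (by have := hd.density_pos R hR0.le hc; positivity) ?_ h1
            have hτS : τ < d.tauS d.Rs :=
              (show τ < d.tauS R from hzR.2.2.1).trans
                (hd.strictMonoOn_tauS hR0.le (hR0.trans hc).le hc)
            have hx : 0 < |τ - d.tauS 0| := abs_pos.2 (sub_ne_zero.2 hne.2.1)
            have hx5 : 0 < (|τ - d.tauS 0| ^ (1 / 6 : ℝ)) ^ 5 := by positivity
            calc _ ≤ C * (d.w R - d.sf (τ, R)) / (|τ - d.tauS 0| ^ (1 / 6 : ℝ)) ^ 5 := by
                  rw [le_div_iff₀ hx5]; exact h3 hc.le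
              _ = C / (|τ - d.tauS 0| ^ (1 / 6 : ℝ)) ^ 5 * (d.w R - d.sf (τ, R)) := by ring
              _ ≤ _ := mul_le_mul_of_nonneg_right (hkC hτS) (sub_pos.2 h1).le
      -- The energy leaving through the outer curve. Its coercive bound `hFU` involves s + r' V,
      -- which is -dr/dτ along this curve.
      set F := V * e (τ, a τ) - j (τ, a τ) with hF
      have hFU : (ut (τ, a τ) - V * uR (τ, a τ)) ^ 2 * (d.rr (τ, a τ) ^ 2 *
          (d.w (a τ) * (d.w (a τ) - d.sf (τ, a τ)))) ≤
          2 * (d.sf (τ, a τ) + d.rp (τ, a τ) * V) * F :=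
        sq_deriv_le_flux hra hpp hww hss.le hsw (by positivity) (hVγ τ hτm)
      have hpos1 : 0 < d.sf (τ, a τ) + d.rp (τ, a τ) * V := by positivity
      have hF0 : 0 ≤ F := by
        have h1 := sub_pos.2 hsw
        have h2 : 0 ≤ 2 * (d.sf (τ, a τ) + d.rp (τ, a τ) * V) * F := le_trans (by positivity) hFU
        exact nonneg_of_mul_nonneg_right h2 (by positivity)
      -- the derivative of the energy
      obtain ⟨E', hE'd, hE'le⟩ : ∃ E', HasDerivAt E E' τ ∧ E' ≤ k * E τ - F := by
        rcases hbd τ hτ hne.1 with ⟨hb0, hbder⟩ | ⟨hb0, hbder⟩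
        · refine ⟨_, hd.hasDerivAt_total_energy hn hu hτ.1 (hbm τ hτm).1.1 (hab τ hτm)
            (hD τ hτm) (had τ) hbder, ?_⟩
          -- At the regular centre r and s vanish, so there is no flux.
          have hj0 : j (τ, b τ) = 0 := by
            rw [hb0]
            simp [hj, flux, jForm, rr, sf, infall]
          rw [← he, ← hj, hj0]
          linarith
        · refine ⟨_, hd.hasDerivAt_total_energy hn hu hτ.1 (hbm τ hτm).1.1 (hab τ hτm)
            (hD τ hτm) (had τ) hbder, ?_⟩
          have hzb := hD τ hτm _ ⟨le_rfl, hab τ hτm⟩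
          obtain ⟨h1, -, -⟩ := hgeo _ hzb hb0
          have h2 : 0 ≤ d.w (b τ) / d.rp (τ, b τ) * e (τ, b τ) + j (τ, b τ) :=
            neg_flux_le (hd.rp_pos hzb) (hd.sf_pos (hd.D₂_subset_tDom hzb) hb0).le h1.le
              (by positivity)
          rw [← he, ← hj]
          linarith
      have hHd := ((hU.const_mul ε).add ((hrd.inv hra.ne').const_mul (-(θ * A / 2)))).add
        ((hE'd.mul (hKk.neg.exp)).const_mul (1 / (2 * θ * c₀)))
      refine ⟨_, hHd, ?_⟩
      simp only [add_apply, smul_apply, ContinuousLinearMap.coe_fst',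
        ContinuousLinearMap.coe_snd', smul_eq_mul, mul_one, Function.comp_apply, Pi.neg_apply]
      set U' := ut (τ, a τ) + uR (τ, a τ) * -V with hU'
      set S := d.sf (τ, a τ) + d.rp (τ, a τ) * V with hS
      set r := d.rr (τ, a τ)
      have hexp : c₀ ≤ Real.exp (-K τ) :=
        Real.exp_le_exp.2 (neg_le_neg ((abs_le.1 (hKB τ hτ.1.le)).2))
      have hlast : 1 / (2 * θ * c₀) * (E' * Real.exp (-K τ) + E τ * (Real.exp (-K τ) * -k)) ≤
          -(F / (2 * θ)) := by
        have h1 : E' * Real.exp (-K τ) + E τ * (Real.exp (-K τ) * -k) ≤ -(F * c₀) := by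
          have h2 : (E' - k * E τ) * Real.exp (-K τ) ≤ -F * Real.exp (-K τ) :=
            mul_le_mul_of_nonneg_right (by linarith) (Real.exp_pos _).le
          have h3 : F * c₀ ≤ F * Real.exp (-K τ) := mul_le_mul_of_nonneg_left hexp hF0
          linarith
        calc _ ≤ 1 / (2 * θ * c₀) * -(F * c₀) := mul_le_mul_of_nonneg_left h1 (by positivity)
          _ = _ := by field_simp
      have hUsq : U' ^ 2 * r ^ 2 ≤ A * S * F := by
        have h1 : (ut (τ, a τ) - V * uR (τ, a τ)) = U' := by rw [hU']; ring
        rw [h1] at hFU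
        have h2 : U' ^ 2 * r ^ 2 * (δ / 2) ≤ 2 * S * F := by
          refine le_trans ?_ hFU
          rw [← mul_assoc]
          exact mul_le_mul_of_nonneg_left (by linarith) (by positivity)
        rw [hA]
        have h3 : U' ^ 2 * r ^ 2 = 2 / δ * (U' ^ 2 * r ^ 2 * (δ / 2)) := by field_simp
        rw [h3]
        calc _ ≤ 2 / δ * (2 * S * F) := mul_le_mul_of_nonneg_left h2 (by positivity)
          _ = _ := by ring
      -- The geometric mean is split by θ: the first term is the derivative of a multiple of θ/r
      -- along the curve, the second is paid for by the loss of energy F.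
      have hUle : |U'| ≤ θ * A * S / (2 * r ^ 2) + F / (2 * θ) := by
        refine abs_le_add_of_sq_le (by positivity) (by positivity) ?_
        have h1 : U' ^ 2 ≤ A * S * F / r ^ 2 := (le_div_iff₀ (by positivity)).2 hUsq
        have h2 : A * S * F / r ^ 2 = 4 * (θ * A * S / (2 * r ^ 2)) * (F / (2 * θ)) := by
          field_simp; ring
        exact h1.trans_eq h2
      have hεU : ε * U' ≤ |U'| := by
        calc ε * U' ≤ |ε * U'| := le_abs_self _
          _ = |U'| := by rw [abs_mul, hε, one_mul]
      have hmid : -(θ * A / 2) * (-(-d.sf (τ, a τ) + d.rp (τ, a τ) * -V) / r ^ 2) =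
          -(θ * A * S / (2 * r ^ 2)) := by rw [hS]; field_simp; ring
      rw [hmid]
      linarith
    simp only [hH, haz, hE1, zero_mul, mul_zero, add_zero] at hle
    rw [← hr₁] at hle
    have hra0 : 0 < d.rr (0, a 0) := hd.rr_pos (hd.D₂_subset_tDom (haD 0 h0m)) (ha0 0 h0m)
    have h1 : 0 ≤ θ * A / 2 * (d.rr (0, a 0))⁻¹ := by positivity
    have hEnn : 0 ≤ E 0 := by
      refine intervalIntegral.integral_nonneg_of_ae_restrict (hab 0 h0m) ?_
      rw [← restrict_Ioo_eq_restrict_Icc]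
      refine (ae_restrict_iff' measurableSet_Ioo).2 (Eventually.of_forall fun R hRm => ?_)
      have hzR := hD 0 h0m R ⟨hRm.1.le, hRm.2.le⟩
      have hR0 : 0 < R := (hbm 0 h0m).1.1.trans_lt hRm.1
      exact hd.energy_nonneg' hlam hzR hR0 (hgeo _ hzR hR0).1
    have h2 : 1 / (2 * θ * c₀) * (E 0 * Real.exp (-K 0)) ≤ Real.exp B / (2 * θ * c₀) * E₀ := by
      have h3 : Real.exp (-K 0) ≤ Real.exp B :=
        Real.exp_le_exp.2 (neg_le.1 (abs_le.1 (hKB 0 le_rfl)).1)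
      have h4 : E 0 * Real.exp (-K 0) ≤ E₀ * Real.exp B :=
        mul_le_mul hE00 h3 (Real.exp_pos _).le (hEnn.trans hE00)
      calc _ ≤ 1 / (2 * θ * c₀) * (E₀ * Real.exp B) :=
            mul_le_mul_of_nonneg_left h4 (by positivity)
        _ = _ := by ring
    have h5 : θ * A / 2 / r₁ = θ * A / 2 * r₁⁻¹ := div_eq_mul_inv _ _
    rw [h5]
    linarith
  have habs : |u (τ₁, R₁) - u (0, a 0)| ≤ θ * A / 2 / r₁ + Real.exp B / (2 * θ * c₀) * E₀ := by
    have h1 := main 1 (by simp)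
    have h2 := main (-1) (by simp)
    exact abs_le.2 ⟨by linarith, by linarith⟩
  have h1 : √r₁ * |u (τ₁, R₁) - u (0, a 0)| ≤ (A / 2 + Real.exp B / (2 * c₀)) * (t + E₀ / t) := by
    have hE₀nn : 0 ≤ E₀ := by simpa using hE₀ 0 0 le_rfl le_rfl
    calc _ ≤ √r₁ * (θ * A / 2 / r₁ + Real.exp B / (2 * θ * c₀) * E₀) :=
          mul_le_mul_of_nonneg_left habs hsr.le
      _ = A / 2 * t + Real.exp B / (2 * c₀) * (E₀ / t) := by
          rw [hθ]
          have : √r₁ ^ 2 = r₁ := Real.sq_sqrt hr₁pos.le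
          conv_lhs => rw [← this]
          field_simp
          simp only [Real.sqrt_sq hsr.le]
          field_simp
      _ ≤ _ := by
          have : 0 ≤ A / 2 * (E₀ / t) := by positivity
          have : 0 ≤ Real.exp B / (2 * c₀) * t := by positivity
          nlinarith
  -- The weight r₁ ≤ R₁ ≤ a 0 is dominated by the radius of the initial point, so the bound on the
  -- initial values applies.
  have h2 : √r₁ * |u (0, a 0)| ≤ N := by
    refine le_trans ?_ (hN (a 0) (ha0 0 h0m).le)
    refine mul_le_mul_of_nonneg_right (Real.sqrt_le_sqrt ?_) (abs_nonneg _)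
    refine le_trans ?_ (haR 0 h0m)
    have h3 : y₁ ^ 2 ≤ 1 := pow_le_one₀ hy₁.1.le hy₁.2
    calc r₁ = R₁ * y₁ ^ 2 := rfl
      _ ≤ R₁ * 1 := mul_le_mul_of_nonneg_left h3 hR.le
      _ = R₁ := mul_one _
  have h3 : |u (τ₁, R₁)| ≤ |u (τ₁, R₁) - u (0, a 0)| + |u (0, a 0)| := by
    have := abs_add_le (u (τ₁, R₁) - u (0, a 0)) (u (0, a 0))
    rwa [sub_add_cancel] at this
  calc _ ≤ √r₁ * (|u (τ₁, R₁) - u (0, a 0)| + |u (0, a 0)|) :=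
        mul_le_mul_of_nonneg_left h3 hsr.le
    _ ≤ _ := by rw [mul_add]; exact add_le_add h1 h2

end Admissible

end DustData

/-! ### Spherical frames and the spherical Laplacian -/

/-- The unit vector with spherical coordinates `k = (θ, φ)` in the frame given by the rows of `Q`. -/
def omega (Q : Matrix (Fin 3) (Fin 3) ℝ) (k : ℝ × ℝ) : Fin 3 → ℝ :=
  (Real.sin k.1 * Real.cos k.2) • Q 0 + (Real.sin k.1 * Real.sin k.2) • Q 1 + Real.cos k.1 • Q 2

/-- The unit vector in the direction of increasing `θ`. -/
def omegaT (Q : Matrix (Fin 3) (Fin 3) ℝ) (k : ℝ × ℝ) : Fin 3 → ℝ :=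
  (Real.cos k.1 * Real.cos k.2) • Q 0 + (Real.cos k.1 * Real.sin k.2) • Q 1 + (-Real.sin k.1) • Q 2

/-- The unit vector in the direction of increasing `φ`. -/
def omegaP (Q : Matrix (Fin 3) (Fin 3) ℝ) (φ : ℝ) : Fin 3 → ℝ :=
  (-Real.sin φ) • Q 0 + Real.cos φ • Q 1

/-- The horizontal unit vector at longitude `φ`. -/
def horiz (Q : Matrix (Fin 3) (Fin 3) ℝ) (φ : ℝ) : Fin 3 → ℝ :=
  Real.cos φ • Q 0 + Real.sin φ • Q 1

section Frame

variable {Q : Matrix (Fin 3) (Fin 3) ℝ}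

theorem hasDerivAt_omega_fst (θ φ : ℝ) :
    HasDerivAt (fun t => omega Q (t, φ)) (omegaT Q (θ, φ)) θ := by
  have h1 := Real.hasDerivAt_sin θ
  have h2 := Real.hasDerivAt_cos θ
  exact (((h1.mul_const (Real.cos φ)).smul_const (Q 0)).add
    ((h1.mul_const (Real.sin φ)).smul_const (Q 1))).add (h2.smul_const (Q 2))

theorem hasDerivAt_omegaT (θ φ : ℝ) :
    HasDerivAt (fun t => omegaT Q (t, φ)) (-omega Q (θ, φ)) θ := by
  have h1 := Real.hasDerivAt_sin θ
  have h2 := Real.hasDerivAt_cos θ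
  refine ((((h2.mul_const (Real.cos φ)).smul_const (Q 0)).add
    ((h2.mul_const (Real.sin φ)).smul_const (Q 1))).add (h1.neg.smul_const (Q 2))).congr_deriv ?_
  simp only [omega]; module

theorem hasDerivAt_omega_snd (θ φ : ℝ) :
    HasDerivAt (fun t => omega Q (θ, t)) (Real.sin θ • omegaP Q φ) φ := by
  have h1 := Real.hasDerivAt_sin φ
  have h2 := Real.hasDerivAt_cos φ
  refine ((((h2.const_mul (Real.sin θ)).smul_const (Q 0)).add
    ((h1.const_mul (Real.sin θ)).smul_const (Q 1))).add_const (Real.cos θ • Q 2)).congr_deriv ?_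
  simp only [omegaP]; module

theorem hasDerivAt_omegaP (φ : ℝ) : HasDerivAt (fun t => omegaP Q t) (-horiz Q φ) φ := by
  have h1 := Real.hasDerivAt_sin φ
  have h2 := Real.hasDerivAt_cos φ
  refine ((h1.neg.smul_const (Q 0)).add (h2.smul_const (Q 1))).congr_deriv ?_
  simp only [horiz]; module

theorem cos_smul_omegaT_sub_horiz (θ φ : ℝ) :
    Real.cos θ • omegaT Q (θ, φ) - horiz Q φ = -(Real.sin θ • omega Q (θ, φ)) := by
  have h := Real.sin_sq_add_cos_sq θ
  ext i
  simp only [omegaT, horiz, omega, Pi.add_apply, Pi.sub_apply, Pi.smul_apply, Pi.neg_apply,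
    smul_eq_mul]
  linear_combination (Real.cos φ * Q 0 i + Real.sin φ * Q 1 i) * h

theorem contDiff_omega : ContDiff ℝ ∞ (omega Q) := by unfold omega; fun_prop

theorem contDiff_omegaT : ContDiff ℝ ∞ (omegaT Q) := by unfold omegaT; fun_prop

theorem contDiff_omegaP : ContDiff ℝ ∞ (omegaP Q) := by unfold omegaP; fun_prop

/-- The spherical frame is complete. -/
theorem frame_complete (hQ : Q * Q.transpose = 1) (k : ℝ × ℝ) (i j : Fin 3) :
    omega Q k i * omega Q k j + omegaT Q k i * omegaT Q k j + omegaP Q k.2 i * omegaP Q k.2 j =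
      if i = j then 1 else 0 := by
  have h1 : Q.transpose * Q = 1 := mul_eq_one_comm.1 hQ
  have h2 := congrFun (congrFun h1 i) j
  rw [Matrix.mul_apply, Fin.sum_univ_three, Matrix.one_apply] at h2
  simp only [Matrix.transpose_apply] at h2
  rw [← h2]
  have ht := Real.sin_sq_add_cos_sq k.1
  have hp := Real.sin_sq_add_cos_sq k.2
  simp only [omega, omegaT, omegaP, Pi.add_apply, Pi.smul_apply, smul_eq_mul]
  generalize Real.sin k.1 = s at *
  generalize Real.cos k.1 = c at *
  generalize Real.sin k.2 = S at *
  generalize Real.cos k.2 = C at *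
  linear_combination (C ^ 2 * Q 0 i * Q 0 j + C * S * (Q 0 i * Q 1 j + Q 1 i * Q 0 j)
    + S ^ 2 * Q 1 i * Q 1 j + Q 2 i * Q 2 j) * ht + (Q 0 i * Q 0 j + Q 1 i * Q 1 j) * hp

theorem sum_sq_omega (hQ : Q * Q.transpose = 1) (k : ℝ × ℝ) : ∑ i, omega Q k i ^ 2 = 1 := by
  have h : ∀ a b, ∑ i, Q a i * Q b i = if a = b then 1 else 0 := fun a b => by
    have := congrFun (congrFun hQ a) b
    rwa [Matrix.mul_apply, Matrix.one_apply] at this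
  have h00 := h 0 0
  have h11 := h 1 1
  have h22 := h 2 2
  have h01 := h 0 1
  have h02 := h 0 2
  have h12 := h 1 2
  have ht := Real.sin_sq_add_cos_sq k.1
  have hp := Real.sin_sq_add_cos_sq k.2
  simp only [omega, Pi.add_apply, Pi.smul_apply, smul_eq_mul, Fin.sum_univ_three] at *
  simp at h00 h11 h22 h01 h02 h12
  generalize Real.sin k.1 = s at *
  generalize Real.cos k.1 = c at *
  generalize Real.sin k.2 = S at *
  generalize Real.cos k.2 = C at *
  linear_combination (s * C) ^ 2 * h00 + (s * S) ^ 2 * h11 + c ^ 2 * h22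
    + 2 * (s * C) * (s * S) * h01 + 2 * (s * C) * c * h02 + 2 * (s * S) * c * h12
    + s ^ 2 * hp + ht

theorem bilin_expand (B : (Fin 3 → ℝ) →L[ℝ] (Fin 3 → ℝ) →L[ℝ] ℝ) (v w : Fin 3 → ℝ) :
    B v w = ∑ i, ∑ j, v i * w j * B (Pi.single i 1) (Pi.single j 1) := by
  have hv : v = ∑ i, v i • (Pi.single i (1 : ℝ) : Fin 3 → ℝ) := by
    ext i; simp [Finset.sum_apply, Pi.single_apply]
  have hw : w = ∑ i, w i • (Pi.single i (1 : ℝ) : Fin 3 → ℝ) := by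
    ext i; simp [Finset.sum_apply, Pi.single_apply]
  conv_lhs => rw [hv, hw]
  simp only [map_sum, map_smul, sum_apply, smul_apply, smul_eq_mul,
    Finset.mul_sum]
  rw [Finset.sum_comm]
  refine Finset.sum_congr rfl fun i _ => Finset.sum_congr rfl fun j _ => by ring

/-- The trace of a bilinear form in the spherical frame. -/
theorem trace_frame (hQ : Q * Q.transpose = 1) (B : (Fin 3 → ℝ) →L[ℝ] (Fin 3 → ℝ) →L[ℝ] ℝ)
    (k : ℝ × ℝ) : B (omega Q k) (omega Q k) + B (omegaT Q k) (omegaT Q k)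
      + B (omegaP Q k.2) (omegaP Q k.2) = ∑ i, B (Pi.single i 1) (Pi.single i 1) := by
  rw [bilin_expand B (omega Q k), bilin_expand B (omegaT Q k), bilin_expand B (omegaP Q k.2),
    ← Finset.sum_add_distrib, ← Finset.sum_add_distrib]
  refine Finset.sum_congr rfl fun i _ => ?_
  rw [← Finset.sum_add_distrib, ← Finset.sum_add_distrib]
  have : ∀ j, omega Q k i * omega Q k j * B (Pi.single i 1) (Pi.single j 1)
      + omegaT Q k i * omegaT Q k j * B (Pi.single i 1) (Pi.single j 1)
      + omegaP Q k.2 i * omegaP Q k.2 j * B (Pi.single i 1) (Pi.single j 1)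
      = if i = j then B (Pi.single i 1) (Pi.single j 1) else 0 := fun j => by
    rw [← add_mul, ← add_mul, frame_complete hQ]; simp
  simp [this]

end Frame

/-- The second derivative as a bilinear form. -/
def hess {V : Type*} [NormedAddCommGroup V] [NormedSpace ℝ V] (g : V → ℝ) (x : V) :
    V →L[ℝ] V →L[ℝ] ℝ := fderiv ℝ (fderiv ℝ g) x

/-- The spherical Laplacian of a function on space. -/
def sphLap (g : (Fin 3 → ℝ) → ℝ) (x : Fin 3 → ℝ) : ℝ :=
  (∑ i, x i ^ 2) * ∑ i, hess g x (Pi.single i 1) (Pi.single i 1) - hess g x x x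
    - 2 * fderiv ℝ g x x

/-- The domain of the spherical coordinates. -/
def sphK : Set (ℝ × ℝ) := Icc 0 Real.pi ×ˢ Icc 0 (2 * Real.pi)

theorem isCompact_sphK : IsCompact sphK := isCompact_Icc.prod isCompact_Icc

/-- The full trace, taken in the spherical frame, loses its radial part against the term `hess g x
x`. -/
theorem sphLap_smul_omega {Q : Matrix (Fin 3) (Fin 3) ℝ} (hQ : Q * Q.transpose = 1)
    (g : (Fin 3 → ℝ) → ℝ) (R : ℝ) (k : ℝ × ℝ) :
    sphLap g (R • omega Q k) = R ^ 2 * (hess g (R • omega Q k) (omegaT Q k) (omegaT Q k)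
      + hess g (R • omega Q k) (omegaP Q k.2) (omegaP Q k.2))
      - 2 * R * fderiv ℝ g (R • omega Q k) (omega Q k) := by
  have h1 : ∑ i, (R • omega Q k) i ^ 2 = R ^ 2 := by
    simp only [Pi.smul_apply, smul_eq_mul, mul_pow, ← Finset.mul_sum, sum_sq_omega hQ, mul_one]
  rw [sphLap, h1, ← trace_frame hQ _ k]
  simp only [map_smul, smul_apply, smul_eq_mul]
  ring

section Angular

variable {Q : Matrix (Fin 3) (Fin 3) ℝ} {g : (Fin 3 → ℝ) → ℝ} {R : ℝ}

theorem hasDerivAt_along {c : ℝ → Fin 3 → ℝ} {t : ℝ} {v : Fin 3 → ℝ}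
    (hg : ContDiffAt ℝ 2 g (c t)) (hc : HasDerivAt c v t) :
    HasDerivAt (fun s => g (c s)) (fderiv ℝ g (c t) v) t :=
  (hg.differentiableAt (by simp)).hasFDerivAt.comp_hasDerivAt t hc

theorem hasDerivAt_along_fderiv {c c' : ℝ → Fin 3 → ℝ} {t : ℝ} {v v' : Fin 3 → ℝ}
    (hg : ContDiffAt ℝ 2 g (c t)) (hc : HasDerivAt c v t) (hc' : HasDerivAt c' v' t) :
    HasDerivAt (fun s => fderiv ℝ g (c s) (c' s))
      (hess g (c t) v (c' t) + fderiv ℝ g (c t) v') t := by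
  have h1 : DifferentiableAt ℝ (fderiv ℝ g) (c t) :=
    (hg.fderiv_right (m := 1) (by norm_num)).differentiableAt (by simp)
  exact (h1.hasFDerivAt.comp_hasDerivAt t hc).clm_apply hc'

theorem continuousOn_omega_comp {G : Type*} [TopologicalSpace G] {F : (Fin 3 → ℝ) → G}
    (hF : ∀ k, ContinuousAt F (R • omega Q k)) : Continuous fun k => F (R • omega Q k) :=
  continuous_iff_continuousAt.2 fun k => ContinuousAt.comp (f := fun k => R • omega Q k) (hF k)
    ((contDiff_omega.continuous.const_smul R).continuousAt)

/-- The spherical Laplacian is symmetric; zonal eigenfunctions given by polynomials. -/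
theorem integral_sphLap (hQ : Q * Q.transpose = 1) (hg : ∀ k, ContDiffAt ℝ 2 g (R • omega Q k))
    {p : Polynomial ℝ} {lam : ℝ}
    (hp : ∀ x, (1 - x ^ 2) * p.derivative.derivative.eval x - 2 * x * p.derivative.eval x
      = -lam * p.eval x) :
    ∫ k in sphK, sphLap g (R • omega Q k) * (p.eval (Real.cos k.1) * Real.sin k.1) =
      -lam * ∫ k in sphK, g (R • omega Q k) * (p.eval (Real.cos k.1) * Real.sin k.1) := by
  have hω := contDiff_omega (Q := Q).continuous
  have hωT := contDiff_omegaT (Q := Q).continuous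
  have hωP := contDiff_omegaP (Q := Q).continuous
  have hg0 : Continuous fun k => g (R • omega Q k) :=
    continuousOn_omega_comp fun k => (hg k).continuousAt
  have hg1 : Continuous fun k => fderiv ℝ g (R • omega Q k) :=
    continuousOn_omega_comp fun k => ((hg k).fderiv_right (m := 1) (by norm_num)).continuousAt
  have hg2 : Continuous fun k => hess g (R • omega Q k) :=
    continuousOn_omega_comp fun k => (((hg k).fderiv_right (m := 1) (by norm_num)).fderiv_right
      (m := 0) (by norm_num)).continuousAt
  have hpc : Continuous fun k : ℝ × ℝ => p.eval (Real.cos k.1) :=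
    p.continuous.comp (Real.continuous_cos.comp continuous_fst)
  have hs : Continuous fun k : ℝ × ℝ => Real.sin k.1 := Real.continuous_sin.comp continuous_fst
  have hc : Continuous fun k : ℝ × ℝ => Real.cos k.1 := Real.continuous_cos.comp continuous_fst
  -- the `θ` part
  set T : ℝ × ℝ → ℝ := fun k => (Real.sin k.1 * (R ^ 2 * hess g (R • omega Q k) (omegaT Q k)
    (omegaT Q k) - R * fderiv ℝ g (R • omega Q k) (omega Q k))
    + Real.cos k.1 * (R * fderiv ℝ g (R • omega Q k) (omegaT Q k))) * p.eval (Real.cos k.1) with hT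
  have hTc : Continuous T := by
    have h1 := (hg2.clm_apply hωT).clm_apply hωT
    have h2 := hg1.clm_apply hω
    have h3 := hg1.clm_apply hωT
    fun_prop
  set F : ℝ × ℝ → ℝ := fun k => g (R • omega Q k) * (p.eval (Real.cos k.1) * Real.sin k.1) with hF
  have hFc : Continuous F := hg0.mul (hpc.mul hs)
  set X : ℝ × ℝ → ℝ := fun k =>
    sphLap g (R • omega Q k) * (p.eval (Real.cos k.1) * Real.sin k.1) with hX
  have hXc : Continuous X := by
    have h1 := (hg2.clm_apply hωT).clm_apply hωT
    have h2 := hg1.clm_apply hω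
    have h3 := (hg2.clm_apply (hωP.comp continuous_snd)).clm_apply (hωP.comp continuous_snd)
    simp only [hX, sphLap_smul_omega hQ, Function.comp_def] at h3 ⊢
    fun_prop
  have hint : ∀ {Y : ℝ × ℝ → ℝ}, Continuous Y → IntegrableOn Y sphK := fun h =>
    h.continuousOn.integrableOn_compact isCompact_sphK
  -- integration in `θ`
  have hθ : ∀ φ, ∫ θ in Icc 0 Real.pi, (T (θ, φ) + lam * F (θ, φ)) = 0 := by
    intro φ
    have hline : ∀ θ, HasDerivAt (fun t => R • omega Q (t, φ)) (R • omegaT Q (θ, φ)) θ :=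
      fun θ => (hasDerivAt_omega_fst θ φ).const_smul R
    -- Green's identity in θ: the equation for p makes the integrand an exact derivative, whose
    -- primitive vanishes at both poles with sin θ.
    have hder : ∀ θ, HasDerivAt (fun t => Real.sin t * fderiv ℝ g (R • omega Q (t, φ))
        (R • omegaT Q (t, φ)) * p.eval (Real.cos t)
        + g (R • omega Q (t, φ)) * (Real.sin t ^ 2 * p.derivative.eval (Real.cos t)))
        (T (θ, φ) + lam * F (θ, φ)) θ := by
      intro θ
      have d1 := hasDerivAt_along (hg (θ, φ)) (hline θ)
      have d2 := hasDerivAt_along_fderiv (c' := fun t => R • omegaT Q (t, φ)) (hg (θ, φ)) (hline θ)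
        ((hasDerivAt_omegaT (Q := Q) θ φ).const_smul R)
      have d3 := Real.hasDerivAt_sin θ
      have d4 := HasDerivAt.comp θ (p.hasDerivAt (Real.cos θ)) (Real.hasDerivAt_cos θ)
      have d5 := HasDerivAt.comp θ (p.derivative.hasDerivAt (Real.cos θ)) (Real.hasDerivAt_cos θ)
      have := ((d3.mul d2).mul d4).add (d1.mul ((d3.pow 2).mul d5))
      refine this.congr_deriv ?_
      have hode := hp (Real.cos θ)
      have hsc := Real.sin_sq_add_cos_sq θ
      simp only [hT, hF, Function.comp_apply, Pi.mul_apply, Pi.pow_apply, map_smul, map_neg,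
        smul_apply, smul_eq_mul, smul_neg]
      linear_combination (-(g (R • omega Q (θ, φ)) * Real.sin θ)) * hode
        + (-(g (R • omega Q (θ, φ)) * Real.sin θ *
          p.derivative.derivative.eval (Real.cos θ))) * hsc
    rw [integral_Icc_eq_integral_Ioc, ← intervalIntegral.integral_of_le Real.pi_pos.le,
      intervalIntegral.integral_eq_sub_of_hasDerivAt (fun θ _ => hder θ)]
    · simp
    · have : Continuous fun θ : ℝ => (θ, φ) := by fun_prop
      exact ((hTc.comp this).add ((hFc.comp this).const_mul lam)).intervalIntegrable _ _
  have hTF : ∫ k in sphK, (T k + lam * F k) = 0 := by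
    have h1 : IntegrableOn (fun k => T k + lam * F k) sphK := hint (hTc.add (hFc.const_mul lam))
    rw [sphK, Measure.volume_eq_prod] at h1 ⊢
    rw [← Measure.prod_restrict, integral_prod_symm _ (by rwa [Measure.prod_restrict])]
    simp [hθ]
  -- integration in `φ`
  have hφ : ∀ θ ∈ Ioo 0 Real.pi, ∫ φ in Icc 0 (2 * Real.pi), (X (θ, φ) - T (θ, φ)) = 0 := by
    intro θ hθm
    have hs0 := (Real.sin_pos_of_mem_Ioo hθm).ne'
    have hline : ∀ φ, HasDerivAt (fun t => R • omega Q (θ, t)) (R • (Real.sin θ • omegaP Q φ)) φ :=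
      fun φ => (hasDerivAt_omega_snd θ φ).const_smul R
    -- The rest of the Laplacian is the derivative of a function 2π-periodic in φ. The division by
    -- sin θ confines this to the open interval 0 < θ < π.
    have hder : ∀ φ, HasDerivAt (fun t => p.eval (Real.cos θ) / Real.sin θ *
        fderiv ℝ g (R • omega Q (θ, t)) (R • (Real.sin θ • omegaP Q t)))
        (X (θ, φ) - T (θ, φ)) φ := by
      intro φ
      have d2 := hasDerivAt_along_fderiv (c' := fun t => R • (Real.sin θ • omegaP Q t))
        (hg (θ, φ)) (hline φ)
        (((hasDerivAt_omegaP (Q := Q) φ).const_smul (Real.sin θ)).const_smul R)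
      refine (d2.const_mul (p.eval (Real.cos θ) / Real.sin θ)).congr_deriv ?_
      have hrel := congrArg (fderiv ℝ g (R • omega Q (θ, φ)))
        (cos_smul_omegaT_sub_horiz (Q := Q) θ φ)
      simp only [hX, hT, sphLap_smul_omega hQ, map_sub, map_smul, map_neg,
        smul_apply, smul_eq_mul, smul_neg] at hrel ⊢
      field_simp
      linear_combination (p.eval (Real.cos θ) * R) * hrel
    rw [integral_Icc_eq_integral_Ioc, ← intervalIntegral.integral_of_le (by positivity),
      intervalIntegral.integral_eq_sub_of_hasDerivAt (fun φ _ => hder φ)]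
    · simp [omega, omegaP]
    · have : Continuous fun φ : ℝ => (θ, φ) := by fun_prop
      exact ((hXc.comp this).sub (hTc.comp this)).intervalIntegrable _ _
  have hXT : ∫ k in sphK, (X k - T k) = 0 := by
    have h1 : IntegrableOn (fun k => X k - T k) sphK := hint (hXc.sub hTc)
    rw [sphK, Measure.volume_eq_prod] at h1 ⊢
    rw [setIntegral_prod _ h1, integral_Icc_eq_integral_Ioc, integral_Ioc_eq_integral_Ioo]
    exact setIntegral_eq_zero_of_forall_eq_zero hφ
  rw [integral_add (hint hTc) ((hint hFc).const_mul lam), integral_const_mul] at hTF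
  rw [integral_sub (hint hXc) (hint hTc)] at hXT
  linarith

end Angular

/-! ### The metric and the wave operator in Cartesian coordinates -/

/-- A matrix of the form `-1 ⊕ (a n nᵀ + b (1 - n nᵀ))`. -/
def blockMat (a b : ℝ) (n : Fin 3 → ℝ) : Matrix (Fin 4) (Fin 4) ℝ :=
  !![-1, 0, 0, 0;
     0, a * (n 0 * n 0) + b * (1 - n 0 * n 0), a * (n 0 * n 1) + b * (0 - n 0 * n 1),
      a * (n 0 * n 2) + b * (0 - n 0 * n 2);
     0, a * (n 1 * n 0) + b * (0 - n 1 * n 0), a * (n 1 * n 1) + b * (1 - n 1 * n 1),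
      a * (n 1 * n 2) + b * (0 - n 1 * n 2);
     0, a * (n 2 * n 0) + b * (0 - n 2 * n 0), a * (n 2 * n 1) + b * (0 - n 2 * n 1),
      a * (n 2 * n 2) + b * (1 - n 2 * n 2)]

theorem blockMat_det (a b : ℝ) {n : Fin 3 → ℝ} (hn : n 0 ^ 2 + n 1 ^ 2 + n 2 ^ 2 = 1) :
    (blockMat a b n).det = -(a * b ^ 2) := by
  have h : (blockMat a b n).det =
      -(b ^ 2 * (b + (a - b) * (n 0 ^ 2 + n 1 ^ 2 + n 2 ^ 2))) := by
    unfold blockMat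
    rw [Matrix.det_succ_row_zero]
    simp [Fin.sum_univ_succ, Matrix.det_fin_three, Fin.succAbove]
    ring
  rw [h, hn]; ring

theorem blockMat_inv {a b : ℝ} (ha : a ≠ 0) (hb : b ≠ 0) {n : Fin 3 → ℝ}
    (hn : n 0 ^ 2 + n 1 ^ 2 + n 2 ^ 2 = 1) : (blockMat a b n)⁻¹ = blockMat a⁻¹ b⁻¹ n := by
  refine Matrix.inv_eq_right_inv ?_
  have h2 : n 2 ^ 2 = 1 - n 0 ^ 2 - n 1 ^ 2 := by linarith
  ext i j
  fin_cases i <;> fin_cases j <;>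
    simp [blockMat, Matrix.mul_apply, Fin.sum_univ_four] <;> field_simp <;> ring_nf <;>
    simp only [h2, show n 2 ^ 3 = n 2 * (1 - n 0 ^ 2 - n 1 ^ 2) by rw [← h2]; ring,
      show n 2 ^ 4 = (1 - n 0 ^ 2 - n 1 ^ 2) ^ 2 by rw [← h2]; ring] <;> ring

theorem rad_sq (p : Fin 4 → ℝ) : rad p ^ 2 = ∑ i : Fin 3, p i.succ ^ 2 :=
  Real.sq_sqrt (Finset.sum_nonneg fun _ _ => sq_nonneg _)

theorem dRad_succ (p : Fin 4 → ℝ) (i : Fin 3) : dRad p i.succ = p i.succ / rad p := by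
  simp [dRad]

theorem sum_sq_dRad {p : Fin 4 → ℝ} (h : 0 < rad p) :
    dRad p (Fin.succ 0) ^ 2 + dRad p (Fin.succ 1) ^ 2 + dRad p (Fin.succ 2) ^ 2 = 1 := by
  have := rad_sq p
  rw [Fin.sum_univ_three] at this
  rw [dRad_succ, dRad_succ, dRad_succ]
  field_simp
  linarith

theorem metric_eq (d : DustData) (p : Fin 4 → ℝ) :
    d.metric p = blockMat (((d.γ (p 0) (rad p))⁻¹) ^ 2) (d.y (p 0) (rad p) ^ 4)
      (fun i => dRad p i.succ) := by
  ext i j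
  fin_cases i <;> fin_cases j <;> simp [DustData.metric, blockMat]

theorem hasFDerivAt_rad {p : Fin 4 → ℝ} (h : 0 < rad p) :
    HasFDerivAt rad (∑ i : Fin 3, (p i.succ / rad p) •
      (ContinuousLinearMap.proj i.succ : (Fin 4 → ℝ) →L[ℝ] ℝ)) p := by
  have h1 : HasFDerivAt (fun z : Fin 4 → ℝ => ∑ i : Fin 3, z i.succ ^ 2)
      (∑ i : Fin 3, (2 * p i.succ) • (ContinuousLinearMap.proj i.succ : (Fin 4 → ℝ) →L[ℝ] ℝ)) p := by
    refine HasFDerivAt.fun_sum fun i _ => ?_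
    refine ((ContinuousLinearMap.proj (R := ℝ) (φ := fun _ : Fin 4 => ℝ)
      i.succ).hasFDerivAt.pow 2).congr_fderiv ?_
    simp
  have h0 : ∑ i : Fin 3, p i.succ ^ 2 ≠ 0 := by rw [← rad_sq]; positivity
  refine (h1.sqrt h0).congr_fderiv ?_
  rw [Finset.smul_sum]
  refine Finset.sum_congr rfl fun i _ => ?_
  rw [smul_smul]
  congr 1
  change 1 / (2 * rad p) * (2 * p i.succ) = _
  field_simp

/-- The coordinates `(τ, R)` of a point. -/
def zet (p : Fin 4 → ℝ) : ℝ × ℝ := (p 0, rad p)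

theorem hasFDerivAt_zet {p : Fin 4 → ℝ} (h : 0 < rad p) :
    HasFDerivAt zet ((ContinuousLinearMap.proj 0 : (Fin 4 → ℝ) →L[ℝ] ℝ).prod
      (∑ i : Fin 3, (p i.succ / rad p) •
        (ContinuousLinearMap.proj i.succ : (Fin 4 → ℝ) →L[ℝ] ℝ))) p :=
  (ContinuousLinearMap.proj (R := ℝ) (φ := fun _ : Fin 4 => ℝ) 0).hasFDerivAt.prodMk
    (hasFDerivAt_rad h)

section Partial

variable {F G : (Fin 4 → ℝ) → ℝ} {p : Fin 4 → ℝ}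

theorem differentiableAt_comp_zet {c : ℝ × ℝ → ℝ} (h : 0 < rad p)
    (hc : DifferentiableAt ℝ c (zet p)) : DifferentiableAt ℝ (fun z => c (zet z)) p :=
  hc.comp p (hasFDerivAt_zet h).differentiableAt

theorem pd_comp_zet_zero {c : ℝ × ℝ → ℝ} (h : 0 < rad p) (hc : DifferentiableAt ℝ c (zet p)) :
    pd 0 (fun z => c (zet z)) p = fderiv ℝ c (zet p) (1, 0) := by
  have := (hc.hasFDerivAt.comp p (hasFDerivAt_zet h)).fderiv
  unfold pd
  rw [show (fun z => c (zet z)) = c ∘ zet from rfl, this]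
  simp

theorem pd_comp_zet_succ {c : ℝ × ℝ → ℝ} (h : 0 < rad p) (hc : DifferentiableAt ℝ c (zet p))
    (i : Fin 3) :
    pd i.succ (fun z => c (zet z)) p = fderiv ℝ c (zet p) (0, 1) * (p i.succ / rad p) := by
  have := (hc.hasFDerivAt.comp p (hasFDerivAt_zet h)).fderiv
  unfold pd
  rw [show (fun z => c (zet z)) = c ∘ zet from rfl, this]
  have h2 : ((0 : ℝ), p i.succ / rad p) = (p i.succ / rad p) • ((0 : ℝ), (1 : ℝ)) := by simp
  have h3 : ((ContinuousLinearMap.proj 0 : (Fin 4 → ℝ) →L[ℝ] ℝ).prod (∑ j : Fin 3,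
      (p j.succ / rad p) • (ContinuousLinearMap.proj j.succ : (Fin 4 → ℝ) →L[ℝ] ℝ)))
      (Pi.single i.succ 1) = ((0 : ℝ), p i.succ / rad p) := by
    ext
    · simp [Pi.single_apply, (Fin.succ_ne_zero i).symm]
    · simp [Pi.single_apply]
  rw [ContinuousLinearMap.comp_apply, h3, h2, map_smul, smul_eq_mul, mul_comm]

theorem pd_mul (i : Fin 4) (hF : DifferentiableAt ℝ F p) (hG : DifferentiableAt ℝ G p) :
    pd i (fun z => F z * G z) p = pd i F p * G p + F p * pd i G p := by
  unfold pd
  rw [fderiv_fun_mul hF hG]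
  simp [mul_comm, add_comm]

theorem pd_add (i : Fin 4) (hF : DifferentiableAt ℝ F p) (hG : DifferentiableAt ℝ G p) :
    pd i (fun z => F z + G z) p = pd i F p + pd i G p := by
  unfold pd
  rw [fderiv_fun_add hF hG]
  rfl

theorem pd_coord (i j : Fin 4) : pd i (fun z => z j) p = if j = i then 1 else 0 := by
  have : HasFDerivAt (fun z : Fin 4 → ℝ => z j) _ p :=
    (ContinuousLinearMap.proj (R := ℝ) (φ := fun _ : Fin 4 => ℝ) j).hasFDerivAt
  unfold pd
  rw [this.fderiv]
  simp [Pi.single_apply]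

theorem differentiableAt_pd (hF : ContDiffAt ℝ 2 F p) (i : Fin 4) :
    DifferentiableAt ℝ (fun z => pd i F z) p :=
  ((hF.fderiv_right (m := 1) (by norm_num)).differentiableAt (by simp)).clm_apply
    (differentiableAt_const _)

theorem pd_pd (hF : ContDiffAt ℝ 2 F p) (i j : Fin 4) :
    pd i (fun z => pd j F z) p = hess F p (Pi.single i 1) (Pi.single j 1) := by
  have h := (hF.fderiv_right (m := 1) (by norm_num)).differentiableAt (n := 1) (by simp)
  unfold pd hess
  rw [fderiv_clm_apply h (differentiableAt_const _)]
  simp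

end Partial

namespace DustData

variable {d : DustData}

/-- `√|g|` in terms of `(τ, R)`. -/
def cA (d : DustData) (z : ℝ × ℝ) : ℝ := d.yE z.1 z.2 ^ 4 * d.rp z / d.w z.2

/-- The radial principal coefficient. -/
def cB (d : DustData) (z : ℝ × ℝ) : ℝ := d.yE z.1 z.2 ^ 4 * d.w z.2 / d.rp z

/-- The angular principal coefficient. -/
def cC (d : DustData) (z : ℝ × ℝ) : ℝ := d.rp z / d.w z.2

/-- The excess of the radial over the angular coefficient. -/
def cβ (d : DustData) (z : ℝ × ℝ) : ℝ := (d.cB z - d.cC z) / z.2 ^ 2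

namespace Admissible

variable {z : ℝ × ℝ}

theorem differentiableAt_cA (hd : d.Admissible) (h : z ∈ d.D₂) : DifferentiableAt ℝ d.cA z :=
  ((((hd.contDiffAt_yE (hd.D₂_subset_tDom h)).pow 4).mul (hd.contDiffAt_rp
    (hd.D₂_subset_tDom h))).div (hd.contDiffAt_wf h.1) (hd.w_pos h.1).ne').differentiableAt (by simp)

theorem differentiableAt_cB (hd : d.Admissible) (h : z ∈ d.D₂) : DifferentiableAt ℝ d.cB z :=
  ((((hd.contDiffAt_yE (hd.D₂_subset_tDom h)).pow 4).mul (hd.contDiffAt_wf h.1)).div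
    (hd.contDiffAt_rp (hd.D₂_subset_tDom h)) (hd.rp_pos h).ne').differentiableAt (by simp)

theorem differentiableAt_cC (hd : d.Admissible) (h : z ∈ d.D₂) : DifferentiableAt ℝ d.cC z :=
  ((hd.contDiffAt_rp (hd.D₂_subset_tDom h)).div (hd.contDiffAt_wf h.1)
    (hd.w_pos h.1).ne').differentiableAt (by simp)

theorem differentiableAt_cβ (hd : d.Admissible) (h : z ∈ d.D₂) (hR : 0 < z.2) :
    DifferentiableAt ℝ d.cβ z := by
  have h1 : DifferentiableAt ℝ (fun z : ℝ × ℝ => z.2 ^ 2) z := by fun_prop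
  have h2 := ((hd.differentiableAt_cB h).fun_sub (hd.differentiableAt_cC h)).fun_mul
    (h1.fun_inv (pow_pos hR 2).ne')
  simp only [← div_eq_mul_inv] at h2
  exact h2

theorem metric_det (hd : d.Admissible) {p : Fin 4 → ℝ} (hp : p ∈ d.D) (hR : 0 < rad p) :
    √|(d.metric p).det| = d.cA (zet p) := by
  have hm := mem_D_iff.1 hp
  have hy := hd.y_mem hm.2.1 hm.2.2.1
  rw [metric_eq, blockMat_det _ _ (sum_sq_dRad hR), abs_neg,
    show ((d.γ (p 0) (rad p))⁻¹) ^ 2 * (d.y (p 0) (rad p) ^ 4) ^ 2 =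
      ((d.γ (p 0) (rad p))⁻¹ * d.y (p 0) (rad p) ^ 4) ^ 2 by ring, abs_sq, Real.sqrt_sq_eq_abs,
    hd.slope_eq hm.2.1 hm.2.2.1, cA, zet, rp, hd.yE_eq_y hm.2.1 hm.2.2.1]
  have h1 := hd.rR_pos hy hm.1
  have h2 := hd.w_pos hm.1
  dsimp only at h1 h2 hy ⊢
  have := hy.1
  rw [abs_of_nonneg (by positivity)]
  ring

/-- The components of the flux vector of the wave operator. -/
theorem metric_flux (hd : d.Admissible) {p : Fin 4 → ℝ} (hp : p ∈ d.D) (hR : 0 < rad p)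
    (v : Fin 4 → ℝ) :
    √|(d.metric p).det| * ∑ j, (d.metric p)⁻¹ 0 j * v j = (-1) * (d.cA (zet p) * v 0) ∧
    ∀ i : Fin 3, √|(d.metric p).det| * ∑ j, (d.metric p)⁻¹ i.succ j * v j =
      p i.succ * (d.cβ (zet p) * (p 1 * v 1 + p 2 * v 2 + p 3 * v 3))
        + d.cC (zet p) * v i.succ := by
  have hm := mem_D_iff.1 hp
  have hy := hd.y_mem hm.2.1 hm.2.2.1
  have h1 := hd.rR_pos hy hm.1
  have h2 := hd.w_pos hm.1
  have hy0 := hy.1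
  have hinv : (d.metric p)⁻¹ = blockMat ((((d.γ (p 0) (rad p))⁻¹) ^ 2)⁻¹)
      ((d.y (p 0) (rad p) ^ 4)⁻¹) (fun i => dRad p i.succ) := by
    rw [metric_eq, blockMat_inv _ (by positivity) (sum_sq_dRad hR)]
    rw [hd.slope_eq hm.2.1 hm.2.2.1]
    positivity
  rw [hd.metric_det hp hR, hinv, hd.slope_eq hm.2.1 hm.2.2.1]
  have hA : d.cA (zet p) = d.y (p 0) (rad p) ^ 4 * d.rR (d.y (p 0) (rad p)) (rad p) / d.w (rad p) := by
    simp only [cA, zet, rp, hd.yE_eq_y hm.2.1 hm.2.2.1]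
  have hC : d.cC (zet p) = d.rR (d.y (p 0) (rad p)) (rad p) / d.w (rad p) := by
    simp only [cC, zet, rp, hd.yE_eq_y hm.2.1 hm.2.2.1]
  have hB : d.cβ (zet p) = (d.y (p 0) (rad p) ^ 4 * d.w (rad p) / d.rR (d.y (p 0) (rad p)) (rad p)
      - d.rR (d.y (p 0) (rad p)) (rad p) / d.w (rad p)) / rad p ^ 2 := by
    simp only [cβ, cB, cC, zet, rp, hd.yE_eq_y hm.2.1 hm.2.2.1]
  rw [hA, hB, hC]
  dsimp only at h1 h2 hy0
  generalize d.rR (d.y (p 0) (rad p)) (rad p) = q at *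
  generalize d.w (rad p) = w at *
  generalize d.y (p 0) (rad p) = y at *
  have hR0 := hR.ne'
  have hw0 := h2.ne'
  have hq0 := h1.ne'
  have hyy := hy0.ne'
  constructor
  · simp [blockMat, Fin.sum_univ_four]
  · intro i
    have d0 := dRad_succ p 0
    have d1 := dRad_succ p 1
    have d2 := dRad_succ p 2
    simp only [Fin.succ_zero_eq_one, Fin.succ_one_eq_two,
      show Fin.succ (2 : Fin 3) = (3 : Fin 4) from rfl] at d0 d1 d2
    fin_cases i <;>
      simp [blockMat, Fin.sum_univ_four, d0, d1, d2] <;>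
      field_simp <;> ring

/-- The Klein–Gordon equation in terms of derivatives of the field. -/
theorem reduced_equation (hd : d.Admissible) (hn : d.GloballyNaked) {μ : ℝ}
    {φ₀ φ₁ : (Fin 3 → ℝ) → ℝ} {Φ : (Fin 4 → ℝ) → ℝ} (hΦ : IsKGSolution d μ φ₀ φ₁ Φ)
    {p : Fin 4 → ℝ} (hp : p ∈ d.D) (h0 : 0 < p 0) (hR : 0 < rad p) :
    -(fderiv ℝ d.cA (zet p) (1, 0) * pd 0 Φ p
        + d.cA (zet p) * hess Φ p (Pi.single 0 1) (Pi.single 0 1))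
      + (4 * d.cβ (zet p) + rad p * fderiv ℝ d.cβ (zet p) (0, 1)
          + fderiv ℝ d.cC (zet p) (0, 1) / rad p) * (∑ a : Fin 3, p a.succ * pd a.succ Φ p)
      + d.cβ (zet p) * (∑ a : Fin 3, ∑ b : Fin 3, p a.succ * p b.succ *
          hess Φ p (Pi.single a.succ 1) (Pi.single b.succ 1))
      + d.cC (zet p) * (∑ a : Fin 3, hess Φ p (Pi.single a.succ 1) (Pi.single a.succ 1))
      - μ ^ 2 * d.cA (zet p) * Φ p = 0 := by
  have hm : zet p ∈ d.D₂ := mem_D_iff.1 hp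
  have hnD := hd.D_mem_nhds hn hp h0
  have hC2 : ContDiffAt ℝ 2 Φ p := hΦ.regular.contDiffAt hnD
  have hnear : ∀ᶠ z in 𝓝 p, z ∈ d.D ∧ 0 < rad z :=
    (eventually_mem_set.2 hnD).and (continuous_rad.continuousAt.eventually (lt_mem_nhds hR))
  have dA := differentiableAt_comp_zet hR (hd.differentiableAt_cA hm)
  have dB := differentiableAt_comp_zet hR (hd.differentiableAt_cβ hm hR)
  have dC := differentiableAt_comp_zet hR (hd.differentiableAt_cC hm)
  have dP := differentiableAt_pd hC2
  have dX : ∀ i : Fin 4, DifferentiableAt ℝ (fun z : Fin 4 → ℝ => z i) p := fun i => by fun_prop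
  have dXP : ∀ i : Fin 4, DifferentiableAt ℝ (fun z => z i * pd i Φ z) p :=
    fun i => (dX i).mul (dP i)
  have dS : DifferentiableAt ℝ (fun z => z 1 * pd 1 Φ z + z 2 * pd 2 Φ z + z 3 * pd 3 Φ z) p :=
    ((dXP 1).fun_add (dXP 2)).add (dXP 3)
  have hpS : ∀ i, pd i (fun z => z 1 * pd 1 Φ z + z 2 * pd 2 Φ z + z 3 * pd 3 Φ z) p =
      ((if (1 : Fin 4) = i then 1 else 0) * pd 1 Φ p + p 1 * hess Φ p (Pi.single i 1) (Pi.single 1 1))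
      + ((if (2 : Fin 4) = i then 1 else 0) * pd 2 Φ p + p 2 * hess Φ p (Pi.single i 1) (Pi.single 2 1))
      + ((if (3 : Fin 4) = i then 1 else 0) * pd 3 Φ p
        + p 3 * hess Φ p (Pi.single i 1) (Pi.single 3 1)) := fun i => by
    rw [pd_add i ((dXP 1).fun_add (dXP 2)) (dXP 3), pd_add i (dXP 1) (dXP 2), pd_mul i (dX 1) (dP 1),
      pd_mul i (dX 2) (dP 2), pd_mul i (dX 3) (dP 3), pd_coord, pd_coord, pd_coord,
      pd_pd hC2, pd_pd hC2, pd_pd hC2]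
  have hcong : ∀ {F G : (Fin 4 → ℝ) → ℝ} (i : Fin 4), F =ᶠ[𝓝 p] G → pd i F p = pd i G p :=
    fun i h => by unfold pd; rw [h.fderiv_eq]
  have ht : pd 0 (fun z => √|(d.metric z).det| * ∑ j, (d.metric z)⁻¹ 0 j * pd j Φ z) p =
      -(fderiv ℝ d.cA (zet p) (1, 0) * pd 0 Φ p
        + d.cA (zet p) * hess Φ p (Pi.single 0 1) (Pi.single 0 1)) := by
    rw [hcong 0 (G := fun z => (-1) * (d.cA (zet z) * pd 0 Φ z)) (by
      filter_upwards [hnear] with z hz using (hd.metric_flux hz.1 hz.2 (fun j => pd j Φ z)).1),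
      pd_mul 0 (differentiableAt_const _) (dA.fun_mul (dP 0)), pd_mul 0 dA (dP 0),
      pd_comp_zet_zero hR (hd.differentiableAt_cA hm), pd_pd hC2]
    simp [pd]
  -- The spatial part of √|g| g^(ij) is C δ_ij + β x_i x_j with C and β functions of (τ, R), so each
  -- component is differentiated by the product rule.
  have hs : ∀ i : Fin 3, pd i.succ
      (fun z => √|(d.metric z).det| * ∑ j, (d.metric z)⁻¹ i.succ j * pd j Φ z) p =
      (1 * (d.cβ (zet p) * (p 1 * pd 1 Φ p + p 2 * pd 2 Φ p + p 3 * pd 3 Φ p))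
        + p i.succ * (fderiv ℝ d.cβ (zet p) (0, 1) * (p i.succ / rad p)
            * (p 1 * pd 1 Φ p + p 2 * pd 2 Φ p + p 3 * pd 3 Φ p)
          + d.cβ (zet p) *
            pd i.succ (fun z => z 1 * pd 1 Φ z + z 2 * pd 2 Φ z + z 3 * pd 3 Φ z) p))
      + (fderiv ℝ d.cC (zet p) (0, 1) * (p i.succ / rad p) * pd i.succ Φ p
        + d.cC (zet p) * hess Φ p (Pi.single i.succ 1) (Pi.single i.succ 1)) := fun i => by
    rw [hcong i.succ (by
      filter_upwards [hnear] with z hz using (hd.metric_flux hz.1 hz.2 (fun j => pd j Φ z)).2 i),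
      pd_add _ ((dX i.succ).fun_mul (dB.fun_mul dS)) (dC.fun_mul (dP i.succ)),
      pd_mul _ (dX i.succ) (dB.fun_mul dS), pd_mul _ dB dS, pd_mul _ dC (dP i.succ),
      pd_comp_zet_succ hR (hd.differentiableAt_cβ hm hR),
      pd_comp_zet_succ hR (hd.differentiableAt_cC hm), pd_pd hC2, pd_coord, if_pos rfl]
  have heq := hΦ.equation p hp h0
  unfold box at heq
  rw [Fin.sum_univ_succ, ht, Finset.sum_congr rfl (fun i _ => hs i), hd.metric_det hp hR,
    Fin.sum_univ_three, hpS, hpS, hpS] at heq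
  have hA0 : d.cA (zet p) ≠ 0 := by
    have h1 := hd.rp_pos hm
    have h2 := hd.w_pos hm.1
    have h3 := (hd.yE_mem hm).1
    exact (div_pos (mul_pos (pow_pos h3 4) h1) h2).ne'
  have hrs := rad_sq p
  rw [Fin.sum_univ_three] at hrs
  simp only [Fin.sum_univ_three, Fin.succ_zero_eq_one, Fin.succ_one_eq_two,
    show Fin.succ (2 : Fin 3) = (3 : Fin 4) from rfl] at heq hrs ⊢
  simp at heq
  have hR0 := hR.ne'
  have hrad : ∀ x : ℝ, rad p * x = (p 1 ^ 2 + p 2 ^ 2 + p 3 ^ 2) / rad p * x := fun x => by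
    rw [← hrs]; field_simp
  rw [hrad]
  field_simp at heq ⊢
  linear_combination (-1) * heq

end Admissible

end DustData

/-! ### From the field to its zonal modes -/

/-- The inclusion of space into spacetime. -/
def spat : (Fin 3 → ℝ) →L[ℝ] (Fin 4 → ℝ) :=
  ContinuousLinearMap.pi (Fin.cons 0 fun i => ContinuousLinearMap.proj i)

theorem spat_zero (x : Fin 3 → ℝ) : spat x 0 = 0 := by simp [spat]

theorem spat_succ (x : Fin 3 → ℝ) (i : Fin 3) : spat x i.succ = x i := by simp [spat]

theorem spat_single (i : Fin 3) : spat (Pi.single i 1) = Pi.single i.succ 1 := by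
  ext j
  refine Fin.cases ?_ (fun j => ?_) j
  · simp [spat_zero, (Fin.succ_ne_zero i).symm]
  · simp [spat_succ, Pi.single_apply]

/-- The unit vector along the time axis. -/
def et : Fin 4 → ℝ := Pi.single 0 1

theorem spat_eq_sum (x : Fin 3 → ℝ) : spat x = ∑ i, x i • (Pi.single i.succ 1 : Fin 4 → ℝ) := by
  have hx : x = ∑ i, x i • (Pi.single i (1 : ℝ) : Fin 3 → ℝ) := by
    ext i; simp [Finset.sum_apply, Pi.single_apply]
  conv_lhs => rw [hx]
  simp only [map_sum, map_smul, spat_single]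

/-- The event with coordinates `(τ, R)` and direction `v`. -/
def event (z : ℝ × ℝ) (v : Fin 3 → ℝ) : Fin 4 → ℝ := z.1 • et + spat (z.2 • v)

theorem event_zero (z : ℝ × ℝ) (v : Fin 3 → ℝ) : event z v 0 = z.1 := by
  simp [event, et, spat_zero]

theorem event_succ (z : ℝ × ℝ) (v : Fin 3 → ℝ) (i : Fin 3) : event z v i.succ = z.2 * v i := by
  simp only [event, et, Pi.add_apply, spat_succ, Pi.smul_apply, smul_eq_mul]
  simp

theorem event_eq_cons (z : ℝ × ℝ) (v : Fin 3 → ℝ) : event z v = Fin.cons z.1 (z.2 • v) := by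
  ext j
  refine Fin.cases ?_ (fun j => ?_) j
  · rw [event_zero]; rfl
  · rw [event_succ]; rfl

theorem rad_event (z : ℝ × ℝ) {v : Fin 3 → ℝ} (hv : ∑ i, v i ^ 2 = 1) : rad (event z v) = |z.2| := by
  unfold rad
  simp only [event_succ, mul_pow, ← Finset.mul_sum, hv, mul_one, Real.sqrt_sq_eq_abs]

/-- A negative second coordinate denotes the antipodal point. Modes are thereby defined on an open
set around the centre and can be differentiated at R = 0. -/
theorem event_mem_D {d : DustData} {z : ℝ × ℝ} {v : Fin 3 → ℝ} (hv : ∑ i, v i ^ 2 = 1) :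
    event z v ∈ d.D ↔ (z.1, |z.2|) ∈ d.D₂ := by
  rw [mem_D_iff, event_zero, rad_event z hv]

/-- The differential of `event` in `(τ, R)`. -/
def eventD (v : Fin 3 → ℝ) : ℝ × ℝ →L[ℝ] (Fin 4 → ℝ) :=
  (ContinuousLinearMap.fst ℝ ℝ ℝ).smulRight et + (ContinuousLinearMap.snd ℝ ℝ ℝ).smulRight (spat v)

theorem event_eq_eventD (z : ℝ × ℝ) (v : Fin 3 → ℝ) : event z v = eventD v z := by
  simp [event, eventD]

theorem hasFDerivAt_event (z : ℝ × ℝ) (v : Fin 3 → ℝ) :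
    HasFDerivAt (fun z => event z v) (eventD v) z := by
  simp only [event_eq_eventD]
  exact (eventD v).hasFDerivAt

theorem eventD_time (v : Fin 3 → ℝ) : eventD v (1, 0) = et := by simp [eventD]

theorem eventD_radius (v : Fin 3 → ℝ) : eventD v (0, 1) = spat v := by simp [eventD]

theorem contDiff_event {Q : Matrix (Fin 3) (Fin 3) ℝ} :
    ContDiff ℝ ∞ fun x : (ℝ × ℝ) × (ℝ × ℝ) => event x.1 (omega Q x.2) := by
  have h := contDiff_omega (Q := Q)
  unfold event
  have h2 : ContDiff ℝ ∞ fun x : (ℝ × ℝ) × (ℝ × ℝ) => omega Q x.2 := h.comp contDiff_snd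
  fun_prop

theorem fderiv_setIntegral_apply {Ψ : (ℝ × ℝ) × (ℝ × ℝ) → ℝ} {U : Set (ℝ × ℝ)} (hU : IsOpen U)
    (hΨ : ContDiffOn ℝ 1 Ψ (U ×ˢ univ)) {K : Set (ℝ × ℝ)} (hK : IsCompact K) {z : ℝ × ℝ} (hz : z ∈ U)
    (v : ℝ × ℝ) : fderiv ℝ (fun z => ∫ k in K, Ψ (z, k)) z v =
      ∫ k in K, fderiv ℝ (fun z => Ψ (z, k)) z v := by
  have hO : IsOpen (U ×ˢ (univ : Set (ℝ × ℝ))) := hU.prod isOpen_univ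
  have h1 := hasFDerivAt_setIntegral_of_contDiffOn (μ := volume) hO hΨ hK hU
    (prod_mono le_rfl (subset_univ K)) hz
  have h2 : ContinuousOn (fun k => (fderiv ℝ Ψ (z, k)).comp
      (ContinuousLinearMap.inl ℝ (ℝ × ℝ) (ℝ × ℝ))) K := by
    refine ContinuousOn.clm_comp ?_ continuousOn_const
    exact (hΨ.continuousOn_fderiv_of_isOpen hO le_rfl).comp (by fun_prop) fun k _ => ⟨hz, mem_univ _⟩
  rw [h1.fderiv, ContinuousLinearMap.integral_apply (h2.integrableOn_compact hK)]
  refine integral_congr_ae (Eventually.of_forall fun k => ?_)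
  have h3 : HasFDerivAt Ψ (fderiv ℝ Ψ (z, k)) (z, k) :=
    ((hΨ.contDiffAt (hO.mem_nhds ⟨hz, mem_univ _⟩)).differentiableAt (by simp)).hasFDerivAt
  have h4 : HasFDerivAt (fun z : ℝ × ℝ => (z, k)) (ContinuousLinearMap.inl ℝ (ℝ × ℝ) (ℝ × ℝ)) z :=
    hasFDerivAt_prodMk_left z k
  simp only
  rw [(HasFDerivAt.comp z h3 h4).fderiv.symm]
  rfl

namespace DustData

variable {d : DustData}

namespace Admissible

theorem rr_sq {z : ℝ × ℝ} (hR : 0 < z.2) : d.yE z.1 z.2 ^ 4 = d.rr z ^ 2 / z.2 ^ 2 := by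
  unfold rr; field_simp

theorem cA_eq {z : ℝ × ℝ} (hR : 0 < z.2) :
    d.cA z = d.rr z ^ 2 * d.rp z / (z.2 ^ 2 * d.w z.2) := by
  rw [cA, rr_sq hR]; ring

theorem cB_eq {z : ℝ × ℝ} (hR : 0 < z.2) :
    d.cB z = d.rr z ^ 2 * d.w z.2 / (z.2 ^ 2 * d.rp z) := by
  rw [cB, rr_sq hR]; ring

theorem cA_time (hd : d.Admissible) {z : ℝ × ℝ} (hz : z ∈ d.D₂) (hR : 0 < z.2) :
    fderiv ℝ d.cA z (1, 0) = (2 * d.rr z * (-d.sf z) * d.rp z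
      + d.rr z ^ 2 * (-fderiv ℝ d.sf z (0, 1))) / (z.2 ^ 2 * d.w z.2) := by
  have ht := hd.D₂_subset_tDom hz
  have h1 := hasDerivAt_slice_fst (hd.differentiableAt_cA hz)
  have r1 := hasDerivAt_slice_fst ((hd.contDiffAt_rr ht).differentiableAt (by simp))
  have p1 := hasDerivAt_slice_fst ((hd.contDiffAt_rp ht).differentiableAt (by simp))
  rw [(hd.hasFDerivAt_rr ht).fderiv] at r1
  rw [hd.rp_time ht] at p1
  have h2 : HasDerivAt (fun t => d.cA (t, z.2)) _ z.1 :=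
    (((r1.pow 2).mul p1).div_const (z.2 ^ 2 * d.w z.2)).congr_of_eventuallyEq
      (Eventually.of_forall fun t => cA_eq (z := (t, z.2)) hR)
  rw [h1.unique h2]
  simp

/-- With B = β R² + C, both sides equal (R² B)'/R², and R² B = r² w / r'. The summand 2C/R is the
first-order term split off with the spherical Laplacian. -/
theorem radial_coefficient (hd : d.Admissible) {z : ℝ × ℝ} (hz : z ∈ d.D₂) (hR : 0 < z.2) :
    (4 * d.cβ z + z.2 * fderiv ℝ d.cβ z (0, 1) + fderiv ℝ d.cC z (0, 1) / z.2) * z.2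
      + d.cC z * (2 / z.2) =
    (2 * d.rr z * d.rp z * d.w z.2 / d.rp z + d.rr z ^ 2 * deriv d.w z.2 / d.rp z
      - d.rr z ^ 2 * d.w z.2 * fderiv ℝ d.rp z (0, 1) / d.rp z ^ 2) / z.2 ^ 2 := by
  have ht := hd.D₂_subset_tDom hz
  have hp0 := (hd.rp_pos hz).ne'
  have r1 := hasDerivAt_slice_snd ((hd.contDiffAt_rr ht).differentiableAt (by simp))
  have p1 := hasDerivAt_slice_snd ((hd.contDiffAt_rp ht).differentiableAt (by simp))
  rw [(hd.hasFDerivAt_rr ht).fderiv] at r1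
  have w1 := hd.hasDerivAt_w hz.1
  have id1 := (hasDerivAt_id' z.2).pow 2
  have B1 := hasDerivAt_slice_snd (hd.differentiableAt_cB hz)
  have C1 := hasDerivAt_slice_snd (hd.differentiableAt_cC hz)
  have b1 := hasDerivAt_slice_snd (hd.differentiableAt_cβ hz hR)
  have hR2 : z.2 ^ 2 ≠ 0 := by positivity
  have hb : HasDerivAt (fun x => d.cβ (z.1, x)) _ z.2 := (B1.sub C1).div id1 hR2
  have hB : HasDerivAt (fun x => d.cB (z.1, x)) _ z.2 :=
    (((r1.pow 2).mul w1).div (id1.mul p1) (mul_ne_zero hR2 hp0)).congr_of_eventuallyEq (by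
      filter_upwards [lt_mem_nhds hR] with x hx using cB_eq (z := (z.1, x)) hx)
  have e1 := b1.unique hb
  have e2 := B1.unique hB
  rw [e1, e2]
  have hz' : (z.1, z.2) = z := rfl
  have e3 : d.cβ z = (d.cB z - d.cC z) / z.2 ^ 2 := rfl
  simp only [Pi.mul_apply, Pi.pow_apply, Pi.sub_apply, hz', e3, cB_eq hR]
  simp
  field_simp
  ring

end Admissible

end DustData

/-- The weight of a zonal mode. -/
def wgt (p : Polynomial ℝ) (k : ℝ × ℝ) : ℝ := p.eval (Real.cos k.1) * Real.sin k.1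

theorem contDiff_wgt (p : Polynomial ℝ) : ContDiff ℝ ∞ (wgt p) := by
  have h : ContDiff ℝ ∞ fun x : ℝ => p.eval x := by
    simpa using p.contDiff_aeval (𝕜 := ℝ) ∞
  have h2 : ContDiff ℝ ∞ fun k : ℝ × ℝ => p.eval (Real.cos k.1) :=
    h.comp (Real.contDiff_cos.comp contDiff_fst)
  exact h2.mul (Real.contDiff_sin.comp contDiff_fst)

/-- The polynomial eigenvalue equation of the zonal spherical Laplacian. -/
def IsZonal (p : Polynomial ℝ) (lam : ℝ) : Prop :=
  ∀ x, (1 - x ^ 2) * p.derivative.derivative.eval x - 2 * x * p.derivative.eval x = -lam * p.eval x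

namespace DustData

variable {d : DustData}

/-- The zonal mode of a field. -/
def mode (Φ : (Fin 4 → ℝ) → ℝ) (Q : Matrix (Fin 3) (Fin 3) ℝ) (p : Polynomial ℝ) (z : ℝ × ℝ) : ℝ :=
  ∫ k in sphK, Φ (event z (omega Q k)) * wgt p k

/-- The time derivative of the zonal mode. -/
def modeT (d : DustData) (Φ : (Fin 4 → ℝ) → ℝ) (Q : Matrix (Fin 3) (Fin 3) ℝ) (p : Polynomial ℝ)
    (z : ℝ × ℝ) : ℝ := ∫ k in sphK, fderivWithin ℝ Φ d.D (event z (omega Q k)) et * wgt p k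

/-- The radial derivative of the zonal mode. -/
def modeR (d : DustData) (Φ : (Fin 4 → ℝ) → ℝ) (Q : Matrix (Fin 3) (Fin 3) ℝ) (p : Polynomial ℝ)
    (z : ℝ × ℝ) : ℝ :=
  ∫ k in sphK, fderivWithin ℝ Φ d.D (event z (omega Q k)) (spat (omega Q k)) * wgt p k

namespace Admissible

/-- The domain away from the initial surface. -/
def Dpos (d : DustData) : Set (Fin 4 → ℝ) := {p | p ∈ d.D ∧ 0 < p 0}

theorem isOpen_Dpos (hd : d.Admissible) (hn : d.GloballyNaked) : IsOpen (Dpos d) := by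
  rw [isOpen_iff_mem_nhds]
  intro p hp
  exact inter_mem (hd.D_mem_nhds hn hp.1 hp.2)
    ((isOpen_lt continuous_const (continuous_apply 0)).mem_nhds hp.2)

variable {Φ : (Fin 4 → ℝ) → ℝ} {Q : Matrix (Fin 3) (Fin 3) ℝ} {p : Polynomial ℝ}

theorem event_mem_Dpos (hQ : Q * Q.transpose = 1) {z : ℝ × ℝ} (hz : z ∈ d.Dx) (k : ℝ × ℝ) :
    event z (omega Q k) ∈ Dpos d :=
  ⟨(event_mem_D (sum_sq_omega hQ k)).2 hz.2, by rw [event_zero]; exact hz.1⟩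

theorem contDiffOn_event_comp (hQ : Q * Q.transpose = 1) {n : WithTop ℕ∞} (hn : n ≤ ∞)
    {G : Type*} [NormedAddCommGroup G] [NormedSpace ℝ G] {Ψ : (Fin 4 → ℝ) → G}
    (hΨ : ContDiffOn ℝ n Ψ (Dpos d)) : ContDiffOn ℝ n
      (fun x : (ℝ × ℝ) × (ℝ × ℝ) => Ψ (event x.1 (omega Q x.2))) (d.Dx ×ˢ univ) :=
  hΨ.comp (contDiff_event.of_le hn).contDiffOn fun x hx => event_mem_Dpos hQ hx.1 x.2

theorem event_maps (hQ : Q * Q.transpose = 1) {x : (ℝ × ℝ) × (ℝ × ℝ)} (hx : x ∈ d.D₂ ×ˢ sphK) :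
    event x.1 (omega Q x.2) ∈ d.D := by
  rw [event_mem_D (sum_sq_omega hQ x.2), abs_of_nonneg hx.1.1]
  exact hx.1

/-- Zonal modes of a solution solve the reduced wave equation. -/
theorem isMode_mode (hd : d.Admissible) (hn : d.GloballyNaked) {μ lam : ℝ}
    {φ₀ φ₁ : (Fin 3 → ℝ) → ℝ} (hΦ : IsKGSolution d μ φ₀ φ₁ Φ) (hQ : Q * Q.transpose = 1)
    (hp : IsZonal p lam) :
    IsMode d μ lam (mode Φ Q p) (modeT d Φ Q p) (modeR d Φ Q p) := by
  have h2top : (2 : WithTop ℕ∞) ≤ ∞ := WithTop.coe_le_coe.2 (le_top (a := (2 : ℕ∞)))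
  have hDo := hd.isOpen_Dpos hn
  have hxo := hd.isOpen_Dx hn
  have hOo : IsOpen (d.Dx ×ˢ (univ : Set (ℝ × ℝ))) := hxo.prod isOpen_univ
  have hC2 : ContDiffOn ℝ 2 Φ (Dpos d) := hΦ.regular.mono fun p hp => hp.1
  have hC1 : ContDiffOn ℝ 1 (fderiv ℝ Φ) (Dpos d) := hC2.fderiv_of_isOpen hDo (by norm_num)
  have hC2At : ∀ {q}, q ∈ Dpos d → ContDiffAt ℝ 2 Φ q := fun hq => hC2.contDiffAt (hDo.mem_nhds hq)
  have hw1 : ContDiff ℝ ∞ fun x : (ℝ × ℝ) × (ℝ × ℝ) => wgt p x.2 :=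
    (contDiff_wgt p).comp contDiff_snd
  have hom : ContDiff ℝ ∞ fun x : (ℝ × ℝ) × (ℝ × ℝ) => spat (omega Q x.2) :=
    spat.contDiff.comp (contDiff_omega.comp contDiff_snd)
  have hS0 : ContDiffOn ℝ 2 (fun x : (ℝ × ℝ) × (ℝ × ℝ) => Φ (event x.1 (omega Q x.2)) * wgt p x.2)
      (d.Dx ×ˢ univ) := (contDiffOn_event_comp hQ h2top hC2).mul (hw1.of_le h2top).contDiffOn
  have hF1 := contDiffOn_event_comp hQ (by exact_mod_cast le_top) hC1
  have hS1 : ContDiffOn ℝ 1 (fun x : (ℝ × ℝ) × (ℝ × ℝ) =>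
      fderiv ℝ Φ (event x.1 (omega Q x.2)) et * wgt p x.2) (d.Dx ×ˢ univ) :=
    (hF1.clm_apply contDiffOn_const).mul (hw1.of_le (by exact_mod_cast le_top)).contDiffOn
  have hS2 : ContDiffOn ℝ 1 (fun x : (ℝ × ℝ) × (ℝ × ℝ) =>
      fderiv ℝ Φ (event x.1 (omega Q x.2)) (spat (omega Q x.2)) * wgt p x.2) (d.Dx ×ˢ univ) :=
    (hF1.clm_apply (hom.of_le (by exact_mod_cast le_top)).contDiffOn).mul
      (hw1.of_le (by exact_mod_cast le_top)).contDiffOn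
  -- first derivatives
  have hT : ∀ z ∈ d.Dx, modeT d Φ Q p z =
      ∫ k in sphK, fderiv ℝ Φ (event z (omega Q k)) et * wgt p k := fun z hz => by
    refine integral_congr_ae (Eventually.of_forall fun k => ?_)
    have := event_mem_Dpos hQ hz k
    simp only
    rw [fderivWithin_of_mem_nhds (hd.D_mem_nhds hn this.1 this.2)]
  have hR : ∀ z ∈ d.Dx, modeR d Φ Q p z = ∫ k in sphK,
      fderiv ℝ Φ (event z (omega Q k)) (spat (omega Q k)) * wgt p k := fun z hz => by
    refine integral_congr_ae (Eventually.of_forall fun k => ?_)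
    have := event_mem_Dpos hQ hz k
    simp only
    rw [fderivWithin_of_mem_nhds (hd.D_mem_nhds hn this.1 this.2)]
  have d0 : ∀ z ∈ d.Dx, ∀ v, fderiv ℝ (mode Φ Q p) z v =
      ∫ k in sphK, fderiv ℝ Φ (event z (omega Q k)) (eventD (omega Q k) v) * wgt p k := by
    intro z hz v
    unfold mode
    rw [fderiv_setIntegral_apply hxo (hS0.of_le (by norm_num)) isCompact_sphK hz v]
    refine integral_congr_ae (Eventually.of_forall fun k => ?_)
    have h1 := ((hC2At (event_mem_Dpos hQ hz k)).differentiableAt (by simp)).hasFDerivAt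
    have h2 := (HasFDerivAt.comp z h1 (hasFDerivAt_event z (omega Q k))).mul_const (wgt p k)
    simp only
    rw [show (fun z => Φ (event z (omega Q k)) * wgt p k) =
      fun z => (Φ ∘ fun z => event z (omega Q k)) z * wgt p k from rfl, h2.fderiv]
    simp [mul_comm]
  have dd : ∀ (z : ℝ × ℝ) (_ : z ∈ d.Dx) (v : ℝ × ℝ) (c : Fin 4 → ℝ) (k : ℝ × ℝ),
      fderiv ℝ (fun z => fderiv ℝ Φ (event z (omega Q k)) c * wgt p k) z v =
      hess Φ (event z (omega Q k)) (eventD (omega Q k) v) c * wgt p k := by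
    intro z hz v c k
    have h1 := (((hC2At (event_mem_Dpos hQ hz k)).fderiv_right (m := 1)
      (by norm_num)).differentiableAt (by simp)).hasFDerivAt
    have h2 := ((HasFDerivAt.comp z h1 (hasFDerivAt_event z (omega Q k))).clm_apply
      (hasFDerivAt_const c z)).mul_const (wgt p k)
    rw [show (fun z => fderiv ℝ Φ (event z (omega Q k)) c * wgt p k) =
      fun z => ((fderiv ℝ Φ) ∘ fun z => event z (omega Q k)) z c * wgt p k from rfl, h2.fderiv]
    simp [hess, mul_comm]
  have dT : ∀ z ∈ d.Dx, ∀ v, fderiv ℝ (modeT d Φ Q p) z v =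
      ∫ k in sphK, hess Φ (event z (omega Q k)) (eventD (omega Q k) v) et * wgt p k := by
    intro z hz v
    rw [Filter.EventuallyEq.fderiv_eq (f := fun z => ∫ k in sphK,
      fderiv ℝ Φ (event z (omega Q k)) et * wgt p k) (by
        filter_upwards [hxo.mem_nhds hz] with x hx using hT x hx),
      fderiv_setIntegral_apply hxo hS1 isCompact_sphK hz v]
    exact integral_congr_ae (Eventually.of_forall fun k => dd z hz v et k)
  have dR : ∀ z ∈ d.Dx, ∀ v, fderiv ℝ (modeR d Φ Q p) z v =
      ∫ k in sphK, hess Φ (event z (omega Q k)) (eventD (omega Q k) v) (spat (omega Q k))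
        * wgt p k := by
    intro z hz v
    rw [Filter.EventuallyEq.fderiv_eq (f := fun z => ∫ k in sphK,
      fderiv ℝ Φ (event z (omega Q k)) (spat (omega Q k)) * wgt p k) (by
        filter_upwards [hxo.mem_nhds hz] with x hx using hR x hx),
      fderiv_setIntegral_apply hxo hS2 isCompact_sphK hz v]
    exact integral_congr_ae (Eventually.of_forall fun k => dd z hz v (spat (omega Q k)) k)
  have hWc : ContinuousOn (fderivWithin ℝ Φ d.D) d.D :=
    hΦ.regular.continuousOn_fderivWithin (hd.uniqueDiffOn_D hn) (by norm_num)
  have hec : ContinuousOn (fun x : (ℝ × ℝ) × (ℝ × ℝ) => event x.1 (omega Q x.2)) (d.D₂ ×ˢ sphK) :=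
    contDiff_event.continuous.continuousOn
  have hwc : ContinuousOn (fun x : (ℝ × ℝ) × (ℝ × ℝ) => wgt p x.2) (d.D₂ ×ˢ sphK) :=
    hw1.continuous.continuousOn
  refine ⟨?_, ?_, ?_, ?_, ?_, ?_, ?_⟩
  · exact contDiffOn_setIntegral 2 hOo isCompact_sphK hxo (prod_mono le_rfl (subset_univ _)) hS0
  · exact continuousOn_setIntegral (F := fun x : (ℝ × ℝ) × (ℝ × ℝ) =>
      Φ (event x.1 (omega Q x.2)) * wgt p x.2) isCompact_sphK
      ((hΦ.regular.continuousOn.comp hec fun x hx => event_maps hQ hx).mul hwc)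
  · exact continuousOn_setIntegral (F := fun x : (ℝ × ℝ) × (ℝ × ℝ) =>
      fderivWithin ℝ Φ d.D (event x.1 (omega Q x.2)) et * wgt p x.2) isCompact_sphK
      (((hWc.comp hec fun x hx => event_maps hQ hx).clm_apply continuousOn_const).mul hwc)
  · exact continuousOn_setIntegral (F := fun x : (ℝ × ℝ) × (ℝ × ℝ) =>
      fderivWithin ℝ Φ d.D (event x.1 (omega Q x.2)) (spat (omega Q x.2)) * wgt p x.2)
      isCompact_sphK (((hWc.comp hec fun x hx => event_maps hQ hx).clm_apply
        hom.continuous.continuousOn).mul hwc)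
  · intro z hz
    rw [hT z hz, d0 z hz]
    simp only [eventD_time]
  · intro z hz
    rw [hR z hz, d0 z hz]
    simp only [eventD_radius]
  · intro z hz hz0
    have hzD := mem_D₂_of_Dx hz hz0.le
    have hzet : ∀ k, zet (event z (omega Q k)) = z := fun k => by
      rw [zet, event_zero, rad_event z (sum_sq_omega hQ k), abs_of_pos hz0]
    have hradk : ∀ k, rad (event z (omega Q k)) = z.2 := fun k => congrArg Prod.snd (hzet k)
    -- the spatial slice
    set g : (Fin 3 → ℝ) → ℝ := fun x => Φ (z.1 • et + spat x) with hg
    have hslice : ∀ x, HasFDerivAt (fun x => z.1 • et + spat x) spat x := fun x =>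
      spat.hasFDerivAt.const_add _
    have hgC2 : ∀ k, ContDiffAt ℝ 2 g (z.2 • omega Q k) := fun k =>
      ContDiffAt.comp (z.2 • omega Q k) (hC2At (event_mem_Dpos hQ hz k))
        (contDiffAt_const.add spat.contDiff.contDiffAt)
    have hgnear : ∀ k, ∀ᶠ x in 𝓝 (z.2 • omega Q k), z.1 • et + spat x ∈ Dpos d := fun k =>
      (hslice _).continuousAt.preimage_mem_nhds (hDo.mem_nhds (event_mem_Dpos hQ hz k))
    have hg1 : ∀ x, z.1 • et + spat x ∈ Dpos d →
        fderiv ℝ g x = (fderiv ℝ Φ (z.1 • et + spat x)).comp spat := fun x hx =>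
      (HasFDerivAt.comp x ((hC2At hx).differentiableAt (by simp)).hasFDerivAt (hslice x)).fderiv
    have hg2 : ∀ k v v', hess g (z.2 • omega Q k) v v' =
        hess Φ (event z (omega Q k)) (spat v) (spat v') := by
      intro k v v'
      unfold hess
      rw [Filter.EventuallyEq.fderiv_eq (by
        filter_upwards [hgnear k] with x hx using hg1 x hx)]
      have h1 := (((hC2At (event_mem_Dpos hQ hz k)).fderiv_right (m := 1)
        (by norm_num)).differentiableAt (by simp)).hasFDerivAt
      have h2 := (HasFDerivAt.comp (z.2 • omega Q k) h1 (hslice _)).clm_comp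
        (hasFDerivAt_const spat (z.2 • omega Q k))
      rw [show (fun x => (fderiv ℝ Φ (z.1 • et + spat x)).comp spat) =
        fun x => (((fderiv ℝ Φ) ∘ fun x => z.1 • et + spat x) x).comp spat from rfl, h2.fderiv]
      simp [event]
    have hlapk : ∀ k, sphLap g (z.2 • omega Q k) =
        z.2 ^ 2 * (∑ a : Fin 3, hess Φ (event z (omega Q k)) (Pi.single a.succ 1)
          (Pi.single a.succ 1))
        - z.2 ^ 2 * hess Φ (event z (omega Q k)) (spat (omega Q k)) (spat (omega Q k))
        - 2 * z.2 * fderiv ℝ Φ (event z (omega Q k)) (spat (omega Q k)) := fun k => by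
      have h1 : ∑ i, (z.2 • omega Q k) i ^ 2 = z.2 ^ 2 := by
        simp only [Pi.smul_apply, smul_eq_mul, mul_pow, ← Finset.mul_sum, sum_sq_omega hQ, mul_one]
      rw [sphLap, h1, hg1 _ (event_mem_Dpos hQ hz k)]
      simp only [hg2, spat_single, map_smul, smul_apply, smul_eq_mul,
        ContinuousLinearMap.comp_apply]
      rw [show z.1 • et + z.2 • spat (omega Q k) = event z (omega Q k) by
        rw [event, map_smul]]
      ring
    have hang := integral_sphLap hQ hgC2 hp
    -- the integrated equation
    have hcont : ∀ {Y : ℝ × ℝ → ℝ}, Continuous Y → IntegrableOn Y sphK := fun h =>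
      h.continuousOn.integrableOn_compact isCompact_sphK
    have hek : Continuous fun k => event z (omega Q k) :=
      contDiff_event.continuous.comp (by fun_prop : Continuous fun k : ℝ × ℝ => (z, k))
    have hk : Continuous (wgt p) := (contDiff_wgt p).continuous
    have hok : Continuous fun k => spat (omega Q k) :=
      spat.continuous.comp contDiff_omega.continuous
    have c0 : Continuous fun k => Φ (event z (omega Q k)) :=
      continuous_iff_continuousAt.2 fun k => ContinuousAt.comp (f := fun k => event z (omega Q k))
        (hC2At (event_mem_Dpos hQ hz k)).continuousAt hek.continuousAt
    have c1 : Continuous fun k => fderiv ℝ Φ (event z (omega Q k)) :=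
      continuous_iff_continuousAt.2 fun k => ContinuousAt.comp (f := fun k => event z (omega Q k))
        ((hC2At (event_mem_Dpos hQ hz k)).fderiv_right (m := 1) (by norm_num)).continuousAt
        hek.continuousAt
    have c2 : Continuous fun k => hess Φ (event z (omega Q k)) :=
      continuous_iff_continuousAt.2 fun k => ContinuousAt.comp (f := fun k => event z (omega Q k))
        (((hC2At (event_mem_Dpos hQ hz k)).fderiv_right (m := 1) (by norm_num)).fderiv_right (m := 0)
          (by norm_num)).continuousAt hek.continuousAt
    have iu := hcont (c0.mul hk)
    have iT := hcont ((c1.clm_apply continuous_const (g := fun _ => et)).mul hk)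
    have iR := hcont ((c1.clm_apply hok).mul hk)
    have iTT := hcont (((c2.clm_apply (continuous_const (y := et))).clm_apply
      (continuous_const (y := et))).mul hk)
    have iRR := hcont (((c2.clm_apply hok).clm_apply hok).mul hk)
    set c' := 4 * d.cβ z + z.2 * fderiv ℝ d.cβ z (0, 1) + fderiv ℝ d.cC z (0, 1) / z.2 with hc'
    set a₁ := fderiv ℝ d.cA z (1, 0) with ha₁
    have hRne := hz0.ne'
    -- The equation is solved for the spherical Laplacian. Integration against the zonal weight then
    -- replaces the left side by the eigenvalue times the mode and the right side by derivatives of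
    -- the mode.
    have hpoint : ∀ k, (d.cC z / z.2 ^ 2) * (sphLap g (z.2 • omega Q k) * wgt p k) =
        a₁ * (fderiv ℝ Φ (event z (omega Q k)) et * wgt p k)
        + d.cA z * (hess Φ (event z (omega Q k)) et et * wgt p k)
        - (c' * z.2 + d.cC z * (2 / z.2))
          * (fderiv ℝ Φ (event z (omega Q k)) (spat (omega Q k)) * wgt p k)
        - (d.cβ z * z.2 ^ 2 + d.cC z) * (hess Φ (event z (omega Q k)) (spat (omega Q k))
          (spat (omega Q k)) * wgt p k)
        + μ ^ 2 * d.cA z * (Φ (event z (omega Q k)) * wgt p k) := by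
      intro k
      have hm := event_mem_Dpos hQ hz k
      have heq := hd.reduced_equation hn hΦ hm.1 hm.2 (by rw [hradk]; exact hz0)
      rw [hzet, hradk] at heq
      have e1 : ∑ a : Fin 3, event z (omega Q k) a.succ * pd a.succ Φ (event z (omega Q k)) =
          z.2 * fderiv ℝ Φ (event z (omega Q k)) (spat (omega Q k)) := by
        rw [spat_eq_sum, map_sum, Finset.mul_sum]
        refine Finset.sum_congr rfl fun a _ => ?_
        rw [event_succ, map_smul, smul_eq_mul, pd]; ring
      have e2 : ∑ a : Fin 3, ∑ b : Fin 3, event z (omega Q k) a.succ * event z (omega Q k) b.succ *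
          hess Φ (event z (omega Q k)) (Pi.single a.succ 1) (Pi.single b.succ 1) =
          z.2 ^ 2 * hess Φ (event z (omega Q k)) (spat (omega Q k)) (spat (omega Q k)) := by
        rw [spat_eq_sum]
        simp only [map_sum, map_smul, sum_apply, smul_apply, smul_eq_mul, Finset.mul_sum]
        rw [Finset.sum_comm]
        refine Finset.sum_congr rfl fun a _ => Finset.sum_congr rfl fun b _ => ?_
        rw [event_succ, event_succ]; ring
      rw [e1, e2] at heq
      have e3 : pd 0 Φ (event z (omega Q k)) = fderiv ℝ Φ (event z (omega Q k)) et := rfl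
      rw [e3, show (Pi.single 0 1 : Fin 4 → ℝ) = et from rfl] at heq
      rw [← hc', ← ha₁] at heq
      rw [hlapk k]
      set lap := ∑ a : Fin 3, hess Φ (event z (omega Q k)) (Pi.single a.succ 1) (Pi.single a.succ 1)
      have e4 : ∀ h f : ℝ, d.cC z / z.2 ^ 2 * ((z.2 ^ 2 * lap - z.2 ^ 2 * h - 2 * z.2 * f) * wgt p k)
          = (d.cC z * lap - d.cC z * h - d.cC z * (2 / z.2) * f) * wgt p k := fun h f => by
        field_simp
      rw [e4]
      linear_combination wgt p k * heq
    have hint := integral_congr_ae (μ := volume.restrict sphK) (Eventually.of_forall hpoint)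
    rw [integral_const_mul, integral_add, integral_sub, integral_sub, integral_add,
      integral_const_mul, integral_const_mul, integral_const_mul, integral_const_mul,
      integral_const_mul] at hint
    rotate_left
    all_goals first
      | exact iT.const_mul _
      | exact iTT.const_mul _
      | exact iR.const_mul _
      | exact iRR.const_mul _
      | exact iu.const_mul _
      | exact (iT.const_mul _).add (iTT.const_mul _)
      | exact ((iT.const_mul _).add (iTT.const_mul _)).sub (iR.const_mul _)
      | exact (((iT.const_mul _).add (iTT.const_mul _)).sub (iR.const_mul _)).sub (iRR.const_mul _)
      | skip
    have hTT := dT z hz (1, 0)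
    have hRR := dR z hz (0, 1)
    simp only [eventD_time, eventD_radius] at hTT hRR
    have hang' : ∫ k in sphK, sphLap g (z.2 • omega Q k) * wgt p k = -lam * mode Φ Q p z := by
      refine hang.trans ?_
      congr 1
    rw [hang', ← hT z hz, ← hR z hz, ← hTT, ← hRR] at hint
    rw [hd.radial_coefficient hzD hz0, ha₁, hd.cA_time hzD hz0] at hint
    change _ = _ + _ - _ - _ + μ ^ 2 * d.cA z * mode Φ Q p z at hint
    have hβ : d.cβ z * z.2 ^ 2 + d.cC z = d.cB z := by unfold cβ; field_simp; ring
    rw [hβ, cA_eq hz0, cB_eq hz0] at hint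
    have hw0 := (hd.w_pos hzD.1).ne'
    have hp0 := (hd.rp_pos hzD).ne'
    have hCz : d.cC z = d.rp z / d.w z.2 := rfl
    rw [hCz] at hint
    field_simp at hint ⊢
    linear_combination (-1) * hint

end Admissible

end DustData

/-! ### Legendre polynomials and recovery of a function at the pole -/

section Legendre

open Polynomial

/-- Unnormalised Legendre polynomials (Rodrigues' formula). -/
def rodrigues (n : ℕ) : ℝ[X] := derivative^[n] ((X ^ 2 - C 1) ^ n)

theorem degree_rodrigues (n : ℕ) : (rodrigues n).degree = n := by
  have hm : ((X ^ 2 - C 1 : ℝ[X]) ^ n).Monic := (monic_X_pow_sub_C 1 two_ne_zero).pow n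
  have hd : ((X ^ 2 - C 1 : ℝ[X]) ^ n).natDegree = 2 * n := by
    rw [natDegree_pow, natDegree_X_pow_sub_C, mul_comm]
  refine degree_eq_of_le_of_coeff_ne_zero (degree_le_of_natDegree_le ?_) ?_
  · have := natDegree_iterate_derivative ((X ^ 2 - C 1 : ℝ[X]) ^ n) n
    rw [hd] at this
    exact this.trans (by omega)
  · have h1 : ((X ^ 2 - C 1 : ℝ[X]) ^ n).coeff (n + n) = 1 := by
      have := hm.coeff_natDegree
      rwa [hd, two_mul] at this
    rw [rodrigues, coeff_iterate_derivative, h1]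
    simp [Nat.descFactorial_eq_zero_iff_lt]

/-- For q = (X² - 1)^n one has (X² - 1) q' = 2n X q; the identity is this one differentiated j + 1
times. For j = n it is the Legendre equation. -/
theorem rodrigues_recursion (n j : ℕ) :
    (X ^ 2 - 1) * derivative^[j + 2] ((X ^ 2 - C 1 : ℝ[X]) ^ n)
      + C (2 * ((j : ℝ) + 1) - 2 * n) * X * derivative^[j + 1] ((X ^ 2 - C 1 : ℝ[X]) ^ n)
      + C (((j : ℝ) + 1) * j - 2 * n * (j + 1)) * derivative^[j] ((X ^ 2 - C 1 : ℝ[X]) ^ n) = 0 := by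
  set q : ℝ[X] := (X ^ 2 - C 1) ^ n with hq
  induction j with
  | zero =>
    have h0 : (X ^ 2 - 1) * derivative q = C (2 * (n : ℝ)) * X * q := by
      rcases n with _ | n
      · simp [hq]
      · rw [hq, derivative_pow]
        simp only [derivative_sub, derivative_X_pow, derivative_C, map_mul, C_eq_natCast,
          Nat.add_one_sub_one]
        simp only [map_ofNat, map_one, Nat.cast_add, Nat.cast_one, Nat.cast_ofNat]
        ring
    have h1 := congrArg derivative h0
    simp only [derivative_mul, derivative_sub, derivative_X_pow, derivative_one, derivative_C,
      derivative_X] at h1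
    simp only [Function.iterate_succ_apply, Function.iterate_zero, id, zero_add]
    simp at h1 ⊢
    linear_combination h1
  | succ j ih =>
    have h1 := congrArg derivative ih
    simp only [derivative_add, derivative_mul, derivative_sub, derivative_X_pow, derivative_one,
      derivative_C, derivative_X, derivative_zero, ← Function.iterate_succ_apply' derivative] at h1
    simp at h1 ⊢
    have hC2 : (C (2 : ℝ) : ℝ[X]) = 2 := rfl
    rw [hC2] at h1 ⊢
    linear_combination h1

theorem isZonal_rodrigues (n : ℕ) : IsZonal (rodrigues n) (n * (n + 1)) := by
  intro x
  rcases n with _ | n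
  · simp [rodrigues]
  · have h := congrArg (eval x) (rodrigues_recursion (n + 1) (n + 1))
    rw [Function.iterate_succ_apply', Function.iterate_succ_apply' derivative (n + 1)] at h
    rw [show derivative^[n + 1] ((X ^ 2 - C 1 : ℝ[X]) ^ (n + 1)) = rodrigues (n + 1) from rfl] at h
    simp at h ⊢
    linear_combination (-1) * h

theorem IsZonal.const_mul {p : ℝ[X]} {lam : ℝ} (h : IsZonal p lam) (a : ℝ) :
    IsZonal (C a * p) lam := fun x => by
  have := h x
  simp only [derivative_C_mul, eval_mul, eval_C]
  linear_combination a * this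

theorem IsZonal.hasDerivAt {p : ℝ[X]} {lam : ℝ} (h : IsZonal p lam) (x : ℝ) :
    HasDerivAt (fun x => (1 - x ^ 2) * p.derivative.eval x) (-lam * p.eval x) x := by
  have h1 := (((hasDerivAt_id' x).pow 2).const_sub 1).mul (p.derivative.hasDerivAt x)
  refine h1.congr_deriv ?_
  rw [← h x]
  simp
  ring

/-- The function (1-x²) p' has derivative -lam p, so it is lam-Lipschitz, and it vanishes at ±1. The
distance from x to the nearer endpoint is at most 1 - x², which can be divided out. At ±1 the
equation gives p' directly. -/
theorem IsZonal.abs_derivative_le {p : ℝ[X]} {lam : ℝ} (h : IsZonal p lam) (hl : 0 ≤ lam)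
    (hp : ∀ x ∈ Icc (-1 : ℝ) 1, |p.eval x| ≤ 1) {x : ℝ} (hx : x ∈ Icc (-1 : ℝ) 1) :
    |p.derivative.eval x| ≤ lam := by
  have hlip : ∀ a ∈ Icc (-1 : ℝ) 1, ∀ b ∈ Icc (-1 : ℝ) 1,
      |(1 - b ^ 2) * p.derivative.eval b - (1 - a ^ 2) * p.derivative.eval a| ≤ lam * |b - a| := by
    intro a ha b hb
    refine (convex_Icc (-1 : ℝ) 1).norm_image_sub_le_of_norm_hasDerivWithin_le
      (f := fun x => (1 - x ^ 2) * p.derivative.eval x) (f' := fun x => -lam * p.eval x)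
      (fun y _ => (h.hasDerivAt y).hasDerivWithinAt) (fun y hy => ?_) ha hb
    rw [norm_mul, Real.norm_eq_abs, Real.norm_eq_abs, abs_neg, abs_of_nonneg hl]
    exact mul_le_of_le_one_right hl (hp y hy)
  have h1 := h x
  rcases hx.1.eq_or_lt with e | hx1
  · rw [← e] at h1 ⊢
    have h2 : p.derivative.eval (-1) = -(lam / 2) * p.eval (-1) := by linarith
    rw [h2, abs_mul, abs_neg, abs_of_nonneg (by positivity)]
    have := hp (-1) (by simp)
    nlinarith [abs_nonneg (p.eval (-1))]
  rcases hx.2.eq_or_lt with e | hx2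
  · rw [e] at h1 ⊢
    have h2 : p.derivative.eval 1 = (lam / 2) * p.eval 1 := by linarith
    rw [h2, abs_mul, abs_of_nonneg (by positivity)]
    have := hp 1 (by simp)
    nlinarith [abs_nonneg (p.eval 1)]
  have hpos : 0 < 1 - x ^ 2 := by nlinarith
  rcases le_total 0 x with h0 | h0
  · have h2 := hlip 1 (by simp) x hx
    have h3 : |(1 - x ^ 2) * p.derivative.eval x| ≤ lam * (1 - x) := by
      have : |x - 1| = 1 - x := by rw [abs_sub_comm]; exact abs_of_nonneg (by linarith)
      rw [this] at h2
      simpa using h2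
    rw [abs_mul, abs_of_pos hpos] at h3
    have h4 : lam * (1 - x) ≤ lam * (1 - x ^ 2) := mul_le_mul_of_nonneg_left (by nlinarith) hl
    nlinarith
  · have h2 := hlip (-1) (by simp) x hx
    have h3 : |(1 - x ^ 2) * p.derivative.eval x| ≤ lam * (1 + x) := by
      have : |x - (-1)| = 1 + x := by rw [sub_neg_eq_add, add_comm]; exact abs_of_nonneg (by linarith)
      rw [this] at h2
      simpa using h2
    rw [abs_mul, abs_of_pos hpos] at h3
    have h4 : lam * (1 + x) ≤ lam * (1 - x ^ 2) := mul_le_mul_of_nonneg_left (by nlinarith) hl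
    nlinarith

/-- By the derivative bound |p| stays above 1/2 within distance 1/(2(1+lam)) of a point where |p| =
1. -/
theorem IsZonal.integral_sq_ge {p : ℝ[X]} {lam : ℝ} (h : IsZonal p lam) (hl : 0 ≤ lam)
    (hp : ∀ x ∈ Icc (-1 : ℝ) 1, |p.eval x| ≤ 1) {x₀ : ℝ} (hx₀ : x₀ ∈ Icc (-1 : ℝ) 1)
    (hp₀ : |p.eval x₀| = 1) : 1 / (8 * (1 + lam)) ≤ ∫ x in (-1 : ℝ)..1, p.eval x ^ 2 := by
  set l := 1 / (2 * (1 + lam)) with hl'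
  have hlpos : 0 < l := by positivity
  have hlhalf : l ≤ 1 / 2 := by
    rw [hl', div_le_div_iff₀ (by positivity) (by norm_num)]; linarith
  have hlam : lam * l ≤ 1 / 2 := by rw [hl']; field_simp; linarith
  have hlow : ∀ x ∈ Icc (-1 : ℝ) 1, |x - x₀| ≤ l → 1 / 4 ≤ p.eval x ^ 2 := by
    intro x hx hd
    have h1 := (convex_Icc (-1 : ℝ) 1).norm_image_sub_le_of_norm_hasDerivWithin_le
      (f := fun x => p.eval x) (f' := fun x => p.derivative.eval x)
      (fun y _ => (p.hasDerivAt y).hasDerivWithinAt) (fun y hy => h.abs_derivative_le hl hp hy)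
      hx₀ hx
    simp only [Real.norm_eq_abs] at h1
    have h2 : |p.eval x - p.eval x₀| ≤ 1 / 2 :=
      h1.trans ((mul_le_mul_of_nonneg_left hd hl).trans hlam)
    have h3 : 1 / 2 ≤ |p.eval x| := by
      have := abs_sub_abs_le_abs_sub (p.eval x₀) (p.eval x)
      rw [abs_sub_comm] at this
      linarith
    rw [← sq_abs]
    nlinarith
  -- An interval of length l with x₀ as an endpoint, placed on the side of x₀ on which it fits into
  -- [-1, 1].
  obtain ⟨a, ha1, ha2, hax⟩ : ∃ a, -1 ≤ a ∧ a + l ≤ 1 ∧ ∀ x ∈ Icc a (a + l), |x - x₀| ≤ l := by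
    rcases le_total x₀ 0 with h0 | h0
    · exact ⟨x₀, hx₀.1, by linarith, fun x hx => abs_le.2 ⟨by linarith [hx.1], by linarith [hx.2]⟩⟩
    · exact ⟨x₀ - l, by linarith, by linarith [hx₀.2], fun x hx =>
        abs_le.2 ⟨by linarith [hx.1], by linarith [hx.2]⟩⟩
  have hc : Continuous fun x => p.eval x ^ 2 := p.continuous.pow 2
  have h1 : ∫ x in a..(a + l), p.eval x ^ 2 ≤ ∫ x in (-1 : ℝ)..1, p.eval x ^ 2 :=
    intervalIntegral.integral_mono_interval ha1 (by linarith) ha2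
      (Eventually.of_forall fun x => sq_nonneg _) (hc.intervalIntegrable _ _)
  have h2 : ∫ _ in a..(a + l), (1 / 4 : ℝ) ≤ ∫ x in a..(a + l), p.eval x ^ 2 :=
    intervalIntegral.integral_mono_on (by linarith) (by simp) (hc.intervalIntegrable _ _)
      fun x hx => hlow x ⟨ha1.trans hx.1, hx.2.trans ha2⟩ (hax x hx)
  rw [intervalIntegral.integral_const] at h2
  refine le_trans (le_of_eq ?_) (h2.trans h1)
  rw [hl', smul_eq_mul]
  field_simp
  ring

/-- The primitive of (lam' - lam) p q is 1 - x² times the Wronskian, which vanishes at ±1. -/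
theorem IsZonal.orthogonal {p q : ℝ[X]} {lam lam' : ℝ} (hp : IsZonal p lam) (hq : IsZonal q lam')
    (hne : lam ≠ lam') : ∫ x in (-1 : ℝ)..1, p.eval x * q.eval x = 0 := by
  have hder : ∀ x ∈ uIcc (-1 : ℝ) 1, HasDerivAt (fun x => (1 - x ^ 2) * p.derivative.eval x * q.eval x
      - p.eval x * ((1 - x ^ 2) * q.derivative.eval x)) ((lam' - lam) * (p.eval x * q.eval x)) x :=
    fun x _ => (((hp.hasDerivAt x).mul (q.hasDerivAt x)).sub
      ((p.hasDerivAt x).mul (hq.hasDerivAt x))).congr_deriv (by ring)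
  have h := intervalIntegral.integral_eq_sub_of_hasDerivAt hder
    ((continuous_const.mul (p.continuous.mul q.continuous)).intervalIntegrable _ _)
  rw [intervalIntegral.integral_const_mul] at h
  simp at h
  exact h.resolve_left (sub_ne_zero.2 hne.symm)

/-- Legendre polynomials, normalised in the supremum norm. -/
theorem exists_zonal_basis : ∃ P : ℕ → ℝ[X], (∀ n, (P n).degree = n) ∧
    (∀ n : ℕ, IsZonal (P n) (n * (n + 1))) ∧
    (∀ n, ∀ x ∈ Icc (-1 : ℝ) 1, |(P n).eval x| ≤ 1) ∧
    (∀ n : ℕ, 1 / (8 * (1 + (n : ℝ) * (n + 1))) ≤ ∫ x in (-1 : ℝ)..1, (P n).eval x ^ 2) ∧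
    ∀ m n, m ≠ n → ∫ x in (-1 : ℝ)..1, (P m).eval x * (P n).eval x = 0 := by
  have hmax : ∀ n, ∃ x₀ ∈ Icc (-1 : ℝ) 1, ∀ x ∈ Icc (-1 : ℝ) 1,
      |(rodrigues n).eval x| ≤ |(rodrigues n).eval x₀| := fun n =>
    isCompact_Icc.exists_isMaxOn ⟨0, by norm_num, by norm_num⟩
      ((rodrigues n).continuous.abs.continuousOn)
  choose x₀ hx₀ hmax using hmax
  have hne : ∀ n, rodrigues n ≠ 0 := fun n h => by
    have := degree_rodrigues n
    rw [h, degree_zero] at this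
    exact absurd this (by simp)
  have hpos : ∀ n, 0 < |(rodrigues n).eval (x₀ n)| := fun n => by
    by_contra hcon
    have h0 : ∀ x ∈ Icc (-1 : ℝ) 1, (rodrigues n).eval x = 0 := fun x hx =>
      abs_nonpos_iff.1 ((hmax n x hx).trans (not_lt.1 hcon))
    refine hne n (Polynomial.eq_zero_of_infinite_isRoot _ ?_)
    exact (Icc_infinite (by norm_num : (-1 : ℝ) < 1)).mono fun x hx => h0 x hx
  set s : ℕ → ℝ := fun n => |(rodrigues n).eval (x₀ n)|⁻¹ with hs
  have hs0 : ∀ n, 0 < s n := fun n => inv_pos.2 (hpos n)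
  have hz : ∀ n : ℕ, IsZonal (C (s n) * rodrigues n) (n * (n + 1)) := fun n =>
    (isZonal_rodrigues n).const_mul _
  have hle : ∀ n, ∀ x ∈ Icc (-1 : ℝ) 1, |(C (s n) * rodrigues n).eval x| ≤ 1 := fun n x hx => by
    rw [eval_mul, eval_C, abs_mul, abs_of_pos (hs0 n), hs]
    have := hpos n
    rw [inv_mul_le_iff₀ this, mul_one]
    exact hmax n x hx
  refine ⟨fun n => C (s n) * rodrigues n, fun n => ?_, hz, hle, fun n => ?_, fun m n hmn => ?_⟩
  · rw [degree_C_mul (hs0 n).ne', degree_rodrigues]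
  · refine (hz n).integral_sq_ge (by positivity) (hle n) (hx₀ n) ?_
    rw [eval_mul, eval_C, abs_mul, abs_of_pos (hs0 n), hs]
    exact inv_mul_cancel₀ (hpos n).ne'
  · refine (hz m).orthogonal (hz n) fun h => hmn ?_
    have h' : m * (m + 1) = n * (n + 1) := by exact_mod_cast h
    rcases lt_trichotomy m n with h1 | h1 | h1
    · nlinarith
    · exact h1
    · nlinarith

/-- Pointwise bound at the pole in terms of Legendre coefficients. -/
theorem pole_bound {P : ℕ → ℝ[X]} (hdeg : ∀ n, (P n).degree = n)
    (hle : ∀ n, ∀ x ∈ Icc (-1 : ℝ) 1, |(P n).eval x| ≤ 1)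
    (hsq : ∀ n : ℕ, 1 / (8 * (1 + (n : ℝ) * (n + 1))) ≤ ∫ x in (-1 : ℝ)..1, (P n).eval x ^ 2)
    (horth : ∀ m n, m ≠ n → ∫ x in (-1 : ℝ)..1, (P m).eval x * (P n).eval x = 0)
    {g : ℝ → ℝ} (hg : ContinuousOn g (Icc (-1) 1)) {b : ℕ → ℝ}
    (hb : ∀ n, |∫ x in (-1 : ℝ)..1, g x * (P n).eval x| ≤ b n)
    (hsum : Summable fun n : ℕ => 8 * (1 + (n : ℝ) * (n + 1)) * b n) :
    |g 1| ≤ ∑' n : ℕ, 8 * (1 + (n : ℝ) * (n + 1)) * b n := by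
  have hb0 : ∀ n, 0 ≤ b n := fun n => (abs_nonneg _).trans (hb n)
  have hcP : ∀ n, Continuous fun x => (P n).eval x := fun n => (P n).continuous
  have hgi : ∀ q : ℝ[X], IntervalIntegrable (fun x => g x * q.eval x) volume (-1) 1 := fun q =>
    ContinuousOn.intervalIntegrable (by
      rw [uIcc_of_le (by norm_num)]; exact hg.mul q.continuous.continuousOn)
  set S : Polynomial.Sequence ℝ := ⟨P, hdeg⟩ with hS
  have hspan : Submodule.span ℝ (range P) = ⊤ :=
    S.span fun i => isUnit_iff_ne_zero.2 (leadingCoeff_ne_zero.2 (S.ne_zero i))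
  -- Averages of g against nonnegative polynomial kernels are bounded uniformly. Such a kernel is a
  -- finite combination of the P n, so no convergence of a Legendre series is needed.
  have hk : ∀ k : ℝ[X], (∀ x ∈ Icc (-1 : ℝ) 1, 0 ≤ k.eval x) →
      |∫ x in (-1 : ℝ)..1, g x * k.eval x| ≤
        (∫ x in (-1 : ℝ)..1, k.eval x) * ∑' n : ℕ, 8 * (1 + (n : ℝ) * (n + 1)) * b n := by
    intro k hk0
    have hmem : k ∈ Submodule.span ℝ (range P) := by rw [hspan]; trivial
    obtain ⟨c, hc⟩ := (Finsupp.mem_span_range_iff_exists_finsupp).1 hmem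
    have heval : ∀ x, k.eval x = ∑ i ∈ c.support, c i * (P i).eval x := fun x => by
      rw [← hc, Finsupp.sum, eval_finsetSum]
      simp
    set I := ∫ x in (-1 : ℝ)..1, k.eval x with hI
    -- Since |P i| ≤ 1 and k ≥ 0, the inner product of k with P i is at most the integral of k;
    -- division by the squared norm of P i gives the factor 8(1 + i(i+1)).
    have hcoef : ∀ i, |c i| ≤ 8 * (1 + (i : ℝ) * (i + 1)) * I := by
      intro i
      have h1 : ∫ x in (-1 : ℝ)..1, k.eval x * (P i).eval x =
          c i * ∫ x in (-1 : ℝ)..1, (P i).eval x ^ 2 := by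
        have h2 : ∀ x, k.eval x * (P i).eval x =
            ∑ j ∈ c.support, c j * ((P j).eval x * (P i).eval x) := fun x => by
          rw [heval, Finset.sum_mul]
          exact Finset.sum_congr rfl fun j _ => by ring
        simp only [h2]
        have hii : ∀ j ∈ c.support, IntervalIntegrable
            (fun x => c j * ((P j).eval x * (P i).eval x)) volume (-1) 1 := fun j _ =>
          (continuous_const.mul ((hcP j).mul (hcP i))).intervalIntegrable _ _
        rw [intervalIntegral.integral_finsetSum hii]
        simp only [intervalIntegral.integral_const_mul]
        by_cases hi : i ∈ c.support
        · rw [Finset.sum_eq_single i (fun j _ hj => by rw [horth j i hj, mul_zero])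
            (fun h => absurd hi h)]
          simp only [pow_two]
        · rw [Finsupp.notMem_support_iff.1 hi, zero_mul]
          refine Finset.sum_eq_zero fun j hj => ?_
          rw [horth j i (fun h => hi (h ▸ hj)), mul_zero]
      have h3 : |∫ x in (-1 : ℝ)..1, k.eval x * (P i).eval x| ≤ I := by
        refine (intervalIntegral.abs_integral_le_integral_abs (by norm_num)).trans ?_
        refine intervalIntegral.integral_mono_on (by norm_num)
          ((k.continuous.mul (hcP i)).abs.intervalIntegrable _ _)
          (k.continuous.intervalIntegrable _ _) fun x hx => ?_
        rw [abs_mul, abs_of_nonneg (hk0 x hx)]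
        exact mul_le_of_le_one_right (hk0 x hx) (hle i x hx)
      have h4 := hsq i
      have h5 : 0 < 1 / (8 * (1 + (i : ℝ) * (i + 1))) := by positivity
      rw [h1, abs_mul, abs_of_pos (h5.trans_le h4)] at h3
      have h6 : |c i| * (1 / (8 * (1 + (i : ℝ) * (i + 1)))) ≤ I :=
        (mul_le_mul_of_nonneg_left h4 (abs_nonneg _)).trans h3
      rw [mul_one_div, div_le_iff₀ (by positivity)] at h6
      linarith
    have hI0 : 0 ≤ I := intervalIntegral.integral_nonneg (by norm_num) hk0
    have h7 : ∫ x in (-1 : ℝ)..1, g x * k.eval x =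
        ∑ i ∈ c.support, c i * ∫ x in (-1 : ℝ)..1, g x * (P i).eval x := by
      have h2 : ∀ x, g x * k.eval x = ∑ j ∈ c.support, c j * (g x * (P j).eval x) := fun x => by
        rw [heval, Finset.mul_sum]
        exact Finset.sum_congr rfl fun j _ => by ring
      simp only [h2]
      rw [intervalIntegral.integral_finsetSum (fun j _ => (hgi (P j)).const_mul _)]
      simp only [intervalIntegral.integral_const_mul]
    rw [h7]
    calc _ ≤ ∑ i ∈ c.support, |c i * ∫ x in (-1 : ℝ)..1, g x * (P i).eval x| :=
          Finset.abs_sum_le_sum_abs _ _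
      _ ≤ ∑ i ∈ c.support, I * (8 * (1 + (i : ℝ) * (i + 1)) * b i) := by
          refine Finset.sum_le_sum fun i _ => ?_
          rw [abs_mul]
          calc _ ≤ (8 * (1 + (i : ℝ) * (i + 1)) * I) * b i :=
                mul_le_mul (hcoef i) (hb i) (abs_nonneg _) (by positivity)
            _ = _ := by ring
      _ = I * ∑ i ∈ c.support, (8 * (1 + (i : ℝ) * (i + 1)) * b i) := by rw [Finset.mul_sum]
      _ ≤ _ := mul_le_mul_of_nonneg_left (hsum.sum_le_tsum _ fun i _ =>
          mul_nonneg (by positivity) (hb0 i)) hI0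
  -- The normalised kernels (1+x)^N concentrate at x = 1, so their averages of g converge to g 1.
  have hpeak := tendsto_setIntegral_pow_smul_of_unique_maximum_of_isCompact_of_continuousOn
    (μ := volume) (s := Icc (-1 : ℝ) 1) (x₀ := 1) (g := g) (c := fun x => 1 + x) isCompact_Icc
    (by fun_prop) (fun y hy hne => by
      have := lt_of_le_of_ne hy.2 hne; linarith)
    (fun x hx => by linarith [hx.1]) (by norm_num)
    (by rw [interior_Icc, closure_Ioo (by norm_num)]; exact ⟨by norm_num, le_rfl⟩) hg
  refine le_of_tendsto hpeak.abs (Eventually.of_forall fun N => ?_)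
  have h1 := hk ((C 1 + X) ^ N) (fun x hx => by
    simp only [eval_pow, eval_add, eval_C, eval_X]
    exact pow_nonneg (by linarith [hx.1]) N)
  simp only [eval_pow, eval_add, eval_C, eval_X] at h1
  have hpos : 0 < ∫ x in (-1 : ℝ)..1, (1 + x) ^ N := by
    refine intervalIntegral.intervalIntegral_pos_of_pos_on
      ((by fun_prop : Continuous fun x : ℝ => (1 + x) ^ N).intervalIntegrable _ _)
      (fun x hx => pow_pos (by linarith [hx.1]) N) (by norm_num)
  have e1 : ∀ f : ℝ → ℝ, ∫ x in Icc (-1 : ℝ) 1, f x = ∫ x in (-1 : ℝ)..1, f x := fun f => by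
    rw [integral_Icc_eq_integral_Ioc, intervalIntegral.integral_of_le (by norm_num)]
  simp only [smul_eq_mul, e1]
  rw [abs_mul, abs_of_pos (inv_pos.2 hpos), inv_mul_le_iff₀ hpos]
  simpa only [mul_comm] using h1

end Legendre

/-! ### Decay of the modes in the angular eigenvalue -/

theorem contDiff_sphLap {φ : (Fin 3 → ℝ) → ℝ} (hφ : ContDiff ℝ ∞ φ) : ContDiff ℝ ∞ (sphLap φ) := by
  have h1 : ContDiff ℝ ∞ (fderiv ℝ φ) := hφ.fderiv_right (by norm_cast)
  have h2 : ContDiff ℝ ∞ (hess φ) := h1.fderiv_right (by norm_cast)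
  have h3 : ∀ i : Fin 3, ContDiff ℝ ∞ fun x : Fin 3 → ℝ => x i := fun i => contDiff_apply ℝ ℝ i
  unfold sphLap
  refine (((ContDiff.sum fun i _ => (h3 i).pow 2).mul (ContDiff.sum fun i _ => ?_)).sub ?_).sub
    (contDiff_const.mul (h1.clm_apply contDiff_id))
  · exact (h2.clm_apply contDiff_const).clm_apply contDiff_const
  · exact (h2.clm_apply contDiff_id).clm_apply contDiff_id

theorem hasCompactSupport_sphLap {φ : (Fin 3 → ℝ) → ℝ} (hc : HasCompactSupport φ) :
    HasCompactSupport (sphLap φ) := by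
  refine hc.mono' fun x hx => ?_
  by_contra hn
  have h1 : x ∉ tsupport (fderiv ℝ φ) := fun h => hn (tsupport_fderiv_subset ℝ h)
  have h2 : x ∉ tsupport (fderiv ℝ (fderiv ℝ φ)) := fun h => h1 (tsupport_fderiv_subset ℝ h)
  have e1 := image_eq_zero_of_notMem_tsupport h1
  have e2 : hess φ x = 0 := image_eq_zero_of_notMem_tsupport h2
  exact hx (by simp [sphLap, e1, e2])

theorem abs_wgt_le_one {p : Polynomial ℝ} (hp : ∀ x ∈ Icc (-1 : ℝ) 1, |p.eval x| ≤ 1) (k : ℝ × ℝ) :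
    |wgt p k| ≤ 1 := by
  rw [wgt, abs_mul]
  exact mul_le_one₀ (hp _ ⟨Real.neg_one_le_cos _, Real.cos_le_one _⟩) (abs_nonneg _)
    (Real.abs_sin_le_one _)

/-- The zonal modes of a smooth function with compact support decay rapidly. -/
theorem zonal_decay (n : ℕ) : ∀ {φ : (Fin 3 → ℝ) → ℝ}, ContDiff ℝ ∞ φ → HasCompactSupport φ →
    ∃ M, 0 ≤ M ∧ ∀ (Q : Matrix (Fin 3) (Fin 3) ℝ), Q * Q.transpose = 1 →
      ∀ (p : Polynomial ℝ) (lam : ℝ), 0 ≤ lam → IsZonal p lam →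
      (∀ x ∈ Icc (-1 : ℝ) 1, |p.eval x| ≤ 1) → ∀ R : ℝ,
      |∫ k in sphK, φ (R • omega Q k) * wgt p k| ≤ M / (1 + lam) ^ n := by
  induction n with
  | zero =>
    intro φ hφ hc
    obtain ⟨B, hB⟩ := hφ.continuous.bounded_above_of_compact_support hc
    have hB0 : 0 ≤ B := (norm_nonneg _).trans (hB 0)
    refine ⟨B * volume.real sphK, by positivity, fun Q hQ p lam hlam hp hp1 R => ?_⟩
    rw [pow_zero, div_one]
    rw [← Real.norm_eq_abs]
    refine norm_setIntegral_le_of_norm_le_const (isCompact_sphK.measure_lt_top (μ := volume)) fun k _ => ?_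
    rw [norm_mul]
    calc _ ≤ B * 1 := mul_le_mul (hB _) (abs_wgt_le_one hp1 k) (abs_nonneg _) hB0
      _ = B := mul_one B
  | succ n ih =>
    intro φ hφ hc
    -- Applied to φ minus its spherical Laplacian, whose zonal integrals are 1 + lam times those of
    -- φ. Each step gains one power, uniformly in the frame and in R.
    obtain ⟨M, hM0, hM⟩ := ih (φ := fun x => φ x - sphLap φ x) (hφ.sub (contDiff_sphLap hφ))
      (hc.sub (hasCompactSupport_sphLap hc))
    refine ⟨M, hM0, fun Q hQ p lam hlam hp hp1 R => ?_⟩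
    have h := hM Q hQ p lam hlam hp hp1 R
    have hω : Continuous fun k => R • omega Q k := contDiff_omega.continuous.const_smul R
    have hi : ∀ {ψ : (Fin 3 → ℝ) → ℝ}, Continuous ψ →
        IntegrableOn (fun k => ψ (R • omega Q k) * wgt p k) sphK := fun hψ =>
      ((hψ.comp hω).mul (contDiff_wgt p).continuous).continuousOn.integrableOn_compact isCompact_sphK
    have h2 : ∫ k in sphK, (φ (R • omega Q k) - sphLap φ (R • omega Q k)) * wgt p k =
        (1 + lam) * ∫ k in sphK, φ (R • omega Q k) * wgt p k := by
      simp only [sub_mul]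
      have h3 : ∫ k in sphK, sphLap φ (R • omega Q k) * wgt p k =
          -lam * ∫ k in sphK, φ (R • omega Q k) * wgt p k :=
        integral_sphLap hQ (fun k => (hφ.of_le
          (WithTop.coe_le_coe.2 (le_top (a := (2 : ℕ∞))))).contDiffAt) hp
      rw [integral_sub (hi hφ.continuous) (hi (contDiff_sphLap hφ).continuous), h3]
      ring
    have hl : 0 < 1 + lam := by linarith
    rw [h2, abs_mul, abs_of_pos hl] at h
    rw [pow_succ, ← div_div, le_div_iff₀ hl]
    linarith

theorem exists_radius_of_compactSupport {φ : (Fin 3 → ℝ) → ℝ} (hc : HasCompactSupport φ) :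
    ∃ ρ > 0, ∀ x, ρ ^ 2 < ∑ i, x i ^ 2 → φ x = 0 := by
  obtain ⟨r, hr⟩ := hc.isCompact.isBounded.subset_closedBall (0 : Fin 3 → ℝ)
  -- The norm on `Fin 3 → ℝ` is the supremum norm, so the Euclidean square on the support is at most
  -- 3 r², which is less than (2|r|+1)².
  refine ⟨2 * |r| + 1, by positivity, fun x hx => ?_⟩
  by_contra hne
  have h1 := hr (subset_tsupport _ hne)
  rw [mem_closedBall_zero_iff] at h1
  have h2 : ∀ i, x i ^ 2 ≤ |r| ^ 2 := fun i => by
    rw [sq_le_sq, abs_abs]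
    exact ((norm_le_pi_norm x i).trans h1).trans (le_abs_self r)
  rw [Fin.sum_univ_three] at hx
  nlinarith [h2 0, h2 1, h2 2, abs_nonneg r]

namespace DustData

variable {d : DustData}

namespace Admissible

variable {μ : ℝ} {φ₀ φ₁ : (Fin 3 → ℝ) → ℝ} {Φ : (Fin 4 → ℝ) → ℝ}

theorem cons_mem_D (hd : d.Admissible) (hn : d.GloballyNaked) {t : ℝ} (h0 : 0 ≤ t)
    (h1 : t < d.tauS 0) (x : Fin 3 → ℝ) : t • et + spat x ∈ d.D := by
  rw [mem_D_iff]
  have : (t • et + spat x) 0 = t := by simp [et, spat_zero]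
  rw [this]
  exact hd.slab_subset hn (rad_nonneg _) h0 h1

theorem cons_eq (t : ℝ) (x : Fin 3 → ℝ) : (Fin.cons t x : Fin 4 → ℝ) = t • et + spat x := by
  have h := event_eq_cons (t, 1) x
  rw [event, one_smul] at h
  exact h.symm

/-- On the initial surface D is one-sided in time; the derivative within D and the prescribed
velocity agree by uniqueness of derivatives on [0, tauS 0). -/
theorem initial_time_derivative (hd : d.Admissible) (hn : d.GloballyNaked)
    (hΦ : IsKGSolution d μ φ₀ φ₁ Φ) (x : Fin 3 → ℝ) :
    fderivWithin ℝ Φ d.D ((0 : ℝ) • et + spat x) et = φ₁ x := by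
  have hS := hd.tauS_pos 0
  have h1 := ((hΦ.regular.differentiableOn (by simp)) _
    (hd.cons_mem_D hn le_rfl hS x)).hasFDerivWithinAt
  have hc : HasDerivWithinAt (fun t : ℝ => t • et + spat x) et (Ico 0 (d.tauS 0)) 0 := by
    simpa using (((hasDerivAt_id (0 : ℝ)).smul_const et).add_const (spat x)).hasDerivWithinAt
  have h2 := h1.comp_hasDerivWithinAt (0 : ℝ) hc
    (fun t ht => hd.cons_mem_D hn ht.1 ht.2 x)
  have h3 : HasDerivWithinAt (fun t : ℝ => Φ (t • et + spat x)) (φ₁ x) (Ico 0 (d.tauS 0)) 0 := by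
    have := (hΦ.initial_velocity x).mono (fun t (ht : t ∈ Ico 0 (d.tauS 0)) => ht.1)
    simpa only [cons_eq] using this
  exact (uniqueDiffOn_Ico 0 (d.tauS 0) 0 ⟨le_rfl, hS⟩).eq_deriv _ h2 h3

theorem initial_space_derivative (hd : d.Admissible) (hn : d.GloballyNaked)
    (hΦ : IsKGSolution d μ φ₀ φ₁ Φ) (x v : Fin 3 → ℝ) :
    fderivWithin ℝ Φ d.D ((0 : ℝ) • et + spat x) (spat v) = fderiv ℝ φ₀ x v := by
  have hS := hd.tauS_pos 0
  have h1 := ((hΦ.regular.differentiableOn (by simp)) _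
    (hd.cons_mem_D hn le_rfl hS x)).hasFDerivWithinAt
  have hc : HasFDerivWithinAt (fun x => (0 : ℝ) • et + spat x) spat univ x :=
    (spat.hasFDerivAt.const_add _).hasFDerivWithinAt
  have h2 := h1.comp x hc fun x _ => hd.cons_mem_D hn le_rfl hS x
  rw [hasFDerivWithinAt_univ] at h2
  have h3 : (Φ ∘ fun x => (0 : ℝ) • et + spat x) = φ₀ := by
    ext x
    rw [Function.comp, ← cons_eq, hΦ.initial_value]
  rw [h3] at h2
  rw [h2.fderiv]; rfl

theorem yE_initial (hd : d.Admissible) (R : ℝ) : d.yE 0 R = 1 := by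
  have h := hd.yE_tau (R := R) (hd.mem_yDom (y := 1) ⟨one_pos, le_rfl⟩)
  rwa [tau_one] at h

/-- The initial energy density of a mode. -/
theorem energy_initial_le (hd : d.Admissible) {lam : ℝ} (hlam : 0 ≤ lam) {u ut uR : ℝ × ℝ → ℝ} {R : ℝ}
    (hR : 0 ≤ R) : d.energy μ lam u ut uR (0, R) ≤ (R * ut (0, R)) ^ 2 + (R * uR (0, R)) ^ 2
      + (lam + μ ^ 2 * R ^ 2) * u (0, R) ^ 2 := by
  have hr : d.rr (0, R) = R := by simp [rr, hd.yE_initial]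
  have hp : d.rp (0, R) = 1 := by simp [rp, hd.yE_initial, rR, tauK_one]
  have hw0 := hd.w_pos hR
  have hw1 := hd.w_le_one R
  have hs : d.sf (0, R) = d.infall 1 R := by simp [sf, hd.yE_initial]
  have hs01 : 0 ≤ d.infall 1 R ∧ d.infall 1 R ≤ 1 := by
    rcases hR.eq_or_lt with rfl | hR
    · simp [infall]
    · refine ⟨(hd.infall_pos (hd.mem_yDom ⟨one_pos, le_rfl⟩) hR).le, ?_⟩
      refine ((hd.infall_le_w_iff ⟨one_pos, le_rfl⟩ hR).2 ?_).trans hw1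
      rw [sq_c_eq d hR, one_pow]
      exact (hd.untrapped R hR).le
  rw [energy, hr, hp, hs, eForm]
  set s := d.infall 1 R
  set a := ut (0, R)
  set b := uR (0, R)
  set v := u (0, R)
  have h1 : d.w R ^ 2 ≤ 1 := by nlinarith
  have h2 : s * ((R * a) * (R * b)) ≤ ((R * a) ^ 2 + (R * b) ^ 2) / 2 := by
    have h3 : (R * a) * (R * b) ≤ ((R * a) ^ 2 + (R * b) ^ 2) / 2 := by
      nlinarith [sq_nonneg (R * a - R * b)]
    have h4 : 0 ≤ ((R * a) ^ 2 + (R * b) ^ 2) / 2 := by positivity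
    calc _ ≤ s * (((R * a) ^ 2 + (R * b) ^ 2) / 2) := mul_le_mul_of_nonneg_left h3 hs01.1
      _ ≤ _ := mul_le_of_le_one_left h4 hs01.2
  have h5 : d.w R ^ 2 * (R * b) ^ 2 ≤ (R * b) ^ 2 := mul_le_of_le_one_left (sq_nonneg _) h1
  have h6 : 0 ≤ (lam + μ ^ 2 * R ^ 2) * v ^ 2 := by positivity
  simp only [div_one, mul_one]
  nlinarith

/-- The zonal modes of a solution with smooth compactly supported data decay rapidly. -/
theorem mode_decay (hd : d.Admissible) (hn : d.GloballyNaked) (hΦ : IsKGSolution d μ φ₀ φ₁ Φ)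
    (hφ₀ : ContDiff ℝ ∞ φ₀) (hφ₀c : HasCompactSupport φ₀)
    (hφ₁ : ContDiff ℝ ∞ φ₁) (hφ₁c : HasCompactSupport φ₁) :
    ∃ C, 0 ≤ C ∧ ∀ (Q : Matrix (Fin 3) (Fin 3) ℝ), Q * Q.transpose = 1 →
      ∀ (p : Polynomial ℝ) (lam : ℝ), 0 ≤ lam → IsZonal p lam →
      (∀ x ∈ Icc (-1 : ℝ) 1, |p.eval x| ≤ 1) → ∀ z ∈ d.D₂, 0 < z.1 → 0 < z.2 →
      √(d.rr z) * |mode Φ Q p z| ≤ C / (1 + lam) ^ 2 := by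
  -- The Euler derivative of φ₀. Restricted to the sphere of radius R it is R times the radial
  -- derivative, so R `modeR` is itself a zonal integral of a smooth compactly supported function.
  set φ₂ : (Fin 3 → ℝ) → ℝ := fun x => fderiv ℝ φ₀ x x with hφ₂def
  have hφ₂ : ContDiff ℝ ∞ φ₂ :=
    (hφ₀.fderiv_right (m := ∞) (by norm_cast)).clm_apply contDiff_id
  have hφ₂c : HasCompactSupport φ₂ := (hφ₀c.fderiv ℝ).mono fun x hx hz => hx (by simp [φ₂, hz])
  obtain ⟨ρ₀, hρ₀, hz₀⟩ := exists_radius_of_compactSupport hφ₀c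
  obtain ⟨ρ₁, hρ₁, hz₁⟩ := exists_radius_of_compactSupport hφ₁c
  obtain ⟨ρ₂, hρ₂, hz₂⟩ := exists_radius_of_compactSupport hφ₂c
  obtain ⟨M₀, hM₀0, hM₀⟩ := zonal_decay 3 hφ₀ hφ₀c
  obtain ⟨M₁, hM₁0, hM₁⟩ := zonal_decay 3 hφ₁ hφ₁c
  obtain ⟨M₂, hM₂0, hM₂⟩ := zonal_decay 3 hφ₂ hφ₂c
  set ρ := ρ₀ + ρ₁ + ρ₂ with hρ
  have hρpos : 0 < ρ := by positivity
  set M := M₀ + M₁ + M₂ with hM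
  have hM0 : 0 ≤ M := by positivity
  obtain ⟨C, hC, hbound⟩ := hd.mode_bound hn
  set K := ρ ^ 2 + 2 + μ ^ 2 * ρ ^ 2 with hK
  have hK0 : 0 ≤ K := by positivity
  set A := 2 * ((1 + ρ ^ 2) * (K * M ^ 2)) with hA
  have hA0 : 0 ≤ A := by positivity
  refine ⟨C * (1 + A) + √ρ * M, by positivity, fun Q hQ p lam hlam hp hp1 z hz h0 hR => ?_⟩
  set Λ := 1 + lam with hΛ
  have hΛ1 : 1 ≤ Λ := by linarith
  have hΛ0 : 0 < Λ := by linarith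
  have hu : ∀ R, mode Φ Q p (0, R) = ∫ k in sphK, φ₀ (R • omega Q k) * wgt p k := fun R => by
    simp only [mode, event_eq_cons, hΦ.initial_value]
  have hut : ∀ R, modeT d Φ Q p (0, R) = ∫ k in sphK, φ₁ (R • omega Q k) * wgt p k := fun R => by
    simp only [modeT, event, hd.initial_time_derivative hn hΦ]
  have huR : ∀ R, R * modeR d Φ Q p (0, R) = ∫ k in sphK, φ₂ (R • omega Q k) * wgt p k := fun R => by
    simp only [modeR, event, hd.initial_space_derivative hn hΦ]
    rw [← integral_const_mul]
    refine integral_congr_ae (Eventually.of_forall fun k => ?_)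
    simp only [φ₂, map_smul, smul_eq_mul]
    ring
  have hzero : ∀ {φ : (Fin 3 → ℝ) → ℝ} {ρ' : ℝ}, 0 < ρ' → ρ' ≤ ρ →
      (∀ x, ρ' ^ 2 < ∑ i, x i ^ 2 → φ x = 0) → ∀ R, ρ < R →
      ∫ k in sphK, φ (R • omega Q k) * wgt p k = 0 := by
    intro φ ρ' h1 h2 h3 R hR
    have : ∀ k, φ (R • omega Q k) = 0 := fun k => h3 _ (by
      simp only [Pi.smul_apply, smul_eq_mul, mul_pow, ← Finset.mul_sum, sum_sq_omega hQ, mul_one]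
      exact pow_lt_pow_left₀ (h2.trans_lt hR) h1.le two_ne_zero)
    simp [this]
  have hle : ∀ {x m : ℝ}, |x| ≤ m / Λ ^ 3 → m ≤ M → |x| ≤ M / Λ ^ 3 := fun h1 h2 =>
    h1.trans (by gcongr)
  have bu : ∀ R, |mode Φ Q p (0, R)| ≤ M / Λ ^ 3 := fun R =>
    hle (by rw [hu]; exact hM₀ Q hQ p lam hlam hp hp1 R) (by linarith)
  have but : ∀ R, |modeT d Φ Q p (0, R)| ≤ M / Λ ^ 3 := fun R =>
    hle (by rw [hut]; exact hM₁ Q hQ p lam hlam hp hp1 R) (by linarith)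
  have buR : ∀ R, |R * modeR d Φ Q p (0, R)| ≤ M / Λ ^ 3 := fun R =>
    hle (by rw [huR]; exact hM₂ Q hQ p lam hlam hp hp1 R) (by linarith)
  have hsq : ∀ {x : ℝ}, |x| ≤ M / Λ ^ 3 → x ^ 2 ≤ M ^ 2 / Λ ^ 6 := fun {x} h => by
    have := pow_le_pow_left₀ (abs_nonneg _) h 2
    rw [sq_abs, div_pow, ← pow_mul] at this
    exact this
  -- Data vanish beyond ρ, and for R ≤ ρ one has (1+ρ²)/(1+R²) ≥ 1. This majorant is integrable on
  -- the whole half-line, so the energy bound is independent of the endpoints. Squares decay like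
  -- Λ^(-6), and the angular term costs one factor Λ.
  have hen : ∀ R, 0 ≤ R → d.energy μ lam (mode Φ Q p) (modeT d Φ Q p) (modeR d Φ Q p) (0, R) ≤
      (1 + ρ ^ 2) * (K * M ^ 2 / Λ ^ 5) * (1 / (1 + R ^ 2)) := by
    intro R hR
    refine (hd.energy_initial_le hlam hR).trans ?_
    rcases le_or_gt R ρ with hRρ | hRρ
    · have h1 := hsq (bu R)
      have h2 := hsq (but R)
      have h3 := hsq (buR R)
      have hRR : R ^ 2 ≤ ρ ^ 2 := pow_le_pow_left₀ hR hRρ 2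
      set e := M ^ 2 / Λ ^ 6 with he
      have he0 : 0 ≤ e := by positivity
      have h4 : (R * modeT d Φ Q p (0, R)) ^ 2 ≤ ρ ^ 2 * e := by
        rw [mul_pow]; gcongr
      have h5 : (lam + μ ^ 2 * R ^ 2) * mode Φ Q p (0, R) ^ 2 ≤ (Λ + μ ^ 2 * ρ ^ 2) * e := by
        gcongr; linarith
      have h6 : K * M ^ 2 / Λ ^ 5 = K * Λ * e := by rw [he]; field_simp
      have h7 : (R * modeT d Φ Q p (0, R)) ^ 2 + (R * modeR d Φ Q p (0, R)) ^ 2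
          + (lam + μ ^ 2 * R ^ 2) * mode Φ Q p (0, R) ^ 2 ≤ K * Λ * e := by
        have h8 : (ρ ^ 2 + 1 + (Λ + μ ^ 2 * ρ ^ 2)) * e ≤ K * Λ * e := by
          refine mul_le_mul_of_nonneg_right ?_ he0
          have h9 : 0 ≤ (ρ ^ 2 + 1 + μ ^ 2 * ρ ^ 2) * (Λ - 1) :=
            mul_nonneg (by positivity) (by linarith)
          rw [hK]; linarith
        linarith
      rw [h6]
      refine h7.trans ?_
      rw [mul_one_div, le_div_iff₀ (by positivity), mul_comm]
      gcongr
    · have e1 := (hu R).trans (hzero hρ₀ (by linarith) hz₀ R hRρ)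
      have e2 := (hut R).trans (hzero hρ₁ (by linarith) hz₁ R hRρ)
      have e3 := (huR R).trans (hzero hρ₂ (by linarith) hz₂ R hRρ)
      rw [e1, e2, e3]
      simp only [mul_zero, ne_eq, OfNat.ofNat_ne_zero, not_false_eq_true, zero_pow, add_zero]
      positivity
  have hE : ∀ b a, 0 ≤ b → b ≤ a → ∫ R in b..a,
      d.energy μ lam (mode Φ Q p) (modeT d Φ Q p) (modeR d Φ Q p) (0, R) ≤ A / Λ ^ 5 := by
    intro b a hb hba
    by_cases hi : IntervalIntegrable (fun R => d.energy μ lam (mode Φ Q p) (modeT d Φ Q p)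
      (modeR d Φ Q p) (0, R)) volume b a
    · have hc : Continuous fun R : ℝ => 1 / (1 + R ^ 2) :=
        continuous_const.div (by fun_prop) fun R => by positivity
      have h1 := intervalIntegral.integral_mono_on hba hi
        ((continuous_const.mul hc).intervalIntegrable b a) fun R hR => hen R (hb.trans hR.1)
      refine h1.trans ?_
      simp only [Pi.mul_apply]
      rw [intervalIntegral.integral_const_mul, integral_one_div_one_add_sq]
      have h2 : Real.arctan a - Real.arctan b ≤ 2 := by
        have := Real.arctan_lt_pi_div_two a
        have := Real.arctan_nonneg.2 hb
        linarith [Real.pi_le_four]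
      have h3 : 0 ≤ (1 + ρ ^ 2) * (K * M ^ 2 / Λ ^ 5) := by positivity
      calc _ ≤ (1 + ρ ^ 2) * (K * M ^ 2 / Λ ^ 5) * 2 := mul_le_mul_of_nonneg_left h2 h3
        _ = A / Λ ^ 5 := by rw [hA]; ring
    -- The interval integral of a non-integrable function is 0 by convention, so the bound holds
    -- without proving integrability.
    · rw [intervalIntegral.integral_undef hi]; positivity
  have hN : ∀ R, 0 ≤ R → √R * |mode Φ Q p (0, R)| ≤ √ρ * (M / Λ ^ 3) := by
    intro R hR
    rcases le_or_gt R ρ with hRρ | hRρ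
    · exact mul_le_mul (Real.sqrt_le_sqrt hRρ) (bu R) (abs_nonneg _) (Real.sqrt_nonneg _)
    · rw [(hu R).trans (hzero hρ₀ (by linarith) hz₀ R hRρ), abs_zero, mul_zero]
      positivity
  -- With t = Λ^(-2) the energy term is A Λ^(-5)/t = A Λ^(-3), so every term is at most of order
  -- Λ^(-2).
  have hfin := hbound μ lam hlam _ _ _ (hd.isMode_mode hn hΦ hQ hp) (A / Λ ^ 5) (√ρ * (M / Λ ^ 3))
    (1 / Λ ^ 2) (by positivity) hE hN z hz h0 hR
  refine hfin.trans ?_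
  have e1 : A / Λ ^ 5 / (1 / Λ ^ 2) = A / Λ ^ 3 := by field_simp
  have e2 : ∀ x : ℝ, 0 ≤ x → x / Λ ^ 3 ≤ x / Λ ^ 2 := fun x hx =>
    div_le_div_of_nonneg_left hx (by positivity) (pow_le_pow_right₀ hΛ1 (by norm_num))
  rw [e1]
  calc _ ≤ C * (1 / Λ ^ 2 + A / Λ ^ 2) + √ρ * (M / Λ ^ 2) := by
        gcongr
        · norm_num
        · norm_num
    _ = _ := by ring

end Admissible

end DustData

/-! ### Recovering the field from its zonal modes -/

theorem exists_frame {v : Fin 3 → ℝ} (hv : ∑ i, v i ^ 2 = 1) :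
    ∃ Q : Matrix (Fin 3) (Fin 3) ℝ, Q * Q.transpose = 1 ∧ Q 2 = v := by
  have hn : ‖WithLp.toLp 2 v‖ = 1 := by
    rw [EuclideanSpace.norm_eq]; simp [hv]
  have ho : Orthonormal ℝ (({2} : Set (Fin 3)).domRestrict fun _ => WithLp.toLp 2 v) :=
    ⟨fun _ => hn, fun i j hij => (hij (Subsingleton.elim i j)).elim⟩
  obtain ⟨b, hb⟩ := ho.exists_orthonormalBasis_extension_of_card_eq (by simp)
  refine ⟨Matrix.of fun i j => b i j, ?_, ?_⟩
  · ext i j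
    have h := orthonormal_iff_ite.1 b.orthonormal j i
    rw [PiLp.inner_apply] at h
    rw [Matrix.mul_apply, Matrix.one_apply]
    simp only [Matrix.transpose_apply, Matrix.of_apply]
    simpa [eq_comm] using h
  · have := hb 2 rfl
    ext j
    exact congrFun (congrArg WithLp.ofLp this) j

namespace DustData

variable {d : DustData}

/-- The zonal mean of a field over the circle of latitude with polar coordinate `cos θ = x`. -/
def zonalMean (Φ : (Fin 4 → ℝ) → ℝ) (Q : Matrix (Fin 3) (Fin 3) ℝ) (z : ℝ × ℝ) (x : ℝ) : ℝ :=
  ∫ φ in Icc 0 (2 * Real.pi), Φ (event z (omega Q (Real.arccos x, φ)))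

namespace Admissible

variable {μ : ℝ} {φ₀ φ₁ : (Fin 3 → ℝ) → ℝ} {Φ : (Fin 4 → ℝ) → ℝ} {Q : Matrix (Fin 3) (Fin 3) ℝ}
  {z : ℝ × ℝ}

theorem continuous_event_comp (hΦ : ContinuousOn Φ d.D) (hQ : Q * Q.transpose = 1) (hz : z ∈ d.D₂) :
    Continuous fun k => Φ (event z (omega Q k)) := by
  refine hΦ.comp_continuous (contDiff_event.continuous.comp
    (by fun_prop : Continuous fun k : ℝ × ℝ => (z, k))) fun k => ?_
  rw [event_mem_D (sum_sq_omega hQ k), abs_of_nonneg hz.1]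
  exact hz

theorem continuous_zonalMean (hΦ : ContinuousOn Φ d.D) (hQ : Q * Q.transpose = 1) (hz : z ∈ d.D₂) :
    Continuous (zonalMean Φ Q z) := by
  rw [← continuousOn_univ]
  refine continuousOn_setIntegral (F := fun x : ℝ × ℝ =>
    Φ (event z (omega Q (Real.arccos x.1, x.2)))) isCompact_Icc ?_
  exact ((continuous_event_comp hΦ hQ hz).comp
    ((Real.continuous_arccos.comp continuous_fst).prodMk continuous_snd)).continuousOn

/-- At the pole the circle of latitude degenerates to a single point, so the mean there is a point
value of the field. -/
theorem zonalMean_one : zonalMean Φ Q z 1 = 2 * Real.pi * Φ (event z (Q 2)) := by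
  have h : ∀ φ, omega Q (0, φ) = Q 2 := fun φ => by simp [omega]
  simp only [zonalMean, Real.arccos_one, h]
  rw [setIntegral_const, measureReal_def, Real.volume_Icc, sub_zero,
    ENNReal.toReal_ofReal Real.two_pi_pos.le, smul_eq_mul]

/-- The substitution x = cos θ: the Legendre coefficients of the zonal mean are the modes. -/
theorem integral_zonalMean (hΦ : ContinuousOn Φ d.D) (hQ : Q * Q.transpose = 1) (hz : z ∈ d.D₂)
    (p : Polynomial ℝ) : ∫ x in (-1 : ℝ)..1, zonalMean Φ Q z x * p.eval x = mode Φ Q p z := by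
  have hc := continuous_event_comp hΦ hQ hz
  have h1 := intervalIntegral.integral_comp_mul_deriv (a := 0) (b := Real.pi)
    (g := fun x => zonalMean Φ Q z x * p.eval x) (fun x _ => Real.hasDerivAt_cos x)
    (Real.continuous_sin.neg.continuousOn) ((continuous_zonalMean hΦ hQ hz).mul p.continuous)
  rw [Real.cos_zero, Real.cos_pi, intervalIntegral.integral_symm (-1 : ℝ) 1] at h1
  have h2 : mode Φ Q p z = ∫ θ in (0 : ℝ)..Real.pi,
      zonalMean Φ Q z (Real.cos θ) * (p.eval (Real.cos θ) * Real.sin θ) := by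
    rw [mode, sphK, Measure.volume_eq_prod, setIntegral_prod]
    · rw [intervalIntegral.integral_of_le Real.pi_pos.le, ← integral_Icc_eq_integral_Ioc]
      refine setIntegral_congr_fun measurableSet_Icc fun θ hθ => ?_
      simp only [wgt, zonalMean, Real.arccos_cos hθ.1 hθ.2, integral_mul_const]
    · exact (hc.mul (contDiff_wgt p).continuous).continuousOn.integrableOn_compact isCompact_sphK
  rw [h2, eq_comm, ← neg_inj, ← h1, ← intervalIntegral.integral_neg]
  refine intervalIntegral.integral_congr fun θ _ => ?_
  simp only [Function.comp]
  ring

theorem summable_inv_eigenvalue : Summable fun n : ℕ => 1 / (1 + (n : ℝ) * (n + 1)) := by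
  have h := ((summable_nat_add_iff 1).2 (Real.summable_one_div_nat_pow.2 one_lt_two)).mul_left 2
  refine Summable.of_nonneg_of_le (fun n => by positivity) (fun n => ?_) h
  push_cast
  rw [mul_one_div, div_le_div_iff₀ (by positivity) (by positivity)]
  nlinarith [sq_nonneg (n : ℝ)]

theorem r_eq_rr (hd : d.Admissible) (hz : z ∈ d.D₂) : d.r z.1 z.2 = d.rr z := by
  rw [r, rr, hd.yE_eq_y hz.2.1 hz.2.2.1]

/-- Boundedness of solutions away from the centre and from the initial surface. -/
theorem interior_bound (hd : d.Admissible) (hn : d.GloballyNaked) (hΦ : IsKGSolution d μ φ₀ φ₁ Φ)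
    (hφ₀ : ContDiff ℝ ∞ φ₀) (hφ₀c : HasCompactSupport φ₀)
    (hφ₁ : ContDiff ℝ ∞ φ₁) (hφ₁c : HasCompactSupport φ₁) :
    ∃ C, 0 ≤ C ∧ ∀ v : Fin 3 → ℝ, ∑ i, v i ^ 2 = 1 → ∀ z ∈ d.D₂, 0 < z.1 → 0 < z.2 →
      √(d.rr z) * |Φ (event z v)| ≤ C := by
  obtain ⟨C, hC0, hC⟩ := hd.mode_decay hn hΦ hφ₀ hφ₀c hφ₁ hφ₁c
  obtain ⟨P, hdeg, hzon, hle, hsq, horth⟩ := exists_zonal_basis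
  set S := ∑' n : ℕ, 1 / (1 + (n : ℝ) * (n + 1)) with hS
  have hS0 : 0 ≤ S := tsum_nonneg fun n => by positivity
  refine ⟨8 * C * S, by positivity, fun v hv z hz h0 hR => ?_⟩
  -- The axis is drawn through the point itself; all previous bounds are uniform in the frame.
  obtain ⟨Q, hQ, hQv⟩ := exists_frame hv
  have hr : 0 < √(d.rr z) := Real.sqrt_pos.2 (hd.rr_pos (hd.D₂_subset_tDom hz) hR)
  set r := √(d.rr z) with hrdef
  have hcΦ := hΦ.regular.continuousOn
  have hb : ∀ n : ℕ, |∫ x in (-1 : ℝ)..1, zonalMean Φ Q z x * (P n).eval x| ≤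
      C / r / (1 + (n : ℝ) * (n + 1)) ^ 2 := fun n => by
    rw [integral_zonalMean hcΦ hQ hz, div_right_comm, le_div_iff₀ hr, mul_comm]
    exact hC Q hQ (P n) _ (by positivity) (hzon n) (hle n) z hz h0 hR
  have heq : (fun n : ℕ => 8 * (1 + (n : ℝ) * (n + 1)) * (C / r / (1 + (n : ℝ) * (n + 1)) ^ 2)) =
      fun n : ℕ => 8 * C / r * (1 / (1 + (n : ℝ) * (n + 1))) := by
    ext n; field_simp
  have h := pole_bound hdeg hle hsq horth (continuous_zonalMean hcΦ hQ hz).continuousOn hb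
    (by rw [heq]; exact summable_inv_eigenvalue.mul_left _)
  rw [heq, tsum_mul_left, ← hS, zonalMean_one, hQv, abs_mul, abs_of_pos Real.two_pi_pos] at h
  have h2 : r * (2 * Real.pi * |Φ (event z v)|) ≤ 8 * C * S := by
    have := mul_le_mul_of_nonneg_left h hr.le
    rwa [show r * (8 * C / r * S) = 8 * C * S by field_simp] at this
  have h3 : 0 ≤ r * |Φ (event z v)| := by positivity
  nlinarith [Real.pi_gt_three]

theorem initial_bound (hφ₀ : ContDiff ℝ ∞ φ₀) (hφ₀c : HasCompactSupport φ₀) :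
    ∃ C, 0 ≤ C ∧ ∀ x, √(√(∑ i, x i ^ 2)) * |φ₀ x| ≤ C := by
  have hcont : Continuous fun x : Fin 3 → ℝ => √(√(∑ i, x i ^ 2)) * φ₀ x :=
    (by fun_prop : Continuous fun x : Fin 3 → ℝ => √(√(∑ i, x i ^ 2))).mul hφ₀.continuous
  obtain ⟨B, hB⟩ := hcont.bounded_above_of_compact_support hφ₀c.mul_left
  refine ⟨B, (norm_nonneg _).trans (hB 0), fun x => ?_⟩
  have := hB x
  rwa [norm_mul, Real.norm_of_nonneg (Real.sqrt_nonneg _)] at this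

/-- Boundedness of solutions, weighted with the square root of the areal radius. -/
theorem weighted_bound (hd : d.Admissible) (hn : d.GloballyNaked) (hΦ : IsKGSolution d μ φ₀ φ₁ Φ)
    (hφ₀ : ContDiff ℝ ∞ φ₀) (hφ₀c : HasCompactSupport φ₀)
    (hφ₁ : ContDiff ℝ ∞ φ₁) (hφ₁c : HasCompactSupport φ₁) :
    ∃ C : ℝ, 0 < C ∧ ∀ p ∈ d.D, √(d.r (p 0) (rad p)) * |Φ p| ≤ C := by
  obtain ⟨C₁, hC₁0, hC₁⟩ := hd.interior_bound hn hΦ hφ₀ hφ₀c hφ₁ hφ₁c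
  obtain ⟨C₂, hC₂0, hC₂⟩ := initial_bound hφ₀ hφ₀c
  refine ⟨C₁ + C₂ + 1, by positivity, fun p hp => ?_⟩
  have hz := mem_D_iff.1 hp
  rcases (rad_nonneg p).eq_or_lt with hR | hR
  -- At the centre the weight √r vanishes, so nothing is claimed about the field there.
  · rw [r, ← hR, zero_mul, Real.sqrt_zero, zero_mul]; positivity
  have hp0 : 0 ≤ p 0 := hp.1
  have hre := hd.r_eq_rr hz
  simp only at hre
  rcases hp0.eq_or_lt with h0 | h0
  · have hpc : p = Fin.cons 0 fun i => p i.succ := by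
      ext j
      refine Fin.cases ?_ (fun j => ?_) j
      · exact h0.symm
      · rfl
    have e1 : Φ p = φ₀ fun i => p i.succ := by
      conv_lhs => rw [hpc]
      exact hΦ.initial_value _
    rw [hre, ← h0, rr, hd.yE_initial, one_pow, mul_one, e1]
    exact (hC₂ _).trans (by linarith)
  · set v : Fin 3 → ℝ := fun i => p i.succ / rad p with hvdef
    have hv : ∑ i, v i ^ 2 = 1 := by
      have h2 : rad p ^ 2 = ∑ i : Fin 3, p i.succ ^ 2 :=
        Real.sq_sqrt (Finset.sum_nonneg fun i _ => sq_nonneg _)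
      simp only [hvdef, div_pow]
      rw [← Finset.sum_div, ← h2, div_self (by positivity)]
    have hev : event (p 0, rad p) v = p := by
      ext j
      refine Fin.cases ?_ (fun j => ?_) j
      · rw [event_zero]
      · rw [event_succ, hvdef]; exact mul_div_cancel₀ _ hR.ne'
    have := hC₁ v hv _ hz h0 hR
    rw [hev] at this
    rw [hre]
    exact this.trans (by linarith)

end Admissible

end DustData

end TolmanBondi

end

theorem theorem2 (d : TolmanBondi.DustData) (hd : d.Admissible) (hnaked : d.GloballyNaked)
    (μ : ℝ) (hμ : 0 ≤ μ)
    (φ₀ φ₁ : (Fin 3 → ℝ) → ℝ)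
    (hφ₀ : ContDiff ℝ ∞ φ₀) (hφ₀c : HasCompactSupport φ₀)
    (hφ₁ : ContDiff ℝ ∞ φ₁) (hφ₁c : HasCompactSupport φ₁)
    (Φ : (Fin 4 → ℝ) → ℝ) (hΦ : TolmanBondi.IsKGSolution d μ φ₀ φ₁ Φ) :
    (∃ C : ℝ, 0 < C ∧ ∀ p ∈ d.D, √(d.r (p 0) (TolmanBondi.rad p)) * |Φ p| ≤ C) ∧
    (∀ r₀ : ℝ, 0 < r₀ →
      ∃ C : ℝ, 0 < C ∧ ∀ p ∈ d.D, r₀ ≤ d.r (p 0) (TolmanBondi.rad p) → |Φ p| ≤ C) := by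
  obtain ⟨C, hC0, hC⟩ := hd.weighted_bound hnaked hΦ hφ₀ hφ₀c hφ₁ hφ₁c
  refine ⟨⟨C, hC0, hC⟩, fun r₀ hr₀ => ⟨C / √r₀, by positivity, fun p hp hr => ?_⟩⟩
  rw [le_div_iff₀ (Real.sqrt_pos.2 hr₀), mul_comm]
  exact (mul_le_mul_of_nonneg_right (Real.sqrt_le_sqrt hr) (abs_nonneg _)).trans (hC p hp)
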